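/- For a set $X\subseteq\mathbb{R}^3$ let $\operatorname{udg}(X)$ be the graph with vertex set $X$ in which two points are adjacent exactly when their Euclidean distance is $1$, and let $\chi(X)$ be the chromatic number of this graph. Let $S^2(r)=\{v\in\mathbb{R}^3:|v|=r\}$, $\tau=\frac{1+\sqrt5}{2}$, $r_1=\cos\frac{\pi}{10}$ and $r_2=\cos\frac{3\pi}{10}$. Let $W_1\subset S^2(r_1)$ be the set of the $12$ points $(0,\pm\frac{\tau}2,\pm\frac12)$, $(\pm\frac{\tau}2,\pm\frac12,0)$, $(\pm\frac12,0,\pm\frac{\tau}2)$, the vertices of the icosahedron with unit edge length, and let $W_2\subset S^2(r_2)$ be the set of the $12$ points $(0,\pm\frac1{2\tau},\pm\frac12)$, $(\pm\frac1{2\tau},\pm\frac12,0)$, $(\pm\frac12,0,\pm\frac1{2\tau})$, the vertices of the great icosahedron with unit edge length. For a finite list of points $p_i$, write $W_j[p_1,p_2,\dots]$ for the union of $W_j$ and of the orbits of the points $p_i$ under the group of all linear isometries of $\mathbb{R}^3$ that map $W_j$ onto itself. **Theorem.** 1. $\chi(S^2(r_1))\ge 5$. Moreover, there are points $p_1,p_2,p_3\in\mathbb{R}^3$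 with the coordinates listed in (A) below such that the set $V_{372}=W_1[p_1,p_2,p_3]$ lies on $S^2(r_1)$, has exactly $372$ points and satisfies $\chi(V_{372})=5$; all coordinates of its points are algebraic numbers, and the largest degree over $\mathbb{Q}$ of such a coordinate is $8$. The graph $G_{372}$ is $\operatorname{udg}(V_{372})$. 2. $\chi(S^2(r_2))\ge 5$. Moreover, there are points $p_1,\dots,p_8\in\mathbb{R}^3$ with the coordinates listed in (B) below such that the set $V_{972}=W_2[p_1,\dots,p_8]$ lies on $S^2(r_2)$, has exactly $972$ points and satisfies $\chi(V_{972})=5$; all coordinates of its points are algebraic numbers, and the largest degree over $\mathbb{Q}$ of such a coordinate is $8$. The graph $G_{972}$ is $\operatorname{udg}(V_{972})$. In the lists, an entry "$x\approx a$, $[c_0,c_1,\dots,c_n]$" means that $|x-a|<10^{-5}$ and $c_0+c_1(2x)+\dots+c_n(2x)^n=0$; likewise for $y$ and $z$. (A) For $r_1$: - $p_{1}$: $x\approx 0.71584$, $[-1, -1, 2, -2, 1]$; $y\approx 0.34924$, $[-1, 2, -2, 1, 1]$; $z\approx 0.51972$, $[-19, 0, 20, 0, 2, 0, -5, 0, 1]$.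 - $p_{2}$: $x\approx -0.07961$, $[1, 8, 9, -7, 28, 6, -4, -1, 1]$; $y\approx -0.08345$, $[-1, -5, 5, -4, 9, -5, 1, -2, 1]$; $z\approx 0.94404$, $[-1, 7, -13, -24, 4, 10, 0, -3, 1]$. - $p_{3}$: $x\approx -0.17646$, $[1, 8, 9, -7, 28, 6, -4, -1, 1]$; $y\approx 0.79929$, $[-1, -5, 5, -4, 9, -5, 1, -2, 1]$; $z\approx 0.48426$, $[-1, -7, -13, 24, 4, -10, 0, 3, 1]$. (B) For $r_2$: - $p_{1}$: $x\approx 0.46246$, $[-49, -147, -71, 67, 129, 97, 42, 10, 1]$; $y\approx -0.32804$, $[-19, 57, 206, 117, -11, -23, 1, 2, 1]$; $z\approx -0.15496$, $[25, 150, 315, 370, 284, 145, 49, 10, 1]$. - $p_{2}$: $x\approx -0.22176$, $[-49, -147, -71, 67, 129, 97, 42, 10, 1]$; $y\approx 0.09483$, $[-19, 57, 206, 117, -11, -23, 1, 2, 1]$; $z\approx 0.53602$, $[25, -150, 315, -370, 284, -145, 49, -10, 1]$. - $p_{3}$: $x\approx -0.57219$, $[1, 1, -16, -21, 34, 156, 234,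 159, 41]$; $y\approx -0.04462$, $[-1, -15, -55, -121, 269, 690, 616, 257, 41]$; $z\approx -0.12687$, $[-41, -211, -231, -148, -13, 75, 223, 174, 41]$. - $p_{4}$: $x\approx -0.13592$, $[1, 1, -16, -21, 34, 156, 234, 159, 41]$; $y\approx -0.22502$, $[-1, 15, -55, 121, 269, -690, 616, -257, 41]$; $z\approx -0.52572$, $[-41, 211, -231, 148, -13, -75, 223, -174, 41]$. - $p_{5}$: $x\approx 0.07219$, $[-1, 5, 10, 8, 69, 205, 269, 169, 41]$; $y\approx 0.35363$, $[1, -13, 61, -138, 164, -118, 96, -93, 41]$; $z\approx 0.46392$, $[269, -232, -669, 471, 642, -335, -258, 72, 41]$. - $p_{6}$: $x\approx -0.36408$, $[-1, 5, 10, 8, 69, 205, 269, 169, 41]$; $y\approx 0.08400$, $[1, -13, 61, -138, 164, -118, 96, -93, 41]$; $z\approx -0.45374$, $[269, 232, -669, -471, 642, 335, -258, -72, 41]$. - $p_{7}$: $x\approx -0.58345$, $[-1, 4, -2, -12, -1, 15, 15, 6, 1]$; $y\approx 0.05157$, $[-1, 10, -5, 18, 19, -15, -1, -1, 1]$; $z\approx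 0.0492$, $[1, -14, 36, 29, 13, 17, 19, 7, 1]$. - $p_{8}$: $x\approx -0.4376$, $[-1, -1, -2, 4, 14, 15, 13, 6, 1]$; $y\approx 0.03856$, $[1, -15, 28, -21, -1, 11, 1, -4, 1]$; $z\approx 0.39052$, $[-41, -37, 108, 45, -42, -11, 4, 2, 1]$. -/

import Mathlib

noncomputable section

namespace SphereColoring

/-- Euclidean three-space. -/
abbrev E3 : Type := EuclideanSpace ℝ (Fin 3)

/-- The (faithful) unit distance graph on a set of points: two points are adjacent exactly when
they are at distance one. -/
def udg (V : Set E3) : SimpleGraph V where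
  Adj u v := dist (u : E3) (v : E3) = 1
  symm := ⟨fun u v h => by rw [dist_comm]; exact h⟩
  loopless := ⟨fun u h => by simp at h⟩

/-- The chromatic number of a set of points: the least number of colours in a colouring of the
points in which points at unit distance have different colours (`⊤` if no finite number is
enough). -/
def chi (X : Set E3) : ℕ∞ := (udg X).chromaticNumber

/-- The twelve points `(0, ±a, ±b)`, `(±a, ±b, 0)`, `(±b, 0, ±a)`. -/
def cyclicPoints (a b : ℝ) : Set E3 :=
  {v | ∃ s ∈ ({1, -1} : Set ℝ), ∃ t ∈ ({1, -1} : Set ℝ),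
    v = !₂[0, s * a, t * b] ∨ v = !₂[s * a, t * b, 0] ∨ v = !₂[t * b, 0, s * a]}

/-- The vertices of the regular icosahedron with unit edge length. -/
def icosahedron : Set E3 := cyclicPoints (Real.goldenRatio / 2) (1 / 2)

/-- The vertices of the great icosahedron with unit edge length. They are the vertices of a
convex regular icosahedron with edge length `1 / Real.goldenRatio`; the edges of the great
icosahedron join the pairs of vertices that are neither adjacent in the convex icosahedron nor
antipodal. -/
def greatIcosahedron : Set E3 := cyclicPoints (1 / (2 * Real.goldenRatio)) (1 / 2)

/-- The orbit of `p` under the group of all linear isometries of space (rotations and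
reflections) that map the set `W` onto itself. -/
def symmetryOrbit (W : Set E3) (p : E3) : Set E3 :=
  {q | ∃ f : E3 ≃ₗᵢ[ℝ] E3, f '' W = W ∧ f p = q}

/-- The set `W` together with the orbits of the points `p i` under the symmetry group of `W`. -/
def withOrbits (W : Set E3) {k : ℕ} (p : Fin k → E3) : Set E3 :=
  W ∪ ⋃ i, symmetryOrbit W (p i)

/-- `2 * x` is a root of the polynomial with integer coefficients `c = [c₀, c₁, c₂, …]`
(constant term first, evaluated here by Horner's rule), and `x` equals `a` to within
`10 ^ (-5)`. -/
def IsRootNear (c : List ℤ) (a x : ℝ) : Prop :=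
  c.foldr (fun k y => (k : ℝ) + 2 * x * y) 0 = 0 ∧ |x - a| < 1 / 10 ^ 5

/-- The coordinates of the representatives of the three vertex classes of the 372-vertex graph,
other than the vertices of the icosahedron. -/
def Coordinates372 (p : Fin 3 → E3) : Prop :=
  IsRootNear [-1, -1, 2, -2, 1] 0.71584 (p 0 0) ∧
  IsRootNear [-1, 2, -2, 1, 1] 0.34924 (p 0 1) ∧
  IsRootNear [-19, 0, 20, 0, 2, 0, -5, 0, 1] 0.51972 (p 0 2) ∧
  IsRootNear [1, 8, 9, -7, 28, 6, -4, -1, 1] (-0.07961) (p 1 0) ∧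
  IsRootNear [-1, -5, 5, -4, 9, -5, 1, -2, 1] (-0.08345) (p 1 1) ∧
  IsRootNear [-1, 7, -13, -24, 4, 10, 0, -3, 1] 0.94404 (p 1 2) ∧
  IsRootNear [1, 8, 9, -7, 28, 6, -4, -1, 1] (-0.17646) (p 2 0) ∧
  IsRootNear [-1, -5, 5, -4, 9, -5, 1, -2, 1] 0.79929 (p 2 1) ∧
  IsRootNear [-1, -7, -13, 24, 4, -10, 0, 3, 1] 0.48426 (p 2 2)

/-- The coordinates of the representatives of the eight vertex classes of the 972-vertex graph,
other than the vertices of the great icosahedron. -/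
def Coordinates972 (p : Fin 8 → E3) : Prop :=
  IsRootNear [-49, -147, -71, 67, 129, 97, 42, 10, 1] 0.46246 (p 0 0) ∧
  IsRootNear [-19, 57, 206, 117, -11, -23, 1, 2, 1] (-0.32804) (p 0 1) ∧
  IsRootNear [25, 150, 315, 370, 284, 145, 49, 10, 1] (-0.15496) (p 0 2) ∧
  IsRootNear [-49, -147, -71, 67, 129, 97, 42, 10, 1] (-0.22176) (p 1 0) ∧
  IsRootNear [-19, 57, 206, 117, -11, -23, 1, 2, 1] 0.09483 (p 1 1) ∧
  IsRootNear [25, -150, 315, -370, 284, -145, 49, -10, 1] 0.53602 (p 1 2) ∧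
  IsRootNear [1, 1, -16, -21, 34, 156, 234, 159, 41] (-0.57219) (p 2 0) ∧
  IsRootNear [-1, -15, -55, -121, 269, 690, 616, 257, 41] (-0.04462) (p 2 1) ∧
  IsRootNear [-41, -211, -231, -148, -13, 75, 223, 174, 41] (-0.12687) (p 2 2) ∧
  IsRootNear [1, 1, -16, -21, 34, 156, 234, 159, 41] (-0.13592) (p 3 0) ∧
  IsRootNear [-1, 15, -55, 121, 269, -690, 616, -257, 41] (-0.22502) (p 3 1) ∧
  IsRootNear [-41, 211, -231, 148, -13, -75, 223, -174, 41] (-0.52572) (p 3 2) ∧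
  IsRootNear [-1, 5, 10, 8, 69, 205, 269, 169, 41] 0.07219 (p 4 0) ∧
  IsRootNear [1, -13, 61, -138, 164, -118, 96, -93, 41] 0.35363 (p 4 1) ∧
  IsRootNear [269, -232, -669, 471, 642, -335, -258, 72, 41] 0.46392 (p 4 2) ∧
  IsRootNear [-1, 5, 10, 8, 69, 205, 269, 169, 41] (-0.36408) (p 5 0) ∧
  IsRootNear [1, -13, 61, -138, 164, -118, 96, -93, 41] 0.08400 (p 5 1) ∧
  IsRootNear [269, 232, -669, -471, 642, 335, -258, -72, 41] (-0.45374) (p 5 2) ∧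
  IsRootNear [-1, 4, -2, -12, -1, 15, 15, 6, 1] (-0.58345) (p 6 0) ∧
  IsRootNear [-1, 10, -5, 18, 19, -15, -1, -1, 1] 0.05157 (p 6 1) ∧
  IsRootNear [1, -14, 36, 29, 13, 17, 19, 7, 1] 0.0492 (p 6 2) ∧
  IsRootNear [-1, -1, -2, 4, 14, 15, 13, 6, 1] (-0.4376) (p 7 0) ∧
  IsRootNear [1, -15, 28, -21, -1, 11, 1, -4, 1] 0.03856 (p 7 1) ∧
  IsRootNear [-41, -37, 108, 45, -42, -11, 4, 2, 1] 0.39052 (p 7 2)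

/-- The coordinates of the points of `V` are algebraic numbers, and the largest degree over `ℚ`
of such a coordinate is `d`. -/
def HasMaxCoordinateDegree (V : Set E3) (d : ℕ) : Prop :=
  (∀ v ∈ V, ∀ j, IsAlgebraic ℚ (v j)) ∧
    IsGreatest {m | ∃ v ∈ V, ∃ j, m = (minpoly ℚ (v j)).natDegree} d

end SphereColoring

end

/-! Both bounds $\chi\ge5$ come from finite subsets of the spheres. By `chi_mono` it suffices to
realise $V_{372}$ and $V_{972}$, to give each an explicit colouring with five colours, and to show
that neither has one with four. Everything is reduced to finite integer computations that the kernel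
evaluates, and symmetry keeps them small.

Arithmetic. All coordinates lie in $\mathbb{Q}(\alpha)$, where α is a real root of one monic integer
octic. A coordinate is stored as an integer polynomial in α over a common denominator. Equalities
are congruences modulo the octic (`value_eq`); inequalities follow from integer approximations with
twelve decimals and an error bound (`approxValue_error`). The octic is irreducible modulo 2, so the
field has degree 8, and one coordinate of each set generates it; hence the largest degree is 8.

Geometry. The two cases are one case with a parameter $t$ satisfying $t^2=t+1$: the vertices are the
cyclic permutations of $(0,\pm t/2,\pm1/2)$, the squared radius is $(t+2)/4$, and two points are at
unit distance exactly when their inner product is $t/4$. The value $t=\tau$ gives $W_1$, the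
conjugate $t=1-\tau=-1/\tau$ gives $W_2$. Every symmetry of $W$ is one of 24 signed cyclic
permutations after one of five powers of a rotation of order five. Indeed a linear isometry is
determined by the images of three mutually adjacent vertices, which span space, and all ordered
triangles of $W$ occur among the images of one triangle under these 120 maps (`Valid.symmetry_eq`).
An orbit is therefore given by five base points, the rotated copies of a representative, and their
images under signed cycles. Points become numbers ("slots"), and neighbours are listed for base
points only. That these lists are complete and that different slots hold different points is checked
numerically (`Valid.dot_base_ne`, `Valid.mem_adj_of_dist_eq_one`, `Valid.point_injOn`).

No four colours. The twelve points of $W$ span an icosahedron graph, and each of its colourings with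
four colours becomes one fixed pattern after a symmetry and a renaming of the colours
(`exists_match`). Since $V$ is invariant under all symmetries of $W$, it is enough to refute
colourings that extend the pattern. Twelve signed cycles, those with an even number of sign changes,
still preserve the pattern up to a permutation of colours. So whenever "slot $u$ has colour $i$" is
refuted by a search tree (`refute_sound`), the images of this assumption under the twelve cycles are
excluded too (`Valid.refuteAll_sound`). A list of such exclusions followed by a last search leaves
no colouring (`Valid.not_isColouring_four`). -/

namespace SphereColoring

/-! ### Integer polynomials as coefficient lists -/

/-- The value at `x` of the polynomial with coefficient list `p`, constant term first. -/
def value (x : ℝ) (p : List ℤ) : ℝ := p.foldr (fun c y => (c : ℝ) + x * y) 0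

@[simp] theorem value_nil (x : ℝ) : value x [] = 0 := rfl

@[simp] theorem value_cons (x : ℝ) (c : ℤ) (p : List ℤ) :
    value x (c :: p) = c + x * value x p := rfl

/-- Sum of coefficient lists. -/
def polyAdd : List ℤ → List ℤ → List ℤ
  | [], q => q
  | a :: p, [] => a :: p
  | a :: p, b :: q => (a + b) :: polyAdd p q

/-- Integer multiple of a coefficient list. -/
def polyScale (c : ℤ) (p : List ℤ) : List ℤ := p.map (c * ·)

/-- Product of coefficient lists. -/
def polyMul : List ℤ → List ℤ → List ℤ
  | [], _ => []
  | a :: p, q => polyAdd (polyScale a q) (0 :: polyMul p q)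

theorem value_polyAdd (x : ℝ) (p q : List ℤ) :
    value x (polyAdd p q) = value x p + value x q := by
  induction p generalizing q with
  | nil => simp [polyAdd]
  | cons a p ih =>
    cases q with
    | nil => simp [polyAdd]
    | cons b q => simp only [polyAdd, value_cons, ih]; push_cast; ring

theorem value_polyScale (x : ℝ) (c : ℤ) (p : List ℤ) :
    value x (polyScale c p) = c * value x p := by
  induction p with
  | nil => simp [polyScale]
  | cons a p ih =>
    rw [polyScale] at ih
    simp only [polyScale, List.map_cons, value_cons, ih]; push_cast; ring

theorem value_polyMul (x : ℝ) (p q : List ℤ) :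
    value x (polyMul p q) = value x p * value x q := by
  induction p with
  | nil => simp [polyMul]
  | cons a p ih =>
    simp only [polyMul, value_polyAdd, value_polyScale, value_cons, ih]; push_cast; ring

/-! ### The generator of the octic field -/

/-- The coefficients of the minimal polynomial of `alpha`. -/
def octic : List ℤ := [-1, -5, 5, -4, 9, -5, 1, -2, 1]

theorem exists_octic_root :
    ∃ x : ℝ, -166895158029 / 10 ^ 12 ≤ x ∧ x ≤ -166895158028 / 10 ^ 12 ∧ value x octic = 0 := by
  have hc : ContinuousOn (fun x : ℝ => value x octic)
      (Set.Icc (-166895158029 / 10 ^ 12) (-166895158028 / 10 ^ 12)) := by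
    simp only [octic, value_cons, value_nil]
    fun_prop
  -- The primed version is needed because the value at the left end of the bracket is the larger
  -- one.
  obtain ⟨x, hx, h⟩ := intermediate_value_Icc' (by norm_num) hc
    (show (0 : ℝ) ∈ Set.Icc _ _ by constructor <;> norm_num [octic])
  exact ⟨x, hx.1, hx.2, h⟩

/-- A real root of `octic`; it generates the field of all coordinates. -/
noncomputable def alpha : ℝ := exists_octic_root.choose

theorem alpha_ge : -166895158029 / 10 ^ 12 ≤ alpha := exists_octic_root.choose_spec.1

theorem alpha_le : alpha ≤ -166895158028 / 10 ^ 12 := exists_octic_root.choose_spec.2.1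

theorem value_alpha_octic : value alpha octic = 0 := exists_octic_root.choose_spec.2.2

/-- Multiplication by the variable, modulo `octic`. -/
def shift : List ℤ → List ℤ
  | [a, b, c, d, e, f, g, h] =>
    [h, a + 5 * h, b - 5 * h, c + 4 * h, d - 9 * h, e + 5 * h, f - h, g + 2 * h]
  | p => 0 :: p

/-- The leading coefficient that overflows is replaced using the octic, which is monic, so the
coefficients stay integers. Lists that do not have length 8 are shifted without reduction, so no
hypothesis on the length is needed. -/
theorem value_shift (p : List ℤ) : value alpha (shift p) = alpha * value alpha p := by
  unfold shift
  split
  · next a b c d e f g h =>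
    have := value_alpha_octic
    simp only [octic, value_cons, value_nil] at this ⊢
    push_cast at this ⊢
    linear_combination (-(h : ℝ)) * this
  · simp

/-- Reduction modulo `octic`. -/
def reduce : List ℤ → List ℤ
  | [] => [0, 0, 0, 0, 0, 0, 0, 0]
  | a :: p => polyAdd [a] (shift (reduce p))

theorem value_reduce (p : List ℤ) : value alpha (reduce p) = value alpha p := by
  induction p with
  | nil => simp [reduce]
  | cons a p ih => simp [reduce, value_polyAdd, value_shift, ih]

/-- Divisibility by `octic`. -/
def isZero (p : List ℤ) : Bool := (reduce p).all (· == 0)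

theorem value_eq_zero_of_all {p : List ℤ} (x : ℝ) (h : p.all (· == 0) = true) :
    value x p = 0 := by
  induction p with
  | nil => rfl
  | cons a p ih =>
    simp only [List.all_cons, Bool.and_eq_true, beq_iff_eq] at h
    simp [h.1, ih h.2]

/-- Only this direction is used: divisibility by the octic forces a zero at α. That a value is not
zero is always shown by approximation instead. -/
theorem value_eq_zero {p : List ℤ} (h : isZero p = true) : value alpha p = 0 := by
  rw [← value_reduce]; exact value_eq_zero_of_all _ h

/-- Congruence modulo `octic`. -/
def congruent (p q : List ℤ) : Bool := isZero (polyAdd p (polyScale (-1) q))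

theorem value_eq {p q : List ℤ} (h : congruent p q = true) : value alpha p = value alpha q := by
  have := value_eq_zero h
  rw [value_polyAdd, value_polyScale] at this
  push_cast at this
  linarith

/-! ### Numerical values -/

/-- `10 ^ 12` times the powers of `alpha`, rounded. -/
def alphaPowers : List ℤ :=
  [1000000000000, -166895158029, 27853993773, -4648696693, 775844969, -129484769, 21610381,
    -3606668]

/-- The sum of the products of corresponding entries. -/
def dotList (p q : List ℤ) : ℤ := (List.zipWith (· * ·) p q).sum

/-- `10 ^ 12` times the value of a polynomial at `alpha`, approximately. -/
def approxValue (p : List ℤ) : ℤ := dotList p alphaPowers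

/-- The sum of the absolute values of the coefficients. -/
def absSum (p : List ℤ) : ℕ := (p.map Int.natAbs).sum

/-- The error bound 2 reproduces itself from one power of α to the next: since $|\alpha|\le1/5$, the
inherited error shrinks to $2/5$, the new error is at most $3/2$, and the sum stays below 2. The two
numerical hypotheses test the ends of the bracket of α. -/
theorem approx_mul_alpha {x a b : ℝ} (h : |x * 10 ^ 12 - a| ≤ 2)
    (h₁ : |-166895158029 / 10 ^ 12 * a - b| ≤ 3 / 2)
    (h₂ : |-166895158028 / 10 ^ 12 * a - b| ≤ 3 / 2) :
    |x * alpha * 10 ^ 12 - b| ≤ 2 := by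
  have hge := alpha_ge
  have hle := alpha_le
  -- The product with $a$ is monotone in α, increasing or decreasing with the sign of $a$, so the
  -- two ends of the bracket control it.
  have h3 : |alpha * a - b| ≤ 3 / 2 := by
    rw [abs_le] at h₁ h₂ ⊢
    rcases le_total 0 a with ha | ha
    · have := mul_le_mul_of_nonneg_right hge ha
      have := mul_le_mul_of_nonneg_right hle ha
      constructor <;> linarith
    · have := mul_le_mul_of_nonpos_right hge ha
      have := mul_le_mul_of_nonpos_right hle ha
      constructor <;> linarith
  have h4 : |alpha * (x * 10 ^ 12 - a)| ≤ 1 / 5 * 2 := by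
    rw [abs_mul]
    refine mul_le_mul ?_ h (abs_nonneg _) (by norm_num)
    rw [abs_le]
    constructor <;> linarith
  have h5 : x * alpha * 10 ^ 12 - b = alpha * (x * 10 ^ 12 - a) + (alpha * a - b) := by ring
  rw [h5]
  exact (abs_add_le _ _).trans ((add_le_add h4 h3).trans (by norm_num))

theorem alphaPowers_approx :
    ∀ i (h : i < alphaPowers.length), |alpha ^ i * 10 ^ 12 - (alphaPowers[i] : ℝ)| ≤ 2 := by
  have h0 : |alpha ^ 0 * 10 ^ 12 - 1000000000000| ≤ 2 := by norm_num
  have h1 : |alpha ^ 1 * 10 ^ 12 - (-166895158029)| ≤ 2 := by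
    rw [pow_succ]; exact approx_mul_alpha h0 (by norm_num [abs_le]) (by norm_num [abs_le])
  have h2 : |alpha ^ 2 * 10 ^ 12 - 27853993773| ≤ 2 := by
    rw [pow_succ]; exact approx_mul_alpha h1 (by norm_num [abs_le]) (by norm_num [abs_le])
  have h3 : |alpha ^ 3 * 10 ^ 12 - (-4648696693)| ≤ 2 := by
    rw [pow_succ]; exact approx_mul_alpha h2 (by norm_num [abs_le]) (by norm_num [abs_le])
  have h4 : |alpha ^ 4 * 10 ^ 12 - 775844969| ≤ 2 := by
    rw [pow_succ]; exact approx_mul_alpha h3 (by norm_num [abs_le]) (by norm_num [abs_le])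
  have h5 : |alpha ^ 5 * 10 ^ 12 - (-129484769)| ≤ 2 := by
    rw [pow_succ]; exact approx_mul_alpha h4 (by norm_num [abs_le]) (by norm_num [abs_le])
  have h6 : |alpha ^ 6 * 10 ^ 12 - 21610381| ≤ 2 := by
    rw [pow_succ]; exact approx_mul_alpha h5 (by norm_num [abs_le]) (by norm_num [abs_le])
  have h7 : |alpha ^ 7 * 10 ^ 12 - (-3606668)| ≤ 2 := by
    rw [pow_succ]; exact approx_mul_alpha h6 (by norm_num [abs_le]) (by norm_num [abs_le])
  intro i hi
  simp only [alphaPowers, List.length_cons, List.length_nil] at hi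
  interval_cases i <;> simp only [alphaPowers, List.getElem_cons_zero, List.getElem_cons_succ] <;>
    push_cast <;> assumption

/-- Each coefficient contributes an error of at most twice its absolute value. The extra factor
$x^k$ lets the induction move down the table of powers together with the coefficients. -/
theorem zipWith_powers_approx {x : ℝ} (L p : List ℤ) (k : ℕ) (hp : p.length ≤ L.length)
    (hL : ∀ i (h : i < L.length), |x ^ (k + i) * 10 ^ 12 - (L[i] : ℝ)| ≤ 2) :
    |x ^ k * value x p * 10 ^ 12 - (dotList p L : ℝ)| ≤ 2 * (absSum p : ℝ) := by
  induction p generalizing L k with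
  | nil => simp [absSum, dotList]
  | cons c p ih =>
    cases L with
    | nil => simp at hp
    | cons l L =>
      have h0 := hL 0 (by simp)
      have h1 := ih L (k + 1) (by simpa using hp) (fun i hi => by
        have := hL (i + 1) (by simpa using hi)
        rwa [show k + (i + 1) = k + 1 + i by ring] at this)
      simp only [Nat.add_zero, List.getElem_cons_zero] at h0
      have h2 : |(c : ℝ) * (x ^ k * 10 ^ 12 - l)| ≤ |(c : ℝ)| * 2 := by
        rw [abs_mul]; exact mul_le_mul_of_nonneg_left h0 (abs_nonneg _)
      have h3 : x ^ k * value x (c :: p) * 10 ^ 12 -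
            (dotList (c :: p) (l :: L) : ℝ) =
          c * (x ^ k * 10 ^ 12 - l) + (x ^ (k + 1) * value x p * 10 ^ 12 -
            (dotList p L : ℝ)) := by
        simp only [dotList, List.zipWith_cons_cons, List.sum_cons, value_cons]
        push_cast
        ring
      have h4 : ((absSum (c :: p) : ℕ) : ℝ) = |(c : ℝ)| + absSum p := by
        simp [absSum, Nat.cast_natAbs]
      rw [h3, h4]
      exact (abs_add_le _ _).trans (by linarith)

theorem approxValue_error {p : List ℤ} (hp : p.length ≤ 8) :
    |value alpha p * 10 ^ 12 - approxValue p| ≤ 2 * (absSum p : ℝ) := by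
  have := zipWith_powers_approx (x := alpha) alphaPowers p 0 hp
    (by simpa using alphaPowers_approx)
  simpa [approxValue] using this

end SphereColoring

/-! ### Irreducibility of the octic and the degree of the field it generates -/

namespace SphereColoring
open Polynomial

-- A proper factorization has a monic factor of degree 1 to 4. For each degree the coefficients of
-- the product give a system of equations over the field with two elements, and exhaustive search
-- shows that it has no solution.
set_option synthInstance.maxHeartbeats 400000 in
set_option synthInstance.maxSize 2000 in
theorem irreducible_octic_mod_two :
    Irreducible (X ^ 8 + X ^ 6 + X ^ 5 + X ^ 4 + X ^ 2 + X + 1 : (ZMod 2)[X]) := by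
  have hd : (X ^ 8 + X ^ 6 + X ^ 5 + X ^ 4 + X ^ 2 + X + 1 : (ZMod 2)[X]).natDegree = 8 := by
    compute_degree!
  have hm : (X ^ 8 + X ^ 6 + X ^ 5 + X ^ 4 + X ^ 2 + X + 1 : (ZMod 2)[X]).Monic := by
    monicity!
  rw [hm.irreducible_iff_natDegree']
  refine ⟨fun h => by rw [h] at hd; simp at hd, fun f g hf hg hfg hmem => ?_⟩
  rw [hd, Finset.mem_Ioc] at hmem
  have hdeg : f.natDegree + g.natDegree = 8 := by
    rw [← hf.natDegree_mul hg, hfg, hd]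
  have hfl := hf.coeff_natDegree
  have hgl := hg.coeff_natDegree
  have hc : ∀ n, ∑ k ∈ Finset.range (n + 1), f.coeff k * g.coeff (n - k) =
      (X ^ 8 + X ^ 6 + X ^ 5 + X ^ 4 + X ^ 2 + X + 1 : (ZMod 2)[X]).coeff n := fun n => by
    rw [← hfg, coeff_mul, Finset.Nat.sum_antidiagonal_eq_sum_range_succ_mk]
  have hf0 : ∀ n, f.natDegree < n → f.coeff n = 0 := fun n h => coeff_eq_zero_of_natDegree_lt h
  have hg0 : ∀ n, g.natDegree < n → g.coeff n = 0 := fun n h => coeff_eq_zero_of_natDegree_lt h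
  have c0 := hc 0
  have c1 := hc 1
  have c2 := hc 2
  have c3 := hc 3
  have c4 := hc 4
  have c5 := hc 5
  have c6 := hc 6
  have c7 := hc 7
  simp only [Finset.sum_range_succ, Finset.sum_range_zero, coeff_add, coeff_X_pow, coeff_X,
    coeff_one] at c0 c1 c2 c3 c4 c5 c6 c7
  norm_num at c0 c1 c2 c3 c4 c5 c6 c7
  obtain ⟨hpos, hle⟩ := hmem
  have hcases : g.natDegree = 1 ∨ g.natDegree = 2 ∨ g.natDegree = 3 ∨ g.natDegree = 4 := by omega
  rcases hcases with h | h | h | h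
  · rw [h] at hgl
    rw [show f.natDegree = 7 by omega] at hfl
    simp only [hg0 2 (by omega), hg0 3 (by omega), hg0 4 (by omega), hg0 5 (by omega),
      hg0 6 (by omega), hg0 7 (by omega), hgl, hfl] at c0 c1 c2 c3 c4 c5 c6 c7
    -- The leading coefficients are 1, so eight unknown coefficients remain, here and in the other
    -- three cases: 256 possibilities each.
    generalize f.coeff 0 = a0, f.coeff 1 = a1, f.coeff 2 = a2, f.coeff 3 = a3, f.coeff 4 = a4,
      f.coeff 5 = a5, f.coeff 6 = a6, g.coeff 0 = b0 at *
    clear * - c0 c1 c2 c3 c4 c5 c6 c7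
    revert a0 a1 a2 a3 a4 a5 a6 b0
    decide +kernel
  · rw [h] at hgl
    rw [show f.natDegree = 6 by omega] at hfl
    simp only [hg0 3 (by omega), hg0 4 (by omega), hg0 5 (by omega), hg0 6 (by omega),
      hg0 7 (by omega), hf0 7 (by omega), hgl, hfl] at c0 c1 c2 c3 c4 c5 c6 c7
    generalize f.coeff 0 = a0, f.coeff 1 = a1, f.coeff 2 = a2, f.coeff 3 = a3, f.coeff 4 = a4,
      f.coeff 5 = a5, g.coeff 0 = b0, g.coeff 1 = b1 at *
    clear * - c0 c1 c2 c3 c4 c5 c6 c7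
    revert a0 a1 a2 a3 a4 a5 b0 b1
    decide +kernel
  · rw [h] at hgl
    rw [show f.natDegree = 5 by omega] at hfl
    simp only [hg0 4 (by omega), hg0 5 (by omega), hg0 6 (by omega), hg0 7 (by omega),
      hf0 6 (by omega), hf0 7 (by omega), hgl, hfl] at c0 c1 c2 c3 c4 c5 c6 c7
    generalize f.coeff 0 = a0, f.coeff 1 = a1, f.coeff 2 = a2, f.coeff 3 = a3, f.coeff 4 = a4,
      g.coeff 0 = b0, g.coeff 1 = b1, g.coeff 2 = b2 at *
    clear * - c0 c1 c2 c3 c4 c5 c6 c7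
    revert a0 a1 a2 a3 a4 b0 b1 b2
    decide +kernel
  · rw [h] at hgl
    rw [show f.natDegree = 4 by omega] at hfl
    simp only [hg0 5 (by omega), hg0 6 (by omega), hg0 7 (by omega), hf0 5 (by omega),
      hf0 6 (by omega), hf0 7 (by omega), hgl, hfl] at c0 c1 c2 c3 c4 c5 c6 c7
    generalize f.coeff 0 = a0, f.coeff 1 = a1, f.coeff 2 = a2, f.coeff 3 = a3, g.coeff 0 = b0,
      g.coeff 1 = b1, g.coeff 2 = b2, g.coeff 3 = b3 at *
    clear * - c0 c1 c2 c3 c4 c5 c6 c7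
    revert a0 a1 a2 a3 b0 b1 b2 b3
    decide +kernel

/-- The minimal polynomial of `alpha`. -/
noncomputable def octicPoly : ℤ[X] :=
  X ^ 8 - 2 * X ^ 7 + X ^ 6 - 5 * X ^ 5 + 9 * X ^ 4 - 4 * X ^ 3 + 5 * X ^ 2 - 5 * X - 1

theorem octicPoly_monic : octicPoly.Monic := by
  unfold octicPoly
  monicity!

theorem octicPoly_natDegree : octicPoly.natDegree = 8 := by
  unfold octicPoly
  compute_degree!

theorem octicPoly_irreducible : Irreducible octicPoly := by
  refine octicPoly_monic.irreducible_of_irreducible_map (Int.castRingHom (ZMod 2)) _ ?_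
  convert irreducible_octic_mod_two using 1
  simp only [octicPoly, Polynomial.map_add, Polynomial.map_sub, Polynomial.map_mul,
    Polynomial.map_pow, map_X, Polynomial.map_ofNat, Polynomial.map_one]
  have h2 : (2 : (ZMod 2)[X]) = 0 := by
    rw [show (2 : (ZMod 2)[X]) = C 2 from rfl, show (2 : ZMod 2) = 0 from rfl, C_0]
  -- The cofactor is half the difference between the octic and its reduction with coefficients 0 and
  -- 1.
  linear_combination (-X ^ 7 - 3 * X ^ 5 + 4 * X ^ 4 - 2 * X ^ 3 + 2 * X ^ 2 - 3 * X - 1) * h2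

theorem aeval_alpha_octicPoly : aeval alpha octicPoly = 0 := by
  have := value_alpha_octic
  simp only [octic, value_cons, value_nil] at this
  simp only [octicPoly, map_add, map_sub, map_mul, map_pow, aeval_X, map_ofNat, map_one]
  push_cast at this
  linarith

/-- By Gauss's lemma the monic octic stays irreducible over the rationals. -/
theorem minpoly_alpha : minpoly ℚ alpha = octicPoly.map (Int.castRingHom ℚ) := by
  symm
  refine minpoly.eq_of_irreducible_of_monic ?_ ?_ (octicPoly_monic.map _)
  · exact (octicPoly_monic.irreducible_iff_irreducible_map_fraction_map (K := ℚ)).1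
      octicPoly_irreducible
  · rw [← aeval_alpha_octicPoly, ← algebraMap_int_eq, aeval_map_algebraMap]

theorem isIntegral_alpha : IsIntegral ℚ alpha := by
  refine ⟨octicPoly.map (Int.castRingHom ℚ), octicPoly_monic.map _, ?_⟩
  rw [← aeval_def, ← aeval_alpha_octicPoly, ← algebraMap_int_eq, aeval_map_algebraMap]

open IntermediateField

theorem finrank_adjoin_alpha : Module.finrank ℚ ℚ⟮alpha⟯ = 8 := by
  rw [adjoin.finrank isIntegral_alpha, minpoly_alpha,
    octicPoly_monic.natDegree_map, octicPoly_natDegree]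

theorem value_mem_adjoin (p : List ℤ) : value alpha p ∈ ℚ⟮alpha⟯ := by
  induction p with
  | nil => exact zero_mem _
  | cons c p ih =>
    exact add_mem (intCast_mem _ c) (mul_mem (mem_adjoin_simple_self ℚ alpha) ih)

theorem isAlgebraic_of_mem_adjoin {x : ℝ} (hx : x ∈ ℚ⟮alpha⟯) : IsAlgebraic ℚ x := by
  have : FiniteDimensional ℚ ℚ⟮alpha⟯ := adjoin.finiteDimensional isIntegral_alpha
  exact (isAlgebraic_iff (S := ℚ⟮alpha⟯) (x := ⟨x, hx⟩)).1 (Algebra.IsAlgebraic.isAlgebraic _)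

theorem natDegree_minpoly_le {x : ℝ} (hx : x ∈ ℚ⟮alpha⟯) : (minpoly ℚ x).natDegree ≤ 8 := by
  have : FiniteDimensional ℚ ℚ⟮alpha⟯ := adjoin.finiteDimensional isIntegral_alpha
  rw [← finrank_adjoin_alpha, ← adjoin.finrank (isAlgebraic_of_mem_adjoin hx).isIntegral]
  exact finrank_le_of_le_right (adjoin_simple_le_iff.2 hx)

/-- The two memberships give $\mathbb{Q}(x)=\mathbb{Q}(\alpha)$, so a single generating coordinate
attains the bound 8. -/
theorem natDegree_minpoly_eq {x : ℝ} (hx : x ∈ ℚ⟮alpha⟯) (h : alpha ∈ ℚ⟮x⟯) :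
    (minpoly ℚ x).natDegree = 8 := by
  rw [← finrank_adjoin_alpha, ← adjoin.finrank (isAlgebraic_of_mem_adjoin hx).isIntegral]
  rw [le_antisymm (adjoin_simple_le_iff.2 hx) (adjoin_simple_le_iff.2 h)]

end SphereColoring

namespace SphereColoring

/-! ### Coordinates in space -/

/-- The point of Euclidean space with given coordinates. -/
def toE3 (v : ℝ × ℝ × ℝ) : E3 := !₂[v.1, v.2.1, v.2.2]

/-- The coordinates of a point of Euclidean space. -/
def coords (x : E3) : ℝ × ℝ × ℝ := (x 0, x 1, x 2)

@[simp] theorem coords_toE3 (v : ℝ × ℝ × ℝ) : coords (toE3 v) = v := by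
  simp [coords, toE3]

@[simp] theorem toE3_coords (x : E3) : toE3 (coords x) = x := by
  ext i
  fin_cases i <;> simp [coords, toE3]

theorem toE3_injective : Function.Injective toE3 :=
  Function.LeftInverse.injective coords_toE3

/-- The dot product of coordinate triples. -/
def dot (v w : ℝ × ℝ × ℝ) : ℝ := v.1 * w.1 + v.2.1 * w.2.1 + v.2.2 * w.2.2

theorem norm_toE3_sq (v : ℝ × ℝ × ℝ) : ‖toE3 v‖ ^ 2 = dot v v := by
  rw [EuclideanSpace.norm_sq_eq, Fin.sum_univ_three]
  simp [toE3, dot, pow_two]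

theorem dist_toE3_sq (v w : ℝ × ℝ × ℝ) :
    dist (toE3 v) (toE3 w) ^ 2 = dot v v + dot w w - 2 * dot v w := by
  rw [dist_eq_norm, EuclideanSpace.norm_sq_eq, Fin.sum_univ_three]
  simp [toE3, dot]
  ring

/-- On the sphere of squared radius $s$ one has $|v-w|^2=2s-2\,v\cdot w$. With $s=(t+2)/4$ the
critical inner product is $t/4$, so adjacency becomes an algebraic equation. -/
theorem dist_toE3_eq_one_iff {v w : ℝ × ℝ × ℝ} {s : ℝ} (hv : dot v v = s) (hw : dot w w = s) :
    dist (toE3 v) (toE3 w) = 1 ↔ dot v w = s - 1 / 2 := by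
  have h := dist_toE3_sq v w
  rw [hv, hw] at h
  constructor
  · intro h1
    rw [h1] at h
    linarith
  · intro h1
    rw [← sq_eq_sq₀ dist_nonneg zero_le_one, h, h1]
    ring

theorem toE3_mem_sphere_iff {v : ℝ × ℝ × ℝ} {r : ℝ} (hr : 0 ≤ r) :
    toE3 v ∈ Metric.sphere 0 r ↔ dot v v = r ^ 2 := by
  rw [mem_sphere_zero_iff_norm, ← norm_toE3_sq, sq_eq_sq₀ (norm_nonneg _) hr]

theorem exists_isometry (f : ℝ × ℝ × ℝ → ℝ × ℝ × ℝ) (hadd : ∀ v w, f (v + w) = f v + f w)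
    (hsmul : ∀ (c : ℝ) v, f (c • v) = c • f v) (hdot : ∀ v, dot (f v) (f v) = dot v v) :
    ∃ φ : E3 ≃ₗᵢ[ℝ] E3, ∀ v, φ (toE3 v) = toE3 (f v) := by
  have h1 : ∀ v w, toE3 (v + w) = toE3 v + toE3 w := fun v w => by
    ext i; fin_cases i <;> simp [toE3]
  have h2 : ∀ (c : ℝ) v, toE3 (c • v) = c • toE3 v := fun c v => by
    ext i; fin_cases i <;> simp [toE3]
  have h3 : ∀ x y, coords (x + y) = coords x + coords y := fun x y => by simp [coords]
  have h4 : ∀ (c : ℝ) x, coords (c • x) = c • coords x := fun x y => by simp [coords]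
  let φ : E3 →ₗᵢ[ℝ] E3 :=
    { toFun := fun x => toE3 (f (coords x))
      map_add' := fun x y => by rw [h3, hadd, h1]
      map_smul' := fun c x => by rw [h4, hsmul, h2, RingHom.id_apply]
      norm_map' := fun x => by
        change ‖toE3 (f (coords x))‖ = ‖x‖
        rw [← sq_eq_sq₀ (norm_nonneg _) (norm_nonneg _), norm_toE3_sq, hdot, ← norm_toE3_sq,
          toE3_coords] }
  -- An isometric linear map between spaces of equal finite dimension is bijective.
  refine ⟨φ.toLinearIsometryEquiv rfl, fun v => ?_⟩
  change toE3 (f (coords (toE3 v))) = _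
  rw [coords_toE3]

/-! ### The pyritohedral group -/

/-- A change of signs of the coordinates followed by a cyclic permutation. -/
abbrev SignedCycle : Type := Fin 3 × Bool × Bool × Bool

/-- Apply `neg` if the sign is set. -/
def applySign {K : Type*} (neg : K → K) (b : Bool) (x : K) : K := bif b then neg x else x

/-- Cyclic permutation of the coordinates. -/
def cycle {K : Type*} (k : Fin 3) (v : K × K × K) : K × K × K :=
  match k with
  | 0 => v
  | 1 => (v.2.1, v.2.2, v.1)
  | 2 => (v.2.2, v.1, v.2.1)

/-- The action of a signed cycle on coordinate triples. -/
def act {K : Type*} (neg : K → K) (g : SignedCycle) (v : K × K × K) : K × K × K :=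
  cycle g.1 (applySign neg g.2.1 v.1, applySign neg g.2.2.1 v.2.1, applySign neg g.2.2.2 v.2.2)

/-- The composition of signed cycles. -/
def compose (g h : SignedCycle) : SignedCycle :=
  let s := cycle (-h.1) g.2
  (g.1 + h.1, xor s.1 h.2.1, xor s.2.1 h.2.2.1, xor s.2.2 h.2.2.2)

/-- The inverse of a signed cycle. -/
def inverse (g : SignedCycle) : SignedCycle := (-g.1, cycle g.1 g.2)

/-- Apply a function to all coordinates. -/
def mapCoords {K L : Type*} (f : K → L) (v : K × K × K) : L × L × L := (f v.1, f v.2.1, f v.2.2)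

theorem mapCoords_act {K L : Type*} {f : K → L} {neg : K → K} {neg' : L → L}
    (hf : ∀ x, f (neg x) = neg' (f x)) (g : SignedCycle) (v : K × K × K) :
    mapCoords f (act neg g v) = act neg' g (mapCoords f v) := by
  have hs : ∀ b x, f (applySign neg b x) = applySign neg' b (f x) := by
    intro b x; cases b <;> simp [applySign, hf]
  obtain ⟨k, a, b, c⟩ := g
  fin_cases k <;> simp [act, mapCoords, cycle, hs]

/-- Signs are applied before the cyclic permutation. Hence the signs of the outer factor have to be
carried back through the permutation of the inner one, which is the twist in `compose`. -/
theorem act_compose (g h : SignedCycle) (v : ℝ × ℝ × ℝ) :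
    act Neg.neg (compose g h) v = act Neg.neg g (act Neg.neg h v) := by
  have hs : ∀ (a b : Bool) (x : ℝ), applySign Neg.neg (xor a b) x =
      applySign Neg.neg a (applySign Neg.neg b x) := by
    intro a b x; cases a <;> cases b <;> simp [applySign]
  obtain ⟨k, a, b, c⟩ := g
  obtain ⟨l, d, e, f⟩ := h
  fin_cases k <;> fin_cases l <;>
    simp only [act, compose, cycle, hs, Fin.zero_eta, Fin.mk_one, Fin.reduceFinMk, neg_zero,
      add_zero, zero_add] <;> rfl

theorem act_inverse (g : SignedCycle) (v : ℝ × ℝ × ℝ) :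
    act Neg.neg g (act Neg.neg (inverse g) v) = v := by
  rw [← act_compose, show compose g (inverse g) = (0, false, false, false) by
    revert g; decide]
  rfl

theorem act_add (g : SignedCycle) (v w : ℝ × ℝ × ℝ) :
    act Neg.neg g (v + w) = act Neg.neg g v + act Neg.neg g w := by
  have hs : ∀ (a : Bool) (x y : ℝ), applySign Neg.neg a (x + y) =
      applySign Neg.neg a x + applySign Neg.neg a y := by
    intro a x y; cases a <;> simp [applySign]; ring
  obtain ⟨k, a, b, c⟩ := g
  fin_cases k <;> simp [act, cycle, hs]

theorem act_smul (g : SignedCycle) (r : ℝ) (v : ℝ × ℝ × ℝ) :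
    act Neg.neg g (r • v) = r • act Neg.neg g v := by
  have hs : ∀ (a : Bool) (x : ℝ), applySign Neg.neg a (r * x) =
      r * applySign Neg.neg a x := by
    intro a x; cases a <;> simp [applySign]
  obtain ⟨k, a, b, c⟩ := g
  fin_cases k <;> simp [act, cycle, hs]

theorem dot_act (g : SignedCycle) (v w : ℝ × ℝ × ℝ) :
    dot (act Neg.neg g v) (act Neg.neg g w) = dot v w := by
  have hs : ∀ (a : Bool) (x y : ℝ), applySign Neg.neg a x * applySign Neg.neg a y = x * y := by
    intro a x y; cases a <;> simp [applySign]
  obtain ⟨k, a, b, c⟩ := g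
  fin_cases k <;> simp [act, cycle, dot, hs] <;> ring

/-! ### Numbering of signed cycles and of their translates of base points -/

/-- The number of a signed cycle. -/
def encode (g : SignedCycle) : ℕ :=
  8 * g.1.val + (bif g.2.1 then 1 else 0) + (bif g.2.2.1 then 2 else 0) +
    (bif g.2.2.2 then 4 else 0)

/-- The signed cycle with a given number. -/
def decode (n : ℕ) : SignedCycle :=
  (Fin.ofNat 3 (n / 8), Nat.beq (n % 2) 1, Nat.beq (n / 2 % 2) 1, Nat.beq (n / 4 % 2) 1)

theorem decode_encode (g : SignedCycle) : decode (encode g) = g := by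
  revert g; decide

theorem encode_lt (g : SignedCycle) : encode g < 24 := by
  revert g; decide

theorem encode_decode {n : ℕ} (h : n < 24) : encode (decode n) = n := by
  interval_cases n <;> rfl

/-- Slots are numbers `24 * b + encode g`; the slots with `b = 0` come in pairs that stand for
the same point. -/
def canon (u : ℕ) : ℕ := if u < 24 then 2 * (u / 2) else u

/-- The action of signed cycles on slots. -/
def slotAct (g : SignedCycle) (u : ℕ) : ℕ :=
  canon (24 * (u / 24) + encode (compose g (decode (u % 24))))

theorem canon_div (u : ℕ) : canon u / 24 = u / 24 := by
  unfold canon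
  split <;> omega

theorem canon_canon (u : ℕ) : canon (canon u) = canon u := by
  unfold canon
  split_ifs <;> omega

theorem slotAct_div (g : SignedCycle) (u : ℕ) : slotAct g u / 24 = u / 24 := by
  have := encode_lt (compose g (decode (u % 24)))
  rw [slotAct, canon_div]
  omega

/-- From slot 24 on the action is left multiplication in the group, and the claim is the group law.
The canonical slots below 24 stand for cosets of the two-element stabilizer of the first vertex,
where multiplication must be followed by `canon`; these twelve slots are checked by enumeration. -/
theorem slotAct_inverse (g : SignedCycle) {u : ℕ} (hu : canon u = u) :
    slotAct g (slotAct (inverse g) u) = u := by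
  by_cases h : u < 24
  · have key : ∀ g : SignedCycle, ∀ n : Fin 12,
        slotAct g (slotAct (inverse g) (2 * n)) = 2 * n := by decide +kernel
    have h2 : u = 2 * (u / 2) := by rw [canon, if_pos h] at hu; exact hu.symm
    rw [h2]
    exact key g ⟨u / 2, by omega⟩
  · have h1 : ∀ x, canon (24 * (u / 24) + x) = 24 * (u / 24) + x := fun x => by
      rw [canon, if_neg (by omega)]
    have h2 : ∀ g, slotAct g u = 24 * (u / 24) + encode (compose g (decode (u % 24))) :=
      fun g => h1 _
    have h3 := encode_lt (compose (inverse g) (decode (u % 24)))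
    have key : ∀ g x : SignedCycle, compose g (compose (inverse g) x) = x := by decide +kernel
    rw [h2 (inverse g), slotAct, show ∀ a b, b < 24 → (24 * a + b) / 24 = a by omega,
      show ∀ a b, b < 24 → (24 * a + b) % 24 = b by omega, decode_encode, key, h1,
      encode_decode (Nat.mod_lt _ (by norm_num))]
    · omega
    all_goals exact h3

end SphereColoring

namespace SphereColoring

/-! ### Point configurations with coordinates in the octic field -/

/-- A configuration of points that is invariant under signed cycles, given by its base points:
all coordinates are values at `alpha` of the given polynomials, divided by `den`. The first base
point is a vertex `(0, t / 2, 1 / 2)` of an icosahedron, with `tau` describing `5 * t`. -/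
structure Configuration where
  /-- The common denominator of the coordinates. -/
  den : ℤ
  /-- The polynomial whose value is `5 * t`. -/
  tau : List ℤ
  /-- The coordinates of the base points. -/
  base : List (List ℤ × List ℤ × List ℤ)
  /-- The values at `alpha` of the coordinates of the base points, times `10 ^ 12`. -/
  approx : List (ℤ × ℤ × ℤ)
  /-- The slots at distance one from the base points. -/
  nbrs : List (List ℕ)

namespace Configuration

variable (m : Configuration)

/-- The number of base points. -/
def size : ℕ := m.base.length

/-- The coordinates of a base point, as polynomials. -/
def basePoly (b : ℕ) : List ℤ × List ℤ × List ℤ := m.base.getD b ([], [], [])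

/-- The coordinates of the point in a slot, as polynomials. -/
def polyPoint (u : ℕ) : List ℤ × List ℤ × List ℤ :=
  act (polyScale (-1)) (decode (u % 24)) (m.basePoly (u / 24))

/-- The real number described by a polynomial. -/
noncomputable def real (p : List ℤ) : ℝ := value alpha p / m.den

/-- The point in a slot. -/
noncomputable def point (u : ℕ) : ℝ × ℝ × ℝ :=
  act Neg.neg (decode (u % 24)) (mapCoords m.real (m.basePoly (u / 24)))

theorem point_eq (u : ℕ) : m.point u = mapCoords m.real (m.polyPoint u) := by
  rw [point, polyPoint, mapCoords_act (neg' := Neg.neg)]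
  intro x
  rw [real, real, value_polyScale]
  push_cast
  ring

theorem point_base (b : ℕ) : m.point (24 * b) = mapCoords m.real (m.basePoly b) := by
  rw [point, Nat.mul_mod_right, Nat.mul_div_cancel_left b (by norm_num)]
  rfl

/-- Dot product of polynomial coordinates. -/
def polyDot (v w : List ℤ × List ℤ × List ℤ) : List ℤ :=
  polyAdd (polyMul v.1 w.1) (polyAdd (polyMul v.2.1 w.2.1) (polyMul v.2.2 w.2.2))

/-- The slots that are used. -/
def slots : List ℕ := (List.range (24 * m.size)).filter fun u => canon u == u

theorem mem_slots {u : ℕ} : u ∈ m.slots ↔ u / 24 < m.size ∧ canon u = u := by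
  simp only [slots, List.mem_filter, List.mem_range, beq_iff_eq]
  constructor <;> rintro ⟨h1, h2⟩ <;> refine ⟨by omega, h2⟩

/-- Ten times the rotation by a fifth of a turn, in polynomial coordinates. -/
def polyRotate (v : List ℤ × List ℤ × List ℤ) : List ℤ × List ℤ × List ℤ :=
  let lin := fun p q r : List ℤ => polyAdd (polyScale 5 p)
    (polyAdd (polyMul m.tau q) (polyMul (polyAdd [-5] m.tau) r))
  (lin v.1 (polyScale (-1) v.2.1) v.2.2, lin (polyScale (-1) v.2.2) v.1 v.2.1,
    lin v.2.1 v.2.2 v.1)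

/-- Congruence of polynomial coordinates. -/
def congruentCoords (v w : List ℤ × List ℤ × List ℤ) : Bool :=
  congruent v.1 w.1 && congruent v.2.1 w.2.1 && congruent v.2.2 w.2.2

/-- The permutation of the slots of the icosahedron by the rotation by a fifth of a turn. -/
def rotateSlot (u : ℕ) : ℕ := [20, 12, 10, 18, 0, 14, 8, 6, 16, 4, 2, 22].getD (u / 2) 0

/-- Exact properties of the base points. -/
def exactCheck : Bool :=
  -- The factors 10 and 20 in these tests clear the denominators in $t/2$, in the rotation matrix,
  -- in $(t+2)/4$ and in $t=\mathrm{tau}/5$, so that only integer polynomials are compared.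
  congruentCoords (mapCoords (polyScale 10) (m.basePoly 0))
    ([], polyScale m.den m.tau, [5 * m.den]) &&
  congruent (polyMul m.tau m.tau) (polyAdd (polyScale 5 m.tau) [25]) &&
  (m.base.all fun p => congruent (polyScale 20 (polyDot p p))
    (polyScale (m.den ^ 2) (polyAdd [10] m.tau))) &&
  -- After the first base point come blocks of five, each point being the rotated image of its
  -- predecessor. When $b\equiv4$ modulo 5, base point $b+1$ closes its block, and nothing is
  -- claimed about the next one.
  ((List.range (m.size - 1)).all fun b => b % 5 == 4 ||
    congruentCoords (mapCoords (polyScale 10) (m.basePoly (b + 2)))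
      (m.polyRotate (m.basePoly (b + 1)))) &&
  ((List.range 12).all fun u =>
    congruentCoords (mapCoords (polyScale 10) (m.polyPoint (rotateSlot (2 * u))))
      (m.polyRotate (m.polyPoint (2 * u))))

/-- The listed neighbours of base points are at distance one. -/
def edgeCheck : Bool :=
  (List.range m.size).all fun b => (m.nbrs.getD b []).all fun w =>
    decide (w / 24 < m.size) && congruent (polyScale 20 (polyDot (m.basePoly b) (m.polyPoint w)))
      (polyScale (m.den ^ 2) m.tau)

/-- The approximate coordinates of a base point. -/
def baseApprox (b : ℕ) : ℤ × ℤ × ℤ := m.approx.getD b (0, 0, 0)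

/-- An approximate coordinate agrees with a polynomial. -/
def approxCoord (p : List ℤ) (a : ℤ) : Bool :=
  approxValue p == a && Nat.ble a.natAbs (10 ^ 15) && Nat.ble (absSum p) 10000 &&
    Nat.ble p.length 8

/-- The approximate coordinates are correct. -/
def approxCheck : Bool :=
  (approxCoord m.tau (approxValue m.tau)) && decide (0 < m.den) && decide (m.den ≤ 1000) &&
  (List.range m.size).all fun b =>
    approxCoord (m.basePoly b).1 (m.baseApprox b).1 &&
    approxCoord (m.basePoly b).2.1 (m.baseApprox b).2.1 &&
    approxCoord (m.basePoly b).2.2 (m.baseApprox b).2.2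

/-- Dot product of approximate coordinates. -/
def intDot (v w : ℤ × ℤ × ℤ) : ℤ := v.1 * w.1 + v.2.1 * w.2.1 + v.2.2 * w.2.2

/-- The approximate coordinates of the point in a slot. -/
def approxPoint (u : ℕ) : ℤ × ℤ × ℤ := act Neg.neg (decode (u % 24)) (m.baseApprox (u / 24))

/-- A base point is separated from the points in other slots, and its distance from the points
that are not listed as neighbours is different from one. -/
def separated (b : ℕ) : Bool :=
  -- In units of $\mathrm{den}^2\cdot10^{24}$ the two numbers stand for twenty times the inner
  -- product $t/4$ of adjacent points and twenty times the squared radius $(t+2)/4$. The margin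
  -- $10^{23}$ exceeds the accumulated error, which is at most $2.3\cdot10^{22}$.
  let s : ℤ := m.den ^ 2 * 10 ^ 12 * approxValue m.tau
  let s' : ℤ := m.den ^ 2 * 10 ^ 12 * (approxValue m.tau + 10 ^ 13)
  let l := m.nbrs.getD b []
  m.slots.all fun w =>
    let d : ℤ := 20 * intDot (m.baseApprox b) (m.approxPoint w)
    (Nat.ble (10 ^ 23) (d - s).natAbs || l.contains w) &&
      (Nat.ble (10 ^ 23) (d - s').natAbs || Nat.beq w (24 * b))

end Configuration

end SphereColoring

/-! ### What the checks imply: positions, adjacency and separation of the points -/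

namespace SphereColoring

/-- The rotation by a fifth of a turn about an axis of the icosahedron (or, for the conjugate
value of `t`, by two fifths of a turn). -/
noncomputable def rotate (t : ℝ) (v : ℝ × ℝ × ℝ) : ℝ × ℝ × ℝ :=
  ((v.1 - t * v.2.1 + (t - 1) * v.2.2) / 2, (t * v.1 + (t - 1) * v.2.1 - v.2.2) / 2,
    ((t - 1) * v.1 + v.2.1 + t * v.2.2) / 2)

/-- The matrix is orthogonal as soon as $t^2=t+1$, so the same formula serves the golden ratio and
its conjugate. -/
theorem dot_rotate {t : ℝ} (ht : t ^ 2 = t + 1) (v : ℝ × ℝ × ℝ) :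
    dot (rotate t v) (rotate t v) = dot v v := by
  obtain ⟨x, y, z⟩ := v
  simp only [dot, rotate]
  linear_combination (x ^ 2 + y ^ 2 + z ^ 2 + x * y + x * z - y * z) / 2 * ht

namespace Configuration

variable {m : Configuration}

/-- The number `t` such that the first base point is `(0, t / 2, 1 / 2)`. -/
noncomputable def t (m : Configuration) : ℝ := value alpha m.tau / 5

/-- All properties of a configuration that are checked by computation. -/
structure Valid (m : Configuration) : Prop where
  exactCheck : m.exactCheck = true
  edgeCheck : m.edgeCheck = true
  approxCheck : m.approxCheck = true
  separated : ∀ b < m.size, m.separated b = true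
  size_pos : 0 < m.size
  nbrs_length : m.nbrs.length = m.size

theorem value_tau : value alpha m.tau = 5 * m.t := by
  rw [t]; ring

theorem Valid.den_pos (h : m.Valid) : (0 : ℝ) < m.den := by
  have := h.approxCheck
  simp only [Configuration.approxCheck, Bool.and_eq_true, decide_eq_true_eq] at this
  exact_mod_cast this.1.1.2

theorem Valid.t_sq (h : m.Valid) : m.t ^ 2 = m.t + 1 := by
  have := h.exactCheck
  simp only [Configuration.exactCheck, Bool.and_eq_true] at this
  have := value_eq this.1.1.1.2
  simp only [value_polyMul, value_polyAdd, value_polyScale, value_tau, value_cons,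
    value_nil] at this
  push_cast at this
  linarith

theorem mapCoords_real_eq {v w : List ℤ × List ℤ × List ℤ}
    (hc : congruentCoords (mapCoords (polyScale 10) v) w = true) :
    mapCoords m.real v = mapCoords (fun p => m.real p / 10) w := by
  simp only [congruentCoords, mapCoords, Bool.and_eq_true] at hc
  have h1 := value_eq hc.1.1
  have h2 := value_eq hc.1.2
  have h3 := value_eq hc.2
  rw [value_polyScale] at h1 h2 h3
  simp only [mapCoords, real, ← h1, ← h2, ← h3]
  push_cast
  ext <;> simp only [] <;> ring

theorem Valid.point_zero (h : m.Valid) : m.point 0 = (0, m.t / 2, 1 / 2) := by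
  have hc := h.exactCheck
  simp only [Configuration.exactCheck, Bool.and_eq_true] at hc
  have hd := h.den_pos
  have h0 := m.point_base 0
  rw [mul_zero] at h0
  rw [h0, mapCoords_real_eq hc.1.1.1.1]
  simp only [mapCoords, real, value_polyScale, value_tau, value_cons, value_nil]
  push_cast
  ext <;> field_simp <;> ring

theorem mapCoords_real_polyRotate (v : List ℤ × List ℤ × List ℤ) :
    mapCoords (fun p => m.real p / 10) (m.polyRotate v) = rotate m.t (mapCoords m.real v) := by
  simp only [mapCoords, polyRotate, rotate, real, value_polyAdd, value_polyMul, value_polyScale,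
    value_tau, value_cons, value_nil]
  push_cast
  ext <;> simp only [] <;> ring

theorem Valid.rotate_base (h : m.Valid) {b : ℕ} (hb : b + 2 < m.size) (h5 : b % 5 ≠ 4) :
    rotate m.t (m.point (24 * (b + 1))) = m.point (24 * (b + 2)) := by
  have hc := h.exactCheck
  simp only [Configuration.exactCheck, Bool.and_eq_true, List.all_eq_true, List.mem_range,
    Bool.or_eq_true, beq_iff_eq] at hc
  have := (hc.1.2 b (by omega)).resolve_left h5
  rw [m.point_base, m.point_base, mapCoords_real_eq this, mapCoords_real_polyRotate]

theorem Valid.rotate_slot (h : m.Valid) {u : ℕ} (hu : u < 12) :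
    rotate m.t (m.point (2 * u)) = m.point (rotateSlot (2 * u)) := by
  have hc := h.exactCheck
  simp only [Configuration.exactCheck, Bool.and_eq_true, List.all_eq_true, List.mem_range] at hc
  have := hc.2 u hu
  rw [m.point_eq, m.point_eq, mapCoords_real_eq this, mapCoords_real_polyRotate]

theorem real_polyDot (v w : List ℤ × List ℤ × List ℤ) :
    value alpha (polyDot v w) / m.den ^ 2 = dot (mapCoords m.real v) (mapCoords m.real w) := by
  simp only [polyDot, value_polyAdd, value_polyMul, dot, mapCoords, real]
  ring

theorem Valid.dot_point (h : m.Valid) {u : ℕ} (hu : u / 24 < m.size) :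
    dot (m.point u) (m.point u) = (m.t + 2) / 4 := by
  have hc := h.exactCheck
  simp only [Configuration.exactCheck, Bool.and_eq_true, List.all_eq_true] at hc
  have hd := h.den_pos
  have hmem : m.basePoly (u / 24) ∈ m.base := by
    rw [basePoly, List.getD_eq_getElem _ _ hu]
    exact List.getElem_mem hu
  have := value_eq (hc.1.1.2 _ hmem)
  simp only [value_polyScale, value_polyAdd, value_tau, value_cons, value_nil] at this
  rw [point, dot_act, ← real_polyDot, div_eq_iff (by positivity)]
  push_cast at this
  linarith

theorem Valid.dot_nbr (h : m.Valid) {b w : ℕ} (hb : b < m.size) (hw : w ∈ m.nbrs.getD b []) :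
    w / 24 < m.size ∧ dot (m.point (24 * b)) (m.point w) = m.t / 4 := by
  have hc := h.edgeCheck
  simp only [Configuration.edgeCheck, Bool.and_eq_true, List.all_eq_true, List.mem_range,
    decide_eq_true_eq] at hc
  obtain ⟨h1, h2⟩ := hc b hb w hw
  have hd := h.den_pos
  have := value_eq h2
  simp only [value_polyScale, value_tau] at this
  refine ⟨h1, ?_⟩
  rw [point_base, point_eq, ← real_polyDot, div_eq_iff (by positivity)]
  push_cast at this
  linarith

/-- This makes `slotAct` a faithful model of the geometric action. Passing to canonical slots is
harmless: it only clears the sign of the first coordinate of the first base point, and that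
coordinate is 0. -/
theorem Valid.act_point (h : m.Valid) (g : SignedCycle) (u : ℕ) :
    act Neg.neg g (m.point u) = m.point (slotAct g u) := by
  have h1 : ∀ v, m.point (canon v) = m.point v := by
    intro v
    by_cases hv : v < 24
    · have h0 : (mapCoords m.real (m.basePoly 0)).1 = 0 := by
        have h0 := m.point_base 0
        rw [mul_zero] at h0
        rw [← h0, h.point_zero]
      -- The first sign is the lowest bit of the number of a signed cycle, so rounding down to an
      -- even number clears it.
      have key : ∀ n < 24, decode (2 * (n / 2)) = ((decode n).1, false, (decode n).2.2) := by
        decide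
      have h2 : 2 * (v / 2) < 24 := by omega
      rw [canon, if_pos hv, point, point, Nat.mod_eq_of_lt h2, Nat.div_eq_of_lt h2,
        Nat.mod_eq_of_lt hv, Nat.div_eq_of_lt hv, key v hv]
      simp only [act, h0]
      cases (decode v).2.1 <;> simp [applySign]
    · rw [canon, if_neg hv]
  rw [slotAct, h1, point, ← act_compose, point]
  have h2 := encode_lt (compose g (decode (u % 24)))
  rw [show (24 * (u / 24) + encode (compose g (decode (u % 24)))) / 24 = u / 24 by omega,
    show (24 * (u / 24) + encode (compose g (decode (u % 24)))) % 24 =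
      encode (compose g (decode (u % 24))) by omega, decode_encode]

/-- Approximation of a real number by an integer. -/
def Near (m : Configuration) (x : ℝ) (a : ℤ) : Prop :=
  |x * (m.den * 10 ^ 12) - a| ≤ 20000 ∧ |(a : ℝ)| ≤ 10 ^ 15

theorem value_near_of_approxCoord {p : List ℤ} {a : ℤ} (h : approxCoord p a = true) :
    |value alpha p * 10 ^ 12 - a| ≤ 20000 ∧ |(a : ℝ)| ≤ 10 ^ 15 := by
  simp only [approxCoord, Bool.and_eq_true, beq_iff_eq, Nat.ble_eq] at h
  obtain ⟨⟨⟨h1, h2⟩, h3⟩, h4⟩ := h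
  have h5 := approxValue_error h4
  have h6 : (absSum p : ℝ) ≤ 10000 := by exact_mod_cast h3
  rw [h1] at h5
  refine ⟨h5.trans (by linarith), ?_⟩
  rw [← Int.cast_abs, Int.abs_eq_natAbs]
  exact_mod_cast h2

theorem Valid.near_real (h : m.Valid) {p : List ℤ} {a : ℤ} (hp : approxCoord p a = true) :
    m.Near (m.real p) a := by
  obtain ⟨h1, h2⟩ := value_near_of_approxCoord hp
  have hd := h.den_pos
  refine ⟨?_, h2⟩
  rwa [real, ← mul_assoc, div_mul_cancel₀ _ hd.ne']

/-- Approximation of coordinates. -/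
def NearCoords (m : Configuration) (v : ℝ × ℝ × ℝ) (a : ℤ × ℤ × ℤ) : Prop :=
  m.Near v.1 a.1 ∧ m.Near v.2.1 a.2.1 ∧ m.Near v.2.2 a.2.2

theorem NearCoords.act {v : ℝ × ℝ × ℝ} {a : ℤ × ℤ × ℤ} (h : m.NearCoords v a)
    (g : SignedCycle) : m.NearCoords (act Neg.neg g v) (act Neg.neg g a) := by
  have hs : ∀ (s : Bool) (x : ℝ) (a : ℤ), m.Near x a →
      m.Near (applySign Neg.neg s x) (applySign Neg.neg s a) := by
    rintro s x a ⟨h1, h2⟩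
    cases s
    · exact ⟨h1, h2⟩
    · simp only [applySign, cond_true, Near]
      push_cast
      rw [abs_neg, ← abs_neg]
      exact ⟨by rwa [show -(-x * (m.den * 10 ^ 12) - -(a : ℝ)) = x * (m.den * 10 ^ 12) - a by ring],
        h2⟩
  obtain ⟨h1, h2, h3⟩ := h
  obtain ⟨k, s1, s2, s3⟩ := g
  have h1 := hs s1 _ _ h1
  have h2 := hs s2 _ _ h2
  have h3 := hs s3 _ _ h3
  fin_cases k
  · exact ⟨h1, h2, h3⟩
  · exact ⟨h2, h3, h1⟩
  · exact ⟨h3, h1, h2⟩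

theorem Valid.nearCoords_point (h : m.Valid) {u : ℕ} (hu : u / 24 < m.size) :
    m.NearCoords (m.point u) (m.approxPoint u) := by
  have hc := h.approxCheck
  simp only [Configuration.approxCheck, Bool.and_eq_true, List.all_eq_true, List.mem_range] at hc
  obtain ⟨⟨h1, h2⟩, h3⟩ := hc.2 _ hu
  exact NearCoords.act ⟨h.near_real h1, h.near_real h2, h.near_real h3⟩ _

/-- The two mixed terms contribute at most $2\cdot10^4\cdot10^{15}$ each and the product of the
errors $4\cdot10^8$, which together stay below $5\cdot10^{19}$. -/
theorem Near.mul {x y : ℝ} {a b : ℤ} (hx : m.Near x a) (hy : m.Near y b) :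
    |x * y * (m.den * 10 ^ 12) ^ 2 - (a * b : ℤ)| ≤ 5 * 10 ^ 19 := by
  obtain ⟨h1, h2⟩ := hx
  obtain ⟨h3, h4⟩ := hy
  have e : x * y * (m.den * 10 ^ 12) ^ 2 - (a * b : ℤ) =
      (x * (m.den * 10 ^ 12) - a) * (y * (m.den * 10 ^ 12) - b) +
      ((x * (m.den * 10 ^ 12) - a) * b + a * (y * (m.den * 10 ^ 12) - b)) := by
    push_cast; ring
  have b1 := mul_le_mul h1 h3 (abs_nonneg _) (by norm_num)
  have b2 := mul_le_mul h1 h4 (abs_nonneg _) (by norm_num)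
  have b3 := mul_le_mul h2 h3 (abs_nonneg _) (by norm_num)
  rw [← abs_mul] at b1 b2 b3
  rw [e]
  refine (abs_add_le _ _).trans
    ((add_le_add b1 ((abs_add_le _ _).trans (add_le_add b2 b3))).trans ?_)
  norm_num

theorem NearCoords.dot {v w : ℝ × ℝ × ℝ} {a b : ℤ × ℤ × ℤ} (hv : m.NearCoords v a)
    (hw : m.NearCoords w b) :
    |dot v w * (m.den * 10 ^ 12) ^ 2 - (intDot a b : ℤ)| ≤ 15 * 10 ^ 19 := by
  have h1 := hv.1.mul hw.1
  have h2 := hv.2.1.mul hw.2.1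
  have h3 := hv.2.2.mul hw.2.2
  have e : SphereColoring.dot v w * (m.den * 10 ^ 12) ^ 2 - (intDot a b : ℤ) =
      (v.1 * w.1 * (m.den * 10 ^ 12) ^ 2 - (a.1 * b.1 : ℤ)) +
      ((v.2.1 * w.2.1 * (m.den * 10 ^ 12) ^ 2 - (a.2.1 * b.2.1 : ℤ)) +
      (v.2.2 * w.2.2 * (m.den * 10 ^ 12) ^ 2 - (a.2.2 * b.2.2 : ℤ))) := by
    simp only [SphereColoring.dot, intDot]; push_cast; ring
  rw [e]
  refine (abs_add_le _ _).trans
    ((add_le_add h1 ((abs_add_le _ _).trans (add_le_add h2 h3))).trans ?_)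
  norm_num

/-- It is applied with $c=0$, where the right side is the inner product $t/4$ of points at unit
distance, and with $c=10$, where it is the squared radius. If equality held, the tested integer
would be at most $20\cdot15\cdot10^{19}$, from the inner product, plus $2\cdot10^{22}$, from $t$
with a denominator up to 1000; this contradicts the margin $10^{23}$. -/
theorem Valid.separated_tau (h : m.Valid) (c : ℤ) {b w : ℕ} (hb : b < m.size)
    (hw : w / 24 < m.size)
    (hd : 10 ^ 23 ≤ (20 * intDot (m.baseApprox b) (m.approxPoint w) -
      m.den ^ 2 * 10 ^ 12 * (approxValue m.tau + 10 ^ 12 * c)).natAbs) :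
    dot (m.point (24 * b)) (m.point w) ≠ (5 * m.t + c) / 20 := by
  intro he
  have h1 := h.nearCoords_point (u := 24 * b) (by omega)
  have h2 := h.nearCoords_point hw
  have h3 := h1.dot h2
  have hc := h.approxCheck
  simp only [Configuration.approxCheck, Bool.and_eq_true, decide_eq_true_eq] at hc
  have h4 := (value_near_of_approxCoord hc.1.1.1).1
  rw [value_tau] at h4
  have hden : (m.den : ℝ) ≤ 1000 := by exact_mod_cast hc.1.2
  have hpos := h.den_pos
  have h5 : m.approxPoint (24 * b) = m.baseApprox b := by
    rw [approxPoint, Nat.mul_mod_right, Nat.mul_div_cancel_left b (by norm_num)]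
    rfl
  rw [h5, he] at h3
  set d : ℤ := intDot (m.baseApprox b) (m.approxPoint w)
  have h6 : |(m.den : ℝ) ^ 2 * 10 ^ 12 * (5 * m.t * 10 ^ 12 - approxValue m.tau)| ≤
      (1000 ^ 2 * 10 ^ 12) * 20000 := by
    rw [abs_mul]
    refine mul_le_mul ?_ h4 (abs_nonneg _) (by norm_num)
    rw [abs_of_nonneg (by positivity)]
    gcongr
  have h7 : (10 : ℝ) ^ 23 ≤ |20 * (d : ℝ) -
      m.den ^ 2 * 10 ^ 12 * (approxValue m.tau + 10 ^ 12 * c)| := by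
    have : (10 : ℝ) ^ 23 ≤ ((20 * d -
      m.den ^ 2 * 10 ^ 12 * (approxValue m.tau + 10 ^ 12 * c)).natAbs : ℝ) := by
      exact_mod_cast hd
    rw [Nat.cast_natAbs] at this
    push_cast at this
    exact this.trans_eq (by norm_num)
  have e : 20 * (d : ℝ) - m.den ^ 2 * 10 ^ 12 * (approxValue m.tau + 10 ^ 12 * c) =
      (m.den : ℝ) ^ 2 * 10 ^ 12 * (5 * m.t * 10 ^ 12 - approxValue m.tau) -
      20 * ((5 * m.t + c) / 20 * (m.den * 10 ^ 12) ^ 2 - d) := by ring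
  rw [e] at h7
  rw [abs_le] at h6 h3
  rcases le_abs.1 h7 with h8 | h8 <;> norm_num at h3 h6 h8 <;> linarith

theorem Valid.dot_base_ne (h : m.Valid) {b w : ℕ} (hb : b < m.size) (hw : w ∈ m.slots) :
    (w ∉ m.nbrs.getD b [] → dot (m.point (24 * b)) (m.point w) ≠ m.t / 4) ∧
    (w ≠ 24 * b → dot (m.point (24 * b)) (m.point w) ≠ (m.t + 2) / 4) := by
  have hc := h.separated b hb
  simp only [Configuration.separated, List.all_eq_true, Bool.and_eq_true, Bool.or_eq_true,
    Nat.ble_eq, List.contains_iff_mem, Nat.beq_eq] at hc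
  obtain ⟨h1, h2⟩ := hc w hw
  have hw' := (m.mem_slots.1 hw).1
  constructor
  · intro hn
    have := h.separated_tau 0 hb hw' (by simpa using h1.resolve_right hn)
    rwa [Int.cast_zero, add_zero, show (5 * m.t / 20) = m.t / 4 by ring] at this
  · intro hn
    have := h.separated_tau 10 hb hw' (by simpa using h2.resolve_right hn)
    push_cast at this
    rwa [show ((5 * m.t + 10) / 20) = (m.t + 2) / 4 by ring] at this

/-- The slots adjacent to a slot. -/
def adj (m : Configuration) (u : ℕ) : List ℕ :=
  (m.nbrs.getD (u / 24) []).map (slotAct (decode (u % 24)))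

theorem point_eq_act (u : ℕ) :
    m.point u = act Neg.neg (decode (u % 24)) (m.point (24 * (u / 24))) := by
  rw [point_base]; rfl

theorem slotAct_mem {u : ℕ} (g : SignedCycle) (hu : u / 24 < m.size) :
    slotAct g u ∈ m.slots := by
  rw [mem_slots, slotAct_div]
  exact ⟨hu, by rw [slotAct, canon_canon]⟩

theorem Valid.dist_eq_one_of_mem_adj (h : m.Valid) {u w : ℕ} (hu : u / 24 < m.size)
    (hw : w ∈ m.adj u) : w ∈ m.slots ∧ dist (toE3 (m.point u)) (toE3 (m.point w)) = 1 := by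
  rw [adj, List.mem_map] at hw
  obtain ⟨w, hw, rfl⟩ := hw
  obtain ⟨h1, h2⟩ := h.dot_nbr hu hw
  have h3 := slotAct_mem (decode (u % 24)) h1
  refine ⟨h3, ?_⟩
  rw [dist_toE3_eq_one_iff (h.dot_point hu) (h.dot_point (m.mem_slots.1 h3).1), point_eq_act u,
    ← h.act_point, dot_act, h2]
  ring

/-- The neighbour lists are complete: an inverse signed cycle moves the first point to its base
point, where the numerical separation excludes unit distance to every slot that is not listed. -/
theorem Valid.mem_adj_of_dist_eq_one (h : m.Valid) {u w : ℕ} (hu : u / 24 < m.size)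
    (hw : w ∈ m.slots) (hd : dist (toE3 (m.point u)) (toE3 (m.point w)) = 1) : w ∈ m.adj u := by
  obtain ⟨h1, h2⟩ := m.mem_slots.1 hw
  rw [dist_toE3_eq_one_iff (h.dot_point hu) (h.dot_point h1), point_eq_act u,
    ← act_inverse (decode (u % 24)) (m.point w), dot_act, h.act_point] at hd
  have h3 := (h.dot_base_ne hu (slotAct_mem (inverse (decode (u % 24))) h1)).1
  rw [adj, List.mem_map]
  refine ⟨_, ?_, slotAct_inverse _ h2⟩
  by_contra hn
  exact h3 hn (by rw [hd]; ring)

/-- Points of a sphere that coincide have the squared radius as inner product. After moving one of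
them to its base point, separation leaves only the base slot itself. -/
theorem Valid.point_injOn (h : m.Valid) : Set.InjOn m.point {u | u ∈ m.slots} := by
  intro u hu w hw he
  obtain ⟨h1, h2⟩ := m.mem_slots.1 hw
  obtain ⟨h3, h4⟩ := m.mem_slots.1 hu
  have hd := h.dot_point h1
  nth_rewrite 1 [← he] at hd
  rw [point_eq_act u, ← act_inverse (decode (u % 24)) (m.point w), dot_act, h.act_point] at hd
  have h5 := (h.dot_base_ne h3 (slotAct_mem (inverse (decode (u % 24))) h1)).2
  have h6 : slotAct (inverse (decode (u % 24))) w = 24 * (u / 24) := by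
    by_contra hn
    exact h5 hn hd
  rw [← slotAct_inverse (decode (u % 24)) h2, h6, slotAct, Nat.mul_mod_right,
    Nat.mul_div_cancel_left _ (by norm_num)]
  -- Number 0 is the identity, so acting on a base slot by a signed cycle yields the slot with the
  -- number of that cycle, up to `canon`.
  have h7 : ∀ g, compose g (decode 0) = g := by decide
  rw [h7, encode_decode (Nat.mod_lt _ (by norm_num)), Nat.div_add_mod, h4]

end Configuration

end SphereColoring

namespace SphereColoring

namespace Configuration

variable {m : Configuration}

/-! ### The icosahedron and its symmetries -/

/-- The vertices of the icosahedron (or great icosahedron) of a configuration. -/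
def vertexSet (m : Configuration) : Set E3 := cyclicPoints (m.t / 2) (1 / 2)

/-- The sign of the vanishing coordinate plays no role. The canonical slots below 24 are those with
the first sign unset, and they correspond to the two remaining signs and the cyclic permutation in
`cyclicPoints`. -/
theorem Valid.mem_vertexSet (h : m.Valid) {x : E3} :
    x ∈ m.vertexSet ↔ ∃ u ∈ m.slots, u < 24 ∧ x = toE3 (m.point u) := by
  have h0 : mapCoords m.real (m.basePoly 0) = (0, m.t / 2, 1 / 2) := by
    have h0 := m.point_base 0
    rw [mul_zero] at h0
    rw [← h0, h.point_zero]
  have hs : ∀ (b : Bool) (x : ℝ), applySign Neg.neg b x = (if b then -1 else 1) * x := by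
    intro b x; cases b <;> simp [applySign]
  have hm : ∀ b : Bool, (if b then -1 else 1 : ℝ) ∈ ({1, -1} : Set ℝ) := by
    intro b; cases b <;> simp
  have hk : ∀ (k : Fin 3) (b c : Bool),
      canon (encode (k, false, b, c)) = encode (k, false, b, c) := by decide
  constructor
  · have key : ∀ (k : Fin 3) (b c : Bool) (x : E3),
        x = toE3 (act Neg.neg (k, false, b, c) (0, m.t / 2, 1 / 2)) →
        ∃ u ∈ m.slots, u < 24 ∧ x = toE3 (m.point u) := by
      intro k b c x hx
      have h1 := encode_lt (k, false, b, c)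
      refine ⟨encode (k, false, b, c), ?_, h1, ?_⟩
      · rw [mem_slots, Nat.div_eq_of_lt h1]
        exact ⟨h.size_pos, hk k b c⟩
      · rw [point, Nat.div_eq_of_lt h1, Nat.mod_eq_of_lt h1, decode_encode, h0, hx]
    have hb : ∀ s ∈ ({1, -1} : Set ℝ), ∃ b : Bool, s = if b then -1 else 1 := by
      rintro s (rfl | rfl)
      · exact ⟨false, by simp⟩
      · exact ⟨true, by simp⟩
    rintro ⟨s, hs', s', hs'', hx⟩
    obtain ⟨b, rfl⟩ := hb s hs'
    obtain ⟨c, rfl⟩ := hb s' hs''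
    rcases hx with hx | hx | hx
    · exact key 0 b c x (by rw [hx]; simp [act, cycle, hs, toE3])
    · exact key 1 b c x (by rw [hx]; simp [act, cycle, hs, toE3])
    · exact key 2 b c x (by rw [hx]; simp [act, cycle, hs, toE3])
  · rintro ⟨u, -, hu, rfl⟩
    rw [point, Nat.div_eq_of_lt hu, h0]
    obtain ⟨k, a, b, c⟩ := decode (u % 24)
    refine ⟨_, hm b, _, hm c, ?_⟩
    fin_cases k
    · left; simp [act, cycle, hs, toE3]
    · right; left; simp [act, cycle, hs, toE3]
    · right; right; simp [act, cycle, hs, toE3]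

/-- The symmetries of the vertex set. -/
def IsSymmetry (m : Configuration) (φ : E3 ≃ₗᵢ[ℝ] E3) : Prop := φ '' m.vertexSet = m.vertexSet

theorem IsSymmetry.trans {φ ψ : E3 ≃ₗᵢ[ℝ] E3} (hφ : m.IsSymmetry φ) (hψ : m.IsSymmetry ψ) :
    m.IsSymmetry (φ.trans ψ) := by
  rw [IsSymmetry] at *
  rw [LinearIsometryEquiv.coe_trans, Set.image_comp, hφ, hψ]

theorem Valid.finite_vertexSet (h : m.Valid) : m.vertexSet.Finite := by
  refine ((Set.finite_lt_nat 24).image fun u => toE3 (m.point u)).subset fun x hx => ?_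
  obtain ⟨u, -, hu, rfl⟩ := h.mem_vertexSet.1 hx
  exact ⟨u, hu, rfl⟩

/-- An injective map of a finite set into itself is onto, so one inclusion suffices. -/
theorem Valid.isSymmetry (h : m.Valid) {φ : E3 ≃ₗᵢ[ℝ] E3}
    (hφ : ∀ x ∈ m.vertexSet, φ x ∈ m.vertexSet) : m.IsSymmetry φ :=
  Set.eq_of_subset_of_ncard_le (Set.image_subset_iff.2 hφ)
    (Set.ncard_image_of_injective _ φ.injective).ge h.finite_vertexSet

theorem Valid.exists_act (h : m.Valid) (g : SignedCycle) :
    ∃ φ : E3 ≃ₗᵢ[ℝ] E3, m.IsSymmetry φ ∧ ∀ v, φ (toE3 v) = toE3 (act Neg.neg g v) := by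
  obtain ⟨φ, hφ⟩ := exists_isometry (act Neg.neg g) (act_add g) (act_smul g)
    fun v => dot_act g v v
  refine ⟨φ, h.isSymmetry fun x hx => ?_, hφ⟩
  obtain ⟨u, hu, hu', rfl⟩ := h.mem_vertexSet.1 hx
  rw [hφ, h.act_point]
  refine h.mem_vertexSet.2 ⟨_, slotAct_mem g (m.mem_slots.1 hu).1, ?_, rfl⟩
  have := slotAct_div g u
  omega

theorem rotateSlot_spec : ∀ u < 24, canon u = u →
    rotateSlot u < 24 ∧ canon (rotateSlot u) = rotateSlot u := by
  decide

theorem Valid.mem_slots_of_lt (h : m.Valid) {u : ℕ} (hu : u < 24) (hc : canon u = u) :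
    u ∈ m.slots := by
  rw [mem_slots, Nat.div_eq_of_lt hu]
  exact ⟨h.size_pos, hc⟩

theorem Valid.rotate_point (h : m.Valid) {u : ℕ} (hu : u < 24) (hc : canon u = u) :
    rotate m.t (m.point u) = m.point (rotateSlot u) := by
  rw [canon, if_pos hu] at hc
  have := h.rotate_slot (u := u / 2) (by omega)
  rwa [hc] at this

theorem Valid.exists_rotate (h : m.Valid) :
    ∃ φ : E3 ≃ₗᵢ[ℝ] E3, m.IsSymmetry φ ∧ ∀ v, φ (toE3 v) = toE3 (rotate m.t v) := by
  obtain ⟨φ, hφ⟩ := exists_isometry (rotate m.t)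
    (fun v w => by ext <;> simp [rotate] <;> ring)
    (fun c v => by ext <;> simp [rotate] <;> ring) (dot_rotate h.t_sq)
  refine ⟨φ, h.isSymmetry fun x hx => ?_, hφ⟩
  obtain ⟨u, hu, hu', rfl⟩ := h.mem_vertexSet.1 hx
  have hc := (m.mem_slots.1 hu).2
  obtain ⟨h1, h2⟩ := rotateSlot_spec u hu' hc
  rw [hφ, h.rotate_point hu' hc]
  exact h.mem_vertexSet.2 ⟨_, h.mem_slots_of_lt h1 h2, h1, rfl⟩

theorem Valid.exists_rotate_iterate (h : m.Valid) (j : ℕ) :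
    ∃ φ : E3 ≃ₗᵢ[ℝ] E3, m.IsSymmetry φ ∧ ∀ v, φ (toE3 v) = toE3 ((rotate m.t)^[j] v) := by
  induction j with
  | zero => exact ⟨.refl ℝ E3, by simp [IsSymmetry], fun v => rfl⟩
  | succ j ih =>
    obtain ⟨φ, h1, h2⟩ := ih
    obtain ⟨ψ, h3, h4⟩ := h.exists_rotate
    refine ⟨φ.trans ψ, h1.trans h3, fun v => ?_⟩
    rw [LinearIsometryEquiv.trans_apply, h2, h4, Function.iterate_succ_apply']

theorem Valid.rotate_iterate_point (h : m.Valid) (j : ℕ) {u : ℕ} (hu : u < 24)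
    (hc : canon u = u) : (rotate m.t)^[j] (m.point u) = m.point (rotateSlot^[j] u) := by
  induction j generalizing u with
  | zero => rfl
  | succ j ih =>
    obtain ⟨h1, h2⟩ := rotateSlot_spec u hu hc
    rw [Function.iterate_succ_apply, Function.iterate_succ_apply, h.rotate_point hu hc, ih h1 h2]

/-- The numbers 8 and 16 belong to the cyclic permutations without sign changes. The slots 0, 8 and
16 therefore hold three mutually adjacent vertices, the frame that determines a symmetry. -/
theorem Valid.point_eight (h : m.Valid) : m.point 8 = (m.t / 2, 1 / 2, 0) := by
  rw [show m.point 8 = act Neg.neg (1, false, false, false) (m.point 0) by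
    rw [h.act_point]; rfl, h.point_zero]
  rfl

theorem Valid.point_sixteen (h : m.Valid) : m.point 16 = (1 / 2, 0, m.t / 2) := by
  rw [show m.point 16 = act Neg.neg (2, false, false, false) (m.point 0) by
    rw [h.act_point]; rfl, h.point_zero]
  rfl

/-- The three vertices of the frame are linearly independent, and a linear isometry is determined by
its values on a basis. -/
theorem Valid.eq_of_eq_on_frame (h : m.Valid) {φ ψ : E3 ≃ₗᵢ[ℝ] E3}
    (h0 : φ (toE3 (m.point 0)) = ψ (toE3 (m.point 0)))
    (h1 : φ (toE3 (m.point 8)) = ψ (toE3 (m.point 8)))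
    (h2 : φ (toE3 (m.point 16)) = ψ (toE3 (m.point 16))) (x : E3) : φ x = ψ x := by
  -- The isometry $\psi^{-1}\varphi$ fixes $u$ and preserves inner products, so it moves $x$ only
  -- orthogonally to $u$.
  have key : ∀ u : E3, φ u = ψ u → inner ℝ u (ψ.symm (φ x) - x) = 0 := by
    intro u hu
    have e : ψ.symm (φ u) = u := by rw [hu, ψ.symm_apply_apply]
    have e2 : inner ℝ (ψ.symm (φ u)) (ψ.symm (φ x)) = inner ℝ u x := by
      rw [LinearIsometryEquiv.inner_map_map, LinearIsometryEquiv.inner_map_map]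
    rw [e] at e2
    rw [inner_sub_right, e2, sub_self]
  have k0 := key _ h0
  have k1 := key _ h1
  have k2 := key _ h2
  set y := ψ.symm (φ x) - x with hy
  rw [h.point_zero, PiLp.inner_apply, Fin.sum_univ_three] at k0
  rw [h.point_eight, PiLp.inner_apply, Fin.sum_univ_three] at k1
  rw [h.point_sixteen, PiLp.inner_apply, Fin.sum_univ_three] at k2
  simp [toE3] at k0 k1 k2
  have ht := h.t_sq
  have ht1 : m.t + 1 ≠ 0 := by
    intro h0
    have : m.t = -1 := by linarith
    rw [this] at ht
    norm_num at ht
  have y0 : y 0 = 0 := by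
    have : (m.t + 1) * y 0 = 0 := by
      -- Up to a power of 2 the determinant of the frame is $t^3+1=2(t+1)$, which is not zero
      -- because $t=-1$ does not satisfy $t^2=t+1$.
      linear_combination k2 - m.t * k0 + m.t ^ 2 * k1 - (m.t + 1) * y 0 / 2 * ht
    exact (mul_eq_zero.1 this).resolve_left ht1
  have y1 : y 1 = 0 := by
    rw [y0] at k1; linarith
  have y2 : y 2 = 0 := by
    rw [y1] at k0; linarith
  have hy0 : y = 0 := by
    ext i; fin_cases i <;> simpa
  rw [hy, sub_eq_zero] at hy0
  rw [← hy0, ψ.apply_symm_apply, hy0]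

/-- The pairs of images of the slots `0`, `8`, `16` under the symmetries. -/
def frames : List (List ℕ) :=
  (List.range 24).flatMap fun g => (List.range 5).map fun j =>
    [0, 8, 16].map fun u => slotAct (decode g) (rotateSlot^[j] u)

/-- All frames of mutually adjacent vertices of the icosahedron are symmetric to each other. -/
def frameCheck (m : Configuration) : Bool :=
  let vertices := (List.range 24).filter fun u => canon u == u
  let near := fun u => (m.adj u).filter fun w => Nat.blt w 24
  vertices.all fun u => (near u).all fun v => (near v).all fun w =>
    !(near u).contains w || frames.contains [u, v, w]

/-- A symmetry sends the frame to an ordered triangle of $W$. By the finite check this triangle is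
also the image of the frame under a signed cycle after a power of the rotation, and two isometries
that agree on the frame are equal. -/
theorem Valid.symmetry_eq (h : m.Valid) (hf : m.frameCheck = true) {φ : E3 ≃ₗᵢ[ℝ] E3}
    (hφ : m.IsSymmetry φ) :
    ∃ g, ∃ j < 5, ∀ v, φ (toE3 v) = toE3 (act Neg.neg g ((rotate m.t)^[j] v)) := by
  have hs : ∀ u < 24, canon u = u →
      ∃ w ∈ m.slots, w < 24 ∧ φ (toE3 (m.point u)) = toE3 (m.point w) := by
    intro u hu hc
    rw [← h.mem_vertexSet, ← hφ]
    exact ⟨_, h.mem_vertexSet.2 ⟨u, h.mem_slots_of_lt hu hc, hu, rfl⟩, rfl⟩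
  obtain ⟨u, hu, hu', eu⟩ := hs 0 (by norm_num) rfl
  obtain ⟨v, hv, hv', ev⟩ := hs 8 (by norm_num) rfl
  obtain ⟨w, hw, hw', ew⟩ := hs 16 (by norm_num) rfl
  have hadj : ∀ {a b c d : ℕ}, a ∈ m.slots → b ∈ m.slots → c ∈ m.slots → d ∈ m.slots →
      b ∈ m.adj a → φ (toE3 (m.point a)) = toE3 (m.point c) →
      φ (toE3 (m.point b)) = toE3 (m.point d) → d ∈ m.adj c := by
    intro a b c d ha hb hc hd hab e1 e2
    refine h.mem_adj_of_dist_eq_one (m.mem_slots.1 hc).1 hd ?_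
    rw [← e1, ← e2, φ.dist_map]
    exact (h.dist_eq_one_of_mem_adj (m.mem_slots.1 ha).1 hab).2
  have h0 : 0 ∈ m.slots := h.mem_slots_of_lt (by norm_num) rfl
  have h8 : 8 ∈ m.slots := h.mem_slots_of_lt (by norm_num) rfl
  have h16 : 16 ∈ m.slots := h.mem_slots_of_lt (by norm_num) rfl
  have d8 : dot (m.point 8) (m.point 8) = (m.t + 2) / 4 :=
    h.dot_point (m.mem_slots.1 h8).1
  have d16 : dot (m.point 16) (m.point 16) = (m.t + 2) / 4 :=
    h.dot_point (m.mem_slots.1 h16).1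
  have d0 : dot (m.point 0) (m.point 0) = (m.t + 2) / 4 :=
    h.dot_point (m.mem_slots.1 h0).1
  have a1 : 8 ∈ m.adj 0 := h.mem_adj_of_dist_eq_one (m.mem_slots.1 h0).1 h8 (by
    rw [dist_toE3_eq_one_iff d0 d8, h.point_zero, h.point_eight]
    simp only [dot]; ring)
  have a2 : 16 ∈ m.adj 0 := h.mem_adj_of_dist_eq_one (m.mem_slots.1 h0).1 h16 (by
    rw [dist_toE3_eq_one_iff d0 d16, h.point_zero, h.point_sixteen]
    simp only [dot]; ring)
  have a3 : 16 ∈ m.adj 8 := h.mem_adj_of_dist_eq_one (m.mem_slots.1 h8).1 h16 (by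
    rw [dist_toE3_eq_one_iff d8 d16, h.point_eight, h.point_sixteen]
    simp only [dot]; ring)
  have b1 := hadj h0 h8 hu hv a1 eu ev
  have b2 := hadj h0 h16 hu hw a2 eu ew
  have b3 := hadj h8 h16 hv hw a3 ev ew
  simp only [frameCheck, List.all_eq_true, List.mem_filter, List.mem_range, beq_iff_eq,
    Bool.or_eq_true, Bool.not_eq_true', List.contains_iff_mem, Nat.blt_eq] at hf
  -- The three images are mutually adjacent, so the only surviving alternative of the check is
  -- membership in `frames`.
  have hmem := (hf u ⟨hu', (m.mem_slots.1 hu).2⟩ v ⟨b1, hv'⟩ w ⟨b3, hw'⟩).resolve_left (by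
    rw [← Bool.not_eq_true, List.contains_iff_mem, List.mem_filter, Nat.blt_eq]
    exact not_not.2 ⟨b2, hw'⟩)
  simp only [frames, List.mem_flatMap, List.mem_map, List.mem_range, List.map_cons, List.map_nil,
    List.cons.injEq, and_true] at hmem
  obtain ⟨n, -, j, hj, f0, f8, f16⟩ := hmem
  obtain ⟨ψ₁, -, h1⟩ := h.exists_rotate_iterate j
  obtain ⟨ψ₂, -, h2⟩ := h.exists_act (decode n)
  refine ⟨decode n, j, hj, fun x => ?_⟩
  have hψ : ∀ x, ψ₁.trans ψ₂ (toE3 x) =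
      toE3 (act Neg.neg (decode n) ((rotate m.t)^[j] x)) := fun x => by
    rw [LinearIsometryEquiv.trans_apply, h1, h2]
  rw [← hψ]
  have hp : ∀ a < 24, canon a = a → ψ₁.trans ψ₂ (toE3 (m.point a)) =
      toE3 (m.point (slotAct (decode n) (rotateSlot^[j] a))) := fun a ha hc => by
    rw [hψ, h.rotate_iterate_point j ha hc, h.act_point]
  refine h.eq_of_eq_on_frame ?_ ?_ ?_ _
  · rw [hp 0 (by norm_num) rfl, eu, f0]
  · rw [hp 8 (by norm_num) rfl, ev, f8]
  · rw [hp 16 (by norm_num) rfl, ew, f16]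

/-! ### The set of all points -/

/-- The points of a configuration. -/
def points (m : Configuration) : Set E3 := (fun u => toE3 (m.point u)) '' {u | u ∈ m.slots}

/-- The representatives of the orbits other than the vertex set. -/
noncomputable def representative (m : Configuration) (i : ℕ) : E3 :=
  toE3 (m.point (24 * (1 + 5 * i)))

theorem Valid.rotate_iterate_base (h : m.Valid) {k : ℕ} (hk : m.size = 1 + 5 * k) {i : ℕ}
    (hi : i < k) {j : ℕ} (hj : j < 5) :
    (rotate m.t)^[j] (m.point (24 * (1 + 5 * i))) = m.point (24 * (1 + 5 * i + j)) := by
  induction j with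
  | zero => rfl
  | succ j ih =>
    rw [Function.iterate_succ_apply', ih (by omega)]
    have := h.rotate_base (b := 5 * i + j) (by omega) (by omega)
    rw [show 1 + 5 * i + j = 5 * i + j + 1 by ring, this]
    congr 1
    ring

/-- The orbits are defined by all linear isometries that preserve $W$; the classification of these
isometries turns the orbits into the explicit list of slots. -/
theorem Valid.withOrbits_eq (h : m.Valid) (hf : m.frameCheck = true) {k : ℕ}
    (hk : m.size = 1 + 5 * k) :
    withOrbits m.vertexSet (fun i : Fin k => m.representative i) = m.points := by
  have hact : ∀ g u, u / 24 < m.size → toE3 (act Neg.neg g (m.point u)) ∈ m.points :=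
    fun g u hu => ⟨_, slotAct_mem g hu, by rw [h.act_point]⟩
  apply Set.Subset.antisymm
  · rintro x (hx | hx)
    · obtain ⟨u, hu, -, rfl⟩ := h.mem_vertexSet.1 hx
      exact ⟨u, hu, rfl⟩
    · obtain ⟨i, φ, hφ, rfl⟩ := Set.mem_iUnion.1 hx
      obtain ⟨g, j, hj, he⟩ := h.symmetry_eq hf hφ
      have hi := i.2
      beta_reduce
      rw [representative, he, h.rotate_iterate_base hk hi hj]
      exact hact g _ (by omega)
  · rintro x ⟨u, hu, rfl⟩
    by_cases hu' : u < 24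
    · exact Or.inl (h.mem_vertexSet.2 ⟨u, hu, hu', rfl⟩)
    · right
      have h1 := (m.mem_slots.1 hu).1
      -- The base point has index $1+5i+j$: the quotient $i$ selects the orbit and the remainder $j$
      -- the power of the rotation.
      refine Set.mem_iUnion.2 ⟨⟨(u / 24 - 1) / 5, by omega⟩, ?_⟩
      obtain ⟨φ, h2, h3⟩ := h.exists_rotate_iterate ((u / 24 - 1) % 5)
      obtain ⟨ψ, h4, h5⟩ := h.exists_act (decode (u % 24))
      refine ⟨φ.trans ψ, h2.trans h4, ?_⟩
      beta_reduce
      rw [LinearIsometryEquiv.trans_apply, representative, h3, h5,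
        h.rotate_iterate_base hk (by omega) (Nat.mod_lt _ (by norm_num)),
        show 1 + 5 * ((u / 24 - 1) / 5) + (u / 24 - 1) % 5 = u / 24 by omega, ← point_eq_act]

theorem Valid.points_subset_sphere (h : m.Valid) {r : ℝ} (hr : 0 ≤ r)
    (hr2 : r ^ 2 = (m.t + 2) / 4) : m.points ⊆ Metric.sphere 0 r := by
  rintro x ⟨u, hu, rfl⟩
  rw [toE3_mem_sphere_iff hr, hr2]
  exact h.dot_point (m.mem_slots.1 hu).1

theorem Valid.ncard_points (h : m.Valid) : m.points.ncard = m.slots.length := by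
  have hn : m.slots.Nodup := List.nodup_range.filter _
  rw [points, Set.InjOn.ncard_image fun u hu w hw e => h.point_injOn hu hw (toE3_injective e),
    ← List.toFinset_card_of_nodup hn, ← Set.ncard_coe_finset]
  congr 1
  ext u
  simp

theorem Valid.mem_points_of_symmetry (h : m.Valid) (hf : m.frameCheck = true) {k : ℕ}
    (hk : m.size = 1 + 5 * k) {φ : E3 ≃ₗᵢ[ℝ] E3} (hφ : m.IsSymmetry φ) {x : E3}
    (hx : x ∈ m.points) : φ x ∈ m.points := by
  rw [← h.withOrbits_eq hf hk] at hx ⊢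
  rcases hx with hx | hx
  · left
    rw [← hφ]
    exact ⟨x, hx, rfl⟩
  · right
    obtain ⟨i, ψ, hψ, rfl⟩ := Set.mem_iUnion.1 hx
    exact Set.mem_iUnion.2 ⟨i, ψ.trans φ, IsSymmetry.trans hψ hφ, rfl⟩

end Configuration

end SphereColoring

namespace SphereColoring

namespace Configuration

variable {m : Configuration}

/-! ### Refuting colourings by unit propagation and branching -/

/-- For each of four colours, the set (as a bit mask) of slots that cannot have it. -/
structure Marks where
  /-- The slots that cannot have colour 0. -/
  m0 : ℕ
  /-- The slots that cannot have colour 1. -/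
  m1 : ℕ
  /-- The slots that cannot have colour 2. -/
  m2 : ℕ
  /-- The slots that cannot have colour 3. -/
  m3 : ℕ

/-- The set of slots that cannot have colour `i`. -/
def Marks.get (S : Marks) (i : Fin 4) : ℕ :=
  match i with
  | 0 => S.m0
  | 1 => S.m1
  | 2 => S.m2
  | 3 => S.m3

/-- Note that the slots in a set cannot have colour `i`. -/
def Marks.mark (S : Marks) (a : ℕ) (i : Fin 4) : Marks :=
  match i with
  | 0 => ⟨Nat.lor S.m0 a, S.m1, S.m2, S.m3⟩
  | 1 => ⟨S.m0, Nat.lor S.m1 a, S.m2, S.m3⟩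
  | 2 => ⟨S.m0, S.m1, Nat.lor S.m2 a, S.m3⟩
  | 3 => ⟨S.m0, S.m1, S.m2, Nat.lor S.m3 a⟩

/-- Note that slot `u` cannot have colour `i`. -/
def Marks.exclude (S : Marks) (u : ℕ) (i : Fin 4) : Marks := S.mark (Nat.shiftLeft 1 u) i

/-- The set of neighbours of a slot as a bit mask. -/
def nbrMask (m : Configuration) (u : ℕ) : ℕ :=
  (m.adj u).foldr (fun w F => Nat.lor F (Nat.shiftLeft 1 w)) 0

/-- Give slot `u` the colour `i`. -/
def assign (m : Configuration) (S : Marks) (u : ℕ) (i : Fin 4) : Marks := S.mark (m.nbrMask u) i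

/-- The slot cannot have the colour with the given set of marks. -/
def isMarked (s u : ℕ) : Bool := Nat.beq (Nat.land 1 (Nat.shiftRight s u)) 1

/-- One step of `refute`: try all possible colours of the first slot in the list. -/
def refuteStep (m : Configuration) (next : ℕ → ℕ → ℕ → ℕ → List ℕ → Option (List ℕ))
    (s0 s1 s2 s3 : ℕ) (l : List ℕ) : Option (List ℕ) :=
  match l with
  | [] => none
  | u :: l =>
    -- The rest of the list is handed from each colour to the next, so the list records the
    -- branching slots of the whole search tree in depth-first order. A slot with all four colours
    -- marked is a leaf; a slot with one open colour is a unit propagation.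
    ((((bif isMarked s0 u then some l else next (Nat.lor s0 (m.nbrMask u)) s1 s2 s3 l).bind
      fun l => bif isMarked s1 u then some l else next s0 (Nat.lor s1 (m.nbrMask u)) s2 s3 l).bind
      fun l => bif isMarked s2 u then some l else next s0 s1 (Nat.lor s2 (m.nbrMask u)) s3 l).bind
      fun l => bif isMarked s3 u then some l else next s0 s1 s2 (Nat.lor s3 (m.nbrMask u)) l)

/-- Search for a colouring that is compatible with the marks, branching on the slots in the
list. The value is the unused part of the list if there is no colouring. -/
def refute (m : Configuration) (fuel : ℕ) : ℕ → ℕ → ℕ → ℕ → List ℕ → Option (List ℕ) :=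
  Nat.rec (fun _ _ _ _ _ => none) (fun _ next => m.refuteStep next) fuel

/-- A colouring of the slots is compatible with the marks. -/
def Compatible (S : Marks) (C : ℕ → Fin 4) : Prop := ∀ i u, (S.get i).testBit u = true → C u ≠ i

/-- A colouring of the slots gives adjacent slots different colours. -/
def ProperOn (m : Configuration) (C : ℕ → Fin 4) : Prop := ∀ u, ∀ w ∈ m.adj u, C u ≠ C w

theorem testBit_shiftLeft_one {u w : ℕ} (h : (Nat.shiftLeft 1 u).testBit w = true) : w = u := by
  have h' : (1 <<< u).testBit w = true := h
  rw [Nat.one_shiftLeft, Nat.testBit_two_pow] at h'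
  exact (of_decide_eq_true h').symm

theorem mem_adj_of_testBit {u w : ℕ} (h : (m.nbrMask u).testBit w = true) : w ∈ m.adj u := by
  have key : ∀ l : List ℕ, (l.foldr (fun w F => Nat.lor F (Nat.shiftLeft 1 w)) 0).testBit w = true →
      w ∈ l := by
    intro l hl
    induction l with
    | nil => simp at hl
    | cons a l ih =>
      have h' : ((l.foldr (fun w F => Nat.lor F (Nat.shiftLeft 1 w)) 0) |||
          (Nat.shiftLeft 1 a)).testBit w = true := hl
      rw [Nat.testBit_or, Bool.or_eq_true] at h'
      rcases h' with h' | h'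
      · exact List.mem_cons_of_mem _ (ih h')
      · rw [testBit_shiftLeft_one h']; exact List.mem_cons_self
  exact key _ h

theorem testBit_lor {a b u : ℕ} (h : (Nat.lor a b).testBit u = true) :
    a.testBit u = true ∨ b.testBit u = true := by
  have h' : (a ||| b).testBit u = true := h
  rwa [Nat.testBit_or, Bool.or_eq_true] at h'

theorem Compatible.mark {S : Marks} {C : ℕ → Fin 4} (h : Compatible S C) {a : ℕ} {i : Fin 4}
    (h' : ∀ u, a.testBit u = true → C u ≠ i) : Compatible (S.mark a i) C := by
  intro j u hu
  fin_cases i <;> fin_cases j <;> first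
    | exact h 0 u hu
    | exact h 1 u hu
    | exact h 2 u hu
    | exact h 3 u hu
    | exact (testBit_lor hu).elim (h 0 u) (h' u)
    | exact (testBit_lor hu).elim (h 1 u) (h' u)
    | exact (testBit_lor hu).elim (h 2 u) (h' u)
    | exact (testBit_lor hu).elim (h 3 u) (h' u)

theorem Compatible.exclude {S : Marks} {C : ℕ → Fin 4} (h : Compatible S C) {u : ℕ} {i : Fin 4}
    (hu : C u ≠ i) : Compatible (S.exclude u i) C :=
  h.mark fun w hw => by rwa [testBit_shiftLeft_one hw]

theorem Compatible.assign {S : Marks} {C : ℕ → Fin 4} (h : Compatible S C) (hC : m.ProperOn C)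
    {u : ℕ} {i : Fin 4} (hu : C u = i) : Compatible (m.assign S u i) C :=
  h.mark fun w hw => by
    rw [← hu]
    exact (hC u w (mem_adj_of_testBit hw)).symm

theorem testBit_of_isMarked {s u : ℕ} (h : isMarked s u = true) : s.testBit u = true := by
  have h' : 1 &&& s >>> u = 1 := Nat.eq_of_beq_eq_true h
  rw [Nat.testBit, h']
  rfl

/-- A result other than `none` requires that each of the four colours of the branching slot be
marked already or lead to a refuted node. The actual colour of the slot contradicts one of these.
The list itself needs no validity condition, since it only guides the search. -/
theorem refute_sound {C : ℕ → Fin 4} (hC : m.ProperOn C) {fuel s0 s1 s2 s3 : ℕ}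
    {l l' : List ℕ} (hr : m.refute fuel s0 s1 s2 s3 l = some l') :
    ¬ Compatible ⟨s0, s1, s2, s3⟩ C := by
  induction fuel generalizing s0 s1 s2 s3 l l' with
  | zero => exact absurd hr (by simp [refute])
  | succ fuel ih =>
    intro hS
    change m.refuteStep (m.refute fuel) s0 s1 s2 s3 l = some l' at hr
    cases l with
    | nil => simp [refuteStep] at hr
    | cons u l =>
      simp only [refuteStep, Option.bind_eq_some_iff] at hr
      obtain ⟨l3, ⟨l2, ⟨l1, h0, h1⟩, h2⟩, h3⟩ := hr
      -- One statement for the four colours: $s$ is the mask of colour $i$ and the masks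
      -- $t_0,\dots,t_3$ are those after giving $u$ this colour.
      have hb : ∀ {i s t0 t1 t2 t3 l l'}, s = Marks.get ⟨s0, s1, s2, s3⟩ i →
          (C u = i → Compatible ⟨t0, t1, t2, t3⟩ C) →
          (bif isMarked s u then some l else m.refute fuel t0 t1 t2 t3 l) = some l' →
          C u ≠ i := by
        intro i s t0 t1 t2 t3 l l' hs ht hi hu
        cases h7 : isMarked s u
        · simp only [h7, cond_false] at hi
          exact ih hi (ht hu)
        · exact hS i u (hs ▸ testBit_of_isMarked h7) hu
      have key : ∀ x : Fin 4, x = 0 ∨ x = 1 ∨ x = 2 ∨ x = 3 := by decide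
      have h4 := hb (i := 0) rfl (hS.assign hC) h0
      have h5 := hb (i := 1) rfl (hS.assign hC) h1
      have h6 := hb (i := 2) rfl (hS.assign hC) h2
      have h7 := hb (i := 3) rfl (hS.assign hC) h3
      rcases key (C u) with h | h | h | h <;> contradiction

end Configuration

end SphereColoring

namespace SphereColoring

namespace Configuration

variable {m : Configuration}

/-! ### Colourings with a fixed pattern on the icosahedron -/

/-- The pattern: a colouring of the icosahedron. -/
def pattern (u : ℕ) : Fin 4 := [0, 1, 2, 3, 1, 3, 2, 0, 3, 0, 2, 1].getD (u / 2) 0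

/-- The signed cycles with an even number of signs; they respect the pattern. -/
def evenCycles : List SignedCycle :=
  ((List.range 24).map decode).filter fun g => !(xor g.2.1 (xor g.2.2.1 g.2.2.2))

/-- The permutation of the colours of the pattern by a signed cycle. -/
def colourPerm (g : SignedCycle) (i : Fin 4) : Fin 4 := pattern (slotAct g (2 * i.val))

/-- Exclude a colour of a slot, and all images under the symmetries of the pattern. -/
def excludeOrbit (S : Marks) (u : ℕ) (i : Fin 4) : Marks :=
  evenCycles.foldr (fun g S => S.exclude (slotAct g u) (colourPerm g i)) S

/-- The vertices of the icosahedron have the colours of the pattern. -/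
def patternMarks (m : Configuration) : Marks :=
  (List.range 12).foldr (fun s S => m.assign S (2 * s) (pattern (2 * s))) ⟨0, 0, 0, 0⟩

/-- The marks are contradictory, by branching on a list of slots. -/
def isRefuted (m : Configuration) (S : Marks) (c : List ℕ) : Bool :=
  -- The fuel bounds the depth of the search tree, not its size. Running out of it gives `none`, so
  -- it cannot affect soundness.
  (m.refute 2000 S.m0 S.m1 S.m2 S.m3 c).isSome

/-- Exclude the listed colours of slots in turn, each by branching on a list of slots, until no
colouring is left, by branching on `c`. -/
def refuteAll (m : Configuration) (S : Marks) (c : List ℕ) :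
    List (ℕ × Fin 4 × List ℕ) → Bool
  | [] => m.isRefuted S c
  | (u, i, c') :: l =>
    m.isRefuted (m.assign S u i) c' && m.refuteAll (excludeOrbit S u i) c l

/-- A proper colouring of the points. -/
def IsColouring (m : Configuration) {n : ℕ} (C : E3 → Fin n) : Prop :=
  ∀ x ∈ m.points, ∀ y ∈ m.points, dist x y = 1 → C x ≠ C y

/-- The colouring of the slots that is induced by a colouring of space. -/
noncomputable def slotColouring (m : Configuration) (C : E3 → Fin 4) (u : ℕ) : Fin 4 :=
  C (toE3 (m.point u))

theorem Valid.point_mem_points (h : m.Valid) {u : ℕ} (hu : u / 24 < m.size) :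
    toE3 (m.point u) ∈ m.points := by
  refine ⟨slotAct (0, false, false, false) u, slotAct_mem _ hu, ?_⟩
  simp only [← h.act_point]
  rfl

theorem Valid.properOn (h : m.Valid) {C : E3 → Fin 4} (hC : m.IsColouring C) :
    m.ProperOn (m.slotColouring C) := by
  intro u w hw
  by_cases hu : u / 24 < m.size
  · obtain ⟨h1, h2⟩ := h.dist_eq_one_of_mem_adj hu hw
    have h3 := (m.mem_slots.1 h1).1
    exact hC _ (h.point_mem_points hu) _ (h.point_mem_points h3) h2
  -- Numbers beyond the last base point have an empty neighbour list, so properness holds for all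
  -- natural numbers, as `ProperOn` demands.
  · rw [adj, List.getD_eq_default _ _ (by rw [h.nbrs_length]; exact not_lt.1 hu)] at hw
    simp at hw

/-- A colouring whose restriction to the icosahedron is the pattern. -/
def HasPattern (m : Configuration) (C : E3 → Fin 4) : Prop :=
  m.IsColouring C ∧ ∀ s < 12, C (toE3 (m.point (2 * s))) = pattern (2 * s)

theorem IsColouring.comp {C : E3 → Fin 4} (hC : m.IsColouring C) {φ : E3 ≃ₗᵢ[ℝ] E3}
    (hφ : ∀ x ∈ m.points, φ x ∈ m.points) (σ : Equiv.Perm (Fin 4)) :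
    m.IsColouring fun x => σ (C (φ x)) := fun x hx y hy hd he =>
  hC _ (hφ x hx) _ (hφ y hy) (by rwa [φ.dist_map]) (σ.injective he)

/-- In the pattern the slots 0, 2, 4, 6 have the colours 0, 1, 2, 3, so slot $2i$ represents colour
$i$, and the colour of its image tells where colour $i$ goes. The check confirms that this
permutation works on all twelve vertices. -/
theorem colourPerm_spec : ∀ g ∈ evenCycles, Function.Injective (colourPerm g) ∧
    ∀ s < 12, pattern (slotAct g (2 * s)) = colourPerm g (pattern (2 * s)) := by
  decide +kernel

theorem not_compatible_of_isRefuted {C : ℕ → Fin 4} (hC : m.ProperOn C) {S : Marks} {c : List ℕ}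
    (h : m.isRefuted S c = true) : ¬ Compatible S C := by
  obtain ⟨l', hl'⟩ := Option.isSome_iff_exists.1 h
  exact refute_sound hC hl'

/-- The marks are kept valid for all colourings with the pattern at once. This is what allows an
exclusion to spread over an orbit: an image of the excluded assumption for one colouring is the
assumption itself for a transported colouring, which again has the pattern. -/
theorem Valid.refuteAll_sound (h : m.Valid)
    (hsym : ∀ φ : E3 ≃ₗᵢ[ℝ] E3, m.IsSymmetry φ → ∀ x ∈ m.points, φ x ∈ m.points)
    {S : Marks} {c : List ℕ} {l : List (ℕ × Fin 4 × List ℕ)} (hl : m.refuteAll S c l = true)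
    (hS : ∀ C, m.HasPattern C → Compatible S (m.slotColouring C)) (C : E3 → Fin 4) :
    ¬ m.HasPattern C := by
  induction l generalizing S C with
  | nil =>
    intro hC
    exact not_compatible_of_isRefuted (h.properOn hC.1) hl (hS C hC)
  | cons a l ih =>
    obtain ⟨u, i, c'⟩ := a
    rw [refuteAll, Bool.and_eq_true] at hl
    obtain ⟨h1, h2⟩ := hl
    have hu : ∀ C, m.HasPattern C → m.slotColouring C u ≠ i := fun C hC hi =>
      not_compatible_of_isRefuted (h.properOn hC.1) h1 ((hS C hC).assign (h.properOn hC.1) hi)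
    refine ih h2 (fun C hC => ?_) C
    have key : ∀ g ∈ evenCycles, m.slotColouring C (slotAct g u) ≠ colourPerm g i := by
      intro g hg he
      obtain ⟨hinj, hpat⟩ := colourPerm_spec g hg
      obtain ⟨φ, h3, h4⟩ := h.exists_act g
      let σ := Equiv.ofBijective _ (Finite.injective_iff_bijective.1 hinj)
      have hσ : ∀ x, σ x = colourPerm g x := fun x => rfl
      -- Composing with the symmetry permutes the colours on the icosahedron by σ; undoing this
      -- permutation restores the pattern.
      have hC' : m.HasPattern fun x => σ.symm (C (φ x)) := by
        refine ⟨hC.1.comp (hsym φ h3) _, fun s hs => ?_⟩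
        have h5 : slotAct g (2 * s) < 24 := by
          have := slotAct_div g (2 * s)
          omega
        have h6 : canon (slotAct g (2 * s)) = slotAct g (2 * s) := by rw [slotAct, canon_canon]
        rw [canon, if_pos h5] at h6
        rw [Equiv.symm_apply_eq, h4, h.act_point, ← h6, hC.2 _ (by omega), h6, hpat s hs, hσ]
      refine hu _ hC' ?_
      rw [slotColouring] at he ⊢
      rw [Equiv.symm_apply_eq, h4, h.act_point, he, hσ]
    rw [excludeOrbit]
    -- The twelve exclusions are added one at a time, by induction on the list of cycles.
    generalize evenCycles = L at key
    induction L with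
    | nil => exact hS C hC
    | cons g L ihL =>
      exact (ihL fun g' hg' => key g' (List.mem_cons_of_mem _ hg')).exclude
        (key g List.mem_cons_self)

theorem Valid.not_hasPattern (h : m.Valid)
    (hsym : ∀ φ : E3 ≃ₗᵢ[ℝ] E3, m.IsSymmetry φ → ∀ x ∈ m.points, φ x ∈ m.points)
    {c : List ℕ} {l : List (ℕ × Fin 4 × List ℕ)} (hl : m.refuteAll m.patternMarks c l = true)
    (C : E3 → Fin 4) :
    ¬ m.HasPattern C := by
  refine h.refuteAll_sound hsym hl (fun C hC => ?_) C
  have key : ∀ L : List ℕ, (∀ s ∈ L, s < 12) → Compatible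
      (L.foldr (fun s S => m.assign S (2 * s) (pattern (2 * s))) ⟨0, 0, 0, 0⟩)
      (m.slotColouring C) := by
    intro L hL
    induction L with
    | nil =>
      intro i u hu
      fin_cases i <;> simp [Marks.get] at hu
    | cons s L ih =>
      exact (ih fun s' hs' => hL s' (List.mem_cons_of_mem _ hs')).assign (h.properOn hC.1)
        (hC.2 s (hL s List.mem_cons_self))
  exact key _ fun s hs => List.mem_range.1 hs

/-! ### All colourings of the icosahedron -/

/-- The action of a power of the rotation followed by a reflection on slots. -/
def symmetrySlot (j : ℕ) (e : Bool) (u : ℕ) : ℕ :=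
  slotAct (0, e, false, false) (rotateSlot^[j] u)

/-- A colouring of the icosahedron is carried to the pattern by a symmetry. -/
def matchesPattern (f : ℕ → Fin 4) (j : ℕ) (e : Bool) : Bool :=
  let f' := fun s => f (symmetrySlot j e (2 * s))
  ((List.range 12).all fun s => f' s == f' (pattern (2 * s)).val) &&
    (f' 0 != f' 1 && f' 0 != f' 2 && f' 0 != f' 3 && f' 1 != f' 2 && f' 1 != f' 3 && f' 2 != f' 3)

/-- The vertices of the icosahedron before vertex `k` that are adjacent to it. -/
def earlier (m : Configuration) (k : ℕ) : List ℕ :=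
  (List.range k).filter fun j => (m.adj (2 * j)).contains (2 * k)

/-- Every proper extension of a partial colouring of the icosahedron, given in reverse order, is
carried to the pattern by a symmetry. Here `n` is the number of vertices that are not coloured. -/
def extensionsMatch (m : Configuration) (n : ℕ) (p : List (Fin 4)) : Bool :=
  match n with
  | 0 => (List.range 5).any fun j => [false, true].any fun e =>
      matchesPattern (fun u => p.getD (11 - u / 2) 0) j e
  -- The vertex to be coloured now has number $11-n$. The newest colour is at the head of the list,
  -- so vertex $j$ sits at index $10-n-j$.
  | n + 1 => [0, 1, 2, 3].all fun i =>
      ((m.earlier (11 - n)).any fun j => p.getD (10 - n - j) 0 == i) || m.extensionsMatch n (i :: p)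

theorem getD_reverse_map_range (f : ℕ → Fin 4) {k s : ℕ} (hs : s < k) :
    ((List.range k).map f).reverse.getD (k - 1 - s) 0 = f s := by
  rw [List.getD_eq_getElem _ _ (by simp; omega), List.getElem_reverse]
  simp only [List.getElem_map, List.getElem_range, List.length_map, List.length_range]
  congr 1
  omega

/-- The enumeration runs over all proper colourings of the icosahedron that extend the given initial
segment. The pattern is preserved up to renaming by 12 of the 120 symmetries, so it has at most ten
images up to renaming, and five rotations with or without a reflection suffice to reach it. -/
theorem exists_match {f : ℕ → Fin 4} (hf : m.ProperOn f) {n k : ℕ} (hnk : k + n = 12)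
    (h : m.extensionsMatch n ((List.range k).map fun s => f (2 * s)).reverse = true) :
    ∃ j e, matchesPattern f j e = true := by
  induction n generalizing k with
  | zero =>
    obtain rfl : k = 12 := by omega
    simp only [extensionsMatch, List.any_eq_true] at h
    obtain ⟨j, -, e, -, hm⟩ := h
    refine ⟨j, e, ?_⟩
    -- The symmetry permutes the even slots below 24, so the values it reads from the list are
    -- indeed colours of vertices.
    have hlt : ∀ s < 12, symmetrySlot j e (2 * s) < 24 ∧
        canon (symmetrySlot j e (2 * s)) = symmetrySlot j e (2 * s) := by
      have h1 : ∀ j u, u < 24 → canon u = u →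
          rotateSlot^[j] u < 24 ∧ canon (rotateSlot^[j] u) = rotateSlot^[j] u := by
        intro j
        induction j with
        | zero => exact fun u hu hc => ⟨hu, hc⟩
        | succ j ih =>
          intro u hu hc
          rw [Function.iterate_succ_apply]
          obtain ⟨h2, h3⟩ := rotateSlot_spec u hu hc
          exact ih _ h2 h3
      intro s hs
      have h2 : canon (2 * s) = 2 * s := by
        rw [canon]; split_ifs <;> omega
      have h3 := (h1 j (2 * s) (by omega) h2).1
      have h4 := slotAct_div (0, e, false, false) (rotateSlot^[j] (2 * s))
      refine ⟨by rw [symmetrySlot]; omega, ?_⟩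
      rw [symmetrySlot, slotAct, canon_canon]
    have hg : ∀ s < 12, (((List.range 12).map fun s => f (2 * s)).reverse.getD
        (11 - symmetrySlot j e (2 * s) / 2) 0) = f (symmetrySlot j e (2 * s)) := by
      intro s hs
      obtain ⟨h1, h2⟩ := hlt s hs
      rw [canon, if_pos h1] at h2
      rw [getD_reverse_map_range (k := 12) (fun s => f (2 * s)) (by omega), h2]
    have hp : ∀ u, (pattern u).val < 12 := fun u => (pattern u).2.trans (by norm_num)
    simp only [matchesPattern, Bool.and_eq_true, List.all_eq_true, List.mem_range, beq_iff_eq,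
      bne_iff_ne] at hm ⊢
    rw [hg 0 (by norm_num), hg 1 (by norm_num), hg 2 (by norm_num), hg 3 (by norm_num)] at hm
    refine ⟨fun s hs => ?_, hm.2⟩
    have := hm.1 s hs
    rwa [hg s hs, hg _ (hp _)] at this
  | succ n ih =>
    have h1 : ∀ x : Fin 4, x ∈ [0, 1, 2, 3] := by decide
    rw [extensionsMatch, List.all_eq_true] at h
    have h2 := h (f (2 * k)) (h1 _)
    rw [Bool.or_eq_true] at h2
    rcases h2 with h2 | h2
    · exfalso
      rw [show 11 - n = k by omega, List.any_eq_true] at h2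
      obtain ⟨x, hx, h3⟩ := h2
      simp only [earlier, List.mem_filter, List.mem_range, List.contains_iff_mem] at hx
      -- The enumeration discards a colour only when an earlier adjacent vertex has it, which
      -- properness forbids for the actual colour.
      rw [show 10 - n - x = k - 1 - x by omega, getD_reverse_map_range (fun s => f (2 * s)) hx.1,
        beq_iff_eq] at h3
      exact hf _ _ hx.2 h3
    · refine ih (k := k + 1) (by omega) ?_
      rwa [List.range_succ, List.map_append, List.reverse_append]

/-- A symmetry and a renaming of colours turn any colouring with four colours into one with the
pattern, because the set of all points is invariant. -/
theorem Valid.not_isColouring_four (h : m.Valid)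
    (hsym : ∀ φ : E3 ≃ₗᵢ[ℝ] E3, m.IsSymmetry φ → ∀ x ∈ m.points, φ x ∈ m.points)
    {c : List ℕ} {l : List (ℕ × Fin 4 × List ℕ)} (hl : m.refuteAll m.patternMarks c l = true)
    (he : m.extensionsMatch 11 [0] = true) (C : E3 → Fin 4) : ¬ m.IsColouring C := by
  intro hC
  -- Subtracting the colour of slot 0 modulo 4 keeps the colouring proper and gives this slot colour
  -- 0, so the enumeration may start from `[0]`.
  obtain ⟨j, e, hm⟩ := exists_match (m := m)
    (f := fun u => m.slotColouring C u - m.slotColouring C 0)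
    (fun u w hw he => h.properOn hC u w hw (sub_left_injective he)) (n := 11) (k := 1)
    (by norm_num) (by simpa using he)
  simp only [matchesPattern, Bool.and_eq_true, List.all_eq_true, List.mem_range, beq_iff_eq,
    bne_iff_ne, ne_eq, sub_left_inj] at hm
  obtain ⟨h1, ⟨⟨⟨⟨h01, h02⟩, h03⟩, h12⟩, h13⟩, h23⟩ := hm
  obtain ⟨φ, hφ, hφ'⟩ := h.exists_rotate_iterate j
  obtain ⟨ψ, hψ, hψ'⟩ := h.exists_act (0, e, false, false)
  have hs : ∀ s < 12, m.slotColouring C (symmetrySlot j e (2 * s)) =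
      C (φ.trans ψ (toE3 (m.point (2 * s)))) := by
    intro s hs
    rw [LinearIsometryEquiv.trans_apply, hφ', hψ', h.rotate_iterate_point j (by omega)
      (by rw [canon]; split_ifs <;> omega), h.act_point]
    rfl
  -- The four representatives of the colours have distinct colours after the symmetry, so reading
  -- them off defines the renaming σ.
  have hinj : Function.Injective fun i : Fin 4 =>
      m.slotColouring C (symmetrySlot j e (2 * i.val)) := by
    intro a b hab
    fin_cases a <;> fin_cases b <;> first
      | rfl
      | exact absurd hab h01
      | exact absurd hab h02
      | exact absurd hab h03
      | exact absurd hab h12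
      | exact absurd hab h13
      | exact absurd hab h23
      | exact absurd hab.symm h01
      | exact absurd hab.symm h02
      | exact absurd hab.symm h03
      | exact absurd hab.symm h12
      | exact absurd hab.symm h13
      | exact absurd hab.symm h23
  let σ := Equiv.ofBijective _ (Finite.injective_iff_bijective.1 hinj)
  have hσ : ∀ i : Fin 4, σ i = m.slotColouring C (symmetrySlot j e (2 * i.val)) := fun i => rfl
  refine h.not_hasPattern hsym hl (fun x => σ.symm (C (φ.trans ψ x)))
    ⟨hC.comp (hsym _ (hφ.trans hψ)) _, fun s hs' => ?_⟩
  rw [Equiv.symm_apply_eq, ← hs s hs', hσ, h1 s hs']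

/-! ### Chromatic numbers -/

/-- The given colours of the slots (three bits each) form a proper colouring with five colours. -/
def fiveColouringCheck (m : Configuration) (c : ℕ) : Bool :=
  m.slots.all fun u => (m.adj u).all fun w =>
    !Nat.beq (c >>> (3 * u) % 8 % 5) (c >>> (3 * w) % 8 % 5)

theorem Valid.colorable_five (h : m.Valid) {c : ℕ} (hc : m.fiveColouringCheck c = true) :
    (udg m.points).Colorable 5 := by
  have key : ∀ x : m.points, ∃ u ∈ m.slots, toE3 (m.point u) = x := fun x => x.2
  choose s hs hs' using key
  refine ⟨SimpleGraph.Coloring.mk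
    -- Reduction modulo 8 extracts the three bits of the slot; the further reduction modulo 5 only
    -- guarantees an element of `Fin 5`.
    (fun x => ⟨c >>> (3 * s x) % 8 % 5, Nat.mod_lt _ (by norm_num)⟩) fun {x y} hxy he => ?_⟩
  have hd : dist (toE3 (m.point (s x))) (toE3 (m.point (s y))) = 1 := by
    rw [hs', hs']; exact hxy
  simp only [fiveColouringCheck, List.all_eq_true, Bool.not_eq_true'] at hc
  have h1 := hc _ (hs x) _ (h.mem_adj_of_dist_eq_one (m.mem_slots.1 (hs x)).1 (hs y) hd)
  rw [← Bool.not_eq_true, Nat.beq_eq] at h1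
  exact h1 (congrArg Fin.val he)

theorem not_colorable_four (hn : ∀ C : E3 → Fin 4, ¬ m.IsColouring C) :
    ¬ (udg m.points).Colorable 4 := by
  classical
  rintro ⟨C⟩
  refine hn (fun x => if hx : x ∈ m.points then C ⟨x, hx⟩ else 0) fun x hx y hy hd => ?_
  simp only [dif_pos hx, dif_pos hy]
  exact C.valid hd

theorem chi_points_eq_five (h5 : (udg m.points).Colorable 5)
    (h4 : ¬ (udg m.points).Colorable 4) : chi m.points = 5 := by
  refine le_antisymm h5.chromaticNumber_le ?_
  by_contra hlt
  rw [chi, not_le] at hlt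
  have h6 : (udg m.points).chromaticNumber ≤ (4 : ℕ) := Order.le_of_lt_add_one (by
    convert hlt using 1; norm_num)
  exact h4 (SimpleGraph.chromaticNumber_le_iff_colorable.1 h6)

end Configuration

theorem chi_mono {X Y : Set E3} (h : X ⊆ Y) : chi X ≤ chi Y := by
  refine SimpleGraph.chromaticNumber_mono_of_hom (G := udg X) (G' := udg Y)
    ⟨Set.inclusion h, fun {a b} hab => hab⟩

namespace Configuration

variable {m : Configuration}

/-! ### Degrees of coordinates -/

open IntermediateField in
theorem real_mem_adjoin (p : List ℤ) : m.real p ∈ ℚ⟮alpha⟯ :=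
  div_mem (value_mem_adjoin p) (intCast_mem _ _)

open IntermediateField in
theorem coordinate_mem_adjoin {x : E3} (hx : x ∈ m.points) (j : Fin 3) : x j ∈ ℚ⟮alpha⟯ := by
  obtain ⟨u, -, rfl⟩ := hx
  simp only [point_eq]
  fin_cases j <;> exact real_mem_adjoin _

-- The field bounds every degree by 8, and a single coordinate that generates it attains the bound.
open IntermediateField in
theorem hasMaxCoordinateDegree {x : E3} (hx : x ∈ m.points) {j : Fin 3}
    (h : alpha ∈ ℚ⟮x j⟯) : HasMaxCoordinateDegree m.points 8 := by
  refine ⟨fun v hv j => isAlgebraic_of_mem_adjoin (coordinate_mem_adjoin hv j),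
    ⟨x, hx, j, (natDegree_minpoly_eq (coordinate_mem_adjoin hx j) h).symm⟩, ?_⟩
  rintro _ ⟨v, hv, j, rfl⟩
  exact natDegree_minpoly_le (coordinate_mem_adjoin hv j)

/-! ### Recognizing roots of polynomials -/

/-- `D ^ c.length` times the value of the polynomial `c` at `p / D`, as a reduced polynomial. -/
def scaledValue (D : ℤ) (p : List ℤ) (c : List ℤ) : List ℤ :=
  match c with
  | [] => []
  | k :: c => reduce (polyAdd [k * D ^ (c.length + 1)] (polyMul p (scaledValue D p c)))

/-- The coordinate `p / den` satisfies `IsRootNear c a` for `a = q / 10 ^ 5`. -/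
def rootNearCheck (m : Configuration) (c : List ℤ) (q : ℤ) (p : List ℤ) : Bool :=
  isZero (scaledValue m.den (polyScale 2 p) c) && Nat.ble (absSum p) 10000 &&
    Nat.ble p.length 8 &&
    decide ((approxValue p - m.den * 10 ^ 7 * q).natAbs + 20000 < m.den * 10 ^ 7)

/-- Multiplying by one power of $D$ at each step of Horner's rule keeps the computation within
integer polynomials. The reduction modulo the octic after each step does not change the value at α.
-/
theorem value_scaledValue {D : ℤ} (hD : (D : ℝ) ≠ 0) (p c : List ℤ) :
    value alpha (scaledValue D p c) / D ^ c.length =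
      (c.map Int.cast).foldr (fun (k y : ℝ) => k + value alpha p / D * y) 0 := by
  induction c with
  | nil => simp [scaledValue]
  | cons k c ih =>
    rw [List.map_cons, List.foldr_cons, ← ih, scaledValue, value_reduce, value_polyAdd,
      value_polyMul,
      List.length_cons]
    simp only [value_cons, value_nil]
    push_cast
    field_simp
    ring

theorem Valid.isRootNear (h : m.Valid) {c : List ℤ} {q : ℤ} {p : List ℤ}
    (hc : m.rootNearCheck c q p = true) : IsRootNear c (q / 10 ^ 5) (m.real p) := by
  simp only [rootNearCheck, Bool.and_eq_true, Nat.ble_eq, decide_eq_true_eq] at hc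
  obtain ⟨⟨⟨h1, h2⟩, h3⟩, h4⟩ := hc
  have hd := h.den_pos
  constructor
  · have := value_scaledValue hd.ne' (polyScale 2 p) c
    rw [value_eq_zero h1, zero_div, value_polyScale] at this
    -- In `IsRootNear` the integer coefficient list is itself coerced to a list of reals, through
    -- the list monad; this rewrites the coercion as a map.
    have hmap : (do let a ← c; pure (a : ℝ)) = c.map (Int.cast : ℤ → ℝ) := by
      simp [List.bind_eq_flatMap, List.pure_def, List.map_eq_flatMap]
    rw [hmap]
    refine Eq.trans ?_ this.symm
    congr 1
    funext k y
    rw [real]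
    push_cast
    ring
  · have h5 := approxValue_error h3
    have h6 : (absSum p : ℝ) ≤ 10000 := by exact_mod_cast h2
    have h7 : |(approxValue p : ℝ) - (m.den : ℝ) * 10 ^ 7 * q| + 20000 < (m.den : ℝ) * 10 ^ 7 := by
      have : (((approxValue p - m.den * 10 ^ 7 * q).natAbs + 20000 : ℤ) : ℝ) <
          (m.den * 10 ^ 7 : ℤ) := by exact_mod_cast h4
      push_cast [Nat.cast_natAbs] at this
      convert this using 1 <;> norm_num
    have h8 : value alpha p * 10 ^ 12 - (m.den : ℝ) * 10 ^ 7 * q =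
        (value alpha p * 10 ^ 12 - approxValue p) +
          ((approxValue p : ℝ) - (m.den : ℝ) * 10 ^ 7 * q) := by ring
    have h9 : |value alpha p * 10 ^ 12 - (m.den : ℝ) * 10 ^ 7 * q| < (m.den : ℝ) * 10 ^ 7 := by
      -- In the scale $\mathrm{den}\cdot10^{12}$ the tolerance $10^{-5}$ is $\mathrm{den}\cdot10^7$,
      -- and 20000 of it is reserved for the error of the approximation.
      rw [h8]
      exact (abs_add_le _ _).trans_lt (by linarith)
    have h10 : m.real p - q / 10 ^ 5 =
        (value alpha p * 10 ^ 12 - (m.den : ℝ) * 10 ^ 7 * q) / (m.den * 10 ^ 12) := by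
      rw [real]; field_simp
    rw [h10, abs_div, abs_of_pos (by positivity : (0 : ℝ) < m.den * 10 ^ 12),
      div_lt_div_iff₀ (by positivity) (by positivity)]
    linarith

end Configuration

end SphereColoring

/-! ### The two configurations: coordinates, approximations and neighbour lists -/

namespace SphereColoring

/-- The first base point. -/
def icosahedralBase0 : List (List ℤ × List ℤ × List ℤ) := [
  ([0, 0, 0, 0, 0, 0, 0, 0], [8, -1, -3, -2, -3, 1, 0, 1], [5, 0, 0, 0, 0, 0, 0, 0])]

/-- The base points in orbit 1. -/
def icosahedralBase1 : List (List ℤ × List ℤ × List ℤ) := [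
  ([9, 12, 6, -1, -14, -2, 0, 3], [1, -12, 14, -19, 14, -3, 5, -3], [5, -1, -1, -12, 3, 0, 3, -1]),
  ([3, 3, -4, 6, 0, 1, -2, 0], [4, 0, 9, -5, -3, -2, 1, 1], [4, -22, 12, -29, 28, -2, 7, -6]),
  ([3, 15, -7, 10, -11, 1, -3, 2], [1, 9, -10, 13, -14, 2, -3, 3], [9, -1, 8, -17, 0, -2, 4, 0]),
  ([4, 3, 7, -9, 3, -2, 2, -1], [-6, -9, -10, 7, 14, 3, -2, -3], [5, -13, 2, -16, 14, 0, 4, -3]),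
  ([8, 3, 16, -14, 0, -4, 3, 0], [0, 12, -3, 4, -11, 0, -1, 2], [3, -10, -2, -10, 14, 1, 2, -3])]

/-- The base points in orbit 2. -/
def icosahedralBase2 : List (List ℤ × List ℤ × List ℤ) := [
  ([2, 14, -14, 13, -11, 4, -4, 2], [0, 5, 0, 0, 0, 0, 0, 0], [7, -14, 3, -3, 8, -1, 0, -1]),
  ([3, -2, -4, 6, 0, 1, -2, 0], [-3, 13, -15, 6, -8, 4, -1, 1], [5, -12, -2, -4, 11, 0, 1, -2]),
  ([7, -7, 5, 1, -3, -1, -1, 1], [-2, 3, -4, 6, 0, 1, -2, 0], [4, -1, -12, 3, 0, 3, -1, 0]),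
  ([7, -2, 5, 1, -3, -1, -1, 1], [1, -16, 10, -7, 11, -3, 2, -2], [3, -9, -6, 2, 11, 1, -1, -2]),
  ([4, 11, -10, 7, -11, 3, -2, 2], [4, -5, 9, -5, -3, -2, 1, 1], [5, -17, -2, -4, 11, 0, 1, -2])]

/-- The base points in orbit 3. -/
def icosahedralBase3 : List (List ℤ × List ℤ × List ℤ) := [
  ([-4, -15, -9, 5, 8, 2, -1, -1], [9, 7, 6, -1, -14, -2, 0, 3], [0, -25, 20, -20, 25, -5, 5, -5]),
  ([-4, 9, -10, 13, -14, 2, -3, 3], [-1, 0, -11, 15, -3, 3, -4, 1], [8, 6, 14, 2, -14, -4, -1, 3]),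
  ([-4, -24, 12, -23, 25, -3, 6, -5], [-8, 2, -16, 14, 0, 4, -3, 0], [-1, -25, 9, -5, 22, -2, 1,
    -4]),
  ([5, -17, 18, -24, 11, -5, 6, -2], [0, 24, -1, 8, -22, 0, -2, 4], [0, 8, -2, 16, -14, 0, -4, 3]),
  ([4, -17, 7, -9, 8, -2, 2, -1], [0, -33, 22, -36, 39, -5, 9, -8], [-1, -1, 8, 3, 0, -2, -1, 0])]

/-- The points of the 372-vertex graph. -/
def icosahedral : Configuration where
  den := 10
  -- This coincides with the second coordinate of the first base point because $5t/10=t/2$.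
  tau := [8, -1, -3, -2, -3, 1, 0, 1]
  base := icosahedralBase0 ++ icosahedralBase1 ++ icosahedralBase2 ++ icosahedralBase3
  approx := [
    (0, 8090169943752, 5000000000000), (7158417082951, 3492392202119, 5197221497290),
    (2359833665132, 4271878865766, 8162909147356), (246371882317, -852225867251, 9469100363056),
    (3738764084436, -4798583417819, 7310683280105),
    (8010642950202, -2113461782815, 4670516945237), (-796067070832, -834475790145, 9440380134993),
    (3194309455277, -5622089057007, 6974191813950),
    (8300664111188, -2640166334868, 3818291077986), (7466188321043, 3990376526109, 4334025479082),
    (1844099264036, 5106354655911, 7808667604095), (-1764572270486, 7992892873096, 4842602393360),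
    (-5852225867251, -1378930419304, 7368911250387),
    (466584016069, -8845118740347, 3463671974056),
    (8459476889165, -4087653596765, -1476207489960), (7080546469861, 6318809883320, -623981622709)]
  nbrs := [
    [4, 8, 10, 16, 20, 42, 46, 64, 68, 72, 73, 105, 107, 122, 123, 144, 145, 177, 179, 194, 195,
    234, 238, 256, 260, 268, 269, 305, 309, 331, 335, 342, 343, 372, 374],
    [12, 49, 82, 107, 112, 126, 134, 144, 264], [8, 25, 80, 83, 115, 132, 142, 168, 288],
    [0, 41, 64, 69, 108, 118, 123, 192, 312], [20, 32, 45, 62, 85, 90, 137, 216, 336],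
    [2, 30, 43, 61, 66, 75, 106, 240, 360], [0, 24, 180, 195, 233, 256, 264, 313],
    [20, 48, 162, 209, 224, 254, 276, 288], [2, 72, 147, 178, 235, 258, 305, 312],
    [12, 96, 154, 184, 206, 241, 336, 354], [8, 120, 152, 187, 204, 217, 360, 370],
    [4, 24, 144, 186, 307, 330, 339, 370], [10, 48, 168, 202, 278, 313, 346, 376],
    [14, 72, 145, 192, 276, 289, 344, 379], [6, 96, 216, 228, 267, 305, 328, 372],
    [18, 120, 240, 257, 281, 296, 326, 354]]

/-- The first base point. -/
def greatIcosahedralBase0 : List (List ℤ × List ℤ × List ℤ) := [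
  ([0, 0, 0, 0, 0, 0, 0, 0], [-123, 41, 123, 82, 123, -41, 0, -41], [205, 0, 0, 0, 0, 0, 0, 0])]

/-- The base points in orbit 1. -/
def greatIcosahedralBase1 : List (List ℤ × List ℤ × List ℤ) := [
  ([246, 410, 451, 0, -697, -123, -41, 164], [-205, -369, 246, -328, 697, 0, 82, -164], [-205,
    -820, 0, -820, 1025, 0, 205, -205]),
  ([164, 369, 123, 123, -820, -82, -41, 205], [246, 902, -287, 984, -1148, 82, -287, 246], [-246,
    -328, -369, -41, 451, 123, 0, -82]),
  ([41, -1107, 369, -779, 779, -123, 205, -123], [164, 984, 123, 123, -1025, -82, -41, 205], [41,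
    82, -287, 164, -123, 82, -82, 41]),
  ([-164, -1476, 615, -1107, 1476, -123, 287, -287], [-82, -41, -328, 123, -123, 41, 0, 41], [-82,
    656, -246, 82, -574, 41, -41, 123]),
  ([82, -574, 328, -123, 328, -41, 0, -41], [-123, -1476, 246, -902, 1599, -41, 246, -328], [-41,
    41, -615, 287, -246, 123, -82, 82])]

/-- The base points in orbit 2. -/
def greatIcosahedralBase2 : List (List ℤ × List ℤ × List ℤ) := [
  ([0, 533, -82, -164, -574, 0, 41, 123], [-246, -1599, 410, -1148, 1599, -82, 328, -328], [82,
    -779, 123, -738, 1148, -41, 205, -246]),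
  ([-41, 1025, 164, 615, -1148, -82, -164, 246], [-41, 328, -533, 451, -697, 123, -123, 164],
    [-246, -1558, 246, -656, 1476, -82, 205, -287]),
  ([-123, 246, 123, 82, 123, -41, 0, -41], [410, 1558, -82, 451, -1599, 0, -164, 328], [41, -451,
    -410, -287, 451, 82, 82, -82]),
  ([-369, -1353, 533, -1066, 1722, -123, 328, -369], [-41, 492, 246, 779, -574, -82, -205, 123],
    [164, 0, 164, -205, -123, -82, 41, 41]),
  ([-410, -1025, 0, -615, 1025, 0, 205, -205], [-82, -779, -41, -533, 1271, 41, 164, -287], [0,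
    41, -164, 492, -123, 0, -123, 41])]

/-- The base points in orbit 3. -/
def greatIcosahedralBase3 : List (List ℤ × List ℤ × List ℤ) := [
  ([-266, -176, 38, -157, 305, -7, 59, -70], [85, 584, -141, 288, -712, 40, -97, 154], [-83, -181,
    6, -137, -36, 14, 46, 17]),
  ([-182, -593, -15, -416, 828, 6, 131, -186], [91, -134, -13, -38, 160, -3, -4, -30], [177, -148,
    -201, -146, -65, 64, 17, 25]),
  ([-212, -283, -40, -221, 363, 16, 76, -86], [-230, -343, 232, -186, 494, -60, 84, -108], [8,
    -315, -7, -175, 124, 11, 42, -13]),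
  ([-127, 301, -181, 67, -349, 56, -21, 68], [84, -417, -53, -259, 523, 13, 72, -116], [-53, -491,
    31, -332, 429, 4, 101, -83]),
  ([-36, 167, -194, 29, -189, 53, -25, 38], [-30, 310, -25, 195, -465, 10, -55, 100], [92, -732,
    -60, -434, 647, 24, 114, -129])]

/-- The base points in orbit 4. -/
def greatIcosahedralBase4 : List (List ℤ × List ℤ × List ℤ) := [
  ([-86, -135, 249, -145, 162, -57, 36, -39], [-58, 195, -18, 255, -29, 14, -52, -12], [-90, 673,
    -322, 776, -824, 50, -174, 168]),
  ([98, -75, 193, -445, 49, -59, 102, -8], [137, -327, 215, -374, 417, -26, 79, -89], [173, 601,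
    -181, 357, -549, 36, -81, 98]),
  ([80, 117, 227, -216, -206, -90, 59, 42], [-245, -120, -175, 190, -20, 45, -50, 20], [47, 346,
    -107, 402, -407, 24, -95, 79]),
  ([22, 312, 209, 39, -235, -76, 7, 30], [184, 60, -56, -300, -113, -2, 66, 31], [-72, 481, -356,
    547, -569, 81, -131, 118]),
  ([159, -15, 424, -335, 182, -102, 86, -59], [-18, 192, 34, 229, -255, -31, -43, 50], [231, 406,
    -163, 102, -520, 22, -29, 110])]

/-- The base points in orbit 5. -/
def greatIcosahedralBase5 : List (List ℤ × List ℤ × List ℤ) := [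
  ([61, 176, -38, 157, -305, 7, -59, 70], [38, -625, 18, -370, 589, 1, 97, -113], [165, -106, 199,
    -437, -87, -55, 118, 24]),
  ([18, 593, -354, 621, -705, 76, -172, 145], [-173, 257, -151, 284, -160, 44, -78, 30], [-13,
    -57, -250, -59, -58, 59, 24, 16]),
  ([-75, 160, -165, 180, -240, 25, -35, 45], [271, 384, 260, 63, -494, -63, -43, 108], [-8, 151,
    48, -153, -247, -11, 40, 54]),
  ([-37, -465, -147, -190, 349, 26, 62, -68], [-43, 417, -316, 464, -400, 69, -113, 75], [258,
    327, 10, 4, -552, -4, -19, 124]),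
  ([-210, -208, -298, 94, 189, 70, -16, -38], [-93, -433, 189, -441, 465, -51, 137, -100], [-51,
    568, -268, 311, -647, 58, -73, 129])]

/-- The base points in orbit 6. -/
def greatIcosahedralBase6 : List (List ℤ × List ℤ × List ℤ) := [
  ([-119, 135, -249, 145, -162, 57, -36, 39], [65, 154, -141, 173, -152, 55, -52, 29], [-156, 106,
    -375, 372, -201, 73, -72, 37]),
  ([87, 15, 27, -280, -59, -21, 78, 18], [64, -218, 321, -386, 196, -72, 80, -32], [179, -78, 81,
    -266, -54, -22, 70, 13]),
  ([-63, 98, -45, -39, -93, -6, 34, 11], [-185, 101, -384, 397, -113, 80, -98, 31], [-92, -112,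
    -54, -14, -5, 1, 8, 5]),
  ([2, 252, -186, 134, -245, 49, -18, 40], [206, -120, 276, -425, 103, -78, 114, -21], [-6, 23,
    -303, 131, -167, 58, -28, 44]),
  ([66, 34, 135, -252, -49, -23, 62, 8], [-150, 83, -72, 241, -34, 15, -44, -7], [114, -232, 222,
    -439, 98, -77, 122, -16])]

/-- The base points in orbit 7. -/
def greatIcosahedralBase7 : List (List ℤ × List ℤ × List ℤ) := [
  ([-205, 205, 0, 0, 0, 0, 0, 0], [-41, -328, 246, -41, 451, -82, 0, -82], [82, 410, 287, 205,
    -574, -41, -82, 123]),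
  ([-41, 451, -410, 287, -451, 123, -82, 82], [0, -287, -82, -164, 451, 0, 41, -82], [205, 41, 41,
    287, -123, 0, -123, 41]),
  ([-41, 943, -328, 451, -902, 123, -123, 164], [-123, -123, 164, -246, 0, -41, 82, 0], [82, 123,
    205, 41, -123, -41, -41, 41]),
  ([-82, 615, -82, 410, -451, 41, -123, 82], [164, 246, -410, 287, -451, 123, -82, 82], [82, -82,
    205, 41, -123, -41, -41, 41]),
  ([-82, 328, -164, 246, 0, 41, -82, 0], [0, 492, 82, 164, -451, 0, -41, 82], [246, 369, -205,
    328, -574, 82, -123, 123])]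

/-- The base points in orbit 8. -/
def greatIcosahedralBase8 : List (List ℤ × List ℤ × List ℤ) := [
  ([-164, 41, -328, -123, 0, 82, 41, 0], [123, 615, -82, 410, -451, 41, -123, 82], [369, 1271,
    205, 287, -1476, -82, -82, 287]),
  ([-123, 410, -738, 410, -574, 164, -82, 123], [-205, -984, 41, -328, 902, 0, 82, -164], [328,
    1271, -246, 902, -1599, 41, -246, 328]),
  ([41, 1353, -451, 861, -1476, 82, -205, 287], [-123, -943, 164, -1066, 1025, -41, 287, -205],
    [164, 287, 246, -41, -574, -82, 0, 123]),
  ([164, 1968, -533, 1271, -1927, 123, -328, 369], [41, 369, -410, 533, -574, 82, -123, 123],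
    [205, 328, -82, -164, -574, 0, 41, 123]),
  ([-41, 984, -492, 943, -1025, 123, -246, 205], [164, 943, 287, 451, -902, -82, -123, 164], [205,
    656, -164, 492, -1148, 0, -123, 246])]

/-- The points of the 972-vertex graph. -/
def greatIcosahedral : Configuration where
  -- The factor 41 is needed only for orbits 3 to 6, whose equations have leading coefficient 41.
  -- The numerators in the other orbits are multiples of 41.
  den := 410
  -- This is 5 minus the polynomial of the icosahedral configuration, so the two values of $t$ are
  -- the two roots of $t^2=t+1$ in the same field.
  tau := [-3, 1, 3, 2, 3, -1, 0, -1]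
  base := greatIcosahedralBase0 ++ greatIcosahedralBase1 ++ greatIcosahedralBase2 ++
    greatIcosahedralBase3 ++ greatIcosahedralBase4 ++ greatIcosahedralBase5 ++
    greatIcosahedralBase6 ++ greatIcosahedralBase7 ++ greatIcosahedralBase8
  approx := [
    (0, -126696967693832, 205000000000000), (189608821563754, -134495704215650, -63533628539690),
    (104642737712056, 81983776503934, -201011640103104),
    (240277581969894, 1843167305576, 18450147964244),
    (105781877754244, -84966083851698, -199168472797528),
    (187765654258178, 135634844257838, -66515935887454),
    (-90921653067940, 38881663987426, 219769403766478),
    (-211242914083314, -113244292863459, 25085513875071),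
    (-160910475089777, 144351450897870, 106525110903019),
    (-122028811102351, -120321261015374, 169436964772941),
    (-235273103965810, 50332438993537, -13796150112355),
    (-234599088454554, -18293242701030, -52016791428652),
    (-80869998845233, 113303045139034, 196722100618673),
    (-164573955529713, -165034935362845, 61286253710382),
    (-182867198230743, 153729089609321, 31687165255828),
    (-69564153091709, -83703956684480, 215015343319703),
    (-55725462045544, -92256738110947, -215546952601615),
    (118009516795807, 199630860069478, 65562148198267),
    (67653194680785, -230752778684860, -15916092532137),
    (-24603543430162, 173734978841351, -165190630486593),
    (175027316639316, -50356322115022, 157818886309214),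
    (29599088454554, 144990210394862, 190207398581660),
    (-94277034651173, -221549864868622, -10228378997827),
    (-107326258237105, 213485001165419, -31342466286962),
    (37663952157757, -123876123105727, 203256622167592),
    (-183885912710865, -13049223585932, -155218589392689),
    (-149274537954456, 34440229582885, -186032536206799),
    (86508830552148, 111281906136101, 195472968018791),
    (-80498537629497, -214498136043945, -74750630070698),
    (-46058308046612, 235783368506604, -19025168025154),
    (65223598089489, -167007368181645, 161032738435906),
    (-239213507395945, 21145110444936, 20171856790813),
    (-129391930174524, 46728356976005, 197866901433175),
    (-210333794546474, -96753180270412, 66900213766818),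
    (-189188684101538, 109821577221421, 101113721162763),
    (-142460327125533, -80941864371950, 176721790988239),
    (-179416753468931, 15811315898462, 160114810329571),
    (-214358014026222, -37406202532635, 103578663138107),
    (-202535058024656, 44713191189898, 122708607796936),
    (-186723742126194, -34941260557291, 148291854328005),
    (-224129944658829, 11822956001566, 87767347239645)]
  nbrs := [
    -- Within $W$ the neighbours of the first vertex have the same numbers 4, 8, 10, 16, 20 in both
    -- configurations. The two graphs on twelve vertices thus agree slot by slot, and one pattern
    -- serves both.
    [4, 8, 10, 16, 20, 283, 287, 294, 295, 324, 326, 340, 341, 377, 381, 401, 405, 427, 431, 438,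
    439, 468, 470, 484, 485, 523, 527, 534, 535, 564, 566, 580, 581, 617, 621, 643, 647, 654, 655,
    684, 686, 700, 701, 737, 741, 761, 765, 787, 791, 798, 799, 828, 830, 844, 845, 883, 887, 894,
    895, 924, 926, 940, 941, 977, 981],
    [146, 189, 504, 777, 868], [205, 242, 528, 764, 921], [150, 218, 552, 839, 908],
    [194, 227, 576, 807, 983], [170, 262, 600, 844, 951], [26, 78, 624, 835, 904],
    [35, 122, 648, 784, 872], [70, 98, 672, 752, 915], [74, 117, 696, 795, 974],
    [50, 133, 720, 854, 955], [14, 296, 331, 348, 361, 391, 625, 832],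
    [6, 280, 324, 339, 377, 415, 708, 800], [18, 278, 306, 353, 368, 439, 737, 843],
    [4, 282, 291, 322, 379, 463, 666, 782], [10, 265, 298, 328, 350, 487, 682, 763],
    [10, 271, 409, 442, 472, 494, 507, 864], [14, 295, 385, 440, 475, 492, 566, 888],
    [6, 319, 401, 424, 468, 483, 547, 912], [18, 343, 392, 422, 450, 497, 616, 936],
    [4, 367, 403, 426, 435, 466, 584, 960], [14, 24, 387, 536, 571, 588, 601, 625],
    [6, 48, 446, 520, 564, 579, 617, 708], [18, 72, 427, 518, 546, 593, 608, 737],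
    [4, 96, 496, 522, 531, 562, 619, 666], [10, 120, 464, 505, 538, 568, 590, 682],
    [14, 144, 265, 505, 656, 691, 708, 721], [6, 168, 348, 588, 640, 684, 699, 737],
    [18, 192, 377, 617, 638, 666, 713, 728], [4, 216, 306, 546, 642, 651, 682, 739],
    [10, 240, 322, 562, 625, 658, 688, 710], [10, 57, 208, 374, 769, 802, 832, 854, 931, 978],
    [14, 44, 176, 355, 745, 800, 835, 852, 874, 880],
    [6, 119, 219, 304, 761, 784, 828, 843, 937, 968],
    [18, 87, 158, 272, 752, 782, 810, 857, 891, 900],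
    [4, 124, 259, 315, 763, 786, 795, 826, 929, 950],
    [14, 28, 184, 384, 776, 785, 896, 931, 948, 961],
    [6, 81, 152, 408, 819, 834, 880, 924, 939, 977],
    [18, 68, 195, 432, 758, 850, 878, 906, 953, 968],
    [4, 143, 254, 456, 793, 859, 882, 891, 922, 979],
    [10, 111, 235, 480, 756, 808, 865, 898, 928, 950]]

theorem icosahedral_exactCheck : icosahedral.exactCheck = true := by decide +kernel

theorem greatIcosahedral_exactCheck : greatIcosahedral.exactCheck = true := by decide +kernel

theorem icosahedral_edgeCheck : icosahedral.edgeCheck = true := by decide +kernel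

theorem greatIcosahedral_edgeCheck : greatIcosahedral.edgeCheck = true := by decide +kernel

theorem icosahedral_approxCheck : icosahedral.approxCheck = true := by decide +kernel

theorem greatIcosahedral_approxCheck : greatIcosahedral.approxCheck = true := by decide +kernel

/-- The range is the number $1+5\cdot3$ of base points. By symmetry it suffices to compare base
points with all slots. -/
theorem icosahedral_separated :
    ((List.range 16).all fun b => icosahedral.separated b) = true := by decide +kernel

theorem greatIcosahedral_separated :
    ((List.range 41).all fun b => greatIcosahedral.separated b) = true := by decide +kernel

end SphereColoring

/-! ### Certificates: search trees against four colours, colourings with five colours -/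

namespace SphereColoring

/-- Slots to branch on. -/
def icosahedralBranching1 : List ℕ := List.flatten [
  [332, 342, 369, 269, 306, 309, 266, 374, 331, 369, 269, 306, 309, 266, 374, 331, 26, 146, 193,
    176, 232, 262, 257, 239, 211, 230, 255, 167, 172, 171, 160, 34, 97, 119, 94, 134, 59, 141, 85,
    254, 138, 54, 165, 112, 231, 37, 209, 89, 329, 119, 134, 49, 85, 138, 51, 102, 130, 59, 222,
    81, 118, 187, 52, 113, 75, 69, 44, 98, 127, 91, 58, 136, 315, 350, 382, 277, 377, 274, 37,
    137, 345, 89, 60, 141, 94, 62, 39, 129, 159, 82, 279, 103, 292, 378, 248, 225, 105, 42, 125,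
    78, 64, 72, 124, 123, 79, 46, 71, 97, 274, 94, 59, 141, 102, 37, 277, 350, 377, 315, 290, 230,
    255, 167, 172, 212, 225, 146, 193, 176, 232, 262, 198, 149, 171, 230, 167, 212, 255, 225, 248,
    211, 160, 331, 172, 91, 266, 374, 306, 309, 369, 269, 189, 69, 245, 207, 156, 220, 36, 155,
    186, 98, 66, 44, 75, 120, 43, 26, 130, 51, 86, 101, 35, 92, 130, 51, 86, 118, 113, 29, 52,
    245, 207, 156, 36, 219, 242, 61, 98, 200, 186, 66, 120, 43, 106, 44, 69, 109, 127, 76, 212,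
    225],
  [248, 92, 160, 225, 248, 255, 167, 230, 167, 230, 84, 135, 117, 375, 27, 35, 329, 50, 58, 270,
    143, 304, 338, 98, 36, 91, 114, 211, 128, 172, 248, 225, 135, 117, 27, 35, 53, 50, 101, 136,
    143, 36, 61, 91, 61, 91, 27, 50, 128, 248, 225, 368, 172, 211, 230, 331, 167, 91, 334, 265,
    311, 338, 341, 98, 101, 36, 143, 50, 128, 143, 248, 101, 225, 368, 35, 61, 172, 58, 211, 91,
    230, 98, 167, 338, 334, 265, 341, 311, 43, 109, 76, 66, 127, 120, 58, 35, 101, 61, 143, 36,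
    50, 114, 128, 101, 35, 143, 50, 128, 114, 248, 36, 225, 368, 61, 172, 91, 211, 136, 230, 167,
    334, 341, 375, 135, 28, 53, 83, 101, 109, 35, 76, 58, 66, 127, 135, 69, 117, 309, 53, 374,
    136, 266, 331, 98, 306, 91, 369, 211, 269, 172, 225, 248, 26, 51, 291, 381, 348, 279, 314,
    292, 317, 378, 347, 51, 86, 130, 133, 36, 113, 61, 52, 143, 29, 118, 72, 41, 64, 108, 107, 71,
    79, 225, 248, 212, 230, 167, 309, 269, 374, 369, 266, 152, 247, 204, 222, 76, 127, 109, 43,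
    69],
  [66, 44, 306, 342, 102, 138, 59, 94, 97, 141, 120, 66, 43, 106, 44, 69, 127, 109, 37, 89, 141,
    102, 138, 94, 34, 59, 102, 342, 306, 186, 50, 128, 114, 28, 83, 135, 53, 27, 128, 114, 28,
    135, 53, 117, 80, 131, 30, 116, 87, 25, 132, 45, 125, 68, 78, 105, 68, 188, 217, 308, 240,
    370, 264, 339, 73, 68, 110, 105, 78, 42, 67, 122, 84, 135, 117, 53, 80, 200, 155, 245, 189,
    220, 207, 102, 141, 138, 97, 34, 94, 59, 75, 127, 69, 240, 187, 217, 360, 159, 97, 188, 326,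
    203, 72, 41, 108, 71, 123, 29, 118, 81, 52, 130, 133, 26, 86, 41, 69, 64, 75, 128, 83, 114,
    323, 50, 358, 27, 118, 29, 81, 130, 51, 45, 125, 68, 73, 105, 110, 230, 171, 167, 212, 255,
    225, 211, 342, 331, 68, 73, 68, 73, 83, 114, 28, 50, 53, 27, 84, 135, 66, 117, 43, 357, 109,
    367, 127, 69, 75, 127, 44, 109, 106, 94, 141, 60, 89, 102, 138, 59, 123, 46, 71, 79, 108, 107,
    32, 272, 291, 348, 314, 378, 292, 347, 272, 347, 378, 292, 314, 317, 348, 381],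
  [261, 147, 199, 192, 148, 236, 258, 178, 66, 240, 106, 187, 360, 159, 326, 281, 303, 354, 357,
    321, 286, 367, 127, 44, 69, 75, 127, 69, 109, 159, 187, 159, 187, 159, 187, 159, 187, 188,
    203, 188, 203, 188, 217, 188, 217]]

/-- Slots to branch on. -/
def icosahedralBranching2 : List ℕ := List.flatten [
  [43, 75, 127, 69, 109, 80, 55, 132, 94, 34, 109, 141, 59, 69, 102, 44, 37, 106, 89, 34, 59, 97,
    102, 138, 89, 37, 60, 131, 30, 116, 115, 25, 48, 39, 93, 62, 142, 32, 57, 90, 103, 96, 343,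
    371, 310, 335, 372, 336, 305, 328, 268, 137, 90, 96, 62, 93, 142, 103, 343, 371, 310, 335,
    372, 336, 305, 328, 268, 109, 141, 69, 76, 44, 66, 116, 106, 25, 131, 356, 346, 48, 30, 37,
    288, 87, 60, 102, 376, 89, 97, 92, 58, 98, 136, 101, 143, 50, 27, 128, 114, 36, 61, 98, 91,
    101, 143, 221, 41, 50, 72, 27, 108, 128, 114, 36, 98, 136, 338, 46, 265, 329, 71, 270, 311,
    341, 25, 48, 25, 48, 30, 131, 30, 131, 25, 48, 116, 115, 30, 55, 87, 131, 132, 60, 97, 141,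
    37, 94, 89, 109, 106, 69, 44, 159, 187, 152, 32, 142, 57, 89, 102, 222, 203, 247, 240, 217,
    188, 68, 247, 105, 222, 125, 102, 45, 78, 89, 73, 67, 37, 122, 141, 57, 97, 90, 94, 137, 62,
    240, 204, 217, 188, 247, 367, 321, 354, 170, 50, 272, 114, 291, 83, 314],
  [128, 348, 378, 69, 228, 347, 44, 109, 163, 76, 253, 66, 106, 28, 53, 173, 164, 227, 250, 208,
    272, 291, 314, 348, 50, 163, 84, 208, 228, 27, 117, 135, 66, 106, 44, 69, 32, 272, 291, 314,
    348, 378, 108, 347, 72, 227, 41, 107, 124, 272, 291, 314, 348, 204, 240, 204, 240, 247, 222,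
    367, 187, 203, 204, 240, 83, 84, 53, 50, 28, 114, 135, 354, 117, 360, 326, 303, 357, 247, 222,
    187, 204, 240, 217, 97, 337, 37, 97, 141, 25, 48, 115, 30, 132, 87, 69, 109, 106, 44, 66, 69,
    215, 170, 227, 164, 250, 35, 101, 92, 58, 143, 98, 136, 91, 107, 64, 41, 124, 117, 135, 84,
    50, 27, 128, 114, 98, 36, 136, 143, 91, 101, 61, 136, 58, 91, 63, 100, 139, 38, 88, 95, 45,
    125, 78, 105, 73, 110, 38, 100, 139, 92, 101, 61, 143, 36, 135, 28, 84, 50, 114, 128, 101, 92,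
    58, 143, 136, 50, 128, 114, 28, 53, 135, 164, 250, 163, 228, 163, 228, 164, 173, 227, 253,
    250, 163, 170, 50, 128, 114, 28, 53, 135, 128, 114, 28, 53, 135, 164, 173, 227, 343, 335],
  [310, 371, 268, 28, 53, 135, 66, 76, 106, 109, 75, 346, 295, 349, 318, 383, 376, 313, 273, 136,
    36, 143, 101, 61, 91, 98, 50, 27, 84, 135, 28, 53, 114, 28, 83, 128, 69, 127, 58, 92, 35, 51,
    86, 133, 113, 33, 52, 56, 140, 130, 118, 72, 41, 108, 123, 29, 81, 133, 52, 130, 81, 118, 72,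
    41, 108, 123, 29, 52, 133, 91, 143, 61, 101, 35, 92, 91, 61, 101, 35, 143, 92, 256, 144, 196,
    195, 151, 233, 263, 180, 349, 318, 383, 376, 313, 288, 278, 273, 376, 318, 349, 383, 151, 196,
    263, 179, 238, 196, 263, 179, 238]]

/-- Excluded colours of slots of the 372-vertex graph, with slots to branch on. -/
def icosahedralExclusions : List (ℕ × Fin 4 × List ℕ) := [
  -- The order matters: each refutation may use all earlier exclusions together with their images
  -- under the twelve cycles. The first entries carry the longest searches.
  (337, 1, icosahedralBranching1), (120, 0, icosahedralBranching2),
  (145, 1, [259, 182, 194, 237, 197, 150, 177, 234, 260, 354, 114, 327, 302, 359, 283, 363, 364,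
    284, 297, 320, 352, 359, 302, 363, 87, 50, 128, 27, 84, 117, 125, 55, 78, 131, 67, 42, 122,
    28, 53, 83, 30, 115, 131, 270, 132, 55, 116, 80, 48, 142, 59, 34, 94, 138, 141, 37, 102, 89,
    329, 338, 375, 265, 341, 334, 34, 102, 94, 37, 141, 93, 102, 39, 137, 62, 94, 96, 34, 90, 97,
    138, 60, 89, 150, 260, 177, 139, 379, 312, 351, 276, 139, 379, 312, 351, 276]),
  (264, 3, [373, 340, 271, 330, 333, 370, 339, 308, 307, 330, 340, 133, 253, 242, 186, 200, 155,
    219, 156, 339, 359, 370, 330, 340, 271, 151, 189, 31, 245, 119, 125, 134, 365, 85, 356, 325,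
    287, 186, 200, 155, 219, 220, 339, 99, 333, 164, 271, 173, 340, 215, 100, 95, 139, 63, 38,
    156, 31, 271, 189, 340, 207, 220, 186, 245, 155, 151, 271, 189, 340, 207, 220, 186, 245, 155,
    271, 189, 333, 219, 339]),
  (240, 2, [120, 360, 354, 188, 217, 204, 159, 187, 247, 222, 308, 370, 339, 264, 333, 330, 164,
    340, 250, 373, 247, 159, 203, 204, 152, 222, 217, 272, 321, 291, 286, 314, 348, 378, 381, 347,
    141, 227, 97, 107, 94, 46, 102, 123, 59, 370, 264, 339, 152, 217, 203, 204, 247, 159]),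
  (361, 2, [261, 285, 141, 358, 381, 298, 348, 279, 317, 366, 126, 282, 301, 77, 162, 181, 42,
    209, 61, 168, 224, 254, 249, 338, 134, 231, 374, 111, 331, 47, 91, 56, 136, 88, 140, 58, 376,
    33, 139, 95, 98, 346, 100, 36, 63, 143, 38, 383, 278, 313, 288, 126, 323, 77, 246, 154, 184,
    216, 70, 121, 47, 104, 111, 40, 65, 142, 74, 314, 272, 32, 96, 134, 85, 54, 119, 31, 121, 47,
    104, 111, 40, 65, 74, 301, 353, 324]),
  (288, 0, [278, 346, 313, 383, 273, 153, 295, 33, 202, 318, 190, 376, 221, 243, 136, 205, 244,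
    356, 123, 372, 185, 322, 363, 158, 270, 362, 320, 38, 341, 128, 375, 135, 311, 53, 265, 28,
    368, 122, 304, 329, 25, 116, 132, 55, 48, 175, 168, 249, 162, 48, 168, 162, 209, 48, 80, 131,
    55, 67, 84, 78, 27, 125, 295, 376, 318]),
  (216, 0, [154, 354, 241, 206, 321, 201, 367, 184, 246, 223, 357, 286, 326, 296, 360, 296, 367,
    286, 360, 120, 281, 72, 41, 64, 75, 134, 184, 201, 81, 49, 118, 24, 29, 130, 133, 52, 113, 26,
    146, 315, 274, 290, 345, 350, 238, 233, 195, 144, 41, 64, 75, 69, 44, 127, 123, 46, 76, 43,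
    109, 141, 69, 94, 75, 59, 44, 102, 138, 71, 108, 191, 41, 64, 184, 246, 157, 223, 43, 127,
    109, 69, 44, 75]),
  (193, 3, [146, 262, 309, 176, 232, 149, 198, 239, 183, 198, 269, 183, 257, 29, 332, 239, 377,
    337, 369, 359, 316, 230, 374, 245, 306, 119, 345, 134, 189, 331, 254, 219, 162, 249, 224, 104,
    214, 74, 165, 175, 40, 231, 99, 209, 168, 288, 278, 313, 73, 110, 45, 68, 139, 105, 88, 95,
    56, 140]),
  (144, 1, [256, 264, 24, 134, 54, 112, 129, 232, 82, 346, 49, 313, 119, 193, 146, 239, 176, 262,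
    112, 129, 31, 151, 179, 196, 238, 233, 195, 180, 263, 85, 141, 119, 31, 151, 196, 179, 233,
    299, 180, 60, 263, 300, 365, 325, 356, 287]),
  (265, 3, [145, 338, 25, 270, 304, 329, 368, 209, 334, 162, 311, 341, 375, 221, 231, 246, 190,
    254, 184, 310, 165, 168, 267, 175, 30, 131, 116, 80, 48, 115, 132, 55, 87, 132, 372, 335, 336,
    343, 371, 268, 328, 305, 329, 304, 375, 368, 311, 334, 341]),
  (241, 0, [154, 361, 201, 121, 157, 191, 206, 223, 216, 246, 354, 184, 281, 321, 304, 296, 367,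
    286, 360, 326, 86, 133, 253, 26, 113, 52, 81, 29, 130, 118, 51, 113, 130, 52, 81, 51, 146,
    130, 139, 193, 81, 29, 52, 118, 113, 238, 353, 345, 282, 274, 323, 315, 31, 54, 151, 85, 179,
    134, 256, 64, 136, 72, 46, 123, 151, 196, 263, 316, 195, 383, 293, 75, 313, 288, 278, 38, 128,
    69, 83, 127, 53, 44, 173, 164, 206, 246, 191, 223]),
  (192, 2, [147, 235, 258, 351, 148, 178, 276, 181, 236, 261, 199, 141, 319, 381, 294, 348, 275,
    379, 312, 72, 123, 243, 158, 35, 58, 133, 92, 253, 108, 71, 79, 46, 107, 227, 173, 250, 164,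
    136, 46, 58, 98, 218, 185, 244, 221, 101, 61, 36, 91, 107, 64, 79, 124]),
  (96, 3, [216, 206, 241, 354, 154, 191, 184, 157, 267, 246, 268, 310, 336, 126, 223, 375, 372,
    366, 201, 305, 335, 323, 321, 328, 215, 343, 296, 103, 56, 27, 125, 62, 137, 39, 159, 204,
    324, 84, 361, 135, 121, 117, 47, 78, 70, 128, 83, 99, 38, 95, 139, 63, 140, 88, 33, 100]),
  (73, 2, [110, 45, 68, 125, 139, 88, 27, 117, 267, 78, 310, 67, 105, 42, 131, 371, 343, 335, 215,
    95, 63, 38, 99, 56, 140, 117, 78, 67, 42, 122]),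
  (24, 1, [82, 107, 126, 49, 246, 81, 157, 52, 206, 191, 29, 118, 133, 130, 113, 26, 86, 51, 118,
    123, 72, 64, 41, 108, 124, 71, 79]),
  (360, 3, [120, 296, 43, 286, 141, 46, 37, 102]), (289, 2, [276, 380, 351, 319, 379, 294]),
  (97, 0, [141, 37, 94, 131, 109, 30, 43, 120]),
  (169, 2, [213, 278, 166, 38, 46, 118, 136, 29, 35, 133]), (192, 3, [178, 258]),
  (25, 2, [145, 194, 260, 237, 182, 302, 283, 363, 43, 359, 120, 327, 30, 87, 115, 132]),
  (72, 1, [41, 108]), (48, 0, [80, 115, 131, 30]), (120, 3, [30, 61, 110, 88])]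

/-- The slots to branch on after the exclusions. -/
def icosahedralLastBranching : List ℕ := [125, 126, 128, 136, 365, 40, 77, 27, 91, 356, 280, 70,
    267, 61, 299, 310, 36, 322, 190, 98, 202, 243, 218]

/-- A colouring of the 372-vertex graph with five colours, three bits for each slot. -/
def icosahedralColouring : ℕ :=
  0x6db24c6db00449201942441b4884c925049200908920024a00a08a28328330b1034c02c222401b41b48b41b25b0516c300044a24b48b0d310c31101840c00b4a445b4a44e424026412445262285a00c0096db9206e10002620e040001824a6d18c08d08428e10426a48c28e06db9246db0004916006d112489948931391385144909085a09448c0440830000c1100042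

/-- Slots to branch on. -/
def greatIcosahedralBranching1 : List ℕ := List.flatten [
  [880, 895, 923, 940, 982, 977, 939, 924, 887, 782, 857, 759, 813, 862, 777, 752, 810, 816, 777,
    783, 820, 859, 785, 760, 794, 808, 820, 859, 820, 859, 824, 760, 794, 837, 804, 855, 773, 803,
    834, 770, 848, 747, 925, 857, 885, 759, 943, 823, 892, 857, 759, 810, 813, 752, 862, 816, 823,
    885, 891, 980, 922, 943, 936, 892, 882, 979, 787, 762, 798, 762, 798, 868, 902, 867, 949, 929,
    965, 962, 934, 946, 897, 867, 839, 972, 877, 907, 831, 914, 767, 797, 854, 846, 805, 760, 794,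
    841, 948, 864, 776, 961, 819, 860, 758, 753, 859, 820, 765, 908, 959, 917, 877, 971, 874, 788,
    845, 798, 825, 762, 807, 775, 852, 750, 745, 851, 768, 952, 835, 907, 914, 854, 955, 904, 916,
    750, 775, 835, 768, 745, 800, 851, 916, 955, 854, 879, 805, 914, 774, 907, 832, 831, 849, 751,
    272, 369, 399, 356, 497, 475, 382, 492, 287, 371, 339, 352, 776, 274, 864, 308, 314, 948, 317,
    841, 846, 790, 797, 356, 369, 475, 408, 492, 447, 390, 491, 440, 476, 355, 279, 316, 399, 463,
    497, 336, 422, 322, 297, 282, 445, 365, 479, 334],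
  [352, 346, 307, 362, 428, 405, 485, 750, 775, 835, 768, 745, 800, 836, 851, 959, 877, 917, 765,
    794, 788, 793, 830, 760, 845, 842, 970, 949, 762, 804, 965, 798, 897, 825, 946, 910, 803, 875,
    773, 834, 954, 855, 905, 918, 805, 854, 955, 916, 879, 774, 751, 832, 849, 929, 962, 891, 922,
    980, 885, 943, 892, 980, 823, 979, 862, 752, 922, 936, 882, 776, 819, 860, 753, 820, 788, 867,
    962, 946, 803, 934, 773, 834, 747, 748, 770, 929, 804, 868, 949, 765, 793, 845, 798, 762, 787,
    842, 830, 765, 793, 845, 798, 762, 825, 787, 842, 898, 830, 901, 935, 950, 967, 960, 945, 928,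
    870, 760, 794, 760, 794, 820, 859, 862, 813, 759, 823, 923, 940, 982, 977, 939, 924, 887, 924,
    887, 939, 977, 982, 923, 940, 752, 777, 810, 862, 857, 782, 816, 759, 813, 823, 841, 767, 790,
    797, 824, 831, 760, 899, 900, 785, 963, 846, 933, 930, 869, 964, 951, 794, 760, 785, 824, 767,
    790, 831, 797, 846, 790, 831, 797, 900, 846, 963, 866, 933, 959, 908, 972, 917, 877, 971, 907,
    914, 754, 952, 814, 779, 869, 951, 964, 757, 809],
  [822, 858, 972, 907, 877, 914, 775, 754, 874, 908, 952, 971, 908, 917, 971, 952, 851, 750, 836,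
    916, 809, 858, 822, 757, 779, 964, 869, 858, 962, 822, 757, 779, 780, 868, 929, 902, 817, 867,
    949, 861, 965, 897, 934, 774, 849, 751, 832, 839, 854, 744, 769, 802, 849, 883, 751, 832, 938,
    839, 978, 854, 744, 879, 883, 938, 926, 978, 805, 839, 854, 751, 769, 981, 884, 941, 921, 894,
    854, 839, 751, 769, 849, 744, 884, 889, 981, 941, 894, 763, 796, 847, 969, 829, 956, 911, 829,
    847, 796, 969, 956, 872, 904, 915, 826, 974, 786, 840, 795, 789, 764, 268, 834, 748, 803, 773,
    848, 873, 770, 968, 958, 919, 975, 878, 912, 953, 906, 349, 329, 454, 394, 277, 419, 457, 359,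
    300, 342, 372, 472, 414, 489, 374, 279, 311, 355, 392, 424, 476, 417, 415, 491, 450, 440, 333,
    327, 408, 363, 293, 385, 484, 492, 401, 447, 286, 320, 349, 302, 329, 417, 454, 392, 394, 279,
    277, 374, 359, 472, 414, 489, 897, 965, 780, 962, 817, 861, 757, 814, 498, 394, 419, 462, 397,
    449, 274, 929, 371, 868, 317, 965, 308, 897, 359],
  [822, 277, 394, 419, 454, 462, 449, 929, 868, 965, 897, 934, 946, 867, 965, 868, 929, 902, 949,
    449, 269, 351, 364, 299, 344, 420, 397, 274, 314, 371, 437, 317, 471, 486, 400, 434, 464, 299,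
    344, 420, 397, 274, 314, 371, 437, 317, 471, 407, 486, 400, 434, 464, 481, 430, 299, 344, 333,
    351, 363, 300, 363, 300, 351, 274, 397, 420, 462, 419, 394, 454, 457, 501, 314, 371, 437, 317,
    471, 407, 430, 464, 400, 434, 486, 425, 397, 274, 462, 371, 317, 308, 359, 277, 394, 822, 419,
    897, 454, 934, 908, 917, 877, 971, 907, 972, 874, 914, 952, 809, 757, 822, 964, 858, 951, 754,
    869, 779, 780, 962, 754, 858, 779, 822, 869, 757, 951, 964, 817, 861, 757, 964, 930, 965, 868,
    929, 902, 949, 845, 765, 788, 825, 867, 798, 946, 787, 830, 842, 793, 762, 970, 274, 308, 371,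
    352, 492, 314, 408, 437, 475, 447, 415, 323, 280, 382, 288, 295, 339, 287, 280, 407, 471, 486,
    400, 425, 434, 310, 464, 430, 305, 910, 318, 875, 354, 954, 370, 918, 313, 438, 427, 485, 402,
    465, 295, 382, 340, 497, 280, 450, 407, 456, 471],
  [392, 486, 417, 400, 302, 434, 362, 464, 267, 430, 837, 910, 308, 317, 371, 949, 902, 867, 929,
    788, 934, 868, 765, 825, 897, 787, 822, 946, 798, 858, 803, 762, 834, 848, 267, 837, 747, 804,
    770, 302, 417, 450, 502, 392, 362, 329, 346, 268, 334, 365, 765, 788, 793, 867, 830, 946, 787,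
    842, 798, 762, 767, 790, 797, 831, 900, 933, 963, 823, 857, 813, 759, 782, 747, 837, 804, 770,
    834, 848, 803, 837, 804, 770, 855, 834, 848, 773, 803, 748, 983, 886, 893, 927, 881, 976, 890,
    920, 937, 976, 902, 949, 929, 868, 962, 965, 867, 934, 946, 897, 861, 817, 927, 780, 890, 881,
    757, 937, 942, 886, 893, 920, 822, 858, 754, 779, 814, 927, 893, 886, 937, 890, 817, 920, 814,
    754, 858, 779, 822, 822, 893, 886, 937, 890, 817, 920, 814, 858, 779, 754, 757, 780, 809, 817,
    814, 964, 810, 899, 816, 869, 779, 951, 754, 900, 963, 866, 944, 930, 926, 883, 938, 858, 889,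
    754, 981, 779, 941, 884, 883, 938, 858, 889, 978, 754, 920, 981, 894, 886, 941, 893, 937, 921,
    942, 863, 856, 881, 781, 811, 821, 818, 812, 778],
  [755, 918, 954, 875, 910, 913, 970, 957, 760, 973, 767, 908, 917, 959, 971, 797, 790, 846, 841,
    785, 794, 831, 972, 907, 914, 824, 959, 794, 917, 785, 877, 846, 797, 831, 971, 907, 874, 914,
    824, 959, 790, 797, 841, 846, 794, 785, 972, 831, 914, 907, 978, 349, 302, 267, 362, 329, 346,
    268, 365, 297, 810, 777, 816, 782, 867, 796, 763, 829, 847, 934, 897, 868, 965, 949, 786, 763,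
    873, 840, 958, 826, 968, 764, 795, 847, 789, 941, 921, 763, 786, 829, 789, 764, 795, 826, 840,
    829, 847, 934, 897, 868, 965, 949, 268, 329, 365, 334, 267, 362, 302, 422, 497, 399, 453, 502,
    417, 392, 450, 456, 266, 300, 363, 333, 344, 330, 453, 399, 463, 497, 417, 502, 450, 392, 300,
    330, 363, 453, 333, 344, 399, 351, 862, 463, 777, 417, 502, 810, 392, 816, 450, 930, 899, 944,
    464, 866, 400, 900, 951, 471, 486, 425, 437, 434, 430, 481, 407, 330, 453, 502, 417, 392, 456,
    497, 450, 394, 454, 419, 300, 333, 351, 364, 269, 299, 454, 419, 300, 333, 351, 364, 269, 299,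
    498, 449, 462, 397, 419, 420, 300, 299, 333, 344],
  [363, 268, 365, 334, 267, 297, 346, 883, 894, 938, 941, 858, 981, 754, 884, 779, 883, 894, 941,
    921, 981, 884, 893, 886, 927, 920, 881, 858, 890, 942, 779, 809, 937, 814, 962, 929, 836, 974,
    911, 915, 879, 956, 955, 872, 904, 969, 916, 955, 879, 911, 916, 915, 904, 835, 807, 852, 810,
    816, 782, 759, 965, 868, 897, 934, 268, 297, 334, 365, 297, 365, 349, 329, 454, 457, 394, 419,
    462, 449, 397, 420, 501, 915, 911, 956, 775, 807, 750, 835, 851, 852, 800, 745, 768, 929, 962,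
    881, 927, 893, 942, 855, 837, 773, 803, 834, 848, 837, 773, 803, 834, 848, 803, 748, 834, 897,
    946, 934, 867, 782, 759, 816, 965, 810, 868, 777, 934, 946, 965, 962, 868, 867, 929, 902, 949,
    770, 834, 848, 834, 848, 949, 804, 965, 837, 868, 934, 773, 777, 748, 810, 834, 816, 848, 782,
    759, 867, 902, 946, 962, 902, 962, 268, 297, 365, 422, 349, 497, 302, 417, 450, 392, 456, 297,
    365, 334, 482, 267, 346, 388, 362, 302, 485, 417, 368, 495, 444, 387, 410, 474, 443, 324, 377,
    288, 502, 280, 463, 323, 340, 295, 382, 497, 399],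
  [422, 495, 413, 443, 477, 474, 444, 357, 323, 382, 497, 422, 399, 456, 463, 343, 336, 276, 313,
    438, 465, 402, 428, 285, 405, 325, 282, 379, 292, 313, 438, 427, 470, 405, 282, 322, 380, 285,
    291, 868, 965, 929, 934, 962, 946, 790, 767, 841, 794, 760, 910, 837, 773, 748, 834, 929, 848,
    868, 798, 825, 845, 825, 845, 787, 819, 860, 815, 758, 958, 873, 919, 968, 753, 912, 776, 878,
    808, 953, 909, 878, 975, 919, 953, 958, 912, 758, 815, 783, 860, 859, 776, 753, 808, 820, 958,
    873, 919, 968, 477, 444, 495, 975, 878, 912, 953, 906, 957, 853, 913, 876, 970, 973, 875, 918,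
    772, 954, 749, 838, 771, 801, 850, 354, 305, 318, 845, 825, 762, 788, 898, 842, 793, 830, 928,
    970, 765, 905, 960, 913, 925, 954, 756, 892, 811, 943, 781, 860, 885, 870, 753, 945, 966, 967,
    871, 815, 783, 758, 878, 958, 975, 919, 953, 912, 758, 815, 860, 753, 776, 837, 875, 773, 970,
    748, 954, 834, 918, 848, 913, 957, 876, 973, 905, 875, 970, 918, 913, 954, 957, 905, 973, 876,
    831, 767, 797, 794, 846, 760, 785, 930, 933, 900],
  [866, 944, 963, 323, 382, 848, 834, 748, 773, 929, 868, 777, 810, 816, 782, 759, 280, 377, 288,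
    340, 339, 459, 460, 815, 819, 860, 758, 776, 783, 753, 808, 820, 859, 860, 776, 819, 958, 873,
    393, 968, 448, 416, 500, 455, 398, 878, 912, 906, 953, 377, 288, 324, 339, 287, 382, 848, 497,
    834, 450, 748, 456, 773, 392, 422, 837, 417, 453, 302, 502, 267, 362, 329, 268, 349, 365, 297,
    810, 816, 782, 759, 377, 280, 340, 288, 295, 324, 287, 444, 377, 340, 759, 295, 782, 382, 816,
    497, 450, 456, 392, 422, 279, 399, 272, 304, 316, 369, 355, 316, 374, 369, 315, 356, 311, 502,
    453, 330, 754, 963, 944, 866, 900, 951, 964, 810, 777, 816, 868, 782, 929, 965, 962, 934, 867,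
    902, 817, 780, 757, 809, 866, 944, 899, 963, 964, 900, 951, 765, 845, 788, 793, 825, 830, 875,
    910, 970, 913, 954, 848, 905, 834, 918, 905, 954, 970, 760, 910, 785, 913, 876, 845, 972, 788,
    907, 914, 793, 825, 877, 952, 830, 787, 842, 762, 971, 797, 767, 841, 824, 280, 760, 340, 785,
    295, 382, 497, 422, 399, 463, 417, 302, 362, 267],
  [837, 773, 910, 748, 970, 834, 913, 905, 876, 972, 822, 757, 779, 858, 814, 299, 817, 861, 965,
    420, 868, 934, 777, 929, 810, 449, 334, 365, 297, 268, 329, 387, 454, 477, 501, 495, 397, 388,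
    413, 443, 893, 474, 410, 890, 920, 976, 942, 462, 419, 498, 757, 779, 814, 959, 917, 877, 908,
    907, 914, 874, 952, 971, 268, 387, 834, 477, 748, 495, 773, 929, 868, 902, 388, 817, 867, 413,
    946, 443, 893, 962, 474, 983, 809, 410, 858, 890, 920, 937, 886, 365, 349, 302, 329, 417, 392,
    450, 456, 422, 497, 297, 382, 810, 295, 777, 287, 340, 868, 400, 280, 929, 965, 962, 814, 934,
    809, 959, 454, 757, 419, 917, 300, 333, 351, 464, 434, 425, 481, 486, 407, 437, 471, 387, 410,
    477, 293, 388, 413, 443, 324, 288, 280, 415, 340, 295, 382, 408, 497, 492, 422, 385, 447, 399,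
    456, 440, 390, 463, 392, 327, 491, 475, 417, 279, 476, 302, 355, 267, 374, 362, 311, 329, 356,
    349, 775, 365, 297, 810, 816, 955, 782, 759, 916, 851, 904, 750, 807, 835, 852, 768, 413, 474,
    443, 488, 868, 777, 929, 810, 297, 365, 334, 449],
  [420, 299, 344, 814, 471, 779, 959, 858, 809, 757, 917, 280, 288, 407, 324, 437, 287, 430, 400,
    481, 425, 434, 288, 340, 415, 295, 408, 492, 385, 440, 491, 971, 908, 952, 874, 900, 951, 964,
    810, 899, 777, 869, 868, 779, 965, 814, 963, 900, 866, 944, 899, 964, 809, 757, 858, 822, 858,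
    822, 757, 779, 959, 814, 917, 299, 965, 877, 908, 344, 420, 868, 907, 777, 929, 972, 810, 862,
    449, 914, 816, 874, 952, 971, 300, 419, 394, 498, 363, 333, 351, 464, 434, 400, 287, 295, 324,
    382, 288, 497, 415, 422, 491, 399, 456, 476, 272, 392, 279, 355, 304, 316, 369, 972, 907, 877,
    917, 908, 971, 797, 767, 841, 824, 280, 340, 295, 382, 408, 497, 422, 399, 463, 417, 302, 231,
    804, 837, 267, 773, 362, 748, 329, 762, 834, 349, 787, 268, 798, 365, 825, 845, 765, 788, 804,
    837, 773, 748, 929, 868, 902, 777, 817, 810, 861, 297, 814, 299, 965, 420, 934, 397, 449, 501,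
    334, 454, 365, 329, 268, 98, 578, 529, 566, 917, 972, 877, 908, 914, 907, 874, 952, 971, 962,
    929, 902, 817, 780, 757, 861, 324, 340, 502, 759],
  [280, 453, 782, 288, 816, 339, 810, 382, 777, 497, 868, 399, 965, 422, 934, 902, 867, 841, 767,
    824, 797, 760, 899, 785, 869, 944, 964, 951, 972, 425, 471, 486, 400, 437, 434, 914, 907, 952,
    874, 971, 908, 917, 310, 318, 354, 305, 370, 373, 313, 357, 276, 275, 354, 370, 845, 765, 787,
    830, 868, 842, 929, 965, 313, 762, 748, 962, 934, 370, 773, 834, 867, 354, 837, 848, 305, 268,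
    365, 349, 329, 362, 267, 334, 346, 297, 387, 477, 444, 323, 410, 495, 488, 388, 443, 324, 287,
    295, 400, 340, 434, 280, 464, 430, 407, 481, 830, 842, 313, 793, 370, 788, 970, 354, 825, 305,
    373, 357, 773, 748, 837, 834, 910, 848, 913, 876, 957, 798, 825, 762, 788, 971, 874, 914, 952,
    907, 400, 471, 486, 907, 877, 959, 908, 971, 874, 952, 914, 899, 824, 944, 841, 866, 900, 933,
    869, 951, 964, 760, 785, 760, 785, 767, 797, 767, 797, 841, 794, 760, 785, 846, 831, 759, 782,
    759, 782, 777, 862, 777, 862, 777, 810, 862, 857, 782, 759, 813, 823, 977, 940, 923, 848, 834,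
    770, 803, 804, 837, 773, 855, 748, 834, 770, 803],
  [804, 747, 837, 773, 855, 748, 868, 777, 902, 813, 823, 862, 759, 752, 782, 810, 816, 867, 887,
    857, 962, 939, 929, 982, 949, 965, 934, 897, 882, 922, 936, 891, 979, 980, 925, 943, 885, 783,
    859, 758, 820, 819, 860, 753, 776, 808, 287, 280, 323, 382, 497, 456, 422, 399, 463, 417, 502,
    450, 392, 340, 295, 323, 382, 323, 377, 382, 288, 339, 382, 497, 456, 422, 399, 463, 417, 502,
    450, 392, 324, 377, 288, 339, 382, 497, 456, 422, 399, 463, 417, 502, 450, 392, 892, 925, 943,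
    860, 776, 819, 922, 891, 936, 862, 752, 823, 939, 982, 887, 782, 759, 816, 857, 810, 934, 957,
    910, 913, 876, 970, 905, 973, 875, 954, 767, 797, 790, 831, 794, 824, 939, 841, 862, 887, 752,
    782, 810, 759, 857, 823, 816, 899, 900, 933, 869, 951, 964, 841, 939, 982, 887, 782, 867, 772,
    853, 749, 833, 933, 963, 900, 866, 951, 944, 806, 801, 746, 850, 853, 749, 933, 963, 900, 866,
    951, 944, 305, 354, 477, 387, 444, 410, 474, 488, 443, 373, 318, 354, 477, 387, 444, 410, 474,
    488, 443, 430, 407, 464, 471, 481, 400, 425, 434],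
  [760, 785, 846, 846, 797, 831, 767, 785, 790, 973, 760, 876, 905, 933, 900, 963, 951, 866, 869,
    944, 850, 801, 749, 772, 875, 910, 970, 913, 954, 875, 918, 771, 746, 930, 964, 810, 899, 752,
    816, 823, 862, 857, 759, 939, 782, 794, 982, 867, 887, 841, 962, 824, 946, 897, 407, 471, 437,
    314, 430, 481, 453, 502, 377, 463, 280, 399, 340, 497, 382, 295, 287, 400, 464, 434, 317, 274,
    308, 359, 372, 277, 307, 352, 371, 330, 344, 266, 833, 806, 853, 772, 875, 910, 970, 913, 502,
    417, 463, 471, 437, 430, 486, 464, 400, 841, 963, 824, 900, 866, 951, 930, 944, 964, 899, 841,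
    794, 824, 939, 862, 887, 752, 782, 810, 759, 857, 823, 816, 899, 900, 869, 951, 964, 767, 797,
    973, 790, 831, 905, 876, 785, 760, 794, 824, 841, 970, 760, 910, 875, 913, 918, 973, 876, 785,
    794, 824, 841, 939, 790, 862, 887, 797, 752, 782, 831, 810, 857, 816, 900, 933, 963, 910, 875,
    918, 954, 973, 905, 760, 783, 859, 758, 820, 819, 860, 753, 776, 808, 909, 878, 975, 919, 953,
    958, 912, 815, 758, 819, 958, 873, 919, 968, 850],
  [912, 878, 906, 953, 954, 918, 875, 749, 838, 771, 801, 772, 853, 806, 833, 746, 853, 772, 801,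
    838, 771, 746, 885, 930, 980, 944, 943, 866, 963, 860, 900, 815, 819, 933, 758, 776, 841, 790,
    797, 831, 785, 864, 948, 961, 772, 801, 838, 912, 771, 878, 746, 953, 906, 833, 853, 749, 772,
    801, 878, 958, 975, 815, 953, 819, 912, 758, 859, 758, 820, 819, 815, 860, 753, 776, 808, 967,
    901, 870, 945, 898, 960, 865, 950, 935, 906, 912, 878, 953, 958, 975, 796, 353, 375, 278, 309,
    426, 469, 436, 487, 403, 436, 480, 487, 429, 404, 435, 466, 949, 929, 965, 897, 946, 962, 752,
    867, 862, 873, 919, 909, 429, 878, 487, 404, 435, 480, 960, 898, 865, 789, 829, 763, 840, 795,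
    826, 786, 968, 346, 488, 387, 443, 410, 324, 444, 323, 382, 339, 497, 287, 288, 295, 415, 340,
    408, 377, 417, 302, 362, 267, 388, 495, 368, 312, 306, 429, 487, 404, 435, 480, 960, 898, 865,
    385, 950, 440, 901, 491, 870, 390, 502, 392, 463, 456, 399, 422, 453, 502, 392, 463, 456, 943,
    936, 922, 882, 892, 925, 979, 309, 319, 273, 306]]

/-- Slots to branch on. -/
def greatIcosahedralBranching2 : List ℕ := List.flatten [
  [358, 368, 306, 312, 278, 368, 375, 495, 388, 443, 324, 488, 474, 410, 954, 387, 918, 867, 875,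
    782, 759, 887, 823, 982, 862, 939, 752, 794, 841, 790, 797, 831, 287, 339, 382, 306, 312, 368,
    847, 829, 763, 789, 786, 764, 840, 826, 795, 763, 829, 878, 909, 878, 909, 873, 919, 873, 912,
    968, 873, 919, 968, 958, 797, 767, 831, 910, 913, 876, 970, 973, 767, 797, 790, 831, 785, 760,
    794, 824, 841, 867, 897, 946, 965, 962, 759, 752, 782, 810, 816, 857, 929, 949, 929, 949, 929,
    949, 929, 949, 748, 803, 834, 803, 834, 773, 837, 855, 837, 855, 804, 747, 837, 970, 913, 910,
    837, 875, 957, 855, 954, 918, 905, 973, 767, 790, 797, 913, 910, 837, 875, 957, 747, 855, 954,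
    876, 770, 918, 834, 905, 803, 973, 982, 767, 887, 797, 939, 790, 831, 785, 760, 846, 794, 824,
    841, 983, 886, 893, 927, 881, 976, 890, 920, 937, 930, 933, 900, 866, 944, 963, 976, 863, 812,
    937, 821, 886, 755, 778, 451, 332, 361, 296, 264, 347, 348, 366, 406, 886, 893, 920, 927, 407,
    481, 430, 437, 464, 434, 754, 858, 779, 822, 858],
  [914, 779, 907, 814, 822, 952, 817, 861, 971, 780, 917, 757, 914, 972, 907, 877, 917, 959, 971,
    874, 908, 481, 430, 437, 471, 486, 425, 467, 439, 431, 484, 483, 964, 963, 951, 944, 869, 899,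
    467, 886, 439, 893, 431, 484, 942, 468, 881, 401, 396, 496, 458, 496, 395, 458, 418, 812, 821,
    755, 781, 778, 881, 886, 890, 937, 881, 927, 893, 942, 899, 944, 866, 900, 933, 869, 951, 964,
    890, 976, 881, 920, 770, 886, 747, 983, 893, 927, 942, 807, 851, 942, 881, 976, 768, 745, 982,
    887, 939, 905, 834, 954, 770, 918, 747, 855, 837, 954, 918, 855, 875, 973, 837, 767, 876, 747,
    910, 770, 834, 803, 785, 760, 831, 846, 794, 841, 790, 824, 797, 831, 959, 908, 972, 874, 867,
    788, 765, 825, 845, 934, 946, 934, 946, 972, 907, 952, 874, 914, 908, 917, 971, 877, 952, 907,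
    957, 876, 913, 846, 797, 831, 767, 790, 973, 876, 913, 910, 837, 875, 855, 918, 760, 971, 797,
    952, 874, 914, 907, 831, 767, 785, 790, 794, 824, 841, 767, 797, 790, 824, 794, 841, 437, 407,
    917, 430, 908, 910, 824, 837, 913, 841, 855, 876],
  [790, 973, 875, 918, 481, 407, 430, 972, 794, 824, 908, 874, 914, 907, 952, 492, 964, 930, 899,
    824, 869, 944, 908, 951, 866, 917, 959, 877, 775, 836, 893, 886, 792, 784, 937, 844, 920, 761,
    799, 766, 791, 843, 828, 843, 791, 828, 843, 828, 761, 791, 927, 766, 881, 920, 976, 930, 899,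
    824, 869, 908, 917, 959, 757, 877, 775, 836, 893, 822, 779, 814, 754, 858, 914, 809, 907, 952,
    841, 907, 831, 952, 785, 874, 794, 908, 824, 917, 959, 757, 877, 775, 750, 836, 371, 800, 893,
    822, 886, 809, 858, 920, 937, 983, 927, 447, 415, 288, 280, 407, 430, 274, 308, 317, 434, 400,
    464, 314, 352, 307, 372, 491, 390, 476, 475, 440, 408, 914, 434, 874, 952, 908, 917, 959, 757,
    877, 775, 750, 836, 371, 893, 317, 822, 308, 809, 274, 858, 754, 814, 817, 831, 914, 952, 797,
    790, 824, 794, 908, 785, 874, 876, 913, 973, 910, 837, 875, 855, 918, 913, 973, 910, 947, 944,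
    899, 930, 899, 930, 407, 430, 969, 916, 904, 835, 872, 955, 750, 852, 956, 854, 879, 371, 775,
    915, 959, 836, 911, 877, 893, 917, 886, 849, 774],
  [802, 832, 744, 769, 307, 352, 274, 314, 308, 359, 372, 472, 491, 489, 415, 374, 476, 355, 279,
    311, 316, 304, 431, 406, 467, 424, 439, 484, 314, 274, 372, 308, 359, 314, 372, 359, 308, 317,
    274, 277, 822, 809, 858, 920, 976, 881, 927, 752, 777, 810, 962, 929, 949, 902, 817, 780, 861,
    777, 810, 911, 956, 915, 852, 872, 974, 835, 879, 750, 904, 775, 836, 800, 976, 842, 928, 945,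
    898, 819, 860, 815, 967, 935, 865, 950, 960, 928, 945, 870, 898, 819, 860, 815, 958, 844, 784,
    799, 827, 791, 766, 784, 761, 827, 766, 791, 920, 799, 937, 792, 828, 909, 975, 919, 873, 786,
    763, 826, 840, 761, 799, 784, 792, 827, 937, 766, 920, 762, 830, 825, 765, 793, 845, 788, 955,
    879, 916, 879, 916, 915, 956, 974, 872, 879, 916, 904, 484, 424, 401, 467, 881, 976, 800, 836,
    775, 893, 750, 886, 835, 406, 920, 852, 766, 937, 983, 927, 447, 761, 415, 475, 476, 356, 385,
    311, 440, 799, 327, 791, 281, 843, 828, 792, 323, 432, 497, 529, 333, 363, 300, 266, 351, 809,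
    344, 269, 471, 951, 866, 930, 963, 450, 899, 483],
  [813, 900, 933, 364, 431, 823, 299, 468, 777, 862, 330, 401, 752, 453, 424, 816, 399, 422, 456,
    392, 279, 311, 374, 315, 355, 272, 356, 304, 369, 386, 930, 490, 899, 869, 389, 441, 493, 412,
    473, 780, 900, 757, 933, 963, 861, 869, 817, 754, 779, 858, 363, 300, 266, 351, 344, 464, 471,
    400, 425, 434, 450, 392, 930, 456, 899, 866, 900, 963, 454, 394, 419, 498, 394, 419, 394, 419,
    538, 585, 568, 510, 600, 607, 505, 471, 386, 951, 490, 869, 389, 441, 493, 412, 473, 782, 299,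
    269, 364, 330, 351, 344, 464, 471, 400, 425, 434, 269, 364, 330, 351, 483, 344, 471, 425, 951,
    434, 486, 869, 400, 966, 464, 871, 903, 931, 948, 864, 903, 781, 881, 976, 568, 419, 585, 300,
    394, 510, 363, 389, 266, 949, 897, 787, 830, 842, 762, 793, 798, 765, 936, 922, 882, 891, 816,
    857, 925, 943, 860, 776, 819, 762, 830, 842, 868, 965, 387, 410, 477, 867, 946, 934, 747, 837,
    983, 855, 893, 918, 413, 954, 388, 474, 443, 488, 444, 410, 488, 443, 388, 413, 495, 477, 477,
    867, 934, 946, 747, 770, 837, 855, 758, 859, 783],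
  [815, 820, 958, 808, 873, 953, 906, 912, 968, 859, 783, 820, 808, 953, 912, 906, 873, 958, 968,
    819, 860, 776, 815, 958, 478, 783, 859, 808, 820, 753, 859, 808, 820, 936, 753, 865, 960, 898,
    950, 901, 967, 935, 398, 273, 455, 319, 423, 358, 460, 309, 375, 353, 488, 278, 968, 393, 873,
    906, 912, 953, 878, 423, 455, 460, 499, 448, 979, 393, 882, 500, 892, 925, 943, 885, 980, 273,
    459, 878, 455, 912, 500, 953, 968, 379, 906, 873, 919, 909, 975, 384, 494, 409, 442, 479, 325,
    445, 292, 282, 411, 801, 322, 336, 291, 380, 806, 499, 979, 746, 833, 772, 882, 892, 412, 473,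
    386, 446, 472, 494, 864, 409, 948, 442, 479, 468, 931, 489, 391, 959, 401, 414, 917, 424, 757,
    381, 289, 802, 849, 774, 832, 744, 374, 279, 311, 472, 864, 931, 948, 468, 961, 431, 932, 406,
    439, 896, 467, 886, 416, 424, 920, 393, 401, 448, 574, 586, 507, 537, 27, 452, 822, 757, 858,
    893, 754, 809, 983, 927, 861, 780, 817, 809, 858, 779, 265, 335, 350, 360, 298, 763, 421, 829,
    396, 461, 796, 395, 418, 875, 458, 954, 938, 850],
  [926, 838, 889, 801, 884, 978, 981, 921, 941, 335, 350, 301, 360, 811, 298, 756, 421, 818, 461,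
    856, 395, 755, 875, 918, 954, 836, 775, 750, 928, 945, 870, 390, 475, 447, 829, 847, 789, 796,
    892, 943, 925, 885, 771, 838, 850, 882, 979, 405, 428, 485, 465, 282, 433, 292, 336, 428, 343,
    465, 402, 285, 291, 380, 322, 282, 470, 292, 427, 433, 325, 402, 482, 438, 838, 801, 850, 771,
    885, 925, 943, 981, 889, 941, 884, 395, 461, 875, 421, 503, 918, 396, 954, 196, 676, 729, 328,
    543, 449, 715, 235, 303, 104, 366, 271, 397, 420, 501, 457, 462, 877, 917, 959, 751, 805, 849,
    839, 832, 145, 891, 802, 980, 102, 922, 230, 442, 710, 489, 625, 695, 374, 661, 727, 311, 630,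
    356, 705, 369, 688, 839, 769, 854, 744, 832, 849, 774, 404, 429, 466, 469, 426, 403, 436, 429,
    435, 487, 699, 311, 551, 840, 315, 786, 795, 763, 826, 360, 764, 921, 202, 682, 740, 555, 651,
    596, 614, 645, 703, 309, 278, 319, 375, 358, 488, 473, 474, 412, 609, 493, 556, 595, 519, 763,
    929, 786, 926, 902, 938, 422, 883, 399, 737, 648],
  [588, 640, 684, 571, 683, 603, 742, 573, 655, 540, 591, 506, 604, 584, 465, 480, 428, 403, 485,
    469, 587, 606, 648, 640, 683, 700, 742, 655, 312, 552, 546, 520, 403, 469, 436, 315, 374, 260,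
    740, 555, 596, 375, 353, 488, 306, 474, 368, 696, 410, 495, 651, 682, 661, 727, 695, 215, 117,
    216, 795, 826, 764, 202, 921, 599, 557, 611, 592, 514, 547, 554, 612, 359, 630, 710, 308, 695,
    371, 625, 727, 720, 705, 562, 658, 522, 352, 576, 479, 619, 409, 565, 294, 413, 283, 893, 378,
    927, 338, 289, 284, 381, 757, 780, 861, 278, 319, 488, 309, 410, 358, 426, 474, 368, 480, 609,
    306, 544, 696, 556, 682, 739, 360, 642, 298, 652, 345, 685, 367, 278, 319, 309, 639, 358, 159,
    368, 37, 306, 171, 696, 651, 740, 555, 651, 614, 696, 682, 642, 739, 556, 519, 595, 403, 580,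
    436, 563, 315, 414, 272, 356, 445, 369, 494, 580, 563, 414, 622, 894, 527, 833, 921, 579, 806,
    978, 99, 229, 709, 532, 522, 583, 619, 565, 795, 826, 764, 551, 555, 596, 490, 386, 411, 441,
    446, 412, 493, 311, 684, 356, 603, 647, 573, 742],
  [591, 683, 604, 465, 428, 559, 513, 549, 598, 615, 608, 479, 552, 409, 737, 494, 700, 369, 304,
    316, 588, 571, 504, 606, 601, 469, 466, 426, 403, 436, 588, 504, 571, 676, 729, 328, 298, 360,
    487, 404, 429, 418, 496, 458, 396, 938, 421, 926, 298, 763, 360, 487, 404, 429, 501, 884, 769,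
    889, 926, 938, 978, 744, 854, 805, 839, 891, 411, 980, 446, 922, 442, 409, 294, 321, 378, 806,
    941, 746, 833, 894, 921, 978, 850, 746, 801, 833, 772, 749, 853, 943, 979, 925, 499, 885, 380,
    891, 411, 292, 490, 282, 441, 322, 412, 291, 763, 847, 764, 826, 786, 840, 586, 605, 537, 602,
    589, 508, 569, 935, 950, 967, 901, 385, 898, 935, 960, 950, 928, 901, 750, 967, 775, 835, 945,
    836, 852, 847, 893, 829, 822, 886, 809, 778, 920, 858, 755, 440, 856, 327, 811, 818, 756, 383,
    496, 418, 301, 458, 270, 396, 938, 328, 367, 421, 335, 345, 265, 298, 360, 812, 763, 863, 926,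
    770, 837, 983, 834, 893, 268, 822, 927, 329, 809, 349, 302, 365, 267, 362, 297, 346, 422, 334,
    902, 861, 780, 817, 965, 868, 934, 929, 867, 902],
  [946, 962, 417, 965, 868, 934, 777, 929, 747, 823, 902, 837, 422, 962, 855, 399, 752, 463, 382,
    862, 502, 287, 813, 324, 759, 377, 929, 868, 965, 814, 754, 817, 861, 902, 757, 962, 809, 822,
    858, 779, 585, 600, 607, 590, 505, 575, 419, 300, 394, 462, 266, 363, 766, 920, 937, 457, 420,
    397, 449, 821, 812, 863, 821, 881, 863, 976, 756, 812, 800, 755, 836, 775, 893, 750, 886, 835,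
    406, 920, 852, 467, 766, 937, 424, 791, 983, 401, 843, 927, 468, 447, 761, 948, 792, 864, 828,
    931, 281, 327, 383, 286, 320, 376, 503, 396, 421, 451, 420, 449, 501, 397, 457, 462, 877, 937,
    419, 917, 886, 394, 959, 920, 976, 881, 546, 434, 400, 464, 401, 424, 467, 406, 439, 483, 431,
    468, 424, 949, 897, 822, 757, 858, 893, 754, 809, 983, 927, 861, 780, 817, 809, 858, 779, 868,
    965, 387, 410, 477, 867, 946, 934, 747, 837, 983, 855, 893, 918, 413, 954, 388, 474, 443, 488,
    444, 410, 488, 443, 388, 413, 495, 477, 477, 867, 934, 946, 747, 770, 837, 855, 758, 859, 783,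
    815, 820, 958, 808, 873, 953, 906, 912, 968, 859],
  [783, 820, 808, 953, 912, 906, 873, 958, 968, 819, 860, 776, 815, 958, 783, 859, 808, 820, 753,
    859, 808, 820, 936, 753, 865, 960, 898, 950, 901, 967, 935, 909, 919, 975, 829, 847, 789, 796,
    398, 273, 319, 358, 309, 368, 375, 795, 306, 488, 764, 429, 968, 826, 786, 840, 873, 763, 906,
    426, 466, 404, 884, 921, 941, 981, 889, 926, 455, 423, 460, 499, 448, 979, 393, 882, 500, 892,
    925, 943, 885, 980, 459, 878, 455, 912, 500, 953, 379, 906, 932, 871, 961, 966, 864, 948, 931,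
    896, 416, 393, 448, 548, 514, 611, 557, 592, 599, 488, 495, 410, 444, 439, 406, 467, 384, 494,
    409, 442, 479, 325, 445, 292, 282, 322, 336, 849, 291, 774, 380, 832, 499, 979, 892, 412, 473,
    386, 411, 446, 494, 409, 479, 472, 864, 827, 799, 844, 931, 948, 903, 871, 892, 882, 943, 925,
    885, 771, 980, 850, 801, 838, 772, 749, 882, 979, 315, 311, 374, 489, 391, 414, 442, 445, 922,
    925, 762, 765, 825, 845, 788, 311, 374, 489, 391, 414, 442, 445, 922, 925, 762, 765, 825, 845,
    788, 436, 487, 883, 403, 426, 480, 466, 774, 832],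
  [849, 403, 469, 429, 404, 863, 926, 938, 889, 884, 265, 360, 298, 421, 396, 458, 418, 452, 395,
    461, 335, 360, 350, 298, 301, 421, 418, 396, 458, 836, 775, 750, 928, 945, 870, 390, 475, 447,
    405, 428, 485, 465, 282, 433, 292, 336, 428, 343, 465, 402, 285, 291, 380, 322, 282, 470, 292,
    427, 433, 402, 482, 715, 543, 588, 504, 571, 303, 676, 348, 366, 639, 331, 734, 575, 505, 590,
    483, 468, 347, 296, 264, 361, 235, 303, 543, 104, 366, 271, 331, 452, 395, 461, 875, 421, 503,
    941, 918, 981, 954, 771, 885, 925, 943, 832, 802, 849, 774, 532, 522, 583, 619, 565, 709, 563,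
    414, 520, 622, 894, 527, 921, 579, 764, 978, 528, 801, 48, 99, 229, 806, 833, 772, 853, 749,
    838, 850, 242, 182, 662, 722, 627, 266, 300, 363, 662, 722, 627, 266, 300, 363, 580, 520, 535,
    664, 196, 676, 729, 328, 568, 585, 510, 738, 318, 558, 545, 650, 344, 363, 471, 266, 300, 486,
    330, 351, 364, 483, 431, 468, 347, 332, 361, 680, 697, 736, 702, 653, 743, 317, 308, 371, 743,
    317, 308, 371, 557, 687, 599, 702, 222, 305, 118],
  [373, 212, 490, 308, 371, 692, 631, 567, 521, 582, 102, 616, 980, 922, 891, 411, 560, 721, 320,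
    286, 376, 337, 290, 412, 726, 493, 663, 707, 595, 614, 555, 596, 656, 721, 624, 708, 691, 521,
    582, 616, 359, 701, 661, 681, 181, 365, 644, 654, 40, 345, 643, 270, 298, 698, 367, 360, 649,
    686, 480, 350, 466, 584, 465, 349, 603, 428, 573, 485, 591, 362, 111, 346, 297, 422, 902, 929,
    840, 786, 763, 826, 55, 205, 162, 284, 764, 685, 921, 645, 202, 682, 642, 740, 652, 703, 697,
    646, 653, 591, 687, 540, 573, 606, 603, 511, 584, 587, 506, 485, 570, 465, 604, 641, 687, 702,
    653, 736, 743, 680, 697, 646, 318, 305, 373, 490, 386, 411, 446, 654, 345, 643, 701, 298, 698,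
    308, 681, 360, 359, 644, 649, 350, 465, 428, 307, 277, 372, 676, 729, 328, 298, 360, 520, 580,
    622, 579, 527, 528, 564, 617, 849, 751, 839, 769, 744, 854, 838, 850, 418, 496, 458, 812, 926,
    821, 938, 981, 894, 889, 941, 921, 978, 801, 838, 850, 756, 821, 818, 755, 778, 856, 943, 979,
    925, 499, 805, 885, 380, 423, 891, 296, 839, 271],
  [332, 361, 486, 471, 344, 951, 363, 869, 266, 389, 478, 411, 292, 490, 282, 441, 322, 412, 291,
    766, 843, 792, 828, 761, 844, 931, 903, 966, 871, 514, 611, 557, 599, 495, 388, 413, 443, 871,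
    896, 827, 864, 799, 844, 931, 903, 948, 763, 789, 847, 902, 796, 962, 929, 840, 786, 795, 826,
    764, 878, 919, 912, 873, 953, 906, 935, 950, 967, 901, 385, 778, 898, 935, 440, 960, 950, 928,
    901, 750, 870, 967, 835, 755, 852, 327, 342, 293, 376, 286, 320, 447, 390, 415, 491, 476, 770,
    983, 834, 893, 268, 927, 329, 349, 365, 297, 334, 422, 861, 902, 780, 817, 929, 965, 962, 902,
    946, 867, 934, 965, 868, 934, 929, 867, 902, 946, 962, 417, 965, 868, 934, 777, 929, 747, 823,
    902, 837, 422, 962, 855, 399, 752, 463, 382, 862, 502, 287, 813, 324, 759, 377, 929, 868, 965,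
    814, 754, 817, 861, 902, 757, 962, 809, 822, 858, 779, 513, 593, 608, 552, 513, 593, 608, 552,
    813, 816, 759, 857, 394, 419, 900, 933, 951, 869, 524, 578, 621, 566, 524, 578, 621, 566, 399,
    422, 453, 456, 933, 450, 900, 963, 930, 866, 401],
  [424, 401, 424, 280, 340, 295, 377, 382, 502, 497, 399, 422, 453, 280, 340, 295, 382, 497, 399,
    422, 453, 456, 933, 450, 900, 963, 930, 866, 852, 974, 835, 879, 904, 916, 852, 835, 750, 775,
    836, 800, 976, 881, 842, 928, 945, 898, 819, 860, 815, 967, 935, 865, 950, 960, 830, 928, 793,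
    945, 870, 898, 819, 860, 776, 815, 958, 783, 859, 808, 820, 753, 758, 859, 808, 820, 960, 753,
    901, 967, 935, 975, 500, 379, 455, 459, 340, 398, 416, 280, 393, 448, 377, 873, 499, 502, 786,
    380, 763, 840, 826, 904, 872, 392, 417, 450, 463, 456, 336, 343, 291, 285, 379, 448, 393, 416,
    460, 873, 459, 896, 968, 455, 864, 961, 906, 423, 932, 827, 871, 799, 903, 844, 931, 435, 480,
    466, 404, 426, 946, 429, 909, 919, 873, 786, 763, 840, 826, 904, 916, 436, 469, 949, 929, 962,
    867, 902, 484, 401, 424, 467, 904, 439, 919, 873, 786, 763, 826, 840, 826, 786, 763, 840, 904,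
    872, 956, 304, 316, 355, 476, 385, 408, 440, 316, 355, 476, 385, 408, 440, 431, 439, 406, 483,
    886, 468, 920, 948, 864, 931, 903, 561, 415, 476]]

/-- Slots to branch on. -/
def greatIcosahedralBranching3 : List ℕ := List.flatten [
  [491, 524, 581, 502, 534, 392, 618, 417, 460, 450, 463, 423, 456, 336, 943, 499, 307, 428, 433,
    405, 282, 885, 292, 925, 325, 343, 892, 979, 285, 882, 936, 291, 922, 322, 980, 849, 802, 832,
    314, 372, 491, 476, 385, 440, 408, 314, 372, 491, 476, 385, 440, 408, 524, 581, 534, 621, 618,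
    459, 460, 423, 398, 455, 786, 840, 763, 795, 929, 829, 974, 902, 879, 962, 916, 752, 904, 872,
    956, 610, 550, 515, 553, 392, 431, 502, 439, 417, 406, 450, 463, 886, 456, 336, 943, 920, 307,
    428, 433, 405, 282, 885, 292, 925, 325, 343, 892, 285, 882, 291, 979, 322, 936, 849, 922, 832,
    980, 802, 314, 372, 491, 476, 385, 440, 408, 314, 372, 491, 476, 385, 440, 408, 476, 550, 385,
    491, 515, 440, 392, 408, 502, 417, 450, 463, 456, 336, 399, 943, 422, 497, 382, 295, 287, 400,
    464, 434, 277, 317, 371, 308, 274, 359, 314, 372, 307, 372, 307, 428, 433, 405, 282, 885, 292,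
    925, 325, 343, 892, 285, 882, 291, 979, 322, 936, 849, 922, 832, 980, 802, 372, 307, 314, 359,
    428, 352, 433, 371, 774, 405, 482, 308, 282, 885],
  [427, 292, 925, 402, 343, 892, 285, 882, 291, 979, 322, 936, 849, 922, 832, 980, 802, 476, 385,
    408, 440, 455, 459, 340, 398, 416, 280, 423, 393, 377, 460, 873, 502, 499, 786, 763, 840, 826,
    904, 872, 916, 392, 879, 417, 463, 943, 980, 802, 885, 891, 925, 922, 892, 882, 832, 979, 744,
    774, 854, 805, 909, 919, 909, 919, 762, 830, 825, 765, 793, 845, 788, 836, 956, 775, 915, 750,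
    852, 835, 916, 904, 835, 872, 955, 852, 956, 854, 879, 959, 877, 917, 849, 774, 805, 751, 839,
    430, 464, 400, 434, 486, 425, 471, 871, 932, 896, 864, 948, 903, 931, 966, 314, 794, 824, 785,
    908, 831, 917, 959, 757, 877, 775, 907, 750, 836, 914, 371, 893, 434, 952, 822, 317, 809, 308,
    858, 274, 754, 814, 817, 408, 475, 447, 415, 491, 440, 476, 385, 794, 785, 831, 797, 907, 877,
    914, 917, 874, 908, 952, 824, 959, 841, 790, 765, 830, 793, 788, 842, 845, 787, 935, 949, 901,
    950, 967, 744, 854, 769, 802, 839, 947, 805, 871, 948, 903, 931, 966, 854, 769, 839, 805, 948,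
    931, 903, 871, 947, 966, 832, 849, 774, 802, 947],
  [979, 805, 925, 854, 892, 839, 882, 943, 936, 980, 891, 922, 805, 751, 854, 839, 892, 925, 936,
    882, 943, 885, 783, 859, 871, 758, 820, 966, 819, 753, 860, 808, 776, 820, 859, 758, 819, 815,
    860, 958, 753, 776, 808, 769, 854, 805, 839, 751, 854, 805, 839, 751, 891, 980, 922, 876, 913,
    973, 910, 798, 825, 913, 973, 897, 868, 965, 867, 934, 946, 911, 879, 956, 915, 852, 872, 974,
    835, 969, 750, 904, 775, 928, 916, 836, 945, 960, 759, 800, 898, 813, 857, 976, 865, 782, 823,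
    881, 816, 899, 752, 900, 930, 962, 866, 929, 784, 963, 902, 754, 817, 814, 861, 927, 893, 983,
    747, 770, 837, 855, 316, 847, 789, 829, 435, 466, 480, 404, 426, 429, 909, 878, 912, 906, 953,
    369, 494, 479, 409, 384, 864, 931, 844, 799, 827, 791, 766, 879, 916, 955, 904, 974, 969, 896,
    864, 932, 931, 871, 948, 903, 881, 976, 800, 836, 893, 822, 886, 809, 920, 858, 976, 861, 814,
    927, 817, 983, 754, 780, 893, 809, 822, 858, 927, 893, 836, 983, 775, 747, 750, 770, 837, 928,
    855, 945, 960, 870, 898, 899, 930, 944, 964, 757],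
  [822, 809, 780, 858, 866, 779, 963, 869, 933, 930, 944, 964, 757, 822, 809, 780, 858, 866, 900,
    388, 413, 495, 532, 565, 583, 503, 396, 421, 447, 390, 475, 492, 317, 434, 400, 464, 430, 407,
    551, 555, 596, 490, 386, 411, 433, 405, 470, 292, 282, 379, 325, 500, 343, 416, 380, 393, 322,
    873, 291, 412, 493, 473, 953, 878, 906, 912, 282, 379, 336, 500, 322, 416, 455, 445, 393, 494,
    460, 479, 423, 409, 296, 384, 271, 303, 332, 366, 361, 331, 348, 264, 325, 411, 379, 442, 386,
    490, 500, 489, 374, 398, 273, 455, 368, 423, 306, 358, 460, 473, 393, 412, 441, 389, 478, 353,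
    278, 309, 375, 319, 455, 499, 423, 460, 273, 459, 878, 416, 912, 393, 953, 448, 906, 873, 919,
    909, 975, 392, 279, 450, 311, 355, 417, 356, 463, 399, 272, 304, 369, 316, 279, 456, 311, 497,
    315, 436, 487, 926, 763, 938, 786, 889, 796, 884, 941, 981, 938, 883, 889, 978, 884, 921, 941,
    894, 981, 384, 409, 494, 479, 472, 864, 414, 931, 948, 903, 871, 394, 419, 498, 323, 444, 710,
    529, 524, 578, 621, 566, 695, 625, 145, 27, 507],
  [574, 586, 230, 102, 196, 676, 575, 505, 590, 600, 505, 590, 600, 568, 729, 328, 360, 265, 298,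
    420, 449, 501, 397, 462, 619, 522, 576, 496, 458, 418, 395, 461, 875, 421, 918, 159, 639, 518,
    734, 593, 335, 671, 715, 552, 579, 427, 622, 438, 563, 402, 580, 465, 664, 350, 729, 301, 328,
    367, 298, 345, 639, 734, 671, 715, 579, 622, 563, 580, 664, 729, 632, 716, 675, 340, 382, 295,
    280, 382, 340, 295, 419, 498, 462, 397, 449, 501, 420, 457, 883, 403, 426, 480, 466, 417, 502,
    463, 555, 596, 490, 386, 411, 371, 308, 274, 427, 314, 352, 307, 428, 465, 402, 438, 359, 371,
    308, 565, 583, 503, 396, 421, 413, 443, 477, 495, 387, 444, 488, 410, 474, 814, 754, 817, 836,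
    956, 775, 915, 750, 852, 835, 902, 946, 934, 747, 983, 893, 822, 927, 809, 858, 754, 817, 780,
    861, 946, 867, 934, 946, 965, 934, 814, 867, 754, 902, 817, 830, 793, 788, 842, 762, 825, 910,
    837, 875, 913, 855, 876, 918, 973, 407, 430, 407, 917, 430, 471, 910, 425, 837, 913, 486, 855,
    876, 400, 973, 434, 918, 875, 824, 280, 908, 874],
  [914, 952, 907, 877, 972, 775, 750, 836, 835, 800, 288, 415, 491, 390, 265, 301, 270, 367, 345,
    788, 765, 825, 845, 270, 335, 367, 350, 787, 762, 830, 842, 790, 841, 797, 874, 952, 767, 908,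
    831, 917, 785, 907, 794, 877, 972, 959, 797, 767, 831, 876, 913, 852, 982, 835, 939, 750, 887,
    775, 800, 852, 836, 835, 893, 750, 983, 775, 747, 927, 770, 837, 881, 834, 855, 976, 803, 758,
    859, 783, 815, 820, 958, 808, 873, 953, 906, 912, 968, 859, 783, 820, 808, 953, 912, 906, 873,
    958, 968, 819, 860, 776, 815, 958, 865, 935, 950, 901, 960, 967, 898, 928, 945, 870, 753, 808,
    820, 859, 783, 908, 959, 917, 877, 971, 797, 952, 767, 907, 831, 874, 952, 971, 909, 919, 975,
    797, 767, 831, 846, 760, 785, 824, 794, 876, 913, 910, 957, 973, 918, 875, 790, 767, 824, 841,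
    905, 913, 910, 957, 973, 767, 831, 846, 760, 824, 794, 841, 785, 939, 790, 982, 887, 830, 842,
    762, 793, 825, 788, 765, 845, 842, 787, 793, 897, 868, 947, 944, 899, 930, 899, 930, 407, 430,
    437, 481, 934, 946, 867, 829, 847, 789, 796, 388],
  [413, 443, 495, 532, 565, 583, 503, 396, 421, 447, 390, 265, 475, 492, 949, 965, 779, 822, 809,
    858, 866, 930, 963, 899, 933, 869, 900, 930, 963, 899, 964, 969, 904, 916, 323, 444, 387, 477,
    955, 904, 916, 281, 290, 376, 503, 396, 421, 439, 484, 333, 363, 300, 266, 351, 344, 269, 471,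
    386, 951, 490, 869, 389, 441, 493, 412, 473, 363, 300, 266, 351, 344, 464, 471, 400, 425, 434,
    450, 266, 363, 300, 344, 471, 425, 434, 400, 464, 351, 269, 299, 364, 330, 363, 300, 766, 419,
    920, 394, 462, 937, 498, 457, 420, 397, 449, 394, 419, 454, 498, 546, 434, 400, 464, 320, 290,
    376, 503, 396, 421, 432, 455, 903, 871, 966, 932, 961, 864, 948, 931, 896, 331, 452, 389, 478,
    869, 933, 951, 507, 271, 510, 568, 585, 537, 538, 568, 585, 548, 398, 423, 878, 460, 953, 499,
    448, 393, 514, 873, 786, 906, 763, 968, 840, 488, 826, 592, 904, 554, 916, 426, 436, 403, 469,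
    273, 459, 878, 416, 500, 912, 379, 393, 953, 906, 873, 784, 476, 415, 956, 491, 872, 911, 392,
    915, 456, 974, 497, 936, 879, 916, 904, 922, 882],
  [891, 816, 839, 810, 769, 857, 854, 884, 805, 751, 979, 981, 892, 889, 925, 885, 771, 838, 850,
    762, 862, 882, 825, 777, 813, 979, 788, 798, 752, 823, 782, 892, 845, 382, 962, 279, 759, 765,
    287, 929, 925, 295, 902, 943, 422, 885, 980, 399, 802, 891, 839, 769, 854, 884, 744, 805, 914,
    832, 931, 751, 907, 948, 981, 864, 889, 941, 384, 472, 551, 555, 596, 490, 386, 411, 441, 446,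
    412, 493, 433, 405, 482, 282, 470, 292, 427, 325, 709, 402, 297, 718, 679, 735, 669, 638, 713,
    302, 267, 346, 362, 365, 718, 334, 238, 449, 92, 395, 461, 875, 421, 396, 749, 772, 838, 833,
    850, 746, 772, 801, 406, 467, 886, 618, 561, 81, 524, 227, 581, 707, 101, 631, 199, 692, 679,
    656, 622, 356, 535, 272, 527, 563, 580, 315, 404, 520, 436, 466, 403, 426, 460, 523, 534, 578,
    499, 566, 380, 621, 285, 581, 291, 502, 336, 377, 417, 572, 511, 31, 186, 666, 672, 728, 534,
    578, 523, 566, 529, 674, 712, 298, 667, 328, 732, 360, 571, 543, 588, 504, 695, 625, 727, 264,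
    565, 705, 583, 658, 669, 688, 735, 630, 720, 679],
  [150, 661, 322, 199, 28, 710, 380, 101, 191, 230, 581, 102, 524, 196, 676, 729, 568, 585, 600,
    682, 696, 651, 645, 740, 703, 685, 607, 471, 425, 486, 361, 348, 303, 715, 664, 632, 675, 671,
    734, 215, 710, 117, 230, 661, 102, 727, 196, 565, 676, 583, 715, 669, 235, 735, 104, 679, 199,
    101, 581, 524, 740, 645, 651, 703, 696, 306, 682, 353, 642, 652, 349, 466, 426, 309, 278, 375,
    682, 696, 216, 795, 826, 764, 202, 921, 645, 682, 651, 703, 642, 696, 652, 739, 685, 614, 625,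
    727, 555, 565, 705, 596, 658, 720, 688, 710, 609, 230, 474, 102, 410, 196, 562, 676, 522, 619,
    732, 571, 667, 712, 634, 731, 572, 511, 587, 606, 376, 667, 732, 290, 755, 338, 712, 571, 778,
    298, 634, 543, 856, 345, 275, 921, 318, 894, 414, 978, 289, 326, 381, 710, 283, 722, 230, 378,
    102, 501, 678, 196, 457, 676, 342, 420, 715, 397, 664, 462, 877, 729, 337, 568, 585, 654, 174,
    738, 38, 681, 701, 221, 308, 115, 371, 274, 635, 670, 730, 673, 717, 95, 237, 814, 817, 156,
    754, 636, 193, 665, 99, 582, 229, 521, 806, 567],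
  [746, 412, 209, 493, 689, 370, 373, 354, 305, 237, 814, 754, 193, 99, 229, 806, 833, 746, 370,
    354, 305, 373, 276, 637, 719, 677, 383, 286, 293, 431, 483, 468, 418, 496, 458, 396, 938, 421,
    926, 298, 763, 360, 487, 404, 429, 555, 596, 490, 386, 411, 441, 446, 412, 493, 891, 411, 980,
    292, 386, 490, 282, 325, 709, 446, 441, 442, 489, 925, 943, 979, 885, 892, 405, 470, 433, 482,
    395, 461, 875, 421, 941, 918, 396, 954, 406, 467, 886, 424, 384, 409, 472, 494, 864, 479, 948,
    391, 959, 931, 414, 917, 757, 381, 289, 284, 802, 321, 849, 294, 774, 832, 805, 744, 854, 472,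
    864, 931, 948, 850, 746, 801, 833, 772, 806, 853, 981, 749, 838, 889, 884, 926, 921, 894, 883,
    978, 938, 771, 838, 801, 816, 857, 884, 769, 889, 921, 409, 894, 978, 744, 938, 854, 458, 805,
    294, 321, 341, 981, 889, 849, 751, 832, 839, 769, 744, 854, 774, 832, 802, 821, 755, 856, 778,
    811, 818, 756, 863, 926, 883, 938, 458, 496, 418, 301, 335, 367, 480, 403, 466, 426, 812, 863,
    781, 404, 429, 466, 469, 426, 403, 436, 429, 487],
  [827, 844, 315, 311, 374, 311, 374, 436, 403, 469, 883, 926, 334, 449, 397, 420, 501, 457, 462,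
    530, 545, 558, 594, 276, 305, 373, 328, 298, 360, 715, 543, 511, 588, 606, 571, 303, 676, 348,
    729, 664, 632, 716, 296, 264, 361, 235, 303, 89, 104, 366, 509, 573, 591, 722, 242, 270, 345,
    631, 367, 151, 301, 335, 29, 350, 734, 187, 360, 298, 712, 667, 578, 566, 408, 523, 621, 618,
    141, 460, 561, 191, 81, 671, 227, 339, 707, 324, 295, 287, 763, 360, 840, 786, 826, 284, 764,
    367, 921, 48, 202, 205, 682, 685, 740, 645, 651, 696, 642, 739, 786, 840, 929, 902, 422, 675,
    195, 734, 67, 671, 257, 191, 639, 716, 28, 159, 536, 632, 508, 37, 513, 569, 605, 171, 598,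
    589, 608, 542, 602, 586, 651, 346, 696, 267, 306, 362, 368, 485, 312, 587, 737, 606, 552, 571,
    427, 588, 907, 648, 914, 854, 769, 744, 374, 311, 699, 551, 555, 596, 734, 671, 639, 716, 676,
    729, 380, 632, 499, 664, 460, 729, 676, 716, 196, 102, 375, 353, 488, 306, 474, 368, 696, 410,
    743, 317, 277, 371, 359, 308, 557, 687, 599, 702],
  [653, 173, 32, 659, 594, 690, 704, 558, 610, 626, 613, 723, 660, 597, 516, 553, 724, 690, 704,
    224, 290, 101, 376, 645, 284, 651, 740, 381, 682, 289, 360, 414, 298, 894, 712, 921, 674, 856,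
    634, 778, 154, 818, 524, 581, 534, 561, 618, 651, 171, 740, 37, 682, 159, 639, 671, 339, 288,
    280, 377, 502, 581, 524, 534, 621, 566, 529, 695, 374, 661, 727, 311, 355, 630, 705, 356, 688,
    369, 272, 304, 710, 230, 805, 751, 215, 117, 216, 795, 826, 764, 202, 921, 727, 565, 583, 619,
    620, 562, 522, 576, 704, 290, 690, 337, 724, 629, 711, 293, 286, 383, 557, 599, 611, 592, 514,
    547, 554, 612, 278, 319, 309, 358, 426, 368, 480, 306, 367, 696, 345, 298, 360, 682, 740, 651,
    703, 645, 278, 319, 309, 639, 358, 159, 734, 368, 37, 671, 306, 171, 191, 696, 28, 651, 508,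
    586, 569, 605, 602, 589, 542, 662, 593, 627, 689, 628, 725, 657, 694, 598, 608, 552, 427, 907,
    914, 972, 118, 222, 702, 305, 354, 373, 370, 275, 313, 310, 357, 326, 283, 381, 338, 289, 560,
    577, 346, 365, 297, 267, 365, 346, 297, 426, 480],
  [466, 766, 844, 843, 761, 791, 828, 751, 802, 917, 805, 769, 757, 877, 744, 381, 861, 959, 978,
    289, 814, 921, 326, 817, 894, 754, 414, 391, 479, 494, 409, 294, 283, 378, 501, 397, 457, 420,
    857, 759, 823, 777, 752, 862, 431, 483, 886, 468, 937, 948, 457, 931, 501, 864, 384, 409, 472,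
    494, 479, 391, 959, 414, 917, 757, 381, 289, 284, 338, 321, 378, 294, 418, 496, 875, 458, 954,
    396, 918, 421, 755, 298, 376, 345, 712, 674, 616, 634, 732, 560, 731, 667, 577, 637, 677, 623,
    463, 417, 572, 536, 601, 466, 426, 480, 367, 301, 335, 885, 405, 428, 485, 465, 943, 979, 892,
    882, 385, 408, 440, 385, 491, 440, 372, 415, 408, 277, 314, 288, 307, 280, 324, 352, 428, 377,
    339, 371, 433, 340, 502, 460, 405, 295, 423, 499, 535, 580, 707, 563, 631, 520, 622, 692, 617,
    656, 356, 624, 691, 663, 708, 355, 528, 564, 579, 501, 457, 937, 886, 406, 467, 424, 311, 315,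
    374, 441, 580, 490, 563, 386, 411, 622, 446, 461, 493, 395, 412, 875, 954, 850, 771, 885, 891,
    936, 979, 892, 925, 707, 227, 81, 561, 524, 581],
  [621, 827, 799, 844, 599, 557, 517, 611, 398, 547, 612, 514, 423, 878, 554, 460, 953, 592, 393,
    488, 873, 968, 906, 574, 586, 366, 347, 296, 264, 332, 361, 366, 303, 416, 459, 500, 398, 393,
    423, 460, 586, 574, 416, 459, 500, 398, 393, 423, 460, 586, 574, 416, 459, 500, 398, 393, 423,
    460, 493, 869, 412, 951, 473, 471, 953, 486, 912, 878, 398, 423, 296, 264, 361, 366, 303, 416,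
    459, 500, 398, 393, 423, 460, 366, 303, 416, 459, 500, 398, 393, 423, 460, 423, 948, 966, 296,
    931, 486, 361, 332, 451, 396, 421, 948, 864, 931, 328, 459, 298, 398, 345, 360, 273, 423, 470,
    487, 319, 368, 460, 433, 429, 358, 306, 405, 404, 309, 884, 795, 764, 826, 921, 786, 873, 393,
    278, 416, 448, 353, 500, 499, 478, 379, 380, 389, 282, 441, 322, 412, 291, 401, 483, 468, 431,
    401, 424, 468, 904, 431, 916, 911, 879, 974, 795, 826, 786, 840, 763, 513, 593, 608, 552, 513,
    593, 608, 552, 419, 300, 462, 498, 363, 766, 920, 937, 457, 420, 397, 449, 406, 467, 290, 320,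
    376, 280, 340, 295, 377, 382, 502, 497, 450, 392],
  [456, 280, 288, 340, 415, 295, 459, 491, 382, 455, 476, 497, 398, 956, 450, 878, 456, 912, 392,
    953, 872, 906, 784, 827, 799, 844, 900, 933, 869, 899, 951, 964, 822, 858, 754, 809, 814, 963,
    861, 900, 817, 866, 780, 902, 929, 962, 565, 583, 503, 396, 421, 413, 495, 443, 477, 387, 444,
    488, 410, 474, 763, 789, 911, 786, 796, 840, 795, 974, 915, 956, 969, 904, 916, 763, 789, 847,
    902, 962, 929, 840, 786, 795, 826, 764, 946, 965, 867, 949, 902, 929, 962, 809, 822, 757, 858,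
    861, 814, 779, 754, 817, 963, 780, 900, 866, 430, 437, 464, 481, 400, 434, 486, 425, 471, 871,
    932, 896, 864, 948, 903, 931, 966, 934, 946, 934, 946, 905, 918, 954, 973, 875, 767, 790, 824,
    841, 878, 919, 912, 873, 953, 906, 959, 877, 917, 820, 783, 859, 935, 950, 901, 960, 808, 820,
    859, 898, 928, 945, 960, 967, 950, 935, 835, 852, 835, 852, 881, 976, 750, 775, 750, 775, 750,
    835, 750, 835, 976, 881, 920, 770, 886, 747, 834, 837, 983, 803, 855, 893, 927, 982, 887, 939,
    918, 954, 875, 905, 910, 913, 876, 957, 973, 954]]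

/-- Slots to branch on. -/
def greatIcosahedralBranching4 : List ℕ := List.flatten [
  [875, 910, 913, 957, 973, 767, 846, 797, 831, 760, 822, 858, 809, 757, 861, 817, 754, 814, 779,
    750, 807, 835, 775, 836, 851, 745, 768, 800, 745, 836, 965, 814, 861, 757, 972, 794, 824, 841,
    790, 797, 831, 907, 877, 917, 908, 971, 959, 852, 917, 807, 835, 908, 775, 768, 824, 851, 874,
    794, 914, 785, 952, 831, 971, 797, 794, 959, 785, 852, 831, 797, 907, 877, 914, 775, 851, 800,
    768, 874, 908, 952, 971, 779, 754, 858, 897, 868, 929, 949, 902, 817, 814, 861, 757, 972, 794,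
    824, 841, 790, 797, 831, 907, 877, 917, 908, 971, 959, 852, 917, 807, 835, 908, 775, 768, 824,
    851, 874, 794, 914, 785, 952, 831, 971, 797, 794, 959, 785, 852, 831, 797, 907, 877, 914, 775,
    851, 800, 768, 874, 908, 952, 971, 897, 949, 868, 934, 929, 902, 867, 962, 946, 836, 775, 807,
    852, 768, 835, 797, 831, 977, 924, 940, 939, 923, 831, 767, 797, 790, 767, 797, 775, 917, 874,
    971, 952, 907, 877, 914, 972, 768, 807, 750, 835, 745, 852, 835, 750, 972, 877, 959, 920, 890,
    937, 976, 983, 800, 851, 836, 893, 927, 942, 881],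
  [385, 492, 408, 440, 475, 476, 447, 491, 415, 390, 270, 881, 890, 976, 770, 834, 848, 747, 803,
    804, 983, 748, 886, 927, 773, 893, 937, 855, 836, 942, 837, 851, 976, 895, 800, 890, 982, 887,
    863, 287, 295, 382, 408, 339, 492, 288, 447, 415, 475, 390, 295, 408, 492, 447, 475, 390, 415,
    288, 324, 339, 377, 382, 340, 323, 280, 870, 928, 945, 898, 967, 819, 960, 901, 820, 808, 859,
    953, 328, 758, 783, 815, 340, 958, 459, 455, 398, 878, 909, 919, 975, 928, 945, 898, 967, 960,
    901, 820, 808, 859, 953, 328, 783, 340, 815, 459, 958, 455, 398, 878, 909, 919, 975, 960, 928,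
    898, 819, 865, 945, 935, 967, 815, 901, 758, 860, 958, 820, 753, 808, 919, 953, 873, 912, 906,
    968, 756, 928, 781, 898, 811, 865, 945, 301, 818, 950, 418, 778, 496, 812, 395, 276, 357, 313,
    373, 265, 298, 328, 360, 298, 350, 360, 465, 328, 438, 345, 485, 470, 405, 433, 318, 305, 354,
    906, 873, 786, 953, 763, 840, 826, 929, 809, 822, 952, 757, 897, 971, 780, 868, 908, 817, 965,
    959, 814, 757, 962, 822, 858, 415, 288, 447, 476],
  [324, 440, 339, 408, 382, 475, 323, 497, 752, 356, 444, 315, 410, 272, 399, 816, 782, 867, 387,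
    788, 902, 268, 488, 765, 422, 817, 474, 365, 297, 780, 861, 334, 346, 267, 388, 443, 495, 413,
    447, 492, 408, 440, 491, 971, 908, 952, 959, 907, 877, 897, 946, 867, 788, 902, 934, 345, 765,
    817, 367, 845, 780, 301, 825, 861, 337, 462, 397, 449, 334, 420, 498, 267, 365, 501, 394, 268,
    457, 297, 454, 346, 329, 362, 320, 286, 383, 327, 496, 756, 781, 811, 818, 856, 778, 755, 376,
    342, 779, 814, 965, 868, 787, 762, 830, 842, 901, 928, 950, 898, 470, 418, 427, 395, 482, 276,
    402, 357, 438, 313, 868, 787, 965, 934, 949, 867, 946, 788, 845, 798, 825, 762, 842, 793, 928,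
    830, 898, 901, 945, 950, 847, 865, 764, 789, 795, 390, 265, 360, 328, 298, 345, 858, 822, 757,
    779, 897, 780, 868, 861, 965, 814, 840, 975, 950, 919, 901, 958, 935, 967, 815, 860, 753, 776,
    808, 808, 820, 753, 860, 919, 776, 975, 819, 878, 815, 912, 958, 968, 953, 808, 912, 820, 753,
    859, 860, 758, 776, 819, 873, 953, 786, 912, 878],
  [968, 975, 958, 763, 840, 950, 901, 935, 967, 815, 758, 819, 781, 821, 812, 778, 856, 811, 818,
    756, 877, 959, 908, 971, 797, 767, 760, 846, 785, 842, 928, 765, 788, 793, 830, 787, 762, 798,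
    825, 845, 825, 788, 898, 345, 793, 845, 819, 945, 367, 830, 870, 301, 901, 418, 935, 865, 950,
    960, 967, 815, 758, 860, 873, 786, 937, 886, 890, 983, 773, 976, 496, 748, 395, 458, 855, 875,
    837, 910, 918, 747, 895, 820, 753, 859, 808, 783, 776, 953, 878, 906, 912, 975, 968, 763, 958,
    840, 848, 826, 834, 803, 905, 876, 954, 970, 913, 957, 973, 309, 795, 764, 789, 865, 960, 950,
    470, 433, 318, 405, 354, 885, 305, 771, 373, 358, 490, 473, 478, 493, 389, 412, 441, 426, 480,
    466, 946, 897, 934, 847, 965, 764, 949, 789, 929, 865, 868, 960, 787, 950, 798, 470, 762, 433,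
    318, 405, 354, 885, 305, 373, 490, 478, 411, 891, 936, 882, 922, 795, 789, 938, 764, 829, 865,
    858, 847, 778, 950, 934, 812, 470, 897, 755, 433, 946, 821, 405, 482, 867, 885, 365, 902, 771,
    349, 817, 850, 268, 754, 746, 297, 329, 387, 814],
  [806, 422, 302, 477, 861, 497, 417, 354, 757, 450, 370, 930, 275, 964, 310, 951, 425, 471, 437,
    486, 983, 886, 927, 773, 893, 836, 942, 851, 976, 952, 496, 907, 395, 427, 470, 482, 402, 438,
    313, 276, 357, 470, 482, 402, 438, 313, 276, 357, 886, 890, 983, 976, 496, 395, 452, 503, 421,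
    396, 451, 458, 958, 919, 968, 753, 912, 776, 878, 808, 953, 958, 968, 912, 878, 906, 953, 762,
    787, 798, 762, 845, 798, 935, 787, 830, 815, 819, 758, 898, 783, 865, 960, 950, 901, 820, 808,
    859, 967, 870, 901, 860, 913, 910, 970, 875, 957, 954, 876, 918, 905, 973, 876, 918, 875, 905,
    910, 954, 970, 875, 910, 970, 957, 954, 905, 834, 370, 354, 477, 276, 305, 318, 373, 433, 357,
    313, 438, 265, 335, 350, 367, 360, 345, 328, 298, 350, 335, 465, 367, 402, 345, 482, 470, 335,
    836, 350, 465, 402, 945, 427, 898, 470, 819, 865, 960, 482, 758, 950, 365, 783, 901, 268, 820,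
    349, 387, 808, 789, 444, 878, 495, 953, 413, 855, 893, 748, 886, 983, 976, 937, 890, 305, 373,
    357, 474, 443, 413, 388, 495, 313, 310, 357, 474],
  [443, 413, 388, 495, 310, 313, 275, 318, 354, 305, 477, 276, 357, 474, 443, 413, 388, 495, 313,
    354, 310, 318, 275, 905, 954, 970, 875, 910, 970, 875, 910, 928, 301, 367, 335, 345, 350, 788,
    787, 793, 830, 798, 970, 793, 875, 830, 910, 787, 825, 762, 905, 834, 954, 973, 918, 876, 875,
    496, 976, 890, 773, 748, 855, 310, 425, 893, 886, 983, 937, 836, 851, 952, 907, 914, 434, 400,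
    464, 486, 481, 361, 366, 276, 357, 313, 438, 427, 402, 465, 482, 350, 470, 265, 345, 335, 367,
    357, 313, 438, 427, 402, 465, 482, 350, 470, 265, 345, 335, 367, 395, 418, 452, 331, 264, 296,
    347, 271, 332, 451, 396, 458, 836, 886, 800, 983, 851, 945, 898, 418, 395, 452, 503, 461, 421,
    396, 275, 354, 293, 803, 848, 946, 747, 913, 934, 910, 867, 957, 477, 387, 413, 444, 495, 410,
    474, 488, 387, 443, 444, 477, 413, 495, 383, 803, 327, 748, 342, 855, 376, 804, 320, 290, 286,
    337, 357, 313, 474, 370, 410, 443, 354, 444, 477, 413, 495, 388, 803, 748, 855, 804, 837, 395,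
    418, 395, 418, 954, 875, 918, 830, 876, 787, 793],
  [913, 973, 788, 957, 345, 765, 910, 367, 845, 825, 762, 482, 365, 405, 433, 470, 433, 470, 451,
    395, 875, 918, 954, 837, 804, 855, 804, 855, 895, 982, 887, 314, 950, 901, 870, 935, 865, 898,
    945, 800, 836, 851, 952, 907, 265, 298, 328, 360, 350, 390, 465, 402, 428, 427, 307, 352, 372,
    491, 440, 408, 475, 447, 492, 371, 308, 317, 359, 277, 470, 901, 935, 433, 967, 318, 870, 354,
    305, 477, 276, 373, 444, 495, 413, 443, 474, 357, 388, 313, 773, 267, 310, 855, 425, 804, 747,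
    268, 297, 834, 346, 803, 362, 946, 302, 934, 349, 897, 466, 868, 480, 965, 435, 949, 469, 429,
    404, 487, 297, 387, 346, 410, 334, 362, 890, 485, 976, 428, 307, 352, 372, 491, 390, 440, 408,
    295, 475, 287, 447, 400, 492, 927, 486, 371, 942, 471, 317, 893, 407, 277, 430, 822, 481, 757,
    434, 861, 914, 817, 952, 780, 809, 470, 960, 433, 898, 428, 945, 307, 465, 870, 352, 372, 402,
    491, 438, 390, 440, 427, 408, 475, 447, 492, 371, 308, 317, 359, 277, 437, 430, 407, 471, 481,
    425, 486, 434, 400, 287, 295, 382, 323, 339, 444],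
  [324, 477, 443, 413, 474, 388, 307, 352, 428, 274, 433, 485, 397, 318, 470, 362, 438, 354, 427,
    477, 308, 444, 371, 495, 317, 413, 277, 443, 394, 474, 388, 267, 302, 349, 268, 329, 454, 501,
    420, 457, 418, 496, 418, 496, 396, 421, 298, 901, 328, 935, 360, 265, 836, 800, 945, 898, 865,
    960, 950, 396, 421, 298, 901, 328, 935, 360, 265, 836, 800, 945, 898, 865, 960, 950, 433, 470,
    433, 470, 762, 787, 825, 830, 788, 793, 787, 762, 830, 765, 788, 845, 793, 825, 898, 418, 945,
    800, 836, 851, 952, 907, 914, 265, 350, 335, 360, 367, 328, 345, 298, 350, 335, 360, 465, 367,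
    448, 328, 428, 345, 307, 298, 918, 905, 876, 954, 970, 910, 913, 875, 395, 910, 970, 452, 496,
    913, 954, 905, 834, 973, 848, 876, 803, 748, 855, 804, 747, 983, 503, 421, 396, 451, 458, 905,
    834, 954, 970, 910, 913, 848, 274, 308, 371, 352, 492, 314, 408, 437, 295, 430, 287, 407, 471,
    481, 486, 434, 400, 314, 372, 491, 440, 408, 295, 287, 323, 340, 382, 459, 455, 398, 499, 460,
    339, 324, 288, 377, 280, 308, 352, 371, 787, 830],
  [765, 793, 788, 845, 798, 825, 762, 794, 824, 841, 907, 959, 908, 824, 971, 952, 851, 800, 836,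
    817, 814, 754, 861, 858, 757, 809, 814, 754, 861, 858, 757, 809, 890, 976, 780, 809, 757, 822,
    861, 893, 814, 942, 927, 295, 408, 492, 447, 475, 390, 415, 288, 280, 340, 377, 287, 934, 359,
    277, 372, 491, 440, 476, 408, 415, 492, 447, 748, 834, 803, 773, 848, 855, 323, 324, 280, 340,
    377, 834, 803, 773, 848, 855, 747, 324, 837, 288, 895, 415, 447, 491, 492, 440, 408, 949, 804,
    747, 855, 837, 965, 868, 787, 762, 842, 830, 765, 845, 798, 428, 307, 277, 372, 485, 465, 350,
    265, 335, 360, 367, 328, 345, 298, 485, 465, 350, 265, 335, 360, 367, 328, 345, 298, 929, 965,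
    868, 277, 372, 491, 440, 476, 408, 415, 492, 447, 965, 897, 868, 946, 787, 867, 788, 765, 830,
    793, 842, 965, 897, 946, 867, 788, 765, 845, 825, 762, 787, 830, 842, 793, 757, 809, 822, 893,
    886, 983, 937, 890, 976, 408, 440, 890, 937, 976, 983, 800, 886, 851, 893, 942, 877, 959, 908,
    971, 797, 767, 760, 846, 785, 755, 855, 748, 773],
  [834, 803, 748, 773, 834, 803, 918, 875, 970, 954, 323, 444, 410, 474, 488, 443, 324, 287, 295,
    382, 295, 287, 340, 382, 324, 339, 377, 288, 280, 295, 444, 340, 382, 408, 492, 385, 440, 491,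
    415, 288, 339, 377, 324, 280, 287, 443, 413, 474, 388, 488, 495, 387, 477, 410, 375, 748, 834,
    803, 905, 848, 876, 770, 913, 354, 957, 275, 821, 812, 863, 310, 425, 400, 486, 437, 407, 471,
    748, 834, 803, 293, 773, 848, 327, 357, 770, 913, 342, 383, 310, 354, 876, 376, 756, 275, 905,
    863, 318, 396, 425, 373, 503, 400, 276, 486, 395, 361, 452, 332, 418, 451, 458, 496, 390, 447,
    475, 778, 856, 778, 856, 794, 824, 841, 907, 959, 952, 908, 971, 877, 959, 800, 836, 852, 982,
    851, 895, 750, 835, 855, 837, 773, 804, 803, 834, 770, 848, 747, 837, 773, 803, 834, 848, 747,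
    983, 886, 893, 803, 748, 834, 747, 804, 837, 804, 837, 770, 834, 848, 834, 848, 323, 444, 848,
    834, 748, 773, 837, 804, 287, 295, 382, 324, 443, 337, 320, 286, 290, 293, 413, 410, 495, 488,
    388, 474, 290, 659, 354, 704, 690, 368, 495, 413],
  [477, 704, 724, 690, 354, 387, 410, 488, 410, 488, 477, 413, 495, 290, 320, 413, 286, 495, 293,
    477, 410, 387, 488, 295, 287, 340, 382, 324, 339, 377, 288, 280, 295, 444, 340, 382, 408, 497,
    98, 578, 529, 566, 476, 385, 415, 440, 492, 491, 371, 372, 390, 971, 475, 908, 751, 839, 805,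
    774, 854, 352, 769, 307, 359, 314, 308, 274, 839, 805, 854, 914, 907, 952, 849, 956, 915, 872,
    904, 969, 955, 916, 415, 440, 288, 491, 377, 971, 280, 908, 824, 972, 794, 760, 824, 280, 841,
    377, 288, 415, 491, 372, 390, 314, 447, 437, 320, 407, 430, 305, 354, 477, 495, 231, 804, 290,
    837, 413, 910, 443, 875, 388, 970, 474, 954, 804, 837, 910, 957, 970, 913, 492, 371, 385, 440,
    327, 491, 415, 288, 339, 377, 324, 280, 443, 824, 908, 959, 877, 290, 320, 337, 383, 286, 293,
    281, 804, 342, 231, 837, 293, 376, 773, 711, 320, 337, 659, 354, 724, 477, 690, 387, 488, 474,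
    357, 660, 626, 723, 724, 690, 368, 495, 388, 474, 357, 660, 626, 723, 704, 723, 626, 690, 368,
    495, 477, 413, 893, 277, 822, 757, 779, 780, 809],
  [861, 858, 814, 754, 817, 372, 307, 352, 274, 314, 372, 394, 307, 457, 352, 274, 397, 420, 449,
    498, 419, 462, 320, 413, 337, 388, 383, 474, 293, 488, 410, 387, 907, 914, 952, 971, 491, 908,
    415, 824, 288, 280, 377, 768, 971, 908, 952, 907, 877, 959, 972, 852, 914, 745, 800, 865, 935,
    950, 807, 901, 960, 835, 967, 750, 945, 928, 935, 950, 807, 901, 960, 835, 750, 928, 762, 842,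
    787, 830, 787, 842, 798, 830, 825, 793, 765, 788, 845, 901, 935, 950, 967, 807, 945, 835, 898,
    750, 928, 935, 967, 945, 870, 898, 928, 440, 408, 492, 385, 798, 846, 785, 797, 767, 973, 876,
    905, 830, 765, 845, 825, 762, 898, 842, 793, 928, 750, 371, 308, 317, 760, 785, 794, 824, 841,
    767, 973, 876, 905, 918, 875, 970, 910, 913, 957, 760, 785, 797, 905, 834, 973, 876, 918, 875,
    762, 825, 845, 910, 765, 957, 788, 913, 793, 842, 867, 946, 803, 934, 962, 748, 848, 855, 929,
    747, 902, 804, 949, 946, 934, 962, 277, 317, 308, 371, 372, 359, 491, 308, 476, 427, 415, 482,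
    390, 433, 870, 470, 945, 345, 847, 967, 270, 935],
  [328, 367, 950, 764, 789, 795, 826, 840, 786, 763, 360, 265, 298, 307, 428, 433, 482, 427, 402,
    465, 438, 485, 787, 825, 830, 898, 842, 793, 928, 750, 371, 308, 317, 427, 434, 438, 425, 313,
    310, 973, 918, 875, 954, 970, 830, 876, 765, 973, 845, 957, 825, 762, 788, 898, 842, 793, 928,
    750, 960, 371, 835, 950, 308, 807, 935, 274, 317, 427, 295, 470, 345, 270, 328, 367, 455, 480,
    433, 913, 970, 875, 954, 918, 318, 428, 482, 307, 402, 277, 438, 372, 313, 491, 310, 476, 275,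
    415, 354, 288, 477, 444, 323, 382, 339, 460, 423, 448, 499, 405, 428, 307, 277, 314, 372, 352,
    359, 491, 476, 355, 415, 390, 475, 356, 802, 769, 744, 374, 832, 854, 311, 774, 849, 315, 805,
    751, 369, 272, 304, 769, 744, 854, 849, 774, 956, 832, 915, 435, 872, 769, 744, 374, 854, 311,
    839, 279, 751, 316, 369, 762, 787, 825, 830, 845, 765, 787, 762, 842, 830, 765, 845, 825, 898,
    928, 945, 960, 950, 935, 967, 870, 265, 350, 335, 448, 460, 393, 416, 459, 455, 398, 423, 499,
    350, 335, 448, 460, 393, 416, 459, 455, 398, 423],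
  [499, 390, 447, 491, 415, 476, 385, 491, 476, 408, 491, 372, 476, 385, 415, 390, 895, 870, 820,
    945, 967, 935, 950, 328, 270, 345, 835, 298, 367, 470, 807, 360, 427, 750, 482, 928, 402, 433,
    405, 428, 307, 465, 314, 350, 265, 335, 860, 815, 819, 758, 783, 885, 943, 925, 765, 830, 842,
    793, 308, 274, 371, 352, 270, 345, 298, 367, 470, 265, 360, 427, 335, 482, 350, 402, 433, 465,
    428, 455, 859, 808, 753, 960, 860, 898, 815, 928, 819, 750, 776, 835, 807, 295, 287, 339, 460,
    423, 448, 499, 877, 959, 908, 972, 971, 794, 797, 760, 785, 846, 877, 959, 908, 972, 971, 794,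
    907, 797, 767, 841, 824, 800, 852, 854, 839, 769, 744, 832, 849, 751, 774, 805, 914, 874, 768,
    745, 836, 849, 879, 911, 956, 915, 872, 974, 969, 955, 916, 904, 774, 911, 805, 832, 839, 948,
    802, 751, 769, 744, 904, 916, 955, 969, 974, 956, 915, 872, 872, 916, 915, 955, 974, 872, 915,
    956, 974, 969, 966, 931, 947, 864, 896, 932, 961, 947, 348, 467, 883, 978, 938, 926, 981, 884,
    921, 941, 894, 951, 900, 933, 869, 791, 899, 766],
  [964, 799, 843, 930, 944, 866, 963, 784, 754, 827, 844, 761, 931, 828, 903, 792, 871, 272, 304,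
    369, 399, 355, 356, 453, 316, 374, 279, 489, 311, 391, 424, 414, 484, 894, 363, 978, 921, 884,
    941, 981, 806, 926, 833, 938, 266, 858, 330, 344, 779, 299, 822, 814, 757, 817, 780, 369, 304,
    494, 355, 374, 489, 391, 414, 445, 304, 355, 369, 374, 356, 315, 311, 933, 869, 900, 791, 899,
    766, 843, 944, 963, 866, 780, 930, 964, 757, 861, 814, 817, 754, 779, 822, 858, 809, 900, 933,
    963, 754, 814, 779, 858, 757, 780, 809, 964, 869, 791, 899, 766, 944, 843, 780, 809, 264, 361,
    264, 361, 871, 903, 774, 751, 832, 839, 769, 805, 802, 948, 872, 792, 951, 933, 869, 791, 899,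
    843, 964, 932, 930, 871, 846, 947, 933, 869, 791, 843, 828, 932, 903, 871, 966, 931, 844, 761,
    784, 900, 933, 963, 828, 843, 932, 871, 903, 966, 931, 844, 784, 761, 827, 974, 766, 955, 969,
    904, 843, 903, 791, 944, 871, 869, 932, 964, 947, 961, 899, 930, 896, 866, 864, 784, 931, 827,
    966, 766, 969, 916, 956, 955, 813, 810, 759, 823]]

/-- Slots to branch on. -/
def greatIcosahedralBranching5 : List ℕ := List.flatten [
  [782, 857, 892, 887, 925, 895, 943, 860, 753, 776, 820, 808, 791, 903, 843, 932, 871, 966, 931,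
    844, 761, 784, 784, 761, 828, 844, 843, 903, 932, 931, 947, 961, 896, 864, 784, 761, 828, 844,
    791, 869, 933, 951, 933, 951, 915, 956, 974, 911, 832, 744, 769, 802, 914, 952, 851, 874, 750,
    836, 768, 745, 835, 982, 895, 887, 904, 916, 955, 969, 872, 915, 974, 879, 911, 956, 849, 774,
    832, 751, 839, 769, 744, 857, 759, 810, 782, 752, 813, 777, 862, 823, 782, 810, 759, 777, 752,
    823, 862, 813, 759, 782, 816, 900, 933, 951, 963, 813, 752, 810, 862, 777, 777, 862, 810, 823,
    964, 892, 899, 869, 925, 944, 791, 843, 932, 871, 414, 391, 445, 489, 494, 374, 355, 279, 311,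
    316, 315, 369, 272, 391, 445, 489, 494, 374, 355, 279, 311, 316, 315, 369, 272, 445, 391, 264,
    479, 361, 352, 314, 437, 486, 471, 407, 425, 430, 434, 464, 955, 916, 879, 974, 915, 872, 956,
    849, 774, 751, 805, 839, 768, 807, 835, 750, 768, 745, 852, 768, 836, 874, 851, 952, 750, 887,
    851, 895, 836, 982, 745, 768, 835, 852, 807, 887],
  [982, 895, 745, 836, 851, 750, 800, 807, 768, 852, 835, 908, 874, 952, 971, 959, 877, 907, 917,
    952, 972, 971, 816, 782, 857, 759, 810, 813, 752, 915, 911, 956, 900, 817, 814, 754, 861, 963,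
    866, 780, 809, 757, 858, 822, 779, 814, 861, 893, 927, 942, 976, 890, 920, 886, 408, 440, 491,
    415, 476, 440, 492, 327, 447, 773, 803, 837, 293, 855, 342, 804, 281, 290, 320, 286, 337, 383,
    748, 837, 855, 927, 983, 942, 976, 890, 920, 937, 886, 890, 976, 920, 937, 983, 893, 927, 942,
    881, 782, 857, 759, 810, 813, 752, 915, 911, 956, 874, 971, 917, 952, 877, 907, 768, 800, 852,
    851, 807, 750, 835, 768, 800, 852, 851, 807, 750, 836, 835, 865, 935, 950, 935, 950, 911, 816,
    782, 857, 759, 810, 916, 879, 955, 900, 901, 935, 950, 935, 950, 872, 904, 956, 969, 916, 759,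
    782, 813, 782, 813, 904, 916, 969, 915, 956, 763, 829, 796, 786, 847, 969, 840, 945, 916, 950,
    879, 935, 955, 967, 870, 759, 782, 857, 810, 752, 747, 837, 804, 770, 834, 848, 803, 837, 804,
    770, 855, 834, 848, 803, 748, 929, 949, 265, 360],
  [487, 469, 346, 267, 297, 334, 268, 365, 390, 415, 288, 324, 377, 934, 867, 902, 962, 946, 803,
    834, 848, 782, 813, 857, 810, 752, 777, 862, 823, 847, 789, 829, 796, 969, 916, 879, 904, 955,
    974, 795, 826, 840, 826, 764, 840, 904, 795, 969, 789, 916, 829, 955, 759, 782, 857, 810, 752,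
    747, 837, 804, 770, 834, 848, 803, 837, 804, 770, 855, 848, 803, 748, 929, 962, 867, 902, 934,
    867, 902, 962, 929, 946, 949, 868, 965, 897, 782, 813, 857, 810, 752, 777, 862, 823, 904, 744,
    769, 802, 854, 849, 955, 832, 774, 751, 805, 839, 874, 914, 907, 952, 914, 952, 907, 971, 972,
    908, 371, 492, 408, 475, 447, 415, 476, 491, 352, 492, 274, 385, 308, 314, 476, 317, 427, 307,
    355, 491, 428, 316, 372, 279, 277, 374, 392, 359, 472, 489, 414, 442, 892, 979, 882, 925, 922,
    445, 765, 762, 980, 830, 943, 842, 798, 793, 928, 825, 788, 898, 960, 950, 470, 935, 345, 405,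
    270, 282, 433, 328, 322, 482, 455, 402, 500, 285, 379, 380, 325, 343, 292, 979, 882, 925, 922,
    445, 765, 762, 980, 830, 943, 787, 885, 798, 405],
  [891, 825, 433, 936, 282, 482, 456, 322, 402, 285, 343, 380, 769, 802, 854, 849, 955, 974, 879,
    774, 751, 805, 839, 279, 355, 374, 316, 355, 304, 374, 369, 311, 315, 356, 272, 392, 839, 769,
    854, 769, 854, 908, 874, 971, 797, 917, 849, 959, 832, 907, 972, 794, 760, 785, 846, 972, 794,
    877, 959, 760, 785, 824, 907, 917, 846, 841, 797, 933, 767, 971, 963, 874, 866, 952, 822, 757,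
    809, 858, 779, 869, 964, 899, 930, 944, 897, 417, 934, 450, 965, 456, 868, 786, 796, 840, 829,
    929, 902, 867, 962, 946, 840, 377, 280, 288, 340, 415, 295, 476, 491, 408, 355, 390, 316, 374,
    447, 315, 492, 475, 356, 272, 369, 304, 280, 288, 340, 415, 295, 476, 491, 408, 355, 390, 316,
    374, 447, 315, 492, 475, 356, 272, 369, 304, 502, 453, 422, 399, 272, 879, 315, 955, 974, 440,
    408, 491, 372, 476, 355, 304, 316, 374, 369, 356, 751, 475, 774, 492, 832, 371, 352, 274, 479,
    308, 317, 277, 359, 472, 489, 414, 445, 391, 494, 264, 384, 361, 271, 332, 296, 347, 385, 476,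
    491, 355, 372, 304, 316, 314, 369, 356, 751, 475],
  [774, 492, 352, 371, 307, 317, 277, 359, 408, 476, 475, 385, 415, 492, 447, 757, 809, 780, 874,
    914, 907, 952, 914, 854, 952, 769, 907, 971, 371, 492, 408, 475, 447, 415, 476, 491, 492, 385,
    476, 355, 440, 491, 316, 374, 408, 372, 751, 369, 304, 272, 356, 475, 955, 974, 879, 774, 832,
    849, 802, 805, 849, 774, 802, 917, 352, 879, 877, 274, 955, 959, 308, 314, 974, 479, 317, 427,
    307, 277, 428, 359, 472, 489, 414, 442, 445, 325, 494, 369, 265, 390, 447, 475, 356, 315, 840,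
    786, 795, 796, 789, 829, 390, 870, 786, 928, 840, 950, 470, 405, 433, 482, 402, 285, 830, 765,
    842, 925, 762, 922, 891, 885, 943, 980, 907, 959, 877, 764, 789, 795, 829, 789, 796, 969, 916,
    879, 904, 955, 974, 795, 826, 840, 829, 796, 786, 847, 840, 945, 950, 898, 928, 960, 782, 857,
    759, 810, 813, 752, 956, 915, 872, 904, 969, 916, 915, 974, 879, 916, 904, 872, 969, 956, 767,
    797, 767, 797]]

/-- Slots to branch on. -/
def greatIcosahedralBranching6 : List ℕ := List.flatten [
  [896, 864, 948, 966, 931, 903, 815, 758, 783, 819, 776, 753, 808, 820, 859, 776, 753, 860, 820,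
    753, 808, 859, 758, 783, 758, 783, 924, 888, 819, 939, 860, 887, 895, 923, 880, 940, 977, 922,
    891, 936, 882, 936, 891, 979, 980, 892, 885, 943, 925, 409, 384, 442, 384, 442, 472, 384, 442,
    384, 442, 756, 870, 781, 967, 863, 812, 755, 821, 898, 928, 960, 778, 812, 863, 781, 811, 818,
    856, 755, 967, 901, 945, 753, 808, 960, 865, 950, 935, 808, 860, 960, 819, 928, 758, 783, 921,
    923, 927, 970, 954, 875, 918, 905, 830, 793, 842, 910, 954, 875, 975, 415, 475, 410, 444, 387,
    495, 477, 488, 957, 474, 910, 954, 825, 875, 918, 905, 973, 830, 842, 762, 787, 793, 798, 936,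
    943, 891, 885, 980, 925, 892, 322, 380, 291, 336, 412, 379, 441, 493, 500, 389, 473, 478, 953,
    958, 909, 968, 878, 912, 906, 873, 393, 416, 448, 282, 445, 379, 414, 336, 500, 391, 489, 442,
    325, 285, 380, 291, 412, 441, 493, 389, 473, 478, 953, 958, 909, 968, 878, 912, 906, 873, 393,
    416, 448, 380, 285, 291, 343, 336, 412, 456, 463],
  [441, 493, 389, 473, 478, 953, 958, 909, 878, 912, 906, 827, 844, 799, 942, 893, 413, 388, 267,
    362, 302, 417, 502, 392, 982, 450, 939, 497, 887, 977, 895, 940, 362, 302, 417, 502, 392, 982,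
    450, 939, 497, 887, 977, 895, 940, 444, 387, 477, 488, 957, 474, 913, 954, 876, 905, 918, 973,
    286, 293, 383, 827, 906, 953, 912, 878, 968, 909, 958, 953, 912, 878, 968, 873, 761, 784, 844,
    784, 844, 828, 909, 958, 747, 848, 770, 804, 837, 977, 895, 940, 848, 983, 770, 893, 804, 834,
    886, 942, 837, 855, 803, 888, 895, 748, 293, 880, 982, 976, 383, 800, 920, 327, 288, 768, 440,
    745, 408, 852, 385, 807, 492, 295, 447, 340, 320, 377, 337, 324, 290, 443, 413, 388, 495, 983,
    937, 792, 784, 843, 932, 803, 293, 848, 383, 834, 327, 748, 773, 886, 893, 920, 440, 408, 385,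
    492, 447, 320, 376, 342, 503, 281, 452, 290, 461, 413, 395, 443, 276, 488, 375, 474, 278, 357,
    353, 373, 478, 490, 773, 848, 886, 834, 893, 920, 748, 942, 976, 773, 837, 855, 748, 804, 977,
    940, 880, 895, 888, 887, 834, 271, 332, 347, 296],
  [423, 398, 460, 499, 393, 448, 347, 366, 481, 407, 430, 437, 464, 910, 471, 400, 957, 486, 913,
    425, 876, 905, 347, 366, 481, 407, 430, 437, 464, 910, 471, 400, 957, 486, 913, 425, 876, 905,
    293, 383, 390, 447, 390, 447, 390, 447, 390, 447, 909, 953, 878, 953, 878, 912, 906, 827, 799,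
    844, 881, 942, 893, 976, 983, 890, 937, 893, 942, 895, 887, 939, 982, 894, 941, 884, 889, 926,
    883, 938, 978, 812, 818, 811, 781, 856, 821, 863, 755, 967, 901, 945, 753, 808, 960, 865, 950,
    935, 808, 860, 960, 819, 928, 975, 283, 294, 338, 378, 294, 341, 378, 321, 847, 829, 763, 789,
    796, 865, 786, 950, 840, 941, 404, 884, 921, 981, 764, 926, 763, 796, 786, 826, 795, 840, 487,
    884, 921, 894, 321, 795, 764, 789, 826, 829, 796, 902, 763, 786, 840, 926, 929, 446, 962, 867,
    934, 897, 946, 842, 830, 787, 762, 868, 825, 949, 788, 910, 469, 765, 429, 793, 306, 936, 891,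
    411, 386, 473, 490, 953, 478, 353, 278, 375, 748, 855, 837, 773, 873, 919, 958, 909, 458, 451,
    496, 418, 301, 335, 367, 764, 789, 829, 865, 763],
  [935, 840, 950, 341, 418, 938, 284, 294, 978, 378, 805, 883, 338, 774, 289, 751, 414, 839, 849,
    854, 832, 744, 802, 947, 932, 871, 391, 264, 331, 348, 452, 303, 395, 271, 366, 496, 347, 451,
    332, 418, 301, 335, 367, 764, 789, 829, 865, 763, 935, 840, 950, 764, 789, 826, 829, 796, 763,
    786, 840, 294, 341, 294, 341, 894, 921, 764, 884, 981, 926, 763, 883, 796, 938, 786, 795, 826,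
    840, 796, 894, 829, 921, 763, 764, 786, 789, 826, 795, 840, 909, 953, 878, 953, 878, 912, 906,
    827, 799, 844, 865, 960, 928, 945, 967, 755, 812, 863, 781, 821, 945, 928, 967, 960, 865, 935,
    950, 901, 901, 967, 935, 950, 960, 865, 928, 898, 818, 811, 856, 778, 812, 863, 781, 821, 755,
    967, 870, 901, 811, 818, 781, 863, 812, 778, 755, 856, 821, 967, 894, 921, 978, 883, 926, 889,
    865, 935, 950, 901, 870, 919, 753, 808, 761, 844, 784, 827, 844, 784, 827, 799, 975, 909, 953,
    878, 828, 909, 838, 958, 801, 873, 850, 968, 764, 912, 789, 878, 909, 958, 873, 786, 763, 840,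
    975, 878, 789, 764, 795, 826, 958, 909, 828, 975],
  [763, 786, 796, 840, 873, 968, 764, 906, 826, 827, 795, 904, 844, 969, 761, 916, 974, 955, 935,
    901, 950, 753, 808, 758, 783, 819, 776, 753, 860, 808, 820, 859, 901, 761, 844, 784, 827, 844,
    784, 792, 827, 828, 799, 878, 953, 975, 909, 958, 975, 919, 953, 975, 909, 756, 983, 937, 863,
    886, 812, 778, 755, 821, 781, 870, 967, 945, 898, 928, 865, 960, 293, 286, 383, 337, 286, 383,
    821, 781, 811, 863, 812, 755, 778, 856, 890, 410, 881, 937, 886, 804, 290, 747, 837, 855, 910,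
    957, 913, 876, 973, 918, 905, 954, 474, 488, 387, 443, 444, 413, 495, 855, 483, 364, 747, 770,
    837, 773, 748, 803, 834, 848, 910, 406, 281, 290, 376, 320, 286, 401, 432, 424, 912, 467, 968,
    439, 906, 919, 873, 432, 912, 968, 906, 873, 919, 439, 431, 467, 468, 424, 401, 484, 401, 912,
    468, 906, 431, 439, 467, 331, 348, 264, 296, 347, 361, 332, 348, 264, 791, 296, 766, 347, 843,
    332, 932, 361, 871, 973, 957, 876, 905, 913, 848, 834, 748, 803, 773, 767, 918, 790, 875, 957,
    876, 913, 269, 838, 850, 771, 801, 954, 970, 875],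
  [772, 853, 806, 833, 746, 838, 771, 850, 746, 833, 853, 749, 772, 801, 957, 913, 876, 973, 918,
    905, 954, 474, 488, 968, 912, 850, 771, 838, 406, 431, 439, 468, 432, 319, 273, 358, 309, 368,
    278, 312, 406, 431, 468, 432, 319, 273, 358, 309, 368, 375, 747, 748, 837, 773, 770, 855, 747,
    773, 848, 803, 834, 748, 881, 927, 942, 893, 937, 886, 920, 893, 976, 942, 812, 863, 781, 937,
    811, 870, 928, 898, 945, 967, 755, 778, 856, 942, 893, 886, 920, 976, 332, 451, 496, 418, 458,
    296, 347, 423, 271, 398, 303, 499, 448, 416, 460, 393, 960, 898, 950, 865, 778, 935, 856, 967,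
    755, 781, 863, 811, 870, 812, 818, 755, 778, 967, 945, 898, 928, 865, 960, 286, 383, 286, 383,
    893, 937, 886, 818, 811, 856, 778, 812, 863, 781, 937, 886, 893, 983, 942, 881, 927, 811, 818,
    781, 863, 812, 778, 755, 856, 821, 894, 921, 978, 883, 926, 889, 838, 801, 850, 912, 968, 906,
    833, 746, 771, 806, 912, 968, 906, 958, 873, 828, 909, 766, 827, 843, 844, 791, 799, 879, 974,
    911, 955, 904, 969, 872, 956, 915, 904, 916, 969],
  [915, 911, 974, 911, 974, 956, 872, 969, 849, 774, 805, 832, 751, 802, 839, 947, 854, 932, 955,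
    843, 916, 791, 792, 969, 799, 872, 844, 784, 769, 802, 744, 832, 854, 774, 805, 802, 744, 832,
    854, 839, 955, 916, 974, 969, 911, 872, 857, 347, 296, 784, 264, 792, 361, 843, 332, 348, 791,
    331, 799, 755, 856, 811, 818, 942, 778, 927, 812, 881, 863, 781, 812, 778, 863, 818, 856, 756,
    811, 856, 811, 818, 756, 778, 863, 812, 271, 784, 303, 384, 844, 366, 494, 799, 331, 791, 264,
    843, 932, 947, 871, 391, 445, 414, 472, 442, 489, 296, 423, 494, 384, 409, 442, 479, 472, 445,
    322, 380, 499, 398, 878, 953, 975, 799, 844, 784, 792, 843, 932, 871, 391, 414, 489, 374, 311,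
    279, 355, 304, 369, 272, 356, 315, 285, 380, 291, 343, 499, 398, 460, 273, 878, 953, 975, 799,
    844, 784, 792, 843, 278, 312, 306, 353, 393, 448, 416, 500, 379, 292, 336, 282, 322, 325, 379,
    455, 328, 472, 384, 442, 384, 442, 414, 445, 391, 925, 871, 885, 932, 943, 843, 892, 792, 979,
    784, 805, 844, 774, 799, 751, 369, 304, 272, 431],
  [356, 468, 475, 483, 432, 401, 265, 836, 893, 942, 881, 927, 298, 390, 345, 447, 270, 927, 835,
    881, 890, 942, 976, 298, 335, 345, 367, 270, 301, 445, 391, 264, 489, 442, 384, 271, 332, 366,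
    361, 331, 348, 303, 398, 500, 459, 325, 380, 379, 291, 322, 336, 282, 264, 332, 361, 759, 782,
    813, 759, 782, 813, 816, 823, 752, 810, 891, 862, 885, 777, 980, 922, 882, 936, 892, 979, 866,
    963, 944, 899, 930, 964, 784, 963, 792, 844, 900, 944, 843, 951, 899, 791, 869, 784, 900, 844,
    963, 799, 791, 843, 944, 899, 930, 398, 423, 296, 264, 348, 361, 499, 380, 343, 456, 450, 497,
    382, 339, 287, 295, 340, 459, 455, 500, 878, 953, 975, 751, 774, 839, 805, 805, 839, 774, 854,
    891, 332, 451, 348, 303, 271, 366, 331, 347, 481, 459, 416, 500, 379, 455, 325, 398, 292, 878,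
    282, 343, 953, 322, 336, 975, 799, 827, 844, 784, 792, 872, 843, 969, 932, 916, 871, 955, 947,
    974, 467, 911, 272, 369, 494, 384, 445, 409, 479, 304, 369, 431, 356, 468, 311, 483, 424, 432,
    484, 401, 816, 752, 782, 777, 759, 813, 823, 862],
  [416, 500, 393, 455, 278, 398, 273, 878, 953, 975, 799, 827, 844, 784, 792, 843, 312, 306, 353,
    340, 270, 328, 345, 298, 367, 421, 301, 396, 458, 503, 418, 496, 452, 395, 328, 835, 345, 852,
    298, 367, 807, 812, 301, 295, 750, 323, 280, 407, 430, 910, 957, 395, 496, 418, 458, 898, 396,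
    825, 928, 876, 960, 973, 865, 950, 798, 935, 845, 418, 452, 418, 452, 835, 395, 496, 458, 418,
    301, 898, 811, 818, 756, 781, 960, 870, 928, 452, 418, 461, 458, 421, 396, 496, 503, 494, 384,
    974, 409, 955, 294, 442, 479, 916, 341, 472, 969, 321, 872, 284, 378, 381, 338, 326, 289, 414,
    489, 391, 871, 947, 932, 843, 791, 792, 799, 784, 844, 384, 409, 294, 442, 479, 341, 472, 445,
    321, 322, 284, 378, 380, 381, 283, 338, 291, 326, 336, 289, 379, 414, 391, 489, 969, 916, 520,
    403, 563, 436, 622, 426, 535, 480, 527, 435, 404, 617, 580, 664, 676, 715, 617, 580, 664, 676,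
    715, 369, 974, 911, 955, 916, 969, 872, 807, 852, 983, 768, 893, 745, 836, 775, 851, 800, 976,
    890, 942, 881, 927, 750, 852, 775, 836, 745, 893],
  [768, 800, 272, 304, 356, 431, 468, 483, 406, 432, 439, 467, 401, 484, 424, 311, 799, 942, 881,
    927, 304, 816, 316, 792, 752, 435, 843, 791, 932, 799, 871, 844, 947, 784, 963, 866, 900, 866,
    900, 813, 862, 777, 810, 823, 759, 899, 377, 782, 280, 857, 288, 824, 324, 339, 790, 287, 875,
    910, 973, 876, 957, 913, 970, 760, 785, 846, 794, 831, 907, 877, 914, 972, 767, 918, 841, 954,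
    933, 970, 900, 760, 831, 846, 957, 876, 905, 913, 918, 954, 811, 970, 760, 846, 785, 794, 831,
    797, 907, 308, 317, 793, 434, 425, 400, 486, 361, 264, 391, 445, 414, 925, 894, 765, 788, 825,
    845, 798, 762, 842, 922, 882, 772, 833, 853, 275, 821, 781, 812, 863, 821, 755, 856, 778, 338,
    326, 283, 404, 466, 946, 867, 962, 359, 317, 372, 277, 434, 307, 425, 352, 400, 486, 361, 264,
    391, 445, 479, 317, 434, 425, 464, 914, 310, 351, 430, 754, 874, 275, 333, 305, 908, 952, 300,
    318, 971, 809, 354, 433, 917, 370, 757, 313, 780, 438, 817, 427, 902, 402, 482, 470, 962, 867,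
    788, 345, 298, 328, 750, 983, 775, 927, 836, 851],
  [800, 976, 881, 890, 452, 418, 461, 458, 421, 396, 503, 361, 791, 264, 799, 331, 832, 827, 844,
    744, 784, 802, 792, 872, 843, 969, 932, 916, 871, 955, 391, 947, 974, 409, 384, 442, 494, 325,
    489, 369, 445, 414, 289, 894, 782, 759, 813, 857, 925, 885, 892, 943, 823, 979, 980, 862, 899,
    777, 272, 356, 311, 279, 315, 374, 304, 816, 316, 435, 831, 767, 846, 841, 785, 794, 760, 824,
    767, 900, 790, 866, 797, 824, 944, 846, 930, 785, 746, 760, 771, 366, 850, 876, 481, 269, 333,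
    351, 464, 430, 910, 875, 957, 970, 913, 333, 351, 464, 430, 910, 875, 957, 970, 913, 838, 749,
    801, 292, 772, 343, 875, 285, 970, 830, 954, 905, 846, 785, 797, 790, 767, 824, 841, 924, 760,
    794, 887, 939, 888, 982, 923, 880, 977, 905, 973, 876, 918, 396, 875, 458, 954, 970, 496, 811,
    913, 856, 270, 328, 345, 367, 480, 466, 404, 426, 403, 284, 341, 381, 781, 756, 863, 812, 821,
    755, 778, 338, 283, 326, 301, 328, 835, 418, 345, 852, 898, 298, 807, 812, 750, 778, 928, 865,
    960, 301, 418, 452, 395, 503, 461, 421, 834, 973],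
  [803, 876, 918, 848, 875, 913, 910, 957, 830, 765, 793, 970, 875, 910, 813, 816, 759, 823, 857,
    892, 925, 759, 813, 816, 857, 752, 925, 862, 892, 823, 384, 494, 442, 445, 489, 414, 472, 479,
    445, 494, 361, 264, 296, 271, 296, 347, 271, 347, 296, 366, 361, 856, 811, 818, 756, 863, 812,
    755, 778, 331, 348, 791, 843, 932, 947, 871, 767, 841, 790, 824, 760, 794, 846, 785, 831, 790,
    841, 797, 831, 846, 760, 785, 794, 811, 818, 778, 812, 863, 756, 781, 872, 969, 791, 974, 799,
    911, 955, 827, 844, 904, 784, 916, 969, 792, 872, 956, 843, 915, 932, 963, 866, 900, 944, 951,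
    899, 869, 866, 900, 944, 951, 899, 869, 869, 951, 964, 810, 899, 925, 885, 943, 892, 980, 979,
    891, 805, 751, 774, 849, 802, 769, 832, 744, 839, 769, 854, 857, 759, 823, 777, 813, 862, 885,
    943, 892, 823, 777, 813, 862, 899, 933, 951, 964, 810, 752, 777, 823, 813, 862, 791, 827, 843,
    799, 792, 932, 844, 784, 947, 871, 933, 869, 951, 869, 951, 841, 930, 846, 760, 794, 824, 790,
    767, 797, 794, 824, 790, 767, 797, 899, 944, 866],
  [963, 944, 899, 869, 964, 903, 947, 871, 931, 932, 827, 753, 776, 808, 820, 783, 758, 815, 819,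
    860, 953, 873, 919, 975, 909, 828, 878, 958, 843, 792, 968, 906, 912, 758, 815, 819, 860, 776,
    906, 968, 912, 958, 792, 843, 766, 828, 791, 909, 975, 878, 747, 770, 848, 770, 848, 834, 770,
    848, 770, 848, 983, 951, 869, 899, 933, 964, 944, 930, 963, 866, 900, 869, 933, 964, 841, 866,
    930, 944, 899, 784, 844, 761, 927, 893, 886, 942, 773, 881, 748, 837, 770, 855, 804, 784, 900,
    761, 927, 785, 794, 846, 760, 831, 767, 797, 790, 846, 930, 899, 944, 425, 471, 486, 310, 437,
    471, 486, 314, 817, 861, 814, 779, 754, 858, 920, 890, 937, 274, 861, 352, 757, 814, 307, 371,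
    779, 372, 317, 822, 359, 277, 780, 861, 886, 893, 856, 942, 781, 821, 881, 812, 976, 863, 890,
    937, 811, 756, 818, 811, 881, 756, 770, 890, 976, 818, 848, 937, 920, 778, 755, 299, 344, 814,
    330, 779, 266, 453, 858, 363, 809, 484, 300, 333, 351, 450, 464, 430, 434, 481, 400, 407, 287,
    471, 486, 361, 348, 467, 424, 904, 835, 807, 295],
  [323, 382, 340, 339, 497, 456, 392, 417, 463, 502, 377, 288, 280, 824, 794, 305, 760, 276, 366,
    303, 271, 331, 332, 452, 451, 395, 496, 344, 330, 266, 833, 746, 806, 850, 771, 420, 457, 501,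
    397, 462, 337, 286, 320, 290, 376, 342, 281, 293, 327, 383, 778, 755, 821, 275, 370, 313, 354,
    746, 357, 850, 771, 838, 749, 373, 305, 430, 794, 481, 824, 760, 366, 331, 347, 303, 271, 778,
    818, 755, 812, 821, 863, 756, 781, 811, 920, 937, 890, 471, 486, 471, 486, 794, 760, 824, 846,
    899, 930, 844, 761, 927, 893, 886, 942, 773, 881, 748, 837, 770, 855, 804, 937, 920, 886, 890,
    893, 927, 881, 942, 976, 784, 761, 844, 906, 968, 958, 909, 828, 792, 843, 906, 912, 758, 878,
    968, 975, 873, 919, 958, 815, 909, 783, 828, 820, 859, 792, 901, 808, 843, 766, 791, 865, 950,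
    960, 950, 960, 755, 821, 812, 778, 863, 856, 781, 818, 811, 756, 778, 812, 967, 870, 935, 945,
    950, 960, 763, 840, 786, 826, 795, 789, 829, 796, 273, 306, 312, 368, 306, 368, 312, 353, 478,
    778, 812, 856, 978, 938, 926, 863, 821, 781, 284],
  [341, 321, 446, 473, 386, 493, 490, 389, 441, 412, 341, 321, 446, 473, 386, 493, 490, 389, 441,
    412, 921, 441, 894, 490, 883, 411, 926, 446, 473, 412, 493, 389, 894, 921, 938, 441, 941, 389,
    490, 884, 869, 779, 899, 858, 944, 754, 920, 814, 861, 276, 373, 357, 773, 886, 893, 927, 761,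
    844, 784, 951, 866, 933, 900, 963, 373, 357, 773, 886, 893, 927, 761, 844, 784, 951, 866, 933,
    900, 963, 818, 756, 781, 863, 821, 812, 818, 821, 756, 781, 863, 786, 840, 796, 829, 847, 789,
    764, 795, 906, 912, 758, 878, 968, 909, 958, 815, 819, 860, 776, 844, 799, 766, 843, 828, 761,
    792, 784, 903, 947, 871, 932]]

/-- Slots to branch on. -/
def greatIcosahedralBranching7 : List ℕ := List.flatten [
  [914, 874, 972, 952, 907, 971, 908, 800, 775, 877, 959, 852, 917, 745, 836, 851, 950, 901, 935,
    865, 967, 945, 870, 898, 928, 960, 935, 865, 901, 798, 928, 870, 945, 967, 898, 825, 762, 845,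
    842, 765, 787, 830, 750, 960, 835, 904, 956, 911, 476, 385, 491, 492, 415, 447, 390, 475, 355,
    491, 372, 415, 440, 826, 847, 764, 789, 945, 795, 967, 840, 870, 786, 316, 279, 374, 475, 356,
    315, 840, 786, 796, 870, 829, 967, 789, 902, 945, 795, 929, 764, 962, 809, 867, 757, 934, 822,
    897, 277, 946, 307, 428, 465, 485, 405, 438, 470, 402, 285, 830, 765, 787, 788, 762, 825, 830,
    765, 845, 788, 345, 367, 480, 435, 466, 408, 447, 492, 390, 371, 385, 870, 786, 796, 763, 762,
    825, 842, 845, 765, 788, 793, 308, 427, 470, 345, 270, 328, 360, 265, 298, 787, 830, 765, 842,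
    793, 308, 274, 317, 314, 277, 307, 359, 352, 472, 479, 489, 414, 442, 445, 922, 925, 891, 885,
    943, 980, 408, 492, 385, 764, 829, 945, 789, 796, 870, 795, 969, 390, 967, 840, 916, 447, 786,
    879, 475, 763, 974, 356, 315, 272, 436, 369, 487],
  [494, 360, 479, 265, 350, 465, 787, 428, 830, 307, 842, 314, 352, 793, 371, 274, 308, 840, 795,
    789, 764, 829, 847, 911, 969, 872, 916, 915, 879, 974, 955, 872, 915, 762, 787, 825, 830, 845,
    765, 787, 762, 842, 830, 765, 845, 825, 898, 928, 960, 807, 901, 835, 935, 750, 967, 945, 928,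
    898, 960, 865, 851, 750, 835, 807, 852, 851, 750, 836, 835, 745, 852, 904, 807, 916, 969, 872,
    915, 911, 956, 960, 928, 950, 865, 935, 898, 901, 476, 385, 491, 492, 415, 447, 390, 475, 355,
    491, 372, 440, 786, 796, 840, 870, 763, 829, 826, 390, 967, 789, 847, 902, 265, 945, 795, 316,
    929, 764, 974, 279, 962, 955, 374, 809, 867, 854, 934, 897, 822, 277, 307, 359, 428, 472, 465,
    489, 350, 485, 442, 360, 405, 438, 325, 470, 402, 285, 830, 842, 793, 788, 345, 328, 367, 270,
    301, 826, 840, 795, 789, 764, 829, 847, 796, 840, 829, 847, 316, 279, 374, 392, 315, 475, 356,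
    272, 369, 304, 408, 955, 492, 974, 371, 879, 274, 352, 774, 849, 751, 917, 369, 877, 494, 959,
    479, 308, 314, 317, 427, 307, 277, 470, 428, 359],
  [405, 472, 433, 489, 482, 442, 402, 962, 752, 810, 777, 862, 922, 762, 891, 825, 936, 282, 456,
    343, 325, 285, 379, 380, 336, 322, 291, 408, 492, 385, 950, 865, 935, 898, 967, 945, 928, 945,
    967, 870, 935, 901, 745, 836, 852, 851, 893, 835, 959, 877, 775, 750, 807, 983, 927, 942, 976,
    890, 920, 937, 886, 972, 971, 807, 852, 745, 835, 750, 775, 851, 877, 952, 907, 775, 836, 851,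
    800, 842, 851, 750, 800, 952, 775, 835, 977, 745, 874, 907, 836, 877, 893, 917, 959, 908, 861,
    757, 927, 780, 809, 983, 817, 822, 886, 902, 825, 788, 765, 793, 867, 830, 962, 787, 946, 897,
    934, 868, 965, 762, 787, 798, 845, 949, 868, 897, 929, 965, 962, 934, 867, 762, 788, 787, 798,
    845, 935, 967, 945, 870, 901, 928, 950, 898, 865, 960, 887, 982, 895, 940, 880, 923, 982, 895,
    939, 940, 794, 880, 923, 760, 785, 831, 797, 846, 924, 888, 819, 880, 939, 815, 940, 982, 758,
    860, 895, 820, 783, 859, 808, 776, 492, 371, 274, 308, 352, 793, 307, 936, 882, 922, 891, 839,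
    854, 805, 774, 751, 849, 438, 402, 427, 465, 470],
  [428, 482, 433, 465, 350, 402, 335, 265, 360, 328, 345, 470, 482, 962, 867, 782, 857, 759, 813,
    956, 911, 969, 879, 916, 974, 955, 427, 402, 482, 470, 345, 328, 270, 367, 335, 350, 265, 360,
    298, 385, 408, 440, 475, 476, 390, 415, 491, 385, 408, 440, 920, 890, 976, 881, 942, 927, 942,
    983, 976, 890, 920, 937, 886, 757, 780, 809, 817, 754, 890, 858, 920, 886, 937, 983, 960, 950,
    865, 898, 935, 928, 745, 901, 800, 836, 852, 775, 750, 877, 835, 907, 904, 952, 916, 874, 969,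
    872, 915, 911, 956, 826, 744, 769, 854, 769, 854, 763, 786, 796, 839, 769, 854, 769, 854, 847,
    796, 829, 279, 355, 374, 316, 355, 304, 374, 369, 311, 315, 356, 272, 392, 816, 752, 810, 777,
    857, 964, 862, 880, 759, 782, 888, 823, 887, 939, 899, 794, 982, 930, 923, 940, 797, 846, 760,
    785, 824, 831, 790, 767, 841, 841, 794, 824, 760, 908, 785, 917, 831, 849, 900, 751, 832, 933,
    774, 802, 963, 805, 879, 980, 754, 866, 854, 974, 749, 769, 780, 817, 861, 757, 964, 869, 930,
    899, 944, 883, 978, 938, 858, 926, 809, 822, 757],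
  [779, 897, 964, 884, 417, 934, 951, 889, 450, 965, 869, 981, 868, 899, 806, 944, 853, 833, 772,
    801, 838, 329, 454, 394, 277, 419, 457, 359, 300, 342, 372, 333, 351, 269, 363, 364, 484, 483,
    761, 424, 431, 467, 406, 281, 327, 828, 792, 304, 369, 316, 355, 476, 440, 491, 302, 349, 789,
    795, 840, 786, 929, 796, 902, 829, 302, 349, 789, 795, 840, 786, 929, 796, 902, 829, 924, 887,
    888, 939, 887, 977, 782, 939, 759, 794, 857, 940, 797, 767, 790, 831, 824, 785, 760, 846, 767,
    977, 831, 900, 933, 963, 866, 862, 752, 777, 810, 823, 880, 759, 940, 857, 813, 759, 782, 857,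
    940, 880, 888, 923, 939, 794, 760, 785, 752, 813, 777, 962, 810, 880, 955, 940, 879, 974, 757,
    780, 809, 964, 822, 951, 897, 869, 417, 934, 779, 302, 867, 965, 902, 817, 829, 949, 861, 796,
    814, 786, 754, 840, 858, 795, 789, 938, 349, 883, 329, 362, 346, 469, 403, 436, 480, 315, 426,
    272, 374, 466, 311, 435, 356, 316, 369, 917, 849, 751, 774, 832, 805, 802, 854, 980, 922, 891,
    936, 456, 882, 979, 343, 892, 325, 925, 943, 285],
  [857, 380, 759, 782, 887, 895, 820, 982, 753, 923, 860, 809, 780, 822, 897, 417, 934, 302, 867,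
    902, 817, 829, 796, 786, 840, 795, 789, 349, 329, 454, 394, 277, 457, 420, 397, 274, 314, 371,
    372, 317, 359, 308, 794, 824, 760, 908, 785, 917, 831, 849, 846, 832, 802, 947, 896, 864, 948,
    961, 752, 810, 962, 777, 857, 862, 782, 867, 887, 902, 939, 794, 888, 982, 502, 895, 417, 940,
    450, 463, 797, 280, 824, 790, 767, 841, 377, 288, 340, 415, 459, 476, 455, 355, 491, 500, 374,
    390, 440, 416, 447, 408, 448, 492, 460, 475, 339, 382, 497, 422, 399, 272, 315, 356, 824, 760,
    846, 785, 831, 796, 829, 786, 796, 840, 795, 789, 764, 829, 847, 950, 865, 898, 935, 967, 945,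
    800, 745, 836, 928, 750, 775, 835, 977, 836, 877, 745, 800, 893, 907, 917, 959, 852, 908, 874,
    952, 887, 982, 895, 940, 880, 923, 982, 895, 939, 940, 794, 880, 923, 760, 785, 831, 797, 846,
    924, 888, 880, 939, 940, 982, 797, 895, 923, 813, 862, 777, 823, 782, 857, 759, 767, 790, 841,
    935, 950, 967, 901, 945, 870, 967, 808, 820, 753],
  [776, 819, 815, 758, 783, 859, 769, 839, 854, 839, 854, 752, 810, 862, 962, 777, 816, 823, 899,
    872, 904, 915, 956, 911, 969, 974, 786, 796, 763, 829, 826, 870, 795, 901, 945, 840, 898, 865,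
    950, 762, 787, 825, 798, 788, 845, 910, 867, 902, 818, 756, 781, 811, 856, 942, 881, 890, 927,
    976, 983, 920, 886, 778, 755, 886, 983, 937, 890, 920, 976, 881, 781, 756, 821, 863, 812, 756,
    778, 896, 781, 811, 863, 856, 757, 809, 780, 817, 861, 814, 754, 858, 938, 883, 978, 921, 894,
    941, 809, 964, 780, 822, 869, 817, 951, 761, 784, 844, 792, 827, 766, 799, 843, 791, 828, 784,
    792, 844, 839, 854, 891, 805, 265, 350, 301, 360, 270, 328, 298, 345, 350, 335, 360, 753, 776,
    820, 819, 864, 948, 961, 758, 783, 815, 820, 860, 859, 815, 819, 758, 776, 814, 754, 779, 858,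
    861, 894, 883, 921, 978, 314, 491, 372, 277, 307, 316, 279, 355, 304, 374, 369, 315, 356, 321,
    381, 284, 341, 322, 282, 336, 688, 720, 658, 352, 625, 705, 774, 710, 294, 751, 849, 802, 289,
    338, 283, 326, 720, 658, 352, 625, 705, 774, 630],
  [832, 271, 264, 331, 303, 348, 369, 272, 304, 332, 496, 383, 396, 451, 421, 458, 298, 345, 328,
    270, 301, 418, 395, 452, 461, 503, 685, 367, 739, 301, 345, 652, 298, 703, 645, 284, 341, 294,
    458, 418, 451, 395, 421, 503, 461, 338, 283, 326, 367, 270, 301, 284, 341, 634, 668, 731, 677,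
    363, 333, 344, 300, 266, 300, 344, 266, 883, 978, 744, 921, 832, 931, 941, 802, 451, 966, 289,
    947, 326, 871, 338, 932, 461, 395, 503, 452, 421, 983, 331, 298, 264, 345, 348, 328, 303, 467,
    859, 271, 815, 484, 347, 758, 424, 439, 431, 468, 401, 432, 881, 912, 953, 975, 878, 770, 747,
    804, 837, 938, 978, 366, 280, 288, 407, 824, 339, 760, 324, 794, 846, 970, 287, 443, 785, 875,
    382, 831, 954, 275, 318, 305, 354, 310, 821, 755, 812, 670, 673, 636, 717, 730, 300, 351, 333,
    269, 299, 714, 635, 665, 678, 337, 286, 320, 293, 827, 290, 327, 803, 766, 804, 799, 843, 837,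
    791, 747, 828, 770, 848, 909, 834, 686, 649, 741, 313, 276, 357, 370, 373, 354, 318, 649, 741,
    313, 276, 357, 370, 373, 354, 318, 362, 267, 302],
  [388, 329, 474, 488, 609, 853, 806, 957, 913, 876, 771, 746, 850, 326, 833, 772, 906, 749, 801,
    850, 912, 968, 873, 958, 773, 357, 855, 373, 748, 375, 353, 478, 441, 490, 772, 806, 833, 278,
    312, 375, 353, 309, 819, 758, 815, 961, 783, 820, 878, 953, 266, 344, 330, 885, 943, 680, 650,
    736, 361, 264, 296, 347, 483, 364, 269, 333, 351, 300, 299, 838, 749, 801, 282, 292, 336, 343,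
    291, 325, 285, 336, 379, 499, 448, 460, 448, 460, 380, 285, 291, 830, 765, 793, 501, 454, 394,
    457, 378, 283, 326, 338, 289, 294, 829, 763, 796, 313, 276, 357, 373, 319, 375, 628, 639, 671,
    734, 159, 636, 673, 717, 683, 693, 723, 626, 660, 393, 448, 460, 402, 502, 621, 581, 534, 668,
    54, 731, 906, 968, 764, 789, 349, 847, 268, 365, 138, 618, 678, 665, 733, 255, 618, 460, 448,
    587, 655, 742, 647, 433, 318, 428, 305, 465, 354, 604, 124, 260, 541, 607, 471, 575, 437, 95,
    590, 649, 741, 127, 257, 944, 930, 866, 900, 161, 43, 523, 566, 529, 444, 323, 295, 118, 598,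
    559, 657, 615, 706, 549, 722, 518, 627, 593, 662],
  [598, 549, 615, 135, 241, 721, 624, 656, 708, 356, 707, 315, 726, 311, 631, 663, 692, 691, 547,
    517, 592, 611, 557, 599, 548, 612, 701, 554, 308, 426, 359, 466, 661, 435, 630, 429, 727, 306,
    705, 353, 658, 478, 352, 389, 774, 441, 751, 412, 981, 473, 889, 386, 926, 446, 432, 517, 592,
    424, 468, 611, 431, 557, 548, 439, 406, 467, 67, 612, 919, 958, 132, 873, 244, 773, 855, 944,
    866, 930, 61, 746, 453, 590, 463, 649, 417, 623, 741, 572, 577, 536, 526, 601, 533, 560, 466,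
    445, 567, 530, 435, 494, 925, 412, 892, 979, 746, 771, 358, 473, 446, 411, 292, 343, 325, 442,
    409, 479, 352, 774, 879, 955, 916, 70, 550, 515, 597, 553, 610, 594, 659, 629, 724, 244, 711,
    855, 660, 748, 357, 773, 590, 649, 698, 741, 738, 643, 681, 654, 701, 405, 428, 526, 559, 577,
    598, 560, 549, 721, 615, 241, 135, 405, 482, 470, 427, 438, 465, 604, 539, 509, 714, 591, 665,
    733, 717, 540, 603, 584, 480, 435, 466, 572, 417, 511, 601, 463, 606, 466, 536, 453, 426, 504,
    571, 422, 297, 346, 469, 403, 436, 485, 438, 465],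
  [873, 912, 37, 773, 919, 432, 517, 855, 958, 547, 244, 132, 612, 691, 624, 726, 708, 663, 524,
    673, 529, 645, 717, 49, 733, 207, 665, 109, 714, 730, 334, 346, 365, 651, 349, 740, 703, 652,
    589, 486, 437, 471, 459, 581, 398, 500, 668, 455, 416, 719, 731, 328, 303, 298, 348, 712, 331,
    732, 637, 667, 453, 463, 438, 465, 655, 742, 725, 657, 358, 706, 771, 627, 746, 876, 722, 850,
    957, 242, 129, 273, 358, 368, 420, 454, 457, 325, 343, 292, 468, 432, 319, 273, 358, 368, 468,
    432, 319, 273, 358, 368, 331, 348, 303, 650, 736, 980, 749, 922, 943, 838, 933, 936, 801, 453,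
    463, 336, 502, 282, 292, 325, 343, 456, 392, 450, 333, 269, 300, 351, 300, 344, 351, 299, 333,
    269, 975, 763, 919, 953, 829, 926, 958, 912, 796, 446, 850, 473, 746, 493, 771, 358, 273, 306,
    312, 353, 478, 389, 441, 326, 283, 289, 338, 815, 859, 783, 820, 309, 312, 353, 819, 306, 375,
    815, 796, 319, 758, 763, 273, 926, 358, 446, 771, 473, 850, 386, 912, 968, 906, 958, 873, 478,
    773, 490, 357, 276, 373, 673, 717, 730, 300, 334],
  [351, 297, 333, 364, 346, 269, 330, 267, 362, 299, 302, 388, 837, 344, 714, 474, 266, 488, 286,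
    293, 320, 337, 410, 290, 387, 413, 804, 444, 477, 747, 323, 495, 770, 848, 975, 834, 803, 878,
    748, 953, 855, 293, 827, 327, 803, 766, 799, 843, 791, 828, 909, 838, 853, 806, 771, 746, 850,
    749, 833, 772, 749, 772, 806, 801, 980, 833, 885, 943, 283, 326, 338, 289, 378, 678, 665, 733,
    636, 294, 829, 763, 796, 975, 878, 953, 758, 815, 961, 783, 819, 864, 820, 948, 747, 770, 848,
    834, 804, 848, 770, 666, 336, 282, 291, 292, 343, 285, 325, 713, 728, 735, 718, 679, 669, 336,
    728, 282, 248, 379, 453, 463, 502, 623, 618, 138, 460, 184, 255, 448, 393, 499, 278, 380, 309,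
    604, 570, 683, 418, 395, 452, 331, 303, 348, 264, 296, 347, 655, 742, 319, 273, 358, 368, 465,
    539, 428, 509, 591, 540, 653, 646, 687, 743, 702, 697, 305, 650, 354, 584, 318, 603, 433, 405,
    470, 124, 465, 570, 683, 485, 438, 313, 402, 480, 584, 650, 736, 641, 680, 361, 264, 296, 347,
    271, 54, 534, 581, 561, 668, 524, 719, 541, 607],
  [575, 95, 161, 43, 523, 578, 529, 566, 621, 534, 561, 581, 668, 731, 107, 587, 572, 655, 511,
    601, 700, 606, 536, 469, 504, 716, 487, 588, 671, 429, 543, 734, 306, 715, 353, 303, 312, 348,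
    737, 648, 640, 587, 655, 742, 319, 375, 90, 830, 285, 765, 291, 793, 434, 400, 481, 464, 523,
    430, 43, 578, 437, 161, 566, 471, 95, 86, 607, 152, 575, 541, 734, 590, 671, 675, 505, 600,
    716, 632, 538, 729, 568, 317, 425, 308, 471, 359, 437, 607, 566, 578, 621, 529, 524, 578, 497,
    529, 450, 444, 323, 295, 963, 866, 944, 930, 900, 866, 933, 386, 930, 58, 746, 538, 61, 505,
    541, 575, 590, 754, 779, 342, 281, 665, 582, 733, 636, 615, 135, 559, 241, 598, 549, 69, 263,
    560, 577, 616, 530, 521, 721, 624, 656, 707, 692, 726, 631, 577, 721, 500, 624, 416, 656, 708,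
    303, 356, 707, 348, 315, 726, 311, 663, 691, 602, 122, 468, 947, 432, 483, 871, 932, 751, 774,
    352, 67, 547, 919, 612, 958, 132, 873, 244, 773, 855, 257, 127, 944, 866, 386, 930, 505, 746,
    575, 61, 590, 541, 547, 517, 592, 554, 658, 612],
  [705, 599, 661, 630, 727, 468, 431, 432, 424, 467, 406, 439, 686, 649, 741, 549, 518, 598, 703,
    593, 559, 645, 546, 513, 740, 608, 260, 472, 847, 384, 764, 442, 789, 409, 349, 479, 652, 391,
    739, 445, 696, 925, 306, 892, 353, 979, 662, 746, 627, 771, 722, 358, 706, 657, 693, 723, 626,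
    660, 86, 523, 152, 43, 161, 95, 575, 541, 734, 719, 675, 637, 632, 732, 664, 331, 715, 303,
    317, 464, 481, 359, 430, 308, 305, 437, 427, 318, 471, 482, 607, 470, 541, 345, 510, 585, 654,
    643, 738, 830, 285, 325, 343, 292, 331, 348, 303, 403, 435, 426, 466, 678, 665, 733, 636, 460,
    534, 448, 581, 499, 561, 524, 621, 459, 398, 423, 455, 422, 463, 502, 417, 450, 392, 456, 783,
    859, 820, 819, 912, 968, 906, 873, 773, 855, 748, 375, 278, 312, 353, 306, 377, 407, 340, 437,
    481, 295, 430, 471, 464, 944, 930, 866, 900, 831, 287, 339, 400, 324, 425, 443, 310, 275, 318,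
    821, 354, 812, 305, 755, 276, 357, 474, 954, 905, 918, 973, 377, 824, 340, 794, 295, 323, 382,
    287, 831, 785, 900, 846, 866, 317, 930, 944, 269],
  [333, 300, 351, 351, 464, 434, 481, 299, 364, 351, 464, 434, 481, 271, 347, 271, 347, 668, 731,
    668, 731, 341, 294, 458, 451, 931, 744, 802, 289, 338, 283, 326, 739, 652, 642, 703, 645, 284,
    341, 458, 451, 931, 744, 802, 289, 338, 283, 326, 451, 458, 931, 341, 744, 284, 294, 802, 289,
    338, 283, 326, 451, 458, 396, 418, 421, 395, 298, 276, 812, 821, 275, 318, 305, 354, 451, 458,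
    396, 418, 421, 301, 298, 270, 345, 328, 271, 347, 282, 336, 284, 341, 284, 341, 279, 304, 355,
    390, 415, 447, 476, 475, 440, 356, 327, 315, 383, 311, 293, 799, 286, 827, 390, 415, 447, 476,
    320, 440, 327, 383, 286, 293, 274, 352, 371, 854, 805, 955, 879, 774, 751, 849, 787, 825, 830,
    845, 765, 796, 763, 829, 840, 795, 950, 789, 865, 915, 969, 956, 915, 872, 956, 969, 777, 862,
    823, 790, 831, 824, 760, 785, 794, 862, 823, 759, 777, 916, 752, 904, 915, 872, 956, 969, 775,
    952, 877, 874, 917, 959, 908, 762, 787, 830, 877, 901, 775, 950, 750, 935, 851, 745, 836, 762,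
    787, 877, 775, 750, 835, 928, 852, 745, 800, 945]]

/-- Slots to branch on. -/
def greatIcosahedralBranching8 : List ℕ := List.flatten [
  [967, 870, 935, 901, 835, 852, 750, 745, 775, 800, 877, 851, 917, 959, 952, 908, 874, 874, 908,
    959, 877, 917, 874, 908, 952, 959, 907, 852, 877, 745, 917, 800, 775, 807, 750, 835, 807, 851,
    750, 836, 835, 904, 916, 969, 872, 915, 911, 960, 928, 950, 865, 935, 898, 901, 786, 796, 840,
    829, 826, 847, 902, 929, 962, 809, 867, 757, 934, 822, 897, 826, 840, 795, 789, 764, 829, 847,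
    796, 826, 840, 763, 829, 847, 788, 825, 762, 842, 793, 830, 765, 798, 787, 929, 868, 962, 897,
    867, 946, 902, 949, 868, 897, 934, 965, 752, 962, 809, 757, 780, 822, 817, 861, 814, 754, 779,
    858, 298, 360, 328, 345, 470, 427, 482, 402, 433, 438, 428, 485, 465, 345, 470, 427, 482, 402,
    433, 438, 428, 485, 465, 265, 345, 350, 335, 367, 270, 764, 301, 795, 938, 883, 926, 978, 756,
    863, 812, 778, 818, 811, 856, 921, 894, 941, 863, 812, 778, 818, 811, 856, 811, 781, 863, 812,
    778, 818, 856, 889, 755, 884, 821, 921, 894, 777, 962, 810, 880, 946, 816, 888, 867, 782, 887,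
    939, 862, 924, 813, 977, 759, 940, 857, 868, 962],
  [897, 752, 946, 777, 867, 810, 880, 816, 888, 782, 887, 939, 862, 924, 813, 977, 759, 940, 857,
    765, 830, 793, 842, 950, 865, 935, 898, 967, 945, 928, 945, 967, 870, 935, 901, 874, 907, 952]]

/-- Slots to branch on. -/
def greatIcosahedralBranching9 : List ℕ := List.flatten [
  [790, 824, 794, 972, 831, 785, 760, 846, 767, 797, 913, 970, 760, 846, 785, 876, 957, 973, 910,
    875, 957, 970, 876, 760, 785, 846, 970, 875, 910, 869, 933, 964, 951, 933, 900, 951, 899, 864,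
    896, 799, 791, 766, 827, 843, 844, 828, 931, 903, 948, 791, 766, 827, 843, 844, 828, 931, 903,
    948, 975, 871, 932, 961, 948, 903, 931, 931, 903, 948, 853, 957, 973, 876, 918, 771, 905, 806,
    746, 833, 850, 772, 894, 838, 749, 801, 980, 978, 755, 821, 781, 903, 948, 966, 961, 947, 812,
    932, 778, 818, 889, 938, 981, 883, 751, 884, 774, 849, 832, 744, 769, 761, 784, 792, 872, 843,
    956, 791, 915, 879, 911, 974, 787, 830, 842, 762, 971, 917, 959, 877, 907, 914, 952, 798, 825,
    762, 922, 891, 839, 885, 936, 854, 979, 955, 892, 904, 925, 264, 391, 445, 414, 494, 479, 409,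
    959, 384, 877, 472, 907, 914, 952, 348, 467, 424, 484, 401, 881, 927, 942, 893, 844, 784, 792,
    872, 843, 956, 969, 791, 915, 879, 974, 916, 955, 904, 828, 791, 843, 812, 778, 818, 756, 889,
    863, 938, 926, 772, 749, 833, 933, 866, 944, 963],
  [845, 765, 825, 788, 793, 830, 787, 798, 762, 971, 768, 874, 914, 952, 874, 914, 952, 793, 765,
    788, 830, 825, 787, 798, 850, 801, 490, 373, 912, 437, 430, 305, 407, 276, 471, 481, 486, 961,
    361, 966, 947, 846, 785, 930, 760, 746, 806, 771, 876, 957, 812, 973, 905, 918, 830, 755, 842,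
    821, 313, 781, 370, 811, 310, 856, 425, 400, 434, 317, 914, 308, 907, 359, 952, 472, 384, 264,
    296, 331, 332, 348, 271, 303, 296, 331, 366, 271, 347, 332, 314, 445, 391, 414, 479, 352, 959,
    307, 372, 798, 825, 973, 762, 876, 787, 785, 877, 760, 907, 846, 914, 952, 472, 359, 308, 317,
    391, 414, 479, 352, 959, 307, 372, 798, 825, 973, 762, 876, 787, 785, 877, 760, 907, 846, 914,
    952, 472, 359, 308, 317, 409, 384, 494, 479, 352, 959, 307, 798, 825, 762, 787, 877, 907, 914,
    952, 472, 414, 442, 489, 494, 384, 479, 352, 959, 307, 372, 798, 825, 973, 762, 876, 787, 785,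
    877, 760, 907, 846, 914, 952, 472, 359, 308, 317, 317, 846, 760, 930, 947, 785, 944, 964, 966,
    876, 951, 903, 973, 806, 948, 957, 746, 961, 758],
  [400, 486, 425, 471, 464, 430, 305, 481, 276, 318, 366, 434, 412, 291, 322, 336, 379, 292, 325,
    285, 442, 830, 384, 842, 472, 313, 414, 391, 264, 361, 486, 425, 310, 275, 370, 354, 361, 296,
    347, 271, 332, 389, 493, 370, 275, 310, 354, 357, 425, 477, 905, 495, 954, 474, 388, 413, 443,
    441, 389, 478, 493, 473, 953, 878, 906, 909, 958, 873, 919, 434, 486, 425, 308, 359, 372, 277,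
    307, 308, 359, 914, 391, 414, 479, 472, 959, 952, 874, 908, 917, 971, 414, 472, 442, 805, 774,
    854, 948, 961, 758, 932, 947, 744, 802, 832, 978, 769, 849, 883, 839, 322, 894, 751, 921, 884,
    981, 806, 291, 336, 379, 325, 285, 343, 380, 832, 802, 907, 849, 980, 952, 751, 922, 971, 839,
    891, 936, 979, 746, 771, 876, 973, 798, 787, 943, 762, 925, 842, 765, 830, 294, 321, 378, 283,
    326, 289, 284, 381, 341, 294, 948, 903, 961, 966, 947, 846, 930, 746, 806, 771, 876, 957, 812,
    973, 905, 918, 830, 755, 778, 821, 818, 781, 756, 341, 863, 321, 378, 283, 266, 389, 441, 412,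
    291, 285, 322, 380, 336, 343, 753, 292, 776, 379],
  [758, 819, 815, 860, 389, 493, 446, 473, 926, 953, 763, 878, 829, 789, 907, 952, 472, 971, 414,
    391, 479, 959, 877, 917, 430, 305, 407, 276, 471, 481, 357, 395, 486, 951, 773, 361, 966, 964,
    947, 930, 846, 932, 746, 785, 961, 806, 760, 771, 366, 876, 957, 812, 973, 918, 755, 778, 821,
    886, 781, 983, 811, 856, 331, 264, 452, 296, 461, 332, 451, 421, 396, 503, 906, 953, 878, 909,
    919, 873, 958, 968, 386, 411, 446, 478, 473, 953, 906, 912, 878, 909, 958, 873, 919, 386, 411,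
    446, 478, 891, 473, 389, 493, 412, 973, 798, 957, 876, 771, 885, 980, 943, 892, 882, 922, 936,
    746, 771, 806, 746, 954, 771, 918, 876, 905, 973, 830, 798, 842, 787, 762, 971, 877, 907, 914,
    952, 917, 959, 917, 959, 765, 793, 788, 830, 825, 787, 798, 900, 930, 951, 964, 772, 919, 749,
    833, 909, 838, 958, 801, 873, 850, 906, 912, 953, 948, 961, 776, 785, 896, 846, 876, 930, 947,
    771, 973, 964, 871, 957, 932, 961, 948, 903, 931, 966, 753, 860, 819, 758, 783, 885, 980, 749,
    933, 951, 900, 866, 784, 827, 844, 799, 766, 791],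
  [843, 828, 772, 853, 785, 797, 846, 767, 760, 970, 875, 910, 913, 876, 973, 905, 918, 954]]

/-- Slots to branch on. -/
def greatIcosahedralBranching10 : List ℕ := List.flatten [
  [383, 342, 327, 281, 290, 320, 376, 779, 817, 814, 902, 754, 861, 858, 822, 757, 809, 893, 962,
    927, 929, 942, 983, 949, 462, 965, 897, 868, 787, 849, 917, 959, 877, 908, 972, 397, 914, 449,
    874, 420, 457, 394, 501, 454, 917, 877, 959, 397, 908, 449, 420, 457, 501, 937, 454, 890, 920,
    394, 881, 874, 781, 768, 914, 952, 835, 972, 971, 852, 327, 745, 807, 440, 800, 750, 775, 491,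
    851, 320, 447, 390, 870, 928, 842, 945, 830, 898, 765, 793, 788, 825, 845, 762, 798, 780, 814,
    754, 858, 809, 822, 780, 930, 866, 964, 944, 899, 963, 754, 900, 814, 861, 757, 809, 822, 858,
    962, 893, 927, 942, 983, 462, 420, 397, 457, 449, 501, 929, 902, 949, 868, 965, 897, 934, 454,
    394, 419, 299, 457, 937, 920, 886, 959, 917, 877, 908, 397, 907, 501, 914, 454, 874, 394, 972,
    914, 907, 877, 952, 917, 849, 908, 971, 790, 797, 824, 846, 794, 760, 344, 797, 330, 846, 266,
    364, 831, 363, 269, 767, 484, 841, 933, 264, 832, 774, 751, 805, 839, 854, 744, 978, 801, 749,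
    838, 361, 348, 467, 406, 439, 483, 431, 361, 348],
  [467, 406, 439, 483, 431, 917, 877, 908, 397, 907, 501, 914, 454, 874, 394, 866, 899, 944, 964,
    757, 869, 861, 899, 814, 754, 858, 809, 822, 893, 927, 983, 886, 920, 890, 916, 904, 835, 955,
    807, 852, 879, 750, 327, 791, 766, 799, 843, 969, 844, 944, 872, 761, 951, 963, 784, 956, 828,
    974, 933, 792, 849, 281, 911, 900, 917, 376, 406, 915, 320, 431, 851, 304, 439, 952, 467, 971,
    348, 874, 914, 907, 272, 369, 316, 751, 355, 774, 768, 832, 800, 264, 976, 331, 881, 781, 756,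
    863, 821, 755, 778, 818, 856, 811, 816, 752, 782, 810, 813, 823, 862, 777, 969, 766, 791, 799,
    879, 844, 761, 974, 911, 956, 872, 915, 969, 766, 791, 799, 843, 844, 944, 761, 963, 828, 866,
    792, 784, 327, 281, 293, 852, 290, 286, 320, 376, 821, 781, 756, 863, 920, 937, 886, 890, 893,
    835, 881, 807, 927, 983, 881, 976, 890, 942, 835, 893, 807, 927, 983, 401, 467, 406, 424, 432,
    483, 431, 468, 424, 484, 432, 904, 439, 468, 835, 406, 431, 768, 886, 893, 937, 890, 976, 942,
    927, 447, 761, 784, 792, 872, 828, 969, 766, 956],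
  [843, 911, 915, 791, 974, 799, 955, 311, 475, 356, 390, 315, 374, 355, 476, 440, 491, 792, 828,
    784, 872, 969, 766, 956, 843, 911, 915, 791, 974, 879, 828, 844, 792, 799, 784, 827, 406, 886,
    893, 937, 890, 835, 976, 768, 942, 745, 755, 856, 811, 818, 896, 947, 966, 903, 828, 792, 761,
    784, 844, 827, 812, 967, 778, 935, 865, 960, 898, 945, 870, 928, 937, 886, 890, 983, 893, 881,
    927, 755, 863, 812, 755, 781, 894, 812, 967, 778, 863, 961, 856, 921, 941, 978, 789, 865, 935,
    901, 950, 865, 935, 950, 901, 960, 898, 927, 983, 893, 886, 942, 937, 881, 920, 890, 976, 942,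
    462, 768, 835, 904, 451, 496, 976, 890, 410, 954, 918, 970, 855, 875, 905, 395, 910, 461, 913,
    421, 876, 957, 396, 458, 418, 938, 883, 780, 926, 861, 889, 981, 757, 884, 809, 964, 779, 962,
    822, 784, 866, 868, 897, 946, 934, 747, 867, 837, 387, 804, 444, 488, 977, 924, 888, 819, 880,
    860, 923, 443, 413, 474, 388, 787, 929, 949, 902, 965, 388, 413, 443, 488, 387, 474, 477, 867,
    934, 847, 946, 829, 796, 969, 916, 334, 449, 397],
  [877, 917, 959, 267, 449, 346, 397, 297, 362, 469, 501, 365, 485, 436, 454, 482, 438, 487, 329,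
    433, 427, 349, 470, 402, 466, 465, 480, 270, 345, 367, 345, 367, 301, 350, 335, 360, 265, 267,
    346, 297, 365, 482, 433, 470, 427, 438, 275, 318, 354, 305, 370, 373, 313, 357, 318, 354, 305,
    373, 490, 386, 411, 446, 413, 443, 477, 488, 387, 929, 902, 949, 866, 930, 899, 944, 474, 918,
    488, 855, 875, 905, 387, 443, 748, 395, 910, 444, 413, 773, 461, 495, 803, 421, 477, 975, 834,
    503, 799, 878, 396, 452, 909, 458, 932, 919, 938, 873, 883, 968, 780, 926, 958, 861, 889, 848,
    757, 884, 770, 964, 779, 354, 275, 318, 370, 276, 313, 357, 305, 373, 430, 357, 481, 313, 407,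
    310, 437, 425, 486, 471, 951, 869, 791, 899, 766, 930, 843, 866, 792, 784, 811, 970, 818, 756,
    913, 910, 875, 918, 855, 905, 748, 773, 834, 803, 421, 396, 503, 496, 976, 881, 401, 890, 424,
    920, 432, 484, 886, 406, 439, 483, 431, 468, 745, 835, 836, 800, 851, 945, 750, 928, 881, 983,
    942, 886, 937, 976, 920, 893, 942, 286, 293, 320],
  [327, 290, 837, 804, 855, 773, 910, 803, 887, 905, 834, 748, 855, 804, 918, 747, 875, 848, 970,
    913, 834, 748, 848, 855, 913, 918, 970, 875, 954, 385, 770, 747, 848, 927, 881, 983, 781, 942,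
    893, 976, 748, 834, 855, 848, 804, 913, 977, 876, 957, 924, 939, 982, 755, 376, 503, 396, 421,
    901, 830, 870, 842, 928, 750, 851, 836, 745, 768, 800, 821, 967, 812, 778, 865, 935, 901, 950,
    812, 821, 863, 983, 747, 886, 848, 893, 834, 913, 748, 970, 855, 875, 918, 755, 778, 967, 865,
    935, 901, 950, 778, 967, 812, 856, 865, 863, 942, 935, 756, 937, 976, 901, 920, 870, 950, 890,
    960, 898, 928, 745, 800, 836, 768, 851, 835, 775, 807, 768, 800, 836, 851, 750, 775, 807, 881,
    893, 942, 804, 834, 747, 848, 440, 408, 888, 939, 924, 982, 977, 880, 923, 940, 895, 440, 408,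
    888, 939, 924, 982, 977, 880, 923, 940, 895, 895, 982, 939, 888, 924, 977, 880, 940, 895, 982,
    923, 940, 977, 880, 924, 888, 773, 803, 747, 804, 848, 770, 848, 983, 770, 804, 834, 855, 888,
    748, 775, 836, 851, 800, 745, 768, 852, 807, 835],
  [893, 886, 937, 863, 756, 781, 811, 818, 778, 812, 856, 755, 811, 768, 800, 745, 852, 807, 835,
    754, 858, 780, 809, 757, 822, 817, 814, 902, 779, 861, 342, 281, 376, 314, 274, 841, 352, 307,
    371, 372, 745, 852, 807, 959, 750, 877, 851, 977, 917, 972, 800, 976, 890, 920, 440, 491, 971,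
    952, 809, 907, 757, 914, 822, 874, 277, 359, 317, 434, 310, 797, 790, 846, 940, 824, 880, 760,
    923, 425, 400, 880, 940, 797, 895, 831, 982, 767, 939, 790, 794, 824, 357, 313, 276, 370, 373,
    818, 275, 354, 856, 821, 305, 755, 318, 967, 935, 845, 788, 798, 825, 501, 457, 454, 329, 268,
    349, 302, 365, 789, 362, 297, 334, 829, 878, 346, 847, 975, 796, 763, 786, 840, 826, 868, 897,
    934, 965, 485, 759, 857, 810, 777, 823, 813, 862, 782, 813, 857, 810, 777, 823, 813, 782, 862,
    816, 752, 962, 867, 946, 842, 762, 787, 922, 798, 877, 891, 825, 972, 936, 788, 959, 882, 765,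
    793, 874, 925, 908, 274, 308, 371, 352, 307, 428, 405, 433, 482, 402, 427, 465, 438, 308, 371,
    317, 352, 359, 479, 445, 494, 409, 442, 472, 414],
  [489, 391, 949, 929, 965, 962, 934, 867, 897, 946, 897, 949, 946, 965, 867, 934, 378, 636, 665,
    733, 329, 268, 454, 349, 302, 365, 789, 362, 334, 829, 878, 346, 847, 975, 796, 934, 763, 786,
    867, 840, 946, 826, 897, 665, 678, 733, 678, 665, 733, 329, 268, 454, 349, 302, 365, 789, 362,
    334, 829, 878, 346, 847, 975, 796, 934, 763, 786, 867, 840, 946, 826, 897, 394, 454, 457, 454,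
    457, 329, 396, 503, 421, 451, 461, 458, 341, 294, 283, 829, 847, 796, 763, 926, 981, 941, 894,
    883, 938, 978, 910, 381, 341, 284, 289, 321, 326, 850, 283, 954, 338, 829, 875, 847, 918, 970,
    796, 913, 763, 957, 926, 853, 981, 310, 275, 357, 821, 313, 755, 370, 856, 746, 833, 894, 883,
    921, 978, 275, 354, 370, 746, 833, 894, 883, 978, 921, 441, 856, 941, 490, 818, 461, 395, 276,
    305, 373, 357, 313, 474, 370, 410, 354, 477, 444, 387, 495, 488, 388, 443, 413, 341, 284, 321,
    321, 365, 382, 373, 357, 276, 305, 313, 818, 318, 842, 778, 946, 338, 867, 934, 962, 395, 875,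
    954, 970, 793, 830, 765, 787, 788, 825, 845, 949],
  [929, 965, 868, 897, 461, 503, 421, 901, 830, 787, 762, 825, 845, 949, 929, 965, 868, 897, 894,
    883, 978, 921, 856, 941, 818, 778, 338, 755, 461, 821, 503, 275, 452, 318, 354, 305, 276, 395,
    496, 418, 458, 283, 326, 338, 829, 289, 847, 284, 796, 341, 763, 458, 926, 981, 941, 461, 503,
    421, 452, 451, 418, 496, 395, 294, 829, 341, 789, 284, 746, 833, 850, 954, 875, 970, 913, 957,
    853, 772, 801, 749, 838, 771, 833, 806, 876, 981, 913, 941, 957, 884, 853, 921, 326, 772, 764,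
    441, 795, 490, 478, 353, 375, 278, 309, 850, 771, 806, 876, 833, 981, 913, 926, 957, 883, 853,
    938, 772, 889, 801, 838, 806, 786, 763, 796, 840, 847, 795, 764, 826, 360, 265, 763, 298, 812,
    821, 755, 967, 870, 945, 847, 764, 795, 826, 840, 265, 298, 350, 812, 301, 787, 821, 335, 755,
    367, 967, 345, 870, 901, 830, 842, 793, 788, 825, 762, 798, 335, 265, 350, 265, 350, 634, 668,
    674, 731, 712, 953, 975, 763, 878, 796, 909, 847, 764, 795, 826, 840, 904, 766, 827, 784, 799,
    792, 843, 791, 828, 799, 827, 969, 791, 844, 784],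
  [872, 761, 956, 792, 849, 843, 778, 812, 856, 865, 755, 818, 821, 275, 318, 354, 370, 305, 276,
    313, 842, 946, 867, 962, 929, 949, 845, 935, 901, 830, 765, 788, 793, 818, 856, 896, 839, 751,
    805, 891, 774, 854, 769, 745, 852, 807, 835, 959, 750, 877, 851, 972, 914, 907, 952, 800, 851,
    762, 825, 842, 946, 867, 962, 929, 949, 845, 788, 793, 765, 830, 842, 940, 880, 895, 923, 977,
    982, 497, 750, 887, 939, 835, 928, 924, 807, 448, 460, 339, 618, 324, 578, 287, 295, 323, 444,
    529, 566, 408, 621, 440, 524, 385, 44, 407, 476, 492, 183, 280, 355, 371, 288, 663, 708, 726,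
    721, 707, 692, 880, 895, 923, 982, 857, 977, 880, 469, 403, 487, 436, 429, 967, 315, 426, 306,
    870, 311, 480, 901, 945, 356, 367, 272, 369, 304, 816, 316, 355, 782, 279, 759, 813, 772, 353,
    833, 312, 375, 853, 278, 319, 309, 819, 358, 776, 273, 368, 758, 815, 961, 783, 860, 864, 753,
    948, 808, 841, 859, 655, 700, 742, 737, 699, 640, 648, 347, 742, 271, 332, 647, 683, 366, 364,
    330, 269, 299, 351, 838, 801, 749, 933, 963, 900],
  [420, 397, 449, 334, 267, 302, 349, 268, 297, 810, 752, 777, 862, 823, 333, 899, 300, 944, 266,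
    809, 464, 344, 757, 481, 917, 437, 407, 471, 299, 838, 749, 801, 980, 885, 943, 798, 831, 767,
    797, 790, 785, 900, 794, 933, 760, 453, 824, 399, 463, 502, 377, 280, 324, 323, 340, 287, 295,
    767, 907, 797, 790, 846, 344, 266, 277, 307, 822, 352, 372, 757, 274, 964, 869, 899, 275, 318,
    354, 821, 305, 812, 276, 794, 755, 357, 760, 918, 923, 973, 957, 477, 495, 413, 443, 388, 474,
    310, 821, 357, 370, 755, 276, 313, 812, 485, 438, 465, 350, 265, 301, 298, 270, 345, 428, 438,
    465, 362, 267, 302, 349, 268, 466, 435, 752, 810, 777, 270, 328, 345, 298, 301, 835, 350, 750,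
    265, 807, 610, 694, 657, 725, 476, 550, 440, 515, 697, 594, 650, 545, 736, 641, 702, 305, 354,
    794, 659, 824, 629, 280, 724, 288, 323, 415, 295, 447, 408, 390, 475, 476, 440, 491, 385, 597,
    553, 516, 550, 741, 545, 697, 649, 594, 650, 698, 558, 736, 738, 702, 318, 305, 354, 494, 550,
    660, 553, 693, 73, 723, 324, 549, 615, 479, 559],
  [445, 598, 322, 391, 657, 725, 628, 79, 832, 264, 296, 361, 589, 652, 685, 739, 642, 602, 468,
    686, 483, 282, 292, 336, 343, 291, 325, 285, 336, 623, 677, 668, 731, 463, 453, 502, 377, 575,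
    541, 607, 734, 590, 719, 505, 668, 624, 731, 721, 708, 663, 726, 631, 510, 585, 538, 568, 712,
    298, 345, 328, 729, 716, 671, 339, 287, 288, 295, 280, 340, 590, 541, 607, 471, 437, 407, 533,
    526, 711, 577, 629, 560, 724, 721, 323, 295, 340, 280, 288, 708, 663, 726, 567, 582, 521, 616,
    530, 567, 582, 665, 733, 95, 824, 280, 288, 339, 287, 534, 443, 561, 581, 413, 474, 524, 410,
    621, 529, 444, 387, 477, 618, 460, 448, 124, 260, 950, 70, 865, 916, 935, 879, 911, 955, 151,
    130, 29, 247, 509, 53, 539, 922, 59, 936, 249, 143, 260, 604, 950, 70, 935, 916, 955, 130,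
    247, 53, 922, 882, 936, 143, 249, 59, 539, 509, 584, 591, 570, 573, 506, 728, 540, 666, 717,
    713, 300, 735, 351, 333, 604, 539, 509, 584, 591, 570, 650, 506, 697, 540, 717, 300, 351, 653,
    646, 743, 523, 581, 561, 524, 618, 621, 460, 566],
  [423, 408, 295, 340, 459, 398, 455, 824, 280, 323, 340, 295, 607, 541, 510, 590, 719, 585, 505,
    649, 668, 538, 698, 731, 712, 298, 345, 654, 643, 738, 463, 533, 417, 453, 526, 577, 670, 635,
    673, 730, 717, 334, 300, 297, 351, 422, 333, 450, 392, 456, 468, 431, 432, 439, 424, 406, 467,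
    686, 649, 741, 486, 437, 471, 652, 703, 739, 740, 696, 645, 651, 832, 264, 331, 348, 303, 598,
    559, 657, 615, 518, 593, 662, 627, 706, 722, 437, 559, 598, 471, 428, 513, 615, 425, 465, 608,
    518, 438, 546, 552, 434, 427, 317, 308, 359, 550, 553, 515, 516, 594, 545, 558, 613, 777, 862,
    823, 317, 359, 822, 308, 809, 274, 793, 757, 352, 917, 971, 952, 472, 384, 442, 325, 409, 292,
    479, 343, 959, 285, 972, 830, 765, 347, 271, 296, 303, 348, 264, 331, 815, 783, 820, 859, 808,
    936, 753, 979, 860, 925, 885, 943, 801, 749, 838, 353, 312, 375, 278, 309, 346, 334, 362, 267,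
    297, 302, 810, 349, 813, 777, 816, 268, 782, 752, 759, 862, 962, 823, 867, 899, 946, 279, 311,
    355, 356, 304, 315, 272, 355, 316, 374, 672, 638],
  [713, 666, 735, 728, 679, 718, 377, 324, 280, 288, 824, 339, 790, 287, 846, 760, 797, 785, 970,
    794, 831, 875, 841, 907, 954, 767, 275, 318, 354, 305, 310, 821, 357, 370, 755, 276, 313, 812,
    967, 870, 901, 945, 307, 277, 317, 359, 822, 308, 809, 274, 793, 757, 352, 917, 971, 952, 472,
    489, 414, 442, 409, 479, 391, 959, 445, 972, 925, 765, 277, 352, 372, 822, 274, 757, 371, 809,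
    648, 348, 331, 361, 264, 303, 332, 296, 832, 815, 347, 808, 744, 819, 860, 271, 776, 978, 758,
    366, 753, 883, 783, 961, 938, 820, 864, 639, 671, 734, 278, 309, 358, 375, 273, 319, 587, 655,
    742, 647, 683, 699, 364, 684, 330, 749, 838, 269, 333, 351, 300, 801, 853, 980, 838, 885, 269,
    943, 299, 798, 344, 787, 601, 466, 435, 429, 480, 487, 367, 270, 328, 345, 298, 301, 350, 265,
    581, 668, 719, 731, 732, 637, 674, 667, 712, 502, 392, 453, 417, 463, 668, 731, 572, 536, 743,
    557, 646, 687, 517, 653, 702, 736, 514, 393, 448, 460, 548, 554, 611, 547, 592, 548, 611, 599,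
    592, 554, 612, 691, 663, 726, 317, 557, 697, 308],
  [517, 650, 793, 584, 736, 788, 603, 825, 845, 455, 398, 459, 416, 448, 500, 393, 328, 423, 540,
    298, 398, 460, 591, 499, 448, 618, 604, 380, 393, 465, 322, 438, 592, 547, 658, 612, 720, 473,
    688, 446, 493, 614, 519, 551, 595, 544, 609, 474, 443, 534, 561, 81, 159, 37, 873, 958, 132,
    244, 54, 924, 939, 138, 184, 48, 242, 528, 921, 129, 617, 941, 957, 137, 913, 250, 64, 56,
    258, 929, 121, 868, 949, 528, 579, 671, 716, 734, 729, 715, 632, 664, 242, 921, 129, 884, 957,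
    941, 876, 913, 64, 258, 121, 949, 929, 56, 250, 137, 617, 458, 418, 451, 452, 421, 395, 461,
    595, 663, 708, 726, 721, 624, 692, 656, 707, 554, 611, 514, 488, 443, 474, 398, 540, 459, 591,
    416, 604, 448, 539, 317, 646, 687, 359, 653, 308, 591, 702, 604, 736, 465, 650, 438, 584, 427,
    603, 482, 470, 680, 650, 736, 536, 588, 454, 504, 457, 571, 420, 543, 449, 772, 853, 833, 606,
    511, 543, 572, 571, 536, 731, 732, 716, 668, 632, 719, 729, 301, 328, 270, 298, 345, 485, 606,
    438, 511, 465, 543, 402, 588, 482, 671, 734, 640],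
  [737, 312, 684, 700, 306, 699, 683, 353, 429, 311, 364, 278, 375, 772, 435, 487, 356, 330, 309,
    819, 319, 833, 404, 466, 315, 369, 358, 776, 853, 480, 272, 367, 304, 269, 333, 351, 300, 299,
    838, 344, 749, 266, 801, 980, 885, 943, 798, 860, 787, 753, 808, 468, 431, 432, 439, 424, 406,
    467, 347, 432, 271, 332, 655, 366, 742, 270, 328, 345, 298, 301, 835, 350, 750, 265, 598, 491,
    440, 476, 657, 694, 725, 628, 743, 557, 646, 687, 517, 653, 697, 547, 591, 702, 550, 736, 610,
    650, 476, 553, 584, 440, 73, 385, 29, 509, 573, 540, 603, 506, 151, 631, 663, 726, 509, 865,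
    539, 898, 950, 960, 935, 928, 59, 211, 691, 612, 554, 599, 592, 548, 611, 514, 317, 557, 697,
    308, 517, 646, 650, 793, 680, 584, 736, 788, 830, 361, 601, 641, 825, 845, 573, 509, 603, 390,
    540, 447, 506, 415, 385, 476, 440, 591, 603, 540, 509, 539, 604, 465, 438, 485, 402, 587, 285,
    291, 336, 322, 592, 547, 658, 612, 688, 473, 446, 493, 564, 528, 617, 723, 520, 660, 704, 580,
    711, 563, 724, 629, 659, 579, 528, 617, 64, 544]]

/-- Slots to branch on. -/
def greatIcosahedralBranching11 : List ℕ := List.flatten [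
  [595, 663, 708, 726, 721, 624, 692, 656, 707, 258, 913, 121, 876, 949, 957, 868, 929, 250, 938,
    883, 978, 744, 832, 264, 331, 348, 303, 56, 536, 454, 457, 420, 449, 397, 498, 462, 419, 137,
    941, 921, 48, 242, 129, 609, 544, 512, 595, 596, 663, 656, 708, 624, 721, 258, 544, 913, 121,
    609, 957, 949, 129, 929, 242, 48, 921, 884, 889, 941, 938, 137, 250, 56, 536, 454, 457, 420,
    449, 397, 498, 462, 419, 409, 527, 617, 479, 458, 528, 445, 418, 451, 520, 579, 421, 622, 563,
    414, 289, 338, 461, 395, 452, 554, 611, 514, 488, 443, 474, 317, 646, 687, 359, 653, 308, 351,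
    591, 702, 333, 604, 305, 736, 465, 318, 650, 438, 485, 584, 402, 427, 570, 482, 506, 728, 433,
    540, 405, 573, 735, 713, 666, 336, 282, 291, 292, 285, 343, 559, 657, 428, 513, 725, 465, 608,
    438, 552, 402, 427, 308, 359, 793, 472, 830, 384, 489, 285, 442, 414, 291, 325, 289, 706, 292,
    338, 709, 326, 662, 722, 627, 347, 948, 271, 296, 961, 758, 815, 303, 348, 264, 331, 640, 737,
    684, 700, 699, 304, 311, 272, 356, 315, 352, 372],
  [798, 274, 359, 787, 825, 308, 830, 788, 793, 845, 765, 797, 947, 767, 932, 841, 961, 948, 864,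
    760, 785, 831, 767, 900, 841, 963, 933, 323, 340, 824, 295, 841, 287, 807, 794, 339, 750, 760,
    928, 923, 448, 443, 460, 388, 393, 474, 488, 375, 278, 312, 353, 306, 638, 713, 666, 735, 728,
    669, 330, 343, 364, 325, 299, 292, 344, 801, 266, 838, 833, 749, 772, 403, 487, 436, 429, 426,
    306, 309, 906, 833, 853, 772, 353, 278, 312, 362, 787, 825, 346, 798, 877, 972, 914, 907, 952,
    874, 788, 765, 845, 318, 949, 469, 403, 487, 436, 967, 426, 870, 480, 901, 945, 367, 898, 345,
    865, 935, 950, 470, 433, 482, 751, 774, 805, 769, 802, 884, 289, 744, 921, 326, 832, 931, 941,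
    338, 461, 503, 421, 452, 451, 331, 332, 264, 271, 348, 303, 799, 791, 827, 828, 784, 843, 792,
    761, 968, 844, 958, 951, 869, 933, 964, 963, 757, 944, 822, 801, 899, 809, 749, 930, 838, 866,
    900, 266, 300, 363, 333, 269, 386, 446, 490, 411, 478, 300, 363, 419, 344, 454, 299, 457, 420,
    389, 833, 772, 853, 326, 441, 478, 353, 375, 278],
  [309, 878, 975, 763, 796, 926, 883, 938, 889, 818, 856, 896, 827, 906, 477, 957, 913, 876, 973,
    918, 755, 967, 870, 945, 847, 764, 795, 826, 840, 495, 368, 444, 306, 358, 387, 273, 268, 319,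
    349, 309, 426, 403, 466, 480, 404, 429, 435, 354, 275, 821, 755, 967, 870, 945, 847, 764, 795,
    826, 840, 878, 912, 975, 909, 763, 926, 883, 938, 889, 818, 896, 827, 906, 833, 968, 853, 958,
    919, 668, 677, 731, 763, 796, 847, 941, 764, 884, 921, 357, 276, 305, 313, 318, 354, 275, 370,
    323, 295, 287, 340, 807, 339, 835, 852, 776, 750, 745, 819, 977, 800, 860, 880, 288, 851, 815,
    940, 377, 758, 783, 857, 324, 859, 759, 808, 820, 782, 916, 960, 895, 813, 867, 923, 823, 962,
    443, 982, 777, 946, 413, 887, 752, 810, 934, 924, 915, 444, 387, 410, 488, 474, 388, 267, 868,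
    302, 897, 349, 362, 965, 268, 466, 949, 297, 435, 334, 480, 346, 426, 469, 436, 429, 487, 404,
    323, 295, 287, 340, 339, 776, 819, 860, 815, 783, 753, 808, 820, 808, 820, 268, 334, 297, 349,
    346, 789, 829, 878, 283, 847, 975, 326, 338, 796],
  [763, 289, 786, 284, 840, 826, 268, 334, 297, 349, 346, 789, 829, 878, 283, 847, 975, 326, 338,
    796, 763, 289, 786, 284, 341, 458, 367, 764, 795, 826, 301, 270, 418, 345, 496, 395, 451, 461,
    503, 421, 298, 265, 328, 360, 764, 795, 826, 294, 850, 283, 954, 326, 829, 875, 847, 970, 796,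
    913, 763, 957, 926, 853, 981, 806, 771, 746, 838, 833, 749, 772, 801, 913, 876, 970, 957, 875,
    812, 918, 755, 778, 856, 818, 503, 421, 451, 461, 901, 458, 452, 341, 294, 321, 283, 284, 338,
    829, 289, 847, 796, 763, 926, 981, 941, 884, 889, 409, 938, 978, 883, 774, 864, 384, 896, 494,
    818, 932, 479, 778, 959, 812, 856, 852, 972, 298, 331, 942, 745, 877, 265, 881, 800, 787, 360,
    927, 851, 350, 328, 301, 335, 270, 835, 807, 750, 303, 271, 332, 366, 347, 784, 792, 761, 843,
    828, 791, 348, 264, 361, 416, 448, 928, 870, 945, 967, 271, 366, 332, 347, 296, 784, 361, 792,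
    348, 761, 843, 828, 791, 931, 961, 948, 896, 931, 744, 948, 802, 903, 849, 947, 751, 871, 932,
    268, 454, 349, 302, 365, 789, 362, 334, 829, 878],
  [346, 847, 975, 796, 934, 763, 786, 867, 840, 946, 826, 897, 457, 454, 329, 268, 349, 789, 829,
    878, 975, 763, 926, 981, 884, 889, 818, 856, 921, 894, 941, 274, 352, 307, 371, 372, 745, 852,
    835, 959, 750, 877, 851, 972, 800, 492, 976, 447, 890, 920, 440, 385, 491, 476, 390, 415, 779,
    814, 822, 817, 858, 780, 809, 858, 822, 920, 779, 976, 342, 890, 281, 817, 376, 780, 809, 757,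
    861, 849, 917, 877, 959, 972, 917, 877, 787, 959, 908, 971, 762, 842, 921, 978, 883, 938, 856,
    884, 818, 778, 889, 755, 938, 821, 396, 458, 503, 451, 421, 275, 354, 370, 313, 276, 305, 318,
    373, 458, 503, 451, 421, 894, 941, 807, 851, 750, 807, 750, 852, 835, 851, 768, 800, 880, 745,
    977, 940, 895, 923, 887, 982]]

/-- Slots to branch on. -/
def greatIcosahedralBranching12 : List ℕ := List.flatten [
  [891, 925, 885, 943, 980, 979, 882, 892, 922, 980, 943, 885, 771, 746, 850, 838, 749, 772, 353,
    900, 933, 841, 951, 963, 844, 964, 869, 930, 899, 866, 823, 944, 784, 767, 831, 846, 785, 794,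
    760, 824, 790, 831, 797, 824, 875, 846, 794, 954, 970, 785, 972, 918, 760, 876, 765, 905, 973,
    798, 845, 825, 788, 793, 830, 842, 759, 857, 810, 816, 777, 752, 782, 343, 813, 819, 888, 924,
    859, 758, 783, 815, 860, 815, 923, 758, 859, 783, 924, 340, 820, 888, 808, 939, 459, 887, 982,
    500, 895, 455, 940, 398, 273, 306, 368, 312, 843, 791, 799, 827, 896, 416, 303, 393, 348, 460,
    361, 499, 296, 423, 776, 898, 928, 960, 865, 932, 871, 961, 758, 948, 864, 896, 931, 966, 753,
    808, 860, 859, 923, 783, 924, 340, 888, 939, 459, 887, 982, 416, 500, 895, 379, 393, 940, 282,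
    336, 460, 322, 499, 380, 843, 947, 961, 792, 896, 758, 783, 859, 912, 340, 815, 808, 968, 820,
    906, 901, 873, 950, 958, 935, 478, 269, 351, 464, 481, 366, 303, 416, 459, 500, 455, 386, 411,
    490, 446, 441, 493, 389, 871, 896, 827, 947, 799],
  [791, 843, 792, 828, 903, 931, 948, 864, 961, 758, 783, 859, 912, 808, 968, 753, 820, 906, 953,
    878, 975, 919, 264, 832, 744, 774, 751, 879, 805, 916, 854, 969, 769, 956, 872, 915, 361, 348,
    331, 366, 452, 418, 395, 496, 451, 332, 347, 468, 432, 319, 273, 358, 296, 348, 423, 467, 398,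
    439, 273, 312, 306, 782, 813, 933, 951, 963, 964, 930, 866, 944, 899, 823, 813, 862, 816, 857,
    810, 752, 862, 823, 759, 813, 782, 857, 885, 979, 771, 943, 746, 860, 892, 980, 806, 850, 922,
    882, 776, 753, 808, 859, 783, 340, 820, 901, 759, 782, 823, 813, 823, 813, 862, 899, 782, 777,
    343, 772, 353, 833, 853, 894, 774, 805, 751, 849, 788, 830, 765, 793, 389, 266, 869, 330, 779,
    951, 964, 809, 300, 858, 351, 754, 333, 364, 814, 269, 299, 300, 757, 333, 363, 822, 917, 351,
    344, 858, 754, 814, 299, 269, 838, 801, 749, 933, 963, 900, 944, 420, 866, 464, 446, 321, 378,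
    294, 501, 283, 397, 457, 326, 338, 877, 289, 959, 381, 972, 765, 793, 842, 762, 971, 908, 874,
    394, 498, 419, 462, 454, 449, 329, 274, 817, 780],
  [861, 334, 365, 268, 297, 349, 346, 302, 267, 308, 352, 359, 371, 277, 317, 493, 473, 386, 411,
    292, 282, 336, 379, 291, 325, 285, 825, 910, 430, 875, 481, 970, 407, 434, 913, 887, 400, 876,
    880, 768, 888, 939, 982, 745, 923, 800, 760, 785, 824, 831, 287, 295, 339, 382, 288, 323, 280,
    386, 493, 473, 858, 822, 757, 780, 861, 941, 981, 756, 863, 926, 883, 938, 863, 926, 883, 938,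
    781, 821, 863, 926, 883, 938, 478, 441, 412, 490, 291, 493, 411, 285, 370, 292, 325, 801, 379,
    749, 282, 373, 825, 798, 910, 845, 875, 318, 970, 275, 913, 954, 821, 957, 918, 781, 755, 812,
    967, 778, 863, 870, 756, 945, 898, 865, 960, 935, 950, 478, 441, 490, 411, 970, 292, 875, 910,
    825, 282, 336, 379, 291, 325, 285, 765, 793, 765, 793, 839, 849, 854, 802, 832, 744, 805, 832,
    839, 802, 744, 769, 854, 749, 801, 838]]

/-- Slots to branch on. -/
def greatIcosahedralBranching13 : List ℕ := List.flatten [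
  [850, 906, 873, 953, 773, 968, 878, 958, 909, 919, 975, 761, 784, 792, 828, 844, 766, 770, 848,
    747, 803, 834, 748, 819, 758, 776, 888, 815, 961, 783, 860, 967, 859, 871, 753, 924, 936, 932,
    820, 966, 939, 891, 843, 947, 808, 895, 901, 903, 931, 791, 792, 896, 887, 935, 864, 799, 784,
    782, 950, 948, 866, 960, 898, 865, 789, 278, 353, 478, 411, 386, 490, 393, 416, 448, 459, 398,
    455, 499, 423, 460, 312, 375, 368, 319, 309, 358, 426, 273, 480, 306, 403, 466, 429, 404, 469,
    487, 435, 949, 436, 902, 929, 962, 946, 867, 934, 847, 764, 795, 974, 879, 911, 272, 356, 369,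
    304, 431, 468, 432, 483, 304, 431, 468, 432, 483, 304, 315, 316, 311, 355, 374, 758, 860, 815,
    776, 898, 882, 892, 925, 943, 980, 885, 922, 891, 979, 784, 792, 843, 791, 799, 879, 827, 774,
    974, 896, 805, 955, 932, 854, 751, 839, 827, 866, 799, 900, 791, 843, 933, 951, 964, 869, 930,
    899, 826, 764, 795, 840, 786, 929, 346, 902, 949, 469, 429, 487, 404, 436, 435, 426, 466, 480,
    960, 928, 870, 945, 967, 840, 763, 786, 411, 478],
  [326, 441, 490, 386, 446, 473, 338, 289, 284, 381, 321, 341, 378, 294, 283, 441, 412, 473, 446,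
    321, 284, 381, 289, 338, 283, 378, 478, 353, 278, 312, 393, 306, 796, 847, 969, 764, 945, 789,
    928, 795, 448, 870, 974, 416, 499, 967, 879, 460, 911, 339, 423, 956, 398, 273, 459, 939, 982,
    887, 895, 820, 923, 940, 901, 977, 950, 804, 880, 935, 768, 745, 800, 852, 288, 415, 390, 476,
    447, 491, 440, 327, 281, 290, 320, 376, 386, 490, 478, 353, 278, 772, 312, 801, 306, 292, 749,
    429, 796, 343, 838, 847, 269, 764, 829, 364, 789, 902, 299, 795, 929, 420, 974, 949, 449, 879,
    469, 346, 334, 297, 422, 399, 456, 497, 763, 786, 796, 847, 764, 829, 789, 786, 929, 763, 902,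
    829, 796, 847, 764, 789, 795, 848, 881, 803, 834, 781, 748, 855, 976, 804, 920, 942, 837, 927,
    910, 983, 913, 886, 937, 970, 863, 875, 756, 918, 811, 856, 755, 778, 791, 799, 791, 799, 844,
    799, 827]]

/-- Slots to branch on. -/
def greatIcosahedralBranching14 : List ℕ := List.flatten [
  [802, 978, 769, 849, 980, 801, 854, 832, 955, 774, 892, 904, 751, 805, 879, 943, 839, 979, 911,
    916, 925, 891, 956, 974, 969, 885, 936, 915, 922, 872, 883, 894, 926, 938, 941, 858, 889, 981,
    809, 920, 884, 766, 921, 467, 348, 264, 331, 303, 815, 860, 967, 966, 753, 931, 947, 776, 844,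
    932, 808, 819, 827, 871, 961, 296, 888, 896, 391, 790, 812, 864, 948, 416, 818, 445, 841, 778,
    414, 494, 794, 755, 479, 785, 821, 856, 409, 846, 863, 811, 384, 797, 332, 781, 472, 767, 451,
    756, 881, 952, 924, 890, 914, 939, 976, 874, 459, 496, 908, 340, 383, 959, 852, 327, 807, 440,
    295, 408, 903, 947, 871, 896, 391, 790, 416, 445, 414, 494, 479, 352, 409, 384, 472, 864, 952,
    931, 914, 844, 948, 874, 907, 827, 961, 908, 799, 959, 975, 852, 972, 807, 794, 877, 824, 787,
    917, 841, 762, 868, 971, 933, 798, 897, 797, 749, 307, 767, 838, 428, 850, 405, 912, 485, 758,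
    362, 819, 888, 924, 939, 977, 459, 340, 280, 295, 323, 382, 444, 497, 495, 399, 388, 463, 267,
    417, 302, 871, 931, 783, 932, 859, 947, 758, 820],
  [896, 819, 753, 416, 864, 888, 325, 343, 379, 380, 456, 285, 392, 291, 450, 336, 417, 463, 379,
    442, 292, 500, 409, 282, 393, 384, 448, 494, 499, 445, 380, 322, 292, 343, 379, 456, 500, 392,
    459, 450, 340, 417, 497, 463, 502, 977, 377, 453, 880, 924, 923, 887, 940, 982, 782, 857, 939,
    330, 759, 813, 862, 333, 363, 266, 300, 424, 484, 401, 439, 881, 406, 976, 886, 942, 893, 424,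
    484, 363, 439, 300, 406, 431, 266, 333, 886, 773, 873, 919, 958, 272, 304, 356, 369, 304, 369,
    316, 356, 355, 311, 374, 399, 816, 752, 782, 900, 810, 862, 887, 964, 939, 951, 888, 933, 924,
    869, 977, 389, 497, 441, 478, 456, 412, 343, 493, 292, 446, 411, 926, 938, 981, 889]]

/-- Slots to branch on. -/
def greatIcosahedralBranching15 : List ℕ := List.flatten [
  [876, 970, 771, 760, 793, 837, 855, 918, 875, 973, 910, 957, 773, 804, 910, 855, 977, 875, 918,
    954, 850, 905, 801, 912, 973, 772, 758, 957, 853, 806, 746, 781, 811, 756, 818, 863, 856, 821,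
    755, 812, 778, 881, 770, 890, 747, 848, 803, 834, 748, 762, 825, 842, 788, 898, 830, 865, 765,
    787, 789, 925, 798, 868, 878, 943, 897, 975, 860, 980, 946, 815, 885, 922, 867, 783, 882, 859,
    776, 808, 960, 756, 950, 863, 901, 821, 937, 920, 976, 275, 396, 421, 451, 496, 418, 458, 354,
    477, 387, 495, 444, 825, 842, 788, 928, 765, 750, 845, 798, 787, 868, 897, 886, 983, 937, 920,
    766, 976, 878, 909, 953, 958, 906, 968, 873, 975, 934, 444, 323, 459, 398, 939, 455, 924, 982,
    423, 500, 888, 923, 499, 819, 448, 393, 278, 873, 375, 906, 353, 968, 312, 488, 368, 387, 443,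
    495, 477, 388, 413, 398, 455, 423, 500, 903, 416, 871, 896, 827, 947, 844, 966, 931, 340, 280,
    295, 824, 807, 790, 794, 899, 852, 841, 930, 835, 767, 768, 904, 797, 800, 826, 831, 288, 287,
    324, 377, 267, 388, 495, 368, 477, 387, 413, 443],
  [474, 488, 375, 968, 353, 873, 312, 786, 278, 306, 763, 819, 796, 840, 888, 847, 924, 764, 859,
    789, 783, 795, 820, 309, 273, 319, 362, 388, 302, 443, 417, 413, 502, 477, 463, 387, 943, 867,
    892, 980, 782, 823, 885, 759, 925, 857, 362, 302, 417, 450, 502, 392, 463, 456, 872, 943, 936,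
    915, 892, 980, 823, 802, 885, 769, 925, 744, 857, 979, 854, 759, 805, 916, 774, 955, 879, 974,
    911, 410, 477, 495, 387, 388, 413, 474, 443, 488, 410, 495, 924, 368, 477, 888, 387, 819, 488,
    375, 353, 278, 312, 946, 962, 867, 929, 902, 893, 920, 927, 937, 983, 787, 798, 747, 848, 770,
    834, 905, 954, 875, 918]]

/-- Excluded colours of slots of the 972-vertex graph, with slots to branch on. -/
def greatIcosahedralExclusions : List (ℕ × Fin 4 × List ℕ) := [
  -- The concatenated pieces form one list for a single search, which runs across the joints.
  (888, 2, greatIcosahedralBranching1 ++ greatIcosahedralBranching2 ++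
    greatIcosahedralBranching3 ++ greatIcosahedralBranching4 ++ greatIcosahedralBranching5),
  (961, 3, greatIcosahedralBranching6),
  (768, 2, greatIcosahedralBranching7 ++ greatIcosahedralBranching8),
  (841, 3, greatIcosahedralBranching9),
  (337, 0, greatIcosahedralBranching10 ++ greatIcosahedralBranching11),
  (936, 0, greatIcosahedralBranching12),
  (889, 2, [926, 863, 938, 981, 858, 978, 941, 884, 921, 894, 883, 774, 751, 805, 756, 818, 811,
    781, 856, 778, 338, 461, 796, 763, 786, 829, 789, 764, 795, 826, 840, 847, 764, 789, 795, 829,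
    826, 763, 902, 786, 975, 840, 929, 950, 949, 901, 960, 421, 865, 503, 898, 935, 396, 967, 451,
    755, 821, 812, 298, 345, 367, 301, 480, 418, 496, 458, 341, 284, 403, 469, 265, 360, 487, 429,
    909, 958, 873, 919, 335, 350, 360, 487, 429, 909, 958, 873, 919, 763, 847, 786, 829, 975, 346,
    789, 764, 795, 826, 840, 904, 955, 879, 916, 403, 469, 436, 949, 426, 487, 902, 309, 429, 929,
    306, 909, 353, 878, 278, 953, 375, 855, 748, 284, 289, 341, 381, 294, 326, 283, 436, 469, 315,
    426, 487, 356, 480, 404, 429, 967, 311, 475, 367, 466, 909, 870, 374, 345, 349, 435, 878, 958,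
    901, 329, 316, 953, 950, 268, 279, 855, 470, 865, 365, 355, 482, 427, 265, 298, 360, 812, 350,
    755, 918, 438, 402, 465, 298, 360, 390, 328, 447, 270, 415, 385, 476, 335, 860, 815, 819, 758,
    776, 912, 753, 906, 919, 873, 781, 818, 811, 981, 941, 894, 883, 938, 978]),
  (865, 1, [789, 898, 950, 901, 960, 935, 967, 870, 928, 783, 815, 758, 819, 859, 776, 808, 820,
    808, 776, 753, 819, 860, 815, 820, 758, 819, 859, 745, 852, 856, 755, 778, 812, 821, 863, 781,
    756, 811, 768, 835, 750, 807, 904, 775, 983, 836, 851, 800, 893, 911, 916, 927, 829, 879, 942,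
    847, 774, 976, 796, 890, 763, 881, 781, 811, 818, 756, 778, 863, 812, 926, 821, 883, 894, 978,
    921, 835, 890, 920, 976, 881, 467, 348, 303, 331, 947, 851, 800, 836, 893, 942, 927, 312, 278,
    353, 306, 375, 273, 319, 844, 761, 784, 792, 827, 843, 766, 439, 484, 401, 424, 904, 955, 916,
    879, 911, 431, 468, 432, 273, 319, 844, 761, 784, 827, 799, 896, 975, 818, 932, 919, 778, 961,
    909, 755, 812, 958, 821, 863, 873, 894, 786, 921, 763, 978, 926, 883, 319, 368, 306, 353, 278,
    375, 439, 406, 484, 886, 401, 778, 937, 424, 818, 983, 904, 811, 807, 955, 750, 775, 356, 475,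
    390, 265, 270, 345, 298, 328, 360, 301, 328, 350, 360, 750, 775, 807, 836, 893, 911, 886, 406,
    431, 439, 947, 896, 818, 778, 886, 406, 439, 431, 484, 911, 424, 904, 955, 879, 916, 974, 969,
    915, 872, 937, 863, 983, 886, 778, 893, 755, 812, 836, 821, 911, 894, 829, 921, 847, 978, 796,
    883, 763, 926, 755, 778, 818, 811, 781, 756, 821, 863, 852, 807, 750, 775, 836, 800, 851]),
  (912, 3, greatIcosahedralBranching13),
  (793, 1, [842, 936, 928, 765, 788, 830, 972, 345, 787, 905, 762, 868, 798, 825, 845, 910, 957,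
    470, 950, 901, 870, 935, 967, 950, 960, 865, 935, 901, 402, 482, 427, 433, 308, 907, 318, 359,
    877, 952, 354, 917, 959, 305, 477, 971, 852, 908, 373, 794, 874, 428, 914, 465, 438, 313, 276,
    357, 277, 307, 317, 372, 434, 314, 745, 437, 768, 430, 800, 464, 836, 351, 400, 775, 785, 425,
    807, 760, 310, 824, 846, 797, 841, 831, 767, 287, 790, 295, 875, 382, 970, 323, 339, 954, 444,
    324, 474, 495, 443, 388, 307, 317, 372, 745, 768, 800, 851, 750, 371, 274, 352, 285, 482, 343,
    433, 405, 282, 292, 325, 379, 882, 776, 922, 979, 808, 980, 925, 859, 857, 885, 943, 820, 405,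
    783, 860, 753, 282, 758, 815, 923, 379, 336, 322, 380, 423, 499, 460, 940, 880, 895, 768, 887,
    745, 982, 296, 455, 500, 459, 416, 303, 348, 361, 264, 332, 331, 271, 366, 347, 499, 460, 940,
    880, 895, 768, 887, 745, 982, 830, 787, 901, 870, 967, 935, 845, 788, 798, 825]),
  (744, 0, greatIcosahedralBranching14), (913, 3, greatIcosahedralBranching15),
  (960, 2, [928, 950, 935, 865, 901, 898, 870, 945, 967]),
  (432, 2, [912, 850, 968, 906, 873, 953, 773, 919, 878, 406, 483, 468, 401, 431, 424, 911, 904,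
    879, 955, 916, 439, 431, 467, 468, 424, 401, 484, 439, 431, 467, 468, 348, 401, 483, 484, 881,
    963, 964, 770, 890, 933, 747, 976, 749, 869, 848, 838, 779, 951, 803, 801, 884, 844, 978, 889,
    799, 931, 938, 827, 744, 286, 271, 303, 331, 366, 347, 332, 451, 496, 383, 458, 293, 418, 410,
    452, 488, 932, 474, 947, 954, 896, 818, 756, 811, 863, 856, 812, 755, 778, 347, 332, 361, 264,
    296, 347, 332, 361, 264, 832, 802, 769, 839, 854]),
  (816, 2, [752, 782, 915, 435, 974, 911, 879, 956, 813, 872, 759, 823, 777, 343, 272, 356, 369,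
    304, 316, 279, 355, 399, 453, 422, 456, 392, 279, 316, 304, 355, 369, 374, 356, 315]),
  (481, 0, [961, 812, 932, 821, 871, 896, 755, 863, 903, 827, 864, 947, 966, 766, 776, 948, 819,
    841, 860, 794, 815, 923, 760, 314, 437, 407, 430, 471, 305, 464, 910, 486, 434, 914, 874, 907,
    908, 832, 971, 271, 332, 361, 451, 348, 767, 264, 790, 331, 875, 452, 856, 818, 276, 395, 418,
    496, 303, 348, 366, 361, 331, 264, 303, 332, 366, 839, 361, 331, 347, 751, 348, 767, 856, 805,
    467, 797, 811, 774, 790, 781, 879, 344, 881, 911, 363, 484, 401, 439, 468, 431, 437, 430, 486,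
    407, 464, 471, 400, 425, 434]),
  (433, 0, [482, 913, 876, 910, 905, 837, 405, 428, 470, 485, 908, 345, 427, 965, 971, 874, 917,
    788, 757, 765, 365, 845, 825, 267, 346, 362, 334, 346, 861, 362, 814, 927, 762, 779, 893, 842,
    822, 942, 793, 858, 308, 809, 780, 337, 817, 462, 274, 498, 397, 449, 428, 485, 908, 438, 874,
    465, 914, 402, 952, 427, 907, 470, 427, 950, 438, 907, 901, 485, 952, 935, 465, 914, 967, 874,
    945, 870, 898, 928, 842, 960, 830, 756, 793, 781, 788, 970, 811, 765, 954, 818, 845, 875, 318,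
    276, 313, 373, 305, 354, 275, 370, 395, 418, 452, 503, 396, 421, 458, 451, 496]),
  (840, 3, [763, 929, 902, 829, 949, 847, 796, 786, 346, 826, 469, 764, 795, 904, 487, 789, 835,
    955, 360, 865, 265, 298, 345, 270, 367, 298, 328, 455, 935, 950, 901, 870, 390, 447, 415, 475,
    492, 385, 408, 476, 440, 491]),
  (817, 2, [861, 757, 780, 822, 809]), (769, 3, [802, 839, 832, 744, 849, 854, 751, 805, 774]),
  (312, 1, [353, 843, 306, 766, 368, 791, 920, 495, 879, 858, 976, 444, 916, 822, 890, 477, 955,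
    809, 881, 413, 904, 962, 388, 868, 897, 946, 934, 747, 848, 770, 834, 748, 375, 278, 309, 319,
    432, 401, 424]),
  (864, 3, [776, 785, 896, 819, 760, 831, 947, 860, 932, 815, 452, 871, 331, 903, 303, 948, 366,
    841, 481, 794, 434, 824, 464, 400, 430, 287, 407, 339, 280, 382, 323]),
  (961, 2, [864, 932, 896]), (409, 0, [972, 442, 384, 472, 494, 952, 479, 914, 959, 874, 908]),
  (408, 1, [440, 888, 939, 924, 887, 895, 415, 476, 385, 492, 447, 475]),
  (456, 1, [969, 422, 450, 936, 392, 417, 922, 979, 872, 891, 925, 915, 816, 765, 956, 752, 857,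
    862, 810, 813, 297, 302, 346, 365, 362, 349, 329, 268]),
  (121, 0, [962, 949, 469, 845, 929, 965, 346, 788, 449, 868, 902, 934, 765, 334, 777, 897, 867,
    747, 267, 297, 752, 823, 946, 848, 388, 810, 862, 770, 495, 857, 834, 444, 759, 268, 387, 782,
    813, 302, 349, 365, 466, 482, 601, 504, 588]),
  (888, 0, [977, 819, 880, 939, 860, 940, 459, 924, 815, 923, 340, 444, 887, 760, 323, 775, 846,
    280, 295, 750, 836, 785, 407, 824, 807, 851, 831, 481, 790, 852, 287, 366, 797, 745, 331, 767,
    768, 303, 800, 348, 288, 361, 339, 460, 423, 296, 332, 347, 271]),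
  (288, 2, [967, 415, 295, 340, 377, 459, 324, 455, 443, 398, 413, 878, 388, 912, 474, 968, 488,
    323, 280, 340, 377, 408, 807, 475, 852, 835, 768, 800, 851, 750, 928, 945, 870, 898, 390, 865,
    385, 440, 476, 491]),
  (792, 0, [983, 304, 937, 431, 920, 439, 886, 406]), (768, 3, [800, 745, 836]),
  (745, 2, [800, 852, 851, 807, 750, 775]),
  (480, 1, [978, 435, 960, 429, 865, 404, 898, 487, 884, 418, 889, 301, 938, 367, 926, 335, 763,
    350, 360]),
  (432, 1, [424, 483, 401, 468]), (265, 1, [448, 335, 301, 350]),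
  (889, 1, [446, 409, 981, 294, 501, 321, 378]), (481, 3, [895, 430, 887, 407]),
  (312, 3, [495, 368, 273, 306]),
  (49, 0, [317, 323, 497, 895, 923, 434, 444, 940, 529, 880, 578, 400, 566, 523]),
  (457, 0, [333, 498, 890, 394, 937, 419, 920, 766, 363, 266, 300]), (384, 1, [409, 494, 479]),
  (265, 0, [328, 331, 360, 452, 298, 395, 421, 461]),
  (504, 2, [279, 482, 392, 588, 456, 571, 422]), (529, 2, [287, 497, 400, 578, 523, 566]),
  (553, 2, [265, 315, 435, 390, 436, 550, 475, 545, 597, 516, 613]),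
  (649, 2, [265, 282, 312, 318, 901, 390, 439, 870, 548, 928, 842, 830, 163, 643, 686, 698, 741,
    738, 701, 654, 643, 686, 698, 741, 738, 701, 654]),
  (672, 3, [276, 331, 333, 666, 395, 452, 713, 512, 537, 735, 633, 679, 728, 718]),
  (697, 1, [266, 273, 276, 312, 317, 318, 495, 310, 389, 398, 439, 743, 275, 313, 478, 517, 548,
    370, 357, 557, 493, 474, 599, 611, 473, 410, 612, 488, 554, 592, 514]),
  (720, 2, [268, 271, 323, 325, 688, 387, 444, 705, 504, 529, 630, 658, 710, 625, 661, 695, 727]),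
  (648, 0, [266, 281, 312, 318, 331, 333, 348, 640, 433, 264, 700, 551, 361, 683, 737, 699, 486,
    684, 471, 363, 300, 344, 351, 299, 364]),
  (696, 3, [651, 739, 682, 642]),
  (361, 3, [271, 331, 334, 296, 332, 449, 347, 543, 366, 715, 303]),
  (673, 3, [273, 274, 279, 282, 287, 334, 497, 500, 398, 392, 405, 400, 730, 459, 456, 526, 523,
    670, 714, 621, 577, 635, 665, 566, 560, 678, 578, 616, 618, 582, 460, 499, 423]),
  (576, 3, [279, 281, 315, 318, 325, 440, 503, 562, 406, 433, 531, 525, 551, 620, 699, 583, 311,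
    565, 374, 727, 695, 661]),
  (192, 3, [265, 268, 315, 323, 328, 333, 898, 904, 752, 915, 390, 387, 450, 916, 382, 65, 870,
    867, 538, 679, 928, 934, 712, 199, 945, 847, 298, 759, 360, 70, 682, 260, 651, 740]),
  (169, 2, [265, 268, 274, 281, 282, 448, 787, 893, 898, 390, 387, 397, 406, 405, 870, 867, 877,
    886, 470, 928, 934, 33, 920, 945, 847, 858, 123, 822, 603, 155, 584, 635, 539, 678, 714]),
  (73, 1, [266, 271, 273, 276, 282, 287, 312, 317, 318, 323, 325, 326, 328, 331, 333, 893, 895,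
    900, 902, 904, 906, 964, 975, 977, 384, 395, 405, 434, 433, 442, 441, 455, 452, 927, 887, 866,
    929, 916, 873, 864, 875, 885, 546, 551, 530, 535, 540, 537, 982, 963, 968, 931, 918, 925, 696,
    699, 704, 707, 717, 718, 844, 855, 857, 306, 219, 295, 300, 827, 837, 816, 368, 792, 382, 363,
    799, 804, 810, 690, 761, 679, 684, 112, 204, 210, 110, 748, 238, 803, 813, 224, 823, 101, 759,
    199])]

/-- The slots to branch on after the exclusions. -/
def greatIcosahedralLastBranching : List ℕ := [265, 271, 273, 287, 317, 328, 333, 334, 894, 896,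
    898, 909, 911, 967, 384, 398, 400, 434, 450, 449, 921, 865, 879, 864, 878, 880, 546, 538, 543,
    960, 974, 931, 912, 923, 696, 712, 715, 844, 850, 860, 298, 827, 838, 819, 360, 89, 74, 815,
    682, 235, 216, 104, 795, 202, 826, 764]

/-- A colouring of the 972-vertex graph with five colours, three bits for each slot. -/
def greatIcosahedralColouring : ℕ :=
  0x6db9006d26c16d280008a00a04104308228a00a01a21b20b25105020169a45226108228a4926db48841b25946449480b11b91b4922e269a2409236e268960430c4db49204b0c32ca8db00c02426004c6042802408814910c224a6db9246d26c16d224908a08a30b20808228a05b25820820825104028168240872408228a4926db48b01b0804988dc6e04d28c80129140880992002234d051924061a20b22421241282165b4922244104510194922082a46596592094922082480806542e069c8908182114048a08634a08e44844da9220c901b9186180616633246d22e261071a6dc8d09104e271431a4216935086e04d350b02029920b20b24908049424048820981331101c49406386229c30c00900901b24b0630a34c030060048124900029202309211b1046e36204119148c83091103002406212c164b20404111a04868448026161140a84945229964891a2404a44c14dc86409b0e485c49869c69c4508c309261a8824c30400c30820c4000041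

/-- This evaluation is the combinatorial core for the first sphere: the marks start from the
pattern, every exclusion in turn is refuted and spread, and the last search closes all remaining
branches. -/
theorem icosahedral_refuteAll :
    icosahedral.refuteAll icosahedral.patternMarks icosahedralLastBranching
    icosahedralExclusions = true := by
  decide +kernel

/-- The first vertex may be taken to have colour 0; the enumeration covers the eleven others. -/
theorem icosahedral_extensionsMatch : icosahedral.extensionsMatch 11 [0] = true := by
  decide +kernel

theorem icosahedral_frameCheck : icosahedral.frameCheck = true := by decide +kernel

theorem icosahedral_fiveColouringCheck :
    icosahedral.fiveColouringCheck icosahedralColouring = true := by decide +kernel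

theorem greatIcosahedral_refuteAll :
    greatIcosahedral.refuteAll greatIcosahedral.patternMarks greatIcosahedralLastBranching
      greatIcosahedralExclusions = true := by
  decide +kernel

theorem greatIcosahedral_extensionsMatch : greatIcosahedral.extensionsMatch 11 [0] = true := by
  decide +kernel

theorem greatIcosahedral_frameCheck : greatIcosahedral.frameCheck = true := by decide +kernel

theorem greatIcosahedral_fiveColouringCheck :
    greatIcosahedral.fiveColouringCheck greatIcosahedralColouring = true := by decide +kernel

end SphereColoring

/-! ### Identification with the given point sets, and the theorem -/

namespace SphereColoring

namespace Configuration

variable {m : Configuration}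

theorem representative_apply_zero (i : ℕ) :
    m.representative i 0 = m.real (m.basePoly (1 + 5 * i)).1 := by
  rw [representative, point_base]; rfl

theorem representative_apply_one (i : ℕ) :
    m.representative i 1 = m.real (m.basePoly (1 + 5 * i)).2.1 := by
  rw [representative, point_base]; rfl

theorem representative_apply_two (i : ℕ) :
    m.representative i 2 = m.real (m.basePoly (1 + 5 * i)).2.2 := by
  rw [representative, point_base]; rfl

theorem Valid.isRootNear_zero (h : m.Valid) {c : List ℤ} {a : ℝ} (q : ℤ) {i : ℕ}
    (hc : m.rootNearCheck c q (m.basePoly (1 + 5 * i)).1 = true) (ha : (q : ℝ) / 10 ^ 5 = a) :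
    IsRootNear c a (m.representative i 0) := by
  rw [representative_apply_zero, ← ha]
  exact h.isRootNear hc

theorem Valid.isRootNear_one (h : m.Valid) {c : List ℤ} {a : ℝ} (q : ℤ) {i : ℕ}
    (hc : m.rootNearCheck c q (m.basePoly (1 + 5 * i)).2.1 = true) (ha : (q : ℝ) / 10 ^ 5 = a) :
    IsRootNear c a (m.representative i 1) := by
  rw [representative_apply_one, ← ha]
  exact h.isRootNear hc

theorem Valid.isRootNear_two (h : m.Valid) {c : List ℤ} {a : ℝ} (q : ℤ) {i : ℕ}
    (hc : m.rootNearCheck c q (m.basePoly (1 + 5 * i)).2.2 = true) (ha : (q : ℝ) / 10 ^ 5 = a) :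
    IsRootNear c a (m.representative i 2) := by
  rw [representative_apply_two, ← ha]
  exact h.isRootNear hc

theorem Valid.representative_mem_points (h : m.Valid) {k : ℕ} (hk : m.size = 1 + 5 * k) {i : ℕ}
    (hi : i < k) : m.representative i ∈ m.points :=
  h.point_mem_points (by omega)

theorem Valid.chi_points (h : m.Valid) (hf : m.frameCheck = true) {k : ℕ}
    (hk : m.size = 1 + 5 * k) {c : List ℕ} {l : List (ℕ × Fin 4 × List ℕ)}
    (hl : m.refuteAll m.patternMarks c l = true) (he : m.extensionsMatch 11 [0] = true) {d : ℕ}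
    (hd : m.fiveColouringCheck d = true) : chi m.points = 5 :=
  chi_points_eq_five (h.colorable_five hd) (not_colorable_four (h.not_isColouring_four
    (fun _ hφ _ hx => h.mem_points_of_symmetry hf hk hφ hx) hl he))

theorem Valid.t_bounds (h : m.Valid) :
    approxValue m.tau - 20000 ≤ 5 * m.t * 10 ^ 12 ∧
      5 * m.t * 10 ^ 12 ≤ approxValue m.tau + 20000 := by
  have hc := h.approxCheck
  simp only [Configuration.approxCheck, Bool.and_eq_true] at hc
  have := (value_near_of_approxCoord hc.1.1.1).1
  rw [value_tau, abs_le] at this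
  constructor <;> linarith

/-- Both numbers on the right are the roots of $X^2=X+1$; the approximation of $t$ then decides
between them. -/
theorem Valid.t_eq_or (h : m.Valid) : m.t = Real.goldenRatio ∨ m.t = 1 - Real.goldenRatio := by
  have h1 : (m.t - Real.goldenRatio) * (m.t - (1 - Real.goldenRatio)) = 0 := by
    linear_combination h.t_sq - Real.goldenRatio_sq
  rcases mul_eq_zero.1 h1 with h2 | h2
  · exact Or.inl (sub_eq_zero.1 h2)
  · exact Or.inr (sub_eq_zero.1 h2)

end Configuration

/-- The parameter of the great icosahedron comes out as $1-\tau=-1/\tau$, which is negative. Since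
both signs of each coordinate occur, its sign does not matter. -/
theorem cyclicPoints_neg (a b : ℝ) : cyclicPoints (-a) b = cyclicPoints a b := by
  have key : ∀ a, cyclicPoints a b ⊆ cyclicPoints (-a) b := by
    rintro a v ⟨s, hs, t, ht, hv⟩
    refine ⟨-s, ?_, t, ht, by simpa only [neg_mul_neg] using hv⟩
    rcases hs with rfl | rfl <;> simp
  exact (by simpa using key (-a) : cyclicPoints (-a) b ⊆ cyclicPoints a b).antisymm (key a)

theorem cos_pi_div_ten_sq : Real.cos (Real.pi / 10) ^ 2 = (Real.goldenRatio + 2) / 4 := by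
  have h := Real.cos_two_mul (Real.pi / 10)
  -- The doubled angle has cosine $\tau/2$, which gives the squared radius.
  rw [show 2 * (Real.pi / 10) = Real.pi / 5 by ring, Real.cos_pi_div_five] at h
  rw [Real.goldenRatio]
  linarith

theorem cos_three_mul_pi_div_ten_sq :
    Real.cos (3 * Real.pi / 10) ^ 2 = (1 - Real.goldenRatio + 2) / 4 := by
  have h := Real.cos_two_mul (3 * Real.pi / 10)
  have h2 := Real.cos_two_mul (Real.pi / 5)
  have h5 : Real.sqrt 5 ^ 2 = 5 := Real.sq_sqrt (by norm_num)
  -- The doubled angle $3\pi/5$ is supplementary to $2\pi/5$, so a second doubling leads back to the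
  -- known cosine of $\pi/5$.
  rw [show 2 * (3 * Real.pi / 10) = Real.pi - 2 * (Real.pi / 5) by ring, Real.cos_pi_sub, h2,
    Real.cos_pi_div_five] at h
  rw [Real.goldenRatio]
  linarith

theorem icosahedral_valid : icosahedral.Valid where
  exactCheck := icosahedral_exactCheck
  edgeCheck := icosahedral_edgeCheck
  approxCheck := icosahedral_approxCheck
  separated := fun _ hb => List.all_eq_true.1 icosahedral_separated _ (List.mem_range.2 hb)
  size_pos := by decide +kernel
  nbrs_length := by decide +kernel

theorem greatIcosahedral_valid : greatIcosahedral.Valid where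
  exactCheck := greatIcosahedral_exactCheck
  edgeCheck := greatIcosahedral_edgeCheck
  approxCheck := greatIcosahedral_approxCheck
  separated := fun _ hb => List.all_eq_true.1 greatIcosahedral_separated _ (List.mem_range.2 hb)
  size_pos := by decide +kernel
  nbrs_length := by decide +kernel

theorem icosahedral_size : icosahedral.size = 1 + 5 * 3 := by decide +kernel

theorem greatIcosahedral_size : greatIcosahedral.size = 1 + 5 * 8 := by decide +kernel

/-- A positive lower bound for $t$ is enough, since the conjugate root is negative. -/
theorem icosahedral_t : icosahedral.t = Real.goldenRatio := by
  refine icosahedral_valid.t_eq_or.resolve_right fun h => ?_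
  have h1 := icosahedral_valid.t_bounds.1
  have h2 : 10 ^ 12 ≤ approxValue icosahedral.tau := by decide +kernel
  have h3 : (10 : ℝ) ^ 12 ≤ approxValue icosahedral.tau := by exact_mod_cast h2
  have h4 := Real.one_lt_goldenRatio
  rw [h] at h1
  linarith

theorem greatIcosahedral_t : greatIcosahedral.t = 1 - Real.goldenRatio := by
  refine greatIcosahedral_valid.t_eq_or.resolve_left fun h => ?_
  have h1 := greatIcosahedral_valid.t_bounds.2
  have h2 : approxValue greatIcosahedral.tau ≤ 0 := by decide +kernel
  have h3 : (approxValue greatIcosahedral.tau : ℝ) ≤ 0 := by exact_mod_cast h2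
  have h4 := Real.one_lt_goldenRatio
  rw [h] at h1
  linarith

theorem vertexSet_icosahedral : icosahedral.vertexSet = icosahedron := by
  rw [Configuration.vertexSet, icosahedral_t, icosahedron]

/-- After the change of sign the parameter is $(\tau-1)/2$, which equals $1/(2\tau)$ by
$\tau^2=\tau+1$. -/
theorem vertexSet_greatIcosahedral : greatIcosahedral.vertexSet = greatIcosahedron := by
  rw [Configuration.vertexSet, greatIcosahedral_t, greatIcosahedron, ← cyclicPoints_neg]
  congr 1
  have h := Real.goldenRatio_ne_zero
  rw [eq_div_iff (by positivity)]
  linear_combination Real.goldenRatio_sq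

theorem coordinates372_representative :
    Coordinates372 fun i => icosahedral.representative i := by
  have h := icosahedral_valid
  -- The integers are the listed decimals times $10^5$; the equations are verified as congruences
  -- modulo the octic.
  exact ⟨h.isRootNear_zero 71584 (by decide +kernel) (by norm_num),
    h.isRootNear_one 34924 (by decide +kernel) (by norm_num),
    h.isRootNear_two 51972 (by decide +kernel) (by norm_num),
    h.isRootNear_zero (-7961) (by decide +kernel) (by norm_num),
    h.isRootNear_one (-8345) (by decide +kernel) (by norm_num),
    h.isRootNear_two 94404 (by decide +kernel) (by norm_num),
    h.isRootNear_zero (-17646) (by decide +kernel) (by norm_num),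
    h.isRootNear_one 79929 (by decide +kernel) (by norm_num),
    h.isRootNear_two 48426 (by decide +kernel) (by norm_num)⟩

theorem coordinates972_representative :
    Coordinates972 fun i => greatIcosahedral.representative i := by
  have h := greatIcosahedral_valid
  exact ⟨h.isRootNear_zero 46246 (by decide +kernel) (by norm_num),
    h.isRootNear_one (-32804) (by decide +kernel) (by norm_num),
    h.isRootNear_two (-15496) (by decide +kernel) (by norm_num),
    h.isRootNear_zero (-22176) (by decide +kernel) (by norm_num),
    h.isRootNear_one 9483 (by decide +kernel) (by norm_num),
    h.isRootNear_two 53602 (by decide +kernel) (by norm_num),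
    h.isRootNear_zero (-57219) (by decide +kernel) (by norm_num),
    h.isRootNear_one (-4462) (by decide +kernel) (by norm_num),
    h.isRootNear_two (-12687) (by decide +kernel) (by norm_num),
    h.isRootNear_zero (-13592) (by decide +kernel) (by norm_num),
    h.isRootNear_one (-22502) (by decide +kernel) (by norm_num),
    h.isRootNear_two (-52572) (by decide +kernel) (by norm_num),
    h.isRootNear_zero 7219 (by decide +kernel) (by norm_num),
    h.isRootNear_one 35363 (by decide +kernel) (by norm_num),
    h.isRootNear_two 46392 (by decide +kernel) (by norm_num),
    h.isRootNear_zero (-36408) (by decide +kernel) (by norm_num),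
    h.isRootNear_one 8400 (by decide +kernel) (by norm_num),
    h.isRootNear_two (-45374) (by decide +kernel) (by norm_num),
    h.isRootNear_zero (-58345) (by decide +kernel) (by norm_num),
    h.isRootNear_one 5157 (by decide +kernel) (by norm_num),
    h.isRootNear_two 4920 (by decide +kernel) (by norm_num),
    h.isRootNear_zero (-43760) (by decide +kernel) (by norm_num),
    h.isRootNear_one 3856 (by decide +kernel) (by norm_num),
    h.isRootNear_two 39052 (by decide +kernel) (by norm_num)⟩

-- The second coordinate of the second representative is $\alpha/2$, which generates the field.
open IntermediateField in
theorem hasMaxCoordinateDegree_icosahedral : HasMaxCoordinateDegree icosahedral.points 8 := by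
  refine Configuration.hasMaxCoordinateDegree (j := 1)
    (icosahedral_valid.representative_mem_points icosahedral_size (i := 1) (by norm_num)) ?_
  have h : alpha = 2 * icosahedral.representative 1 1 := by
    rw [Configuration.representative_apply_one, Configuration.real,
      show (icosahedral.basePoly (1 + 5 * 1)).2.1 = [0, 5, 0, 0, 0, 0, 0, 0] by decide +kernel,
      show icosahedral.den = 10 from rfl]
    simp only [value_cons, value_nil]
    push_cast
    ring
  nth_rewrite 1 [h]
  exact mul_mem (ofNat_mem _ 2) (mem_adjoin_simple_self _ _)

-- The first coordinate of the seventh representative is $(\alpha-1)/2$, which generates the field.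
open IntermediateField in
theorem hasMaxCoordinateDegree_greatIcosahedral :
    HasMaxCoordinateDegree greatIcosahedral.points 8 := by
  refine Configuration.hasMaxCoordinateDegree (j := 0)
    (greatIcosahedral_valid.representative_mem_points greatIcosahedral_size (i := 6)
      (by norm_num)) ?_
  have h : alpha = 2 * greatIcosahedral.representative 6 0 + 1 := by
    rw [Configuration.representative_apply_zero, Configuration.real,
      show (greatIcosahedral.basePoly (1 + 5 * 6)).1 = [-205, 205, 0, 0, 0, 0, 0, 0] by
        decide +kernel,
      show greatIcosahedral.den = 410 from rfl]
    simp only [value_cons, value_nil]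
    push_cast
    ring
  nth_rewrite 1 [h]
  exact add_mem (mul_mem (ofNat_mem _ 2) (mem_adjoin_simple_self _ _)) (one_mem _)

theorem chi_points_icosahedral : chi icosahedral.points = 5 :=
  icosahedral_valid.chi_points icosahedral_frameCheck icosahedral_size icosahedral_refuteAll
    icosahedral_extensionsMatch icosahedral_fiveColouringCheck

theorem chi_points_greatIcosahedral : chi greatIcosahedral.points = 5 :=
  greatIcosahedral_valid.chi_points greatIcosahedral_frameCheck greatIcosahedral_size
    greatIcosahedral_refuteAll greatIcosahedral_extensionsMatch
    greatIcosahedral_fiveColouringCheck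

theorem points_icosahedral_subset :
    icosahedral.points ⊆ Metric.sphere 0 (Real.cos (Real.pi / 10)) :=
  icosahedral_valid.points_subset_sphere
    (Real.cos_nonneg_of_neg_pi_div_two_le_of_le (by linarith [Real.pi_pos])
      (by linarith [Real.pi_pos]))
    (by rw [cos_pi_div_ten_sq, icosahedral_t])

theorem points_greatIcosahedral_subset :
    greatIcosahedral.points ⊆ Metric.sphere 0 (Real.cos (3 * Real.pi / 10)) :=
  greatIcosahedral_valid.points_subset_sphere
    (Real.cos_nonneg_of_neg_pi_div_two_le_of_le (by linarith [Real.pi_pos])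
      (by linarith [Real.pi_pos]))
    (by rw [cos_three_mul_pi_div_ten_sq, greatIcosahedral_t])

/-- There are 12 canonical slots for the vertices and $5\cdot24=120$ for each of the three orbits,
and different slots hold different points. -/
theorem ncard_points_icosahedral : icosahedral.points.ncard = 372 := by
  rw [icosahedral_valid.ncard_points]
  decide +kernel

/-- The count is $12+8\cdot120$. -/
theorem ncard_points_greatIcosahedral : greatIcosahedral.points.ncard = 972 := by
  rw [greatIcosahedral_valid.ncard_points]
  decide +kernel

end SphereColoring

theorem mainTheorem1 :
    (5 ≤ SphereColoring.chi (Metric.sphere 0 (Real.cos (Real.pi / 10))) ∧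
      ∃ p : Fin 3 → SphereColoring.E3, SphereColoring.Coordinates372 p ∧
        ∃ V : Set SphereColoring.E3,
          V = SphereColoring.withOrbits SphereColoring.icosahedron p ∧
          V ⊆ Metric.sphere 0 (Real.cos (Real.pi / 10)) ∧
          V.ncard = 372 ∧
          SphereColoring.chi V = 5 ∧
          SphereColoring.HasMaxCoordinateDegree V 8) ∧
    (5 ≤ SphereColoring.chi (Metric.sphere 0 (Real.cos (3 * Real.pi / 10))) ∧
      ∃ q : Fin 8 → SphereColoring.E3, SphereColoring.Coordinates972 q ∧
        ∃ V : Set SphereColoring.E3,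
          V = SphereColoring.withOrbits SphereColoring.greatIcosahedron q ∧
          V ⊆ Metric.sphere 0 (Real.cos (3 * Real.pi / 10)) ∧
          V.ncard = 972 ∧
          SphereColoring.chi V = 5 ∧
          SphereColoring.HasMaxCoordinateDegree V 8) :=
  ⟨⟨SphereColoring.chi_points_icosahedral ▸
      SphereColoring.chi_mono SphereColoring.points_icosahedral_subset,
    fun i => SphereColoring.icosahedral.representative i,
    SphereColoring.coordinates372_representative, SphereColoring.icosahedral.points,
    by rw [← SphereColoring.vertexSet_icosahedral,
      SphereColoring.icosahedral_valid.withOrbits_eq SphereColoring.icosahedral_frameCheck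
        SphereColoring.icosahedral_size],
    SphereColoring.points_icosahedral_subset, SphereColoring.ncard_points_icosahedral,
    SphereColoring.chi_points_icosahedral, SphereColoring.hasMaxCoordinateDegree_icosahedral⟩,
  ⟨SphereColoring.chi_points_greatIcosahedral ▸
      SphereColoring.chi_mono SphereColoring.points_greatIcosahedral_subset,
    fun i => SphereColoring.greatIcosahedral.representative i,
    SphereColoring.coordinates972_representative, SphereColoring.greatIcosahedral.points,
    by rw [← SphereColoring.vertexSet_greatIcosahedral,
      SphereColoring.greatIcosahedral_valid.withOrbits_eq
        SphereColoring.greatIcosahedral_frameCheck SphereColoring.greatIcosahedral_size],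
    SphereColoring.points_greatIcosahedral_subset,
    SphereColoring.ncard_points_greatIcosahedral, SphereColoring.chi_points_greatIcosahedral,
    SphereColoring.hasMaxCoordinateDegree_greatIcosahedral⟩⟩
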